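/- \textbf{Setting.} Let $Q\subset\mathbb R^2$ be an open, convex, non-degenerate quadrilateral with vertices $v_1,\dots,v_4$ in counter-clockwise order (indices modulo $4$; the boundary makes a strict left turn at each vertex). Let $e_i$ be the edge from $v_i$ to $v_{i+1}$, parametrized by $F_{e_i}(s)=(1-s)v_i+s\,v_{i+1}$, $s\in[0,1]$. Let $n_i$ be a unit normal to $e_i$ in either of the two directions, and let $\partial_{n_i}$ be the derivative in direction $n_i$. Let $h_Q$ be the maximal edge length and $\rho_Q$ the minimum of the angles of the four triangles $v_iv_{i+1}v_{i+2}$ formed by the edges and the diagonals. Let $F_Q:[0,1]^2\to\overline Q$, $$F_Q(\xi_1,\xi_2)=(1-\xi_1)(1-\xi_2)v_1+\xi_1(1-\xi_2)v_2+\xi_1\xi_2v_3+(1-\xi_1)\xi_2v_4 .$$ For an integer $p\ge 3$ put $k=\max(1,6-p)$ and split $[0,1]$ into the intervals $I_a=[\frac ak,\frac{a+1}k]$, $0\le a<k$. The local space $P_Q^p$ consists of all $u:\overline Q\to\mathbb R$ such that, for all $a,b$ and all $i$: $u\in C^{p-2}(\overline Q)$; $u\circ F_Q$ coincides on $I_a\times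 I_b$ with a polynomial of bi-degree $(p,p)$; $u\circ F_{e_i}\in C^{p-1}([0,1])$; and $(\partial_{n_i}u)\circ F_{e_i}$ coincides on $I_a$ with a polynomial of degree at most $p-1$. (For $p\ge5$ we have $k=1$ and the two smoothness conditions are automatic.) The set $\Lambda_Q^p$ of degrees of freedom consists of the following functionals on functions $u$ (derivatives at boundary points are one-sided, from $\overline Q$): \begin{itemize} \item $u,\ \partial_1u,\ \partial_2u,\ \partial_1\partial_1u,\ \partial_1\partial_2u,\ \partial_2\partial_2u$ at each vertex $v_i$; \item $u(F_{e_i}(j/p))$ for $1\le i\le4$, $3\le j\le p-3$ (none if $p\le5$); \item $\partial_{n_i}u(F_{e_i}(1/2))$ for $1\le i\le 4$ if $p\in\{3,4\}$, and $\partial_{n_i}u(F_{e_i}(\tfrac j{p-1}))$ for $1\le i\le 4$, $2\le j\le p-3$ if $p\ge5$; \item $u(F_Q(\eta_1,\eta_2))$ for $\eta_1,\eta_2\in N_p$, where $N_3=\{\frac29,\frac49,\frac59,\frac79\}$, $N_4=\{\frac14,\frac24,\frac34\}$ and $N_p=\{\frac2p,\dots,\frac{p-2}p\}$ for $p\ge5$.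 \end{itemize} The local projector is $\Pi_{P_Q^p}\psi=\sum_{\lambda\in\Lambda_Q^p}\lambda(\psi)\beta_\lambda$ for $\psi\in C^2(\overline Q)$, where $(\beta_\lambda)\subset P_Q^p$ is the basis dual to the degrees of freedom: $\lambda(\beta_\lambda)=1$, and $\lambda'(\beta_\lambda)=0$ for $\lambda'\ne\lambda$. Write $|f|_{W^m_q(Q)}=\big(\sum_{|\alpha|=m}\|D^\alpha f\|_{L^q(Q)}^q\big)^{1/q}$ for $q<\infty$, $|f|_{W^m_\infty(Q)}=\max_{|\alpha|=m}\|D^\alpha f\|_{L^\infty(Q)}$ (weak derivatives), and $H^m=W^m_2$. \textbf{Theorem.} Let $p\ge3$ be an integer and $\rho>0$. There is a constant $C>0$, depending only on $\rho$ and $p$, such that for every quadrilateral $Q$ as above with $\rho_Q\ge\rho$ and for every choice of the directions of the normals $n_i$, the following hold. \begin{enumerate} \item The dual family $(\beta_\lambda)_{\lambda\in\Lambda_Q^p}$ in $P_Q^p$ exists and is unique, so that $\Pi_{P_Q^p}$ is well defined. \item For all integers $0\le\ell\le2$ and $4\le m\le p+1$, each $\varphi\in H^m(Q)$ has a representative in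 $C^2(\overline Q)$, to which $\Pi_{P_Q^p}$ is applied, and $$|\varphi-\Pi_{P_Q^p}\varphi|_{H^\ell(Q)}\le C\,h_Q^{m-\ell}\,|\varphi|_{H^m(Q)} .$$ \item For all integers $3\le m\le p+1$, each $\varphi\in W^m_\infty(Q)$ has a representative in $C^2(\overline Q)$, to which $\Pi_{P_Q^p}$ is applied, and $$\|\varphi-\Pi_{P_Q^p}\varphi\|_{L^\infty(Q)}\le C\,h_Q^{m}\,|\varphi|_{W^m_\infty(Q)} .$$ \end{enumerate} -/

import Mathlib

open scoped ENNReal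

namespace BSQuad

noncomputable section

/-- The physical plane `ℝ²` with its Euclidean norm; `x 0` and `x 1` are the coordinates
`x₁` and `x₂`. -/
abbrev Plane : Type := EuclideanSpace ℝ (Fin 2)

/-! ### Derivatives, weak derivatives and Sobolev seminorms -/

/-- The partial derivative of `u` in the `k`-th coordinate direction, taken within the set `S`
(one-sided at boundary points of `S`; the usual one for `S = Set.univ`). -/
def pderivWithin (S : Set Plane) (k : Fin 2) (u : Plane → ℝ) : Plane → ℝ :=
  fun x => fderivWithin ℝ u S x (EuclideanSpace.single k 1)

/-- The partial derivative `∂₁^{α₁} ∂₂^{α₂} u` for the multi-index `α`, taken within `S`. -/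
def mderivWithin (S : Set Plane) (α : ℕ × ℕ) (u : Plane → ℝ) : Plane → ℝ :=
  (pderivWithin S 0)^[α.1] ((pderivWithin S 1)^[α.2] u)

/-- `g` is a weak derivative `D^α f` on the open set `U`. -/
def HasWeakDeriv (U : Set Plane) (α : ℕ × ℕ) (f g : Plane → ℝ) : Prop :=
  MeasureTheory.LocallyIntegrableOn f U ∧ MeasureTheory.LocallyIntegrableOn g U ∧
    ∀ η : Plane → ℝ, ContDiff ℝ ((⊤ : ℕ∞) : WithTop ℕ∞) η → HasCompactSupport η → tsupport η ⊆ U →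
      ∫ x in U, f x * mderivWithin Set.univ α η x =
        (-1 : ℝ) ^ (α.1 + α.2) * ∫ x in U, g x * η x

/-- `f ∈ W^m_q(U)`: all weak derivatives of order at most `m` exist and lie in `L^q(U)`.
The case `q = 2` is `H^m(U)`. -/
def MemSobolev (q : ℝ≥0∞) (m : ℕ) (U : Set Plane) (f : Plane → ℝ) : Prop :=
  ∀ α : ℕ × ℕ, α.1 + α.2 ≤ m →
    ∃ g : Plane → ℝ, HasWeakDeriv U α f g ∧
      MeasureTheory.MemLp g q (MeasureTheory.volume.restrict U)

/-- The norm `‖D^α f‖_{L^q(U)}` of the weak derivative. Weak derivatives are unique almost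
everywhere, so the infimum is over equal values; it is `∞` when there is no weak derivative. -/
def weakDerivNorm (q : ℝ≥0∞) (U : Set Plane) (α : ℕ × ℕ) (f : Plane → ℝ) : ℝ≥0∞ :=
  ⨅ (g : Plane → ℝ) (_ : HasWeakDeriv U α f g),
    MeasureTheory.eLpNorm g q (MeasureTheory.volume.restrict U)

/-- The Sobolev seminorm `|f|_{W^m_q(U)}`, built from the weak derivatives of order exactly `m`:
`(∑_{|α|=m} ‖D^α f‖_q^q)^{1/q}` for finite `q`, and `max_{|α|=m} ‖D^α f‖_∞` for `q = ∞`. -/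
def sobolevSeminorm (q : ℝ≥0∞) (m : ℕ) (U : Set Plane) (f : Plane → ℝ) : ℝ≥0∞ :=
  if q = ∞ then ⨆ α ∈ Finset.HasAntidiagonal.antidiagonal m, weakDerivNorm q U α f
  else (∑ α ∈ Finset.HasAntidiagonal.antidiagonal m, weakDerivNorm q U α f ^ q.toReal) ^ (1 / q.toReal)

/-! ### Convex quadrilaterals -/

/-- `det (s, t)` for two vectors of the plane. -/
def det2 (s t : Plane) : ℝ := s 0 * t 1 - s 1 * t 0

/-- A non-degenerate convex quadrilateral, given by its four vertices in counter-clockwise order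
(indices modulo `4`): at every vertex the boundary makes a strict left turn. -/
structure ConvexQuad where
  vertex : Fin 4 → Plane
  left_turn : ∀ i : Fin 4, 0 < det2 (vertex i - vertex (i - 1)) (vertex (i + 1) - vertex i)

namespace ConvexQuad

variable (Q : ConvexQuad)

/-- The edge vector `t⁽ⁱ⁾ = v_{i+1} - v_i`. -/
def edgeVec (i : Fin 4) : Plane := Q.vertex (i + 1) - Q.vertex i

/-- The closed quadrilateral `Q̄`. -/
def closed : Set Plane := convexHull ℝ (Set.range Q.vertex)

/-- The open quadrilateral `Q`. -/
def opened : Set Plane := interior Q.closed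

/-- `h_Q`, the length of the longest edge. -/
def size : ℝ := ⨆ i : Fin 4, ‖Q.edgeVec i‖

/-- `ρ_Q`, the minimum of the angles of the four triangles `v_i v_{i+1} v_{i+2}` that are formed
by edges and diagonals. -/
def minAngle : ℝ :=
  ⨅ i : Fin 4,
    min (EuclideanGeometry.angle (Q.vertex i) (Q.vertex (i + 1)) (Q.vertex (i + 2)))
      (min (EuclideanGeometry.angle (Q.vertex (i + 1)) (Q.vertex (i + 2)) (Q.vertex i))
        (EuclideanGeometry.angle (Q.vertex (i + 2)) (Q.vertex i) (Q.vertex (i + 1))))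

/-- The bilinear parametrization `F_Q` of `Q̄` over the unit square, in the parameters `s`, `t`. -/
def param (s t : ℝ) : Plane :=
  ((1 - s) * (1 - t)) • Q.vertex 0 + (s * (1 - t)) • Q.vertex 1 +
    (s * t) • Q.vertex 2 + ((1 - s) * t) • Q.vertex 3

/-- The parametrization of the `i`-th edge over `[0,1]`, which up to the direction is the
restriction of `F_Q` to that edge. -/
def edgeParam (i : Fin 4) (s : ℝ) : Plane :=
  (1 - s) • Q.vertex i + s • Q.vertex (i + 1)

/-- The unit normal vector of the `i`-th edge that points into `Q`. -/
def innerNormal (i : Fin 4) : Plane :=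
  ‖Q.edgeVec i‖⁻¹ • !₂[-(Q.edgeVec i 1), Q.edgeVec i 0]

/-- The derivative of `u` at `x` in the direction of the inner normal of the `i`-th edge,
taken within `Q̄`. -/
def normalDeriv (i : Fin 4) (u : Plane → ℝ) (x : Plane) : ℝ :=
  fderivWithin ℝ u Q.closed x (Q.innerNormal i)

end ConvexQuad

/-! ### The local space -/

/-- The number `k` of subintervals of the split of `[0,1]`: `3` for `p = 3`, `2` for `p = 4`, and
`1` (no split) for `p ≥ 5`. -/
def numSplit (p : ℕ) : ℕ := max 1 (6 - p)

/-- The `j`-th interval `[j/k, (j+1)/k]` of the split. -/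
def subInterval (p : ℕ) (j : Fin (numSplit p)) : Set ℝ :=
  Set.Icc ((j : ℝ) / numSplit p) (((j : ℝ) + 1) / numSplit p)

/-- `w` coincides on `A × B` with a polynomial of bi-degree `(p, p)`. -/
def IsBiPolyOn (p : ℕ) (A B : Set ℝ) (w : ℝ → ℝ → ℝ) : Prop :=
  ∃ c : Fin (p + 1) → Fin (p + 1) → ℝ, ∀ s ∈ A, ∀ t ∈ B,
    w s t = ∑ i, ∑ j, c i j * s ^ (i : ℕ) * t ^ (j : ℕ)

/-- `w` coincides on `A` with a univariate polynomial of degree at most `d`. -/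
def IsPolyOn (d : ℕ) (A : Set ℝ) (w : ℝ → ℝ) : Prop :=
  ∃ P : Polynomial ℝ, P.natDegree ≤ d ∧ ∀ s ∈ A, w s = P.eval s

/-- The local space of the Brenner-Sung quadrilateral of degree `p`. A function `Q̄ → ℝ` is
represented by its extension by zero to the plane. For `p ≥ 5` there is one subinterval, and the
two smoothness conditions follow from the polynomial condition. -/
structure MemLocalSpace (Q : ConvexQuad) (p : ℕ) (u : Plane → ℝ) : Prop where
  eq_zero_off : ∀ x, x ∉ Q.closed → u x = 0
  smooth : ContDiffOn ℝ (p - 2 : ℕ) u Q.closed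
  bipoly : ∀ a b : Fin (numSplit p),
    IsBiPolyOn p (subInterval p a) (subInterval p b) (fun s t => u (Q.param s t))
  trace_smooth : ∀ i : Fin 4,
    ContDiffOn ℝ (p - 1 : ℕ) (fun s => u (Q.edgeParam i s)) (Set.Icc 0 1)
  normal_poly : ∀ i : Fin 4, ∀ a : Fin (numSplit p),
    IsPolyOn (p - 1) (subInterval p a) (fun s => Q.normalDeriv i u (Q.edgeParam i s))

/-! ### Degrees of freedom and the local projector -/

/-- The multi-indices of order at most two. -/
def vertexJets : Finset (ℕ × ℕ) := {(0, 0), (1, 0), (0, 1), (2, 0), (1, 1), (0, 2)}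

/-- Parameters of the point evaluations on an edge: `j/p` for `3 ≤ j ≤ p - 3` (none for
`p ≤ 5`). -/
def traceNodes (p : ℕ) : Finset ℚ :=
  (Finset.Icc 3 (p - 3)).image fun j : ℕ => (j : ℚ) / p

/-- Parameters of the normal derivative evaluations on an edge: the midpoint for `p ≤ 5`, and
`j/(p-1)` for `2 ≤ j ≤ p - 3` if `p ≥ 5`. -/
def normalNodes (p : ℕ) : Finset ℚ :=
  if p ≤ 4 then {1 / 2} else (Finset.Icc 2 (p - 3)).image fun j : ℕ => (j : ℚ) / ((p : ℚ) - 1)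

/-- Coordinates of the preimages of the face points. -/
def faceNodes (p : ℕ) : Finset ℚ :=
  if p = 3 then {2 / 9, 4 / 9, 5 / 9, 7 / 9}
  else if p = 4 then {1 / 4, 2 / 4, 3 / 4}
  else (Finset.Icc 2 (p - 2)).image fun j : ℕ => (j : ℚ) / p

/-- The index set of the local degrees of freedom: derivatives of order at most two at the
vertices, values on the edges, normal derivatives on the edges, values at the face points. -/
abbrev DofIndex (p : ℕ) : Type :=
  (Fin 4 × vertexJets) ⊕ (Fin 4 × traceNodes p) ⊕ (Fin 4 × normalNodes p) ⊕
    (faceNodes p × faceNodes p)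

/-- The local degrees of freedom. The sign `σ i` fixes the direction of the unit normal of the
`i`-th edge: inner for `1`, outer for `-1`. -/
def dof (Q : ConvexQuad) (p : ℕ) (σ : Fin 4 → ℤˣ) : DofIndex p → (Plane → ℝ) → ℝ
  | Sum.inl (i, α), u => mderivWithin Q.closed α u (Q.vertex i)
  | Sum.inr (Sum.inl (i, r)), u => u (Q.edgeParam i ((r : ℚ) : ℝ))
  | Sum.inr (Sum.inr (Sum.inl (i, r))), u =>
      ((σ i : ℤ) : ℝ) * Q.normalDeriv i u (Q.edgeParam i ((r : ℚ) : ℝ))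
  | Sum.inr (Sum.inr (Sum.inr (r, s))), u => u (Q.param ((r : ℚ) : ℝ) ((s : ℚ) : ℝ))

/-- `β` is a family of functions of the local space that is dual to the degrees of freedom. -/
def IsDualBasis (Q : ConvexQuad) (p : ℕ) (σ : Fin 4 → ℤˣ)
    (β : DofIndex p → Plane → ℝ) : Prop :=
  (∀ l, MemLocalSpace Q p (β l)) ∧
    ∀ l l', dof Q p σ l' (β l) = if l' = l then 1 else 0

open Classical in
/-- The dual basis (the zero family, should there be none). -/
def dualBasis (Q : ConvexQuad) (p : ℕ) (σ : Fin 4 → ℤˣ) : DofIndex p → Plane → ℝ :=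
  if h : ∃ β, IsDualBasis Q p σ β then h.choose else 0

/-- The local projector `Π ψ = ∑ λ(ψ) β_λ`. -/
def localProjector (Q : ConvexQuad) (p : ℕ) (σ : Fin 4 → ℤˣ) (ψ : Plane → ℝ) : Plane → ℝ :=
  fun x => ∑ l, dof Q p σ l ψ * dualBasis Q p σ l x

/-- `ψ` is the representative in `C²(Q̄)` of the class of `f` modulo equality almost everywhere
on `Q`; its values on `Q̄` are determined by `f`. -/
def IsC2Rep (Q : ConvexQuad) (f ψ : Plane → ℝ) : Prop :=
  ContDiffOn ℝ 2 ψ Q.closed ∧ ψ =ᵐ[MeasureTheory.volume.restrict Q.opened] f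

end

end BSQuad

/-! The estimate rests on three facts. The projector is stable in a scaled `C²` norm, with a
constant that depends only on `p` and on the shape; it reproduces polynomials of degree at most `p`;
and a Sobolev function on a convex set has a `C²` representative that is close to such a polynomial.
If `E` is the representative minus the polynomial, then the error of the projector equals `E` minus
the projection of `E` (`sub_localProjector_eq`), and both terms are small.

Shape. By the law of sines the angle condition yields a `κ > 0` such that all edges are at least `κ
h` and all corner determinants at least `κ h²` (`exists_shape_of_minAngle`). The Jacobian of the
bilinear map interpolates the corner determinants (`jac_eq`). So this map is a bijection from the
square onto the closed quadrilateral, and its inverse is smooth with components of Lipschitz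
constant `1 / (κ h)`.

Stability. Apart from the edge conditions, the local space consists of the tensor product splines on
the square, carried over by the bilinear map (`memBase_lift`, `MemBase.exists_lift`). Its members
are thus arrays of coefficients of a size fixed by `p`. On an edge the trace is a spline of degree
`p` and smoothness `p - 1`, the normal derivative one of degree `p - 1` and smoothness `p - 2`.
Vertex jets and edge functionals determine both (`splineUnisolvent_trace`,
`splineUnisolvent_normal`), hence control the values and the transversal derivatives on the boundary
of the square (`exists_edge_bound`). With the face values this bounds all coefficients
(`exists_surf_bound`, `exists_coef_bound`).

Dual basis. The coefficient bound with vanishing data gives uniqueness. For existence, `2k - 1`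
linear equations on each edge suffice for the edge conditions, and the number of coefficients minus
the number of these equations is exactly the number of degrees of freedom (`dof_count`). The degrees
of freedom are injective on the solution space, hence bijective (`exists_dualBasis`).

Approximation. Contracting a convex set towards the centre of a ball inside it makes room for
mollification up to the boundary. An averaged first order Taylor formula bounds the maximum of a
function by the `L²` norms of its derivatives of order at most two; if derivatives are bounded,
equi-Lipschitz continuity plays the same part. The mollifications therefore converge uniformly
together with their derivatives, and they produce both the representative and a polynomial with an
explicit error (`exists_jet_of_l2`, `exists_jet_of_bounded`).

For `p = 3` the local space is only known to be `C¹` as a whole. The seminorm of order two is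
therefore estimated through the Lipschitz constant of the gradient (`exists_lift_bound`,
`sobolevSeminorm_two_le_of_lipschitz`). `exists_error_bound` joins the pieces. -/

namespace BSQuad
noncomputable section

open MeasureTheory Set Filter Topology

/-! ### Estimates on convex sets -/

/-- The linear form with components `g`. -/
def gradL (g : Fin 2 → ℝ) : Plane →L[ℝ] ℝ := ∑ k, g k • EuclideanSpace.proj k

@[simp] lemma gradL_apply (g : Fin 2 → ℝ) (v : Plane) : gradL g v = ∑ k, g k * v k := by
  simp [gradL]

lemma abs_coord_le (v : Plane) (k : Fin 2) : |v k| ≤ ‖v‖ := by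
  simpa using PiLp.norm_apply_le v k

lemma norm_gradL_le (g : Fin 2 → ℝ) : ‖gradL g‖ ≤ ∑ k, |g k| := by
  refine ContinuousLinearMap.opNorm_le_bound _ (Finset.sum_nonneg fun _ _ => abs_nonneg _) fun v => ?_
  rw [gradL_apply, Finset.sum_mul]
  refine (Finset.abs_sum_le_sum_abs _ _).trans (Finset.sum_le_sum fun k _ => ?_)
  rw [abs_mul]
  exact mul_le_mul_of_nonneg_left (abs_coord_le v k) (abs_nonneg _)

/-- The `L²(D)` norm as a real number. -/
def l2norm (D : Set Plane) (u : Plane → ℝ) : ℝ := (eLpNorm u 2 (volume.restrict D)).toReal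

/-- By convexity a contraction towards a point of the closure maps `D` into itself, and it
multiplies areas by `s²`. -/
lemma map_homothety_restrict_le {D : Set Plane} (hD : Convex ℝ D) (hDo : IsOpen D) {x : Plane}
    (hx : x ∈ closure D) {s : ℝ} (hs : 0 < s) (hs1 : s ≤ 1) :
    Measure.map (fun z => x + s • (z - x)) (volume.restrict D) ≤
      ENNReal.ofReal (s⁻¹ ^ 2) • volume.restrict D := by
  have hmeas : Measurable fun z : Plane => x + s • (z - x) := by fun_prop
  refine Measure.le_iff.2 fun A hA => ?_
  rw [Measure.map_apply hmeas hA, Measure.restrict_apply (hmeas hA), Measure.smul_apply,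
    Measure.restrict_apply hA, smul_eq_mul]
  have hsub : (fun z : Plane => x + s • (z - x)) ⁻¹' A ∩ D ⊆
      AffineMap.homothety x s⁻¹ '' (A ∩ D) := by
    rintro z ⟨hz, hzD⟩
    refine ⟨x + s • (z - x), ⟨hz, ?_⟩, ?_⟩
    · have h := hD.combo_interior_closure_mem_interior (x := z) (y := x)
        (by rwa [hDo.interior_eq]) hx hs (sub_nonneg.2 hs1) (by ring)
      rw [hDo.interior_eq] at h
      convert h using 1
      module
    · simp [AffineMap.homothety_apply, smul_smul, hs.ne']
  refine (measure_mono hsub).trans ?_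
  rw [Measure.addHaar_image_homothety]
  simp [abs_of_pos hs]

/-- After the Cauchy-Schwarz inequality the change of variables costs only the square root of `s⁻²`.
The remaining `s⁻¹` is harmless, because the Taylor remainder carries a weight `s`. -/
lemma lintegral_homothety_le {D : Set Plane} (hD : Convex ℝ D) (hDo : IsOpen D) {x : Plane}
    (hx : x ∈ closure D) {s : ℝ} (hs : 0 < s) (hs1 : s ≤ 1) {F : Plane → ℝ} (hF : Continuous F) :
    ∫⁻ z in D, ENNReal.ofReal |F (x + s • (z - x))| ≤
      ENNReal.ofReal s⁻¹ * eLpNorm F 2 (volume.restrict D) * volume D ^ (1 / 2 : ℝ) := by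
  have hT : Continuous fun z : Plane => x + s • (z - x) := by fun_prop
  have h1 : ∫⁻ z in D, ENNReal.ofReal |F (x + s • (z - x))| =
      eLpNorm (F ∘ fun z => x + s • (z - x)) 1 (volume.restrict D) := by
    rw [eLpNorm_one_eq_lintegral_enorm]
    refine lintegral_congr fun z => ?_
    simp [Real.enorm_eq_ofReal_abs]
  rw [h1]
  refine (eLpNorm_le_eLpNorm_mul_rpow_measure_univ (p := 1) (q := 2) (by norm_num)
    (hF.comp hT).aestronglyMeasurable).trans ?_
  rw [Measure.restrict_apply_univ]
  have hexp : (1 / (1 : ℝ≥0∞).toReal - 1 / (2 : ℝ≥0∞).toReal) = 1 / 2 := by norm_num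
  rw [hexp]
  gcongr
  rw [← eLpNorm_map_measure hF.aestronglyMeasurable hT.aemeasurable]
  refine (eLpNorm_mono_measure _ (map_homothety_restrict_le hD hDo hx hs hs1)).trans ?_
  rw [eLpNorm_smul_measure_of_ne_top (by norm_num), smul_eq_mul]
  gcongr
  rw [ENNReal.ofReal_rpow_of_nonneg (by positivity) (by norm_num)]
  apply ENNReal.ofReal_le_ofReal
  rw [show (1 / (2 : ℝ≥0∞)).toReal = ((2 : ℕ) : ℝ)⁻¹ by simp, Real.pow_rpow_inv_natCast (by positivity) (by norm_num)]

lemma memLp_of_continuous {D : Set Plane} (hDb : Bornology.IsBounded D) {F : Plane → ℝ}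
    (hF : Continuous F) (q : ℝ≥0∞) : MemLp F q (volume.restrict D) := by
  have hfin : IsFiniteMeasure (volume.restrict D) :=
    ⟨by simpa using hDb.measure_lt_top⟩
  obtain ⟨C, hC⟩ := (hDb.isCompact_closure).exists_bound_of_continuousOn hF.continuousOn
  refine MemLp.of_bound hF.aestronglyMeasurable C ?_
  have : ∀ᵐ x ∂volume.restrict (closure D), ‖F x‖ ≤ C :=
    (ae_restrict_iff' isClosed_closure.measurableSet).2 (ae_of_all _ hC)
  exact ae_mono (Measure.restrict_mono subset_closure le_rfl) this

/-- The remainder of the first order Taylor polynomial, averaged over its centre. -/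
lemma abs_sub_average_taylor_le {D : Set Plane} (hD : Convex ℝ D) (hDo : IsOpen D)
    (hDb : Bornology.IsBounded D) {d : ℝ} (hd : ∀ x ∈ closure D, ∀ z ∈ D, ‖z - x‖ ≤ d)
    {v : Plane → ℝ} {v1 : Fin 2 → Plane → ℝ} {v2 : Fin 2 → Fin 2 → Plane → ℝ}
    (hv : Continuous v) (hv1 : ∀ k, Continuous (v1 k)) (hv2 : ∀ k l, Continuous (v2 k l))
    (h1 : ∀ x ∈ closure D, HasFDerivAt v (gradL fun k => v1 k x) x)
    (h2 : ∀ k, ∀ x ∈ closure D, HasFDerivAt (v1 k) (gradL fun l => v2 k l x) x)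
    {x : Plane} (hx : x ∈ closure D) :
    |v x * volume.real D - ∫ z in D, (v z + ∑ k, v1 k z * (x - z) k)| ≤
      d ^ 2 * Real.sqrt (volume.real D) * ∑ k, ∑ l, l2norm D (v2 k l) := by
  have hfin : IsFiniteMeasure (volume.restrict D) := ⟨by simpa using hDb.measure_lt_top⟩
  have hseg : ∀ z ∈ D, ∀ s ∈ Icc (0 : ℝ) 1, x + s • (z - x) ∈ closure D := fun z hz s hs => by
    have := hD.closure hx (subset_closure hz) (sub_nonneg.2 hs.2) hs.1 (by ring)
    convert this using 1
    module
  -- the pointwise bound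
  have hpt : ∀ z ∈ D, ENNReal.ofReal |v x - (v z + ∑ k, v1 k z * (x - z) k)| ≤
      ∫⁻ s in Ioc (0 : ℝ) 1, ∑ k, ∑ l,
        ENNReal.ofReal (d ^ 2 * s) * ENNReal.ofReal |v2 k l (x + s • (z - x))| := by
    intro z hz
    set w : Plane := z - x with hw
    have hy : ∀ s : ℝ, HasDerivAt (fun s : ℝ => x + s • w) w s := fun s => by
      simpa using ((hasDerivAt_id s).smul_const w).const_add x
    have hφ : ∀ s ∈ Icc (0 : ℝ) 1, HasDerivAt (fun s : ℝ => v (x + s • w))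
        (∑ k, v1 k (x + s • w) * w k) s := fun s hs => by
      have := (h1 _ (hseg z hz s hs)).comp_hasDerivAt s (hy s)
      rwa [gradL_apply] at this
    have hφ1 : ∀ k, ∀ s ∈ Icc (0 : ℝ) 1, HasDerivAt (fun s : ℝ => v1 k (x + s • w))
        (∑ l, v2 k l (x + s • w) * w l) s := fun k s hs => by
      have := (h2 k _ (hseg z hz s hs)).comp_hasDerivAt s (hy s)
      rwa [gradL_apply] at this
    -- This combination equals `v x` at `s = 0` and the Taylor polynomial with centre `z`, evaluated
    -- at `x`, at `s = 1`. The first derivatives cancel, so its derivative is a second derivative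
    -- with the weight `s`.
    have hφ' : ∀ s ∈ Icc (0 : ℝ) 1, HasDerivAt
        (fun s : ℝ => v (x + s • w) - s * ∑ k, v1 k (x + s • w) * w k)
        (-(s * ∑ k, (∑ l, v2 k l (x + s • w) * w l) * w k)) s := fun s hs => by
      have h := (hφ s hs).sub ((hasDerivAt_id s).mul
        (HasDerivAt.fun_sum (u := Finset.univ) fun k _ => (hφ1 k s hs).mul_const (w k)))
      refine HasDerivAt.congr_deriv h ?_
      simp only [id, one_mul]
      ring
    have hcont : Continuous fun s : ℝ => -(s * ∑ k, (∑ l, v2 k l (x + s • w) * w l) * w k) := by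
      fun_prop
    have hint := intervalIntegral.integral_eq_sub_of_hasDerivAt
      (fun s hs => hφ' s (by rwa [uIcc_of_le zero_le_one] at hs))
      (hcont.intervalIntegrable (μ := volume) 0 1)
    have hL : v x - (v z + ∑ k, v1 k z * (x - z) k) =
        ∫ s in Ioc (0 : ℝ) 1, (s * ∑ k, (∑ l, v2 k l (x + s • w) * w l) * w k) := by
      rw [intervalIntegral.integral_neg, intervalIntegral.integral_of_le zero_le_one] at hint
      have hxw : x + (1 : ℝ) • w = z := by simp [hw]
      rw [hxw] at hint
      simp only [Fin.sum_univ_two, zero_smul, add_zero, zero_mul, one_mul] at hint ⊢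
      have e : ∀ k, (x - z) k = - w k := fun k => by simp [hw]
      rw [e, e]; linarith
    rw [hL, ← Real.enorm_eq_ofReal_abs]
    refine (enorm_integral_le_lintegral_enorm _).trans ?_
    refine setLIntegral_mono' measurableSet_Ioc fun s hs => ?_
    rw [Real.enorm_eq_ofReal_abs]
    have hwd : ∀ k, |w k| ≤ d := fun k => (abs_coord_le w k).trans (hd x hx z hz)
    have hd0 : 0 ≤ d := (abs_nonneg _).trans (hwd 0)
    have hb : |s * ∑ k, (∑ l, v2 k l (x + s • w) * w l) * w k| ≤
        ∑ k, ∑ l, d ^ 2 * s * |v2 k l (x + s • w)| := by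
      rw [abs_mul, abs_of_pos hs.1]
      refine (mul_le_mul_of_nonneg_left (Finset.abs_sum_le_sum_abs _ _) hs.1.le).trans ?_
      rw [Finset.mul_sum]
      refine Finset.sum_le_sum fun k _ => ?_
      rw [abs_mul, ← Finset.mul_sum]
      have : |∑ l, v2 k l (x + s • w) * w l| ≤ ∑ l, |v2 k l (x + s • w)| * d :=
        (Finset.abs_sum_le_sum_abs _ _).trans (Finset.sum_le_sum fun l _ => by
          rw [abs_mul]; exact mul_le_mul_of_nonneg_left (hwd l) (abs_nonneg _))
      rw [← Finset.sum_mul] at this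
      calc s * (|∑ l, v2 k l (x + s • w) * w l| * |w k|)
          ≤ s * (((∑ l, |v2 k l (x + s • w)|) * d) * d) := by
            gcongr
            · exact hs.1.le
            · exact hwd k
        _ = _ := by ring
    refine (ENNReal.ofReal_le_ofReal hb).trans (le_of_eq ?_)
    rw [ENNReal.ofReal_sum_of_nonneg fun k _ => Finset.sum_nonneg fun l _ => by
      have := hs.1; positivity]
    refine Finset.sum_congr rfl fun k _ => ?_
    rw [ENNReal.ofReal_sum_of_nonneg fun l _ => by have := hs.1; positivity]
    refine Finset.sum_congr rfl fun l _ => ?_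
    rw [ENNReal.ofReal_mul (by have := hs.1; positivity)]
  have hcontI : Continuous fun z => v z + ∑ k, v1 k z * (x - z) k := by fun_prop
  have hI := (memLp_of_continuous hDb hcontI 1).integrable le_rfl
  have hL : v x * volume.real D - ∫ z in D, (v z + ∑ k, v1 k z * (x - z) k) =
      ∫ z in D, (v x - (v z + ∑ k, v1 k z * (x - z) k)) := by
    rw [integral_sub (integrable_const _) hI]
    simp [mul_comm]
  have hfinal : ENNReal.ofReal |v x * volume.real D - ∫ z in D, (v z + ∑ k, v1 k z * (x - z) k)| ≤
      ENNReal.ofReal (d ^ 2) * volume D ^ (1 / 2 : ℝ) *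
        ∑ k, ∑ l, eLpNorm (v2 k l) 2 (volume.restrict D) := by
    rw [hL, ← Real.enorm_eq_ofReal_abs]
    refine (enorm_integral_le_lintegral_enorm _).trans ?_
    simp_rw [Real.enorm_eq_ofReal_abs]
    refine (setLIntegral_mono' hDo.measurableSet hpt).trans ?_
    -- With the integral over `z` inside, `lintegral_homothety_le` applies; the weight `s` cancels
    -- its `s⁻¹`, and the integral over `s` is that of a constant.
    rw [lintegral_lintegral_swap]
    swap
    · refine Measurable.aemeasurable ?_
      simp only [Function.uncurry_def]
      refine Finset.measurable_sum _ fun k _ => Finset.measurable_sum _ fun l _ => ?_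
      have hc : Continuous fun p : Plane × ℝ => |v2 k l (x + p.2 • (p.1 - x))| := by fun_prop
      exact (by fun_prop : Measurable fun p : Plane × ℝ => ENNReal.ofReal (d ^ 2 * p.2)).mul
        hc.measurable.ennreal_ofReal
    have hin : ∀ s ∈ Ioc (0 : ℝ) 1, ∫⁻ z in D, ∑ k, ∑ l,
        ENNReal.ofReal (d ^ 2 * s) * ENNReal.ofReal |v2 k l (x + s • (z - x))| ≤
        ENNReal.ofReal (d ^ 2) * volume D ^ (1 / 2 : ℝ) *
          ∑ k, ∑ l, eLpNorm (v2 k l) 2 (volume.restrict D) := by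
      intro s hs
      have hm : ∀ k l, Measurable fun z : Plane =>
          ENNReal.ofReal (d ^ 2 * s) * ENNReal.ofReal |v2 k l (x + s • (z - x))| := fun k l => by
        have hc : Continuous fun z : Plane => |v2 k l (x + s • (z - x))| := by fun_prop
        exact hc.measurable.ennreal_ofReal.const_mul _
      rw [lintegral_finsetSum _ fun k _ => Finset.measurable_sum _ fun l _ => hm k l,
        Finset.mul_sum]
      refine Finset.sum_le_sum fun k _ => ?_
      rw [lintegral_finsetSum _ fun l _ => hm k l, Finset.mul_sum]
      refine Finset.sum_le_sum fun l _ => ?_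
      rw [lintegral_const_mul' _ _ ENNReal.ofReal_ne_top]
      refine (mul_le_mul_right (lintegral_homothety_le hD hDo hx hs.1 hs.2 (hv2 k l)) _).trans
        (le_of_eq ?_)
      rw [ENNReal.ofReal_mul (by positivity), ENNReal.ofReal_inv_of_pos hs.1]
      have h0 : ENNReal.ofReal s * (ENNReal.ofReal s)⁻¹ = 1 :=
        ENNReal.mul_inv_cancel (by simpa using hs.1) ENNReal.ofReal_ne_top
      calc ENNReal.ofReal (d ^ 2) * ENNReal.ofReal s * ((ENNReal.ofReal s)⁻¹ *
            eLpNorm (v2 k l) 2 (volume.restrict D) * volume D ^ (1 / 2 : ℝ))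
          = (ENNReal.ofReal s * (ENNReal.ofReal s)⁻¹) * (ENNReal.ofReal (d ^ 2) *
            volume D ^ (1 / 2 : ℝ) * eLpNorm (v2 k l) 2 (volume.restrict D)) := by ring
        _ = _ := by rw [h0, one_mul]
    refine (setLIntegral_mono' measurableSet_Ioc hin).trans ?_
    simp
  have hne : ∀ k l, eLpNorm (v2 k l) 2 (volume.restrict D) ≠ ∞ := fun k l =>
    (memLp_of_continuous hDb (hv2 k l) 2).2.ne
  have hvol : volume D ≠ ∞ := hDb.measure_lt_top.ne
  have := ENNReal.toReal_mono (by
    refine ENNReal.mul_ne_top (ENNReal.mul_ne_top ENNReal.ofReal_ne_top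
      (ENNReal.rpow_ne_top_of_nonneg (by norm_num) hvol)) ?_
    exact ENNReal.sum_ne_top.2 fun k _ => ENNReal.sum_ne_top.2 fun l _ => hne k l) hfinal
  rw [ENNReal.toReal_ofReal (abs_nonneg _)] at this
  refine this.trans (le_of_eq ?_)
  rw [ENNReal.toReal_mul, ENNReal.toReal_mul, ENNReal.toReal_ofReal (by positivity),
    ← ENNReal.toReal_rpow, ← Real.sqrt_eq_rpow, ENNReal.toReal_sum fun k _ =>
      ENNReal.sum_ne_top.2 fun l _ => hne k l]
  congr 1
  refine Finset.sum_congr rfl fun k _ => ?_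
  rw [ENNReal.toReal_sum fun l _ => hne k l]
  rfl

end
end BSQuad

namespace BSQuad
noncomputable section

open MeasureTheory Set Filter Topology

/-! ### Inequalities for the `L²` norm on bounded convex sets -/

lemma eLpNorm_comp_homothety_le {D : Set Plane} (hD : Convex ℝ D) (hDo : IsOpen D) {x : Plane}
    (hx : x ∈ closure D) {s : ℝ} (hs : 0 < s) (hs1 : s ≤ 1) {F : Plane → ℝ} (hF : Continuous F) :
    eLpNorm (fun z => F (x + s • (z - x))) 2 (volume.restrict D) ≤
      ENNReal.ofReal s⁻¹ * eLpNorm F 2 (volume.restrict D) := by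
  have hT : Continuous fun z : Plane => x + s • (z - x) := by fun_prop
  have := eLpNorm_map_measure (p := 2) (μ := volume.restrict D) hF.aestronglyMeasurable
    hT.aemeasurable
  change eLpNorm (F ∘ fun z => x + s • (z - x)) 2 (volume.restrict D) ≤ _
  rw [← this]
  refine (eLpNorm_mono_measure _ (map_homothety_restrict_le hD hDo hx hs hs1)).trans ?_
  rw [eLpNorm_smul_measure_of_ne_top (by norm_num), smul_eq_mul]
  gcongr
  rw [ENNReal.ofReal_rpow_of_nonneg (by positivity) (by norm_num)]
  apply ENNReal.ofReal_le_ofReal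
  rw [show (1 / (2 : ℝ≥0∞)).toReal = ((2 : ℕ) : ℝ)⁻¹ by simp,
    Real.pow_rpow_inv_natCast (by positivity) (by norm_num)]

lemma l2norm_nonneg (D : Set Plane) (u : Plane → ℝ) : 0 ≤ l2norm D u := ENNReal.toReal_nonneg

lemma l2norm_add_le {D : Set Plane} {u v : Plane → ℝ} (hu : MemLp u 2 (volume.restrict D))
    (hv : MemLp v 2 (volume.restrict D)) :
    l2norm D (fun x => u x + v x) ≤ l2norm D u + l2norm D v := by
  rw [l2norm, l2norm, l2norm, ← ENNReal.toReal_add hu.2.ne hv.2.ne]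
  exact ENNReal.toReal_mono (ENNReal.add_ne_top.2 ⟨hu.2.ne, hv.2.ne⟩)
    (eLpNorm_add_le hu.1 hv.1 (by norm_num))

lemma l2norm_sub_le {D : Set Plane} {u v : Plane → ℝ} (hu : MemLp u 2 (volume.restrict D))
    (hv : MemLp v 2 (volume.restrict D)) :
    l2norm D (fun x => u x - v x) ≤ l2norm D u + l2norm D v := by
  rw [l2norm, l2norm, l2norm, ← ENNReal.toReal_add hu.2.ne hv.2.ne]
  exact ENNReal.toReal_mono (ENNReal.add_ne_top.2 ⟨hu.2.ne, hv.2.ne⟩)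
    (eLpNorm_sub_le hu.1 hv.1 (by norm_num))

lemma l2norm_const_mul (D : Set Plane) (a : ℝ) (u : Plane → ℝ) :
    l2norm D (fun x => a * u x) = |a| * l2norm D u := by
  have : (fun x => a * u x) = a • u := rfl
  rw [l2norm, this, eLpNorm_const_smul, ENNReal.toReal_mul, l2norm]
  simp

lemma integral_abs_le_l2norm {D : Set Plane} (hDb : Bornology.IsBounded D) {u : Plane → ℝ}
    (hu : MemLp u 2 (volume.restrict D)) :
    ∫ z in D, |u z| ≤ Real.sqrt (volume.real D) * l2norm D u := by
  have h1 : ENNReal.ofReal (∫ z in D, |u z|) = eLpNorm u 1 (volume.restrict D) := by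
    have hfin : IsFiniteMeasure (volume.restrict D) := ⟨by simpa using hDb.measure_lt_top⟩
    rw [eLpNorm_one_eq_lintegral_enorm, ofReal_integral_eq_lintegral_ofReal]
    · simp [Real.enorm_eq_ofReal_abs]
    · exact (hu.integrable (by norm_num)).abs
    · exact ae_of_all _ fun _ => abs_nonneg _
  have h2 := eLpNorm_le_eLpNorm_mul_rpow_measure_univ (p := 1) (q := 2) (by norm_num) hu.1
  rw [Measure.restrict_apply_univ, show (1 / (1 : ℝ≥0∞).toReal - 1 / (2 : ℝ≥0∞).toReal) = 1 / 2 by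
    norm_num, ← h1] at h2
  have := ENNReal.toReal_mono (ENNReal.mul_ne_top hu.2.ne
    (ENNReal.rpow_ne_top_of_nonneg (by norm_num) hDb.measure_lt_top.ne)) h2
  rw [ENNReal.toReal_ofReal (integral_nonneg fun _ => abs_nonneg _), ENNReal.toReal_mul,
    ← ENNReal.toReal_rpow, ← Real.sqrt_eq_rpow] at this
  rw [mul_comm]
  exact this

lemma abs_integral_taylor_le {D : Set Plane} (hDo : IsOpen D) (hDb : Bornology.IsBounded D) {d : ℝ}
    {x : Plane} (hd : ∀ z ∈ D, ‖z - x‖ ≤ d) {u : Plane → ℝ} {u1 : Fin 2 → Plane → ℝ}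
    (hu : MemLp u 2 (volume.restrict D)) (hu1 : ∀ k, MemLp (u1 k) 2 (volume.restrict D)) :
    |∫ z in D, (u z + ∑ k, u1 k z * (x - z) k)| ≤
      Real.sqrt (volume.real D) * (l2norm D u + d * ∑ k, l2norm D (u1 k)) := by
  have hfin : IsFiniteMeasure (volume.restrict D) := ⟨by simpa using hDb.measure_lt_top⟩
  have i0 := (hu.integrable (by norm_num)).abs
  have i1 : ∀ k, Integrable (fun z => |u1 k z|) (volume.restrict D) :=
    fun k => ((hu1 k).integrable (by norm_num)).abs
  have hb : ∀ᵐ z ∂volume.restrict D, ‖u z + ∑ k, u1 k z * (x - z) k‖ ≤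
      |u z| + ∑ k, |u1 k z| * d := by
    refine (ae_restrict_iff' hDo.measurableSet).2 (ae_of_all _ fun z hz => ?_)
    rw [Real.norm_eq_abs]
    refine (abs_add_le _ _).trans (add_le_add le_rfl
      ((Finset.abs_sum_le_sum_abs _ _).trans (Finset.sum_le_sum fun k _ => ?_)))
    rw [abs_mul]
    refine mul_le_mul_of_nonneg_left ((abs_coord_le _ k).trans ?_) (abs_nonneg _)
    rw [norm_sub_rev]; exact hd z hz
  have := norm_integral_le_of_norm_le
    (i0.add (integrable_finsetSum _ fun k _ => (i1 k).mul_const d)) hb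
  rw [Real.norm_eq_abs] at this
  refine this.trans ?_
  simp only [Pi.add_apply]
  rw [integral_add i0 (integrable_finsetSum _ fun k _ => (i1 k).mul_const d),
    integral_finsetSum _ fun k _ => (i1 k).mul_const d, mul_add, Finset.mul_sum, Finset.mul_sum]
  refine add_le_add (integral_abs_le_l2norm hDb hu) (Finset.sum_le_sum fun k _ => ?_)
  rw [integral_mul_const]
  have h := integral_abs_le_l2norm hDb (hu1 k)
  rcases D.eq_empty_or_nonempty with rfl | ⟨z, hz⟩
  · simp
  have hd0 : 0 ≤ d := (norm_nonneg _).trans (hd z hz)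
  calc _ ≤ (Real.sqrt (volume.real D) * l2norm D (u1 k)) * d := by gcongr
    _ = _ := by ring

/-- The value at `x` is compared with the mean over the copy of `D` contracted towards `x` by the
factor `s`. Since `s` is free, smallness in `L²` together with a Lipschitz bound forces smallness in
the maximum norm. -/
lemma abs_mul_volume_le_of_lipschitz {D : Set Plane} (hD : Convex ℝ D) (hDo : IsOpen D)
    (hDb : Bornology.IsBounded D) {d : ℝ} {x : Plane} (hx : x ∈ closure D)
    (hd : ∀ z ∈ D, ‖z - x‖ ≤ d) {v : Plane → ℝ} (hv : Continuous v) {L : ℝ} (hL0 : 0 ≤ L)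
    (hL : ∀ y ∈ closure D, |v y - v x| ≤ L * ‖y - x‖) {s : ℝ} (hs : 0 < s) (hs1 : s ≤ 1) :
    |v x| * volume.real D ≤
      s⁻¹ * Real.sqrt (volume.real D) * l2norm D v + L * s * d * volume.real D := by
  have hfin : IsFiniteMeasure (volume.restrict D) := ⟨by simpa using hDb.measure_lt_top⟩
  have hT : Continuous fun z : Plane => v (x + s • (z - x)) := by fun_prop
  have hm := memLp_of_continuous hDb hT 2
  have h1 : l2norm D (fun z => v (x + s • (z - x))) ≤ s⁻¹ * l2norm D v := by
    have := ENNReal.toReal_mono (ENNReal.mul_ne_top ENNReal.ofReal_ne_top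
      (memLp_of_continuous hDb hv 2).2.ne) (eLpNorm_comp_homothety_le hD hDo hx hs hs1 hv)
    rwa [ENNReal.toReal_mul, ENNReal.toReal_ofReal (by positivity)] at this
  have h2 := integral_abs_le_l2norm hDb hm
  have h3 : |v x| * volume.real D = ∫ z in D, |v x| := by simp [mul_comm]
  have i0 := (hm.integrable (by norm_num)).abs
  have h4 : ∫ z in D, |v x| ≤ ∫ z in D, (|v (x + s • (z - x))| + L * s * d) := by
    refine setIntegral_mono_on (integrable_const _) (i0.add (integrable_const _))
      hDo.measurableSet fun z hz => ?_
    have hy : x + s • (z - x) ∈ closure D := by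
      have := hD.closure hx (subset_closure hz) (sub_nonneg.2 hs1) hs.le (by ring)
      convert this using 1
      module
    have h5 := hL _ hy
    rw [add_sub_cancel_left, norm_smul, Real.norm_eq_abs, abs_of_pos hs] at h5
    have h6 : L * (s * ‖z - x‖) ≤ L * s * d := by
      rw [← mul_assoc]; exact mul_le_mul_of_nonneg_left (hd z hz) (by positivity)
    have := abs_sub_abs_le_abs_sub (v x) (v (x + s • (z - x)))
    rw [abs_sub_comm] at this
    linarith
  rw [integral_add i0 (integrable_const _)] at h4
  rw [h3]
  refine h4.trans (add_le_add (h2.trans ?_) ?_)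
  · calc _ ≤ Real.sqrt (volume.real D) * (s⁻¹ * l2norm D v) := by gcongr
      _ = _ := by ring
  · simp [mul_comm]

/-! ### Mollification -/

open ContinuousLinearMap in
/-- The mollification of `G`, extended by zero off `D`. -/
def moll (φ : ContDiffBump (0 : Plane)) (D : Set Plane) (G : Plane → ℝ) : Plane → ℝ :=
  convolution (φ.normed volume) (D.indicator G) (lsmul ℝ ℝ) volume

lemma moll_apply (φ : ContDiffBump (0 : Plane)) (D : Set Plane) (G : Plane → ℝ) (z : Plane) :
    moll φ D G z = ∫ w, φ.normed volume w * D.indicator G (z - w) := rfl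

lemma moll_eq (φ : ContDiffBump (0 : Plane)) {D : Set Plane} (hDo : IsOpen D) (G : Plane → ℝ)
    (z : Plane) : moll φ D G z = ∫ y in D, G y * φ.normed volume (z - y) := by
  rw [moll_apply, ← integral_indicator hDo.measurableSet,
    ← integral_sub_left_eq_self (fun w => φ.normed volume w * D.indicator G (z - w)) volume z]
  congr 1; ext y
  by_cases hy : y ∈ D <;> simp [hy, mul_comm]

lemma integrable_indicator_of_memLp {D : Set Plane} (hDo : IsOpen D) (hDb : Bornology.IsBounded D)
    {G : Plane → ℝ} (hG : MemLp G 2 (volume.restrict D)) : Integrable (D.indicator G) := by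
  have hfin : IsFiniteMeasure (volume.restrict D) := ⟨by simpa using hDb.measure_lt_top⟩
  exact (integrable_indicator_iff hDo.measurableSet).2 (hG.integrable (by norm_num))

lemma continuous_moll (φ : ContDiffBump (0 : Plane)) {D : Set Plane} (hDo : IsOpen D)
    (hDb : Bornology.IsBounded D) {G : Plane → ℝ} (hG : MemLp G 2 (volume.restrict D)) :
    Continuous (moll φ D G) :=
  φ.hasCompactSupport_normed.continuous_convolution_left _ φ.continuous_normed
    (integrable_indicator_of_memLp hDo hDb hG).locallyIntegrable

/-- Test functions on `D`. -/
def IsTest (D : Set Plane) (η : Plane → ℝ) : Prop :=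
  ContDiff ℝ ((⊤ : ℕ∞) : WithTop ℕ∞) η ∧ HasCompactSupport η ∧ tsupport η ⊆ D

/-- Once the ball around `z` lies in `D`, the reflected and shifted kernel is a test function on
`D`. The weak derivative identity then moves the derivative from the kernel to `G`, and the cut-off
at the boundary of `D` is not felt. -/
lemma hasFDerivAt_moll (φ : ContDiffBump (0 : Plane)) {D : Set Plane} (hDo : IsOpen D)
    (hDb : Bornology.IsBounded D) {G : Plane → ℝ} (hG : MemLp G 2 (volume.restrict D))
    {G1 : Fin 2 → Plane → ℝ}
    (h : ∀ k, ∀ η, IsTest D η →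
      ∫ x in D, G x * pderivWithin univ k η x = -∫ x in D, G1 k x * η x)
    {z : Plane} (hz : Metric.closedBall z φ.rOut ⊆ D) :
    HasFDerivAt (moll φ D G) (gradL fun k => moll φ D (G1 k) z) z := by
  have hφ : ContDiff ℝ ((⊤ : ℕ∞) : WithTop ℕ∞) (φ.normed volume) := φ.contDiff_normed
  have hd := φ.hasCompactSupport_normed.hasFDerivAt_convolution_left
    (ContinuousLinearMap.lsmul ℝ ℝ) (μ := volume) (f := φ.normed volume)
    (hφ.of_le (by exact_mod_cast le_top))
    (integrable_indicator_of_memLp hDo hDb hG).locallyIntegrable z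
  refine hd.congr_fderiv ?_
  have hint : Integrable fun w => (ContinuousLinearMap.precompL Plane
      (ContinuousLinearMap.lsmul ℝ ℝ : ℝ →L[ℝ] ℝ →L[ℝ] ℝ)) (fderiv ℝ (φ.normed volume) w)
        (D.indicator G (z - w)) :=
    (φ.hasCompactSupport_normed.fderiv ℝ).convolutionExists_left
      (ContinuousLinearMap.precompL Plane (ContinuousLinearMap.lsmul ℝ ℝ : ℝ →L[ℝ] ℝ →L[ℝ] ℝ))
      (hφ.continuous_fderiv (by simp))
      (integrable_indicator_of_memLp hDo hDb hG).locallyIntegrable z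
  have key : ∀ k, (convolution (fderiv ℝ (φ.normed volume)) (D.indicator G)
      (ContinuousLinearMap.precompL Plane (ContinuousLinearMap.lsmul ℝ ℝ)) volume z :
        Plane →L[ℝ] ℝ) (EuclideanSpace.single k 1) = moll φ D (G1 k) z := by
    intro k
    have hη : IsTest D fun y => φ.normed volume (z - y) := by
      refine ⟨hφ.comp (contDiff_const.sub contDiff_id), ?_, ?_⟩
      · exact φ.hasCompactSupport_normed.comp_homeomorph (Homeomorph.subLeft z)
      · have : tsupport (fun y => φ.normed volume (z - y)) ⊆ Metric.closedBall z φ.rOut := by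
          refine closure_minimal (fun y hy => ?_) Metric.isClosed_closedBall
          have : z - y ∈ Function.support (φ.normed volume) := hy
          rw [φ.support_normed_eq, mem_ball_zero_iff] at this
          rw [Metric.mem_closedBall, dist_comm, dist_eq_norm]; exact this.le
        exact this.trans hz
    have h1 := h k _ hη
    rw [moll_eq φ hDo, convolution_def, ContinuousLinearMap.integral_apply hint]
    have h2 : ∀ y, pderivWithin univ k (fun y => φ.normed volume (z - y)) y =
        -(fderiv ℝ (φ.normed volume) (z - y) (EuclideanSpace.single k 1)) := by
      intro y
      rw [pderivWithin, fderivWithin_univ]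
      have hdiff := (hφ.differentiable (by simp) (z - y)).hasFDerivAt
      have : HasFDerivAt (fun y => φ.normed volume (z - y)) _ y :=
        hdiff.comp y ((hasFDerivAt_const z y).sub (hasFDerivAt_id y))
      rw [this.fderiv]
      simp
    simp_rw [h2] at h1
    simp only [mul_neg, integral_neg, neg_inj] at h1
    rw [← h1, ← integral_indicator hDo.measurableSet, ← integral_sub_left_eq_self _ volume z]
    congr 1; ext y
    by_cases hy : y ∈ D <;> simp [hy, ContinuousLinearMap.precompL_apply, mul_comm]
  ext v
  have hv : v = ∑ k, v k • EuclideanSpace.single k (1 : ℝ) := by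
    ext j; fin_cases j <;> simp
  conv_lhs => rw [hv, map_sum]
  rw [gradL_apply]
  refine Finset.sum_congr rfl fun k _ => ?_
  rw [map_smul, key k, smul_eq_mul, mul_comm]

lemma abs_moll_le (φ : ContDiffBump (0 : Plane)) {D : Set Plane} (hDo : IsOpen D)
    {G : Plane → ℝ} {B : ℝ} (hB0 : 0 ≤ B) (hB : ∀ᵐ x ∂volume.restrict D, |G x| ≤ B) (z : Plane) :
    |moll φ D G z| ≤ B := by
  have h1 : ∀ᵐ x, |D.indicator G x| ≤ B := by
    filter_upwards [(ae_restrict_iff' hDo.measurableSet).1 hB] with x hx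
    by_cases h : x ∈ D <;> simp [h, hB0, hx]
  have h2 : ∀ᵐ w, |D.indicator G (z - w)| ≤ B :=
    (Measure.measurePreserving_sub_left volume z).quasiMeasurePreserving.ae h1
  rw [moll_apply, ← Real.norm_eq_abs]
  refine (norm_integral_le_of_norm_le (φ.integrable_normed.mul_const B) ?_).trans ?_
  · filter_upwards [h2] with w hw
    rw [norm_mul, Real.norm_eq_abs, Real.norm_eq_abs, abs_of_nonneg (φ.nonneg_normed w)]
    exact mul_le_mul_of_nonneg_left hw (φ.nonneg_normed w)
  · rw [integral_mul_const, φ.integral_normed, one_mul]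

/-- The kernel is a probability density, so the square of the mean is at most the mean of the
squares; Tonelli's theorem and translation invariance finish the estimate. -/
lemma eLpNorm_convolution_normed_le (φ : ContDiffBump (0 : Plane)) {G : Plane → ℝ}
    (hG : Measurable G) :
    eLpNorm (fun z => ∫ w, φ.normed volume w * G (z - w)) 2 volume ≤ eLpNorm G 2 volume := by
  set ν : Measure Plane := volume.withDensity fun w => ENNReal.ofReal (φ.normed volume w) with hν
  have hφm : Measurable fun w => ENNReal.ofReal (φ.normed volume w) :=
    φ.continuous_normed.measurable.ennreal_ofReal
  have hprob : IsProbabilityMeasure ν := ⟨by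
    rw [hν, withDensity_apply _ MeasurableSet.univ, Measure.restrict_univ,
      ← ofReal_integral_eq_lintegral_ofReal φ.integrable_normed
        (ae_of_all _ fun w => φ.nonneg_normed w), φ.integral_normed, ENNReal.ofReal_one]⟩
  have hpt : ∀ z, ‖∫ w, φ.normed volume w * G (z - w)‖ₑ ^ 2 ≤ ∫⁻ w, ‖G (z - w)‖ₑ ^ 2 ∂ν := by
    intro z
    have hGz : Measurable fun w => G (z - w) := hG.comp (by fun_prop)
    have h1 : ‖∫ w, φ.normed volume w * G (z - w)‖ₑ ≤ eLpNorm (fun w => G (z - w)) 1 ν := by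
      rw [eLpNorm_one_eq_lintegral_enorm, hν,
        lintegral_withDensity_eq_lintegral_mul _ hφm hGz.enorm]
      refine (enorm_integral_le_lintegral_enorm _).trans (le_of_eq (lintegral_congr fun w => ?_))
      rw [enorm_mul, Pi.mul_apply, Real.enorm_eq_ofReal (φ.nonneg_normed w)]
    have h2 := h1.trans (eLpNorm_le_eLpNorm_of_exponent_le (μ := ν) (p := 1) (q := 2) (by norm_num)
      hGz.aestronglyMeasurable)
    refine (pow_le_pow_left' h2 2).trans (le_of_eq ?_)
    rw [eLpNorm_eq_lintegral_rpow_enorm_toReal (by norm_num) (by norm_num)]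
    rw [← ENNReal.rpow_natCast, ← ENNReal.rpow_mul]
    simp
  rw [eLpNorm_eq_lintegral_rpow_enorm_toReal (by norm_num) (by norm_num),
    eLpNorm_eq_lintegral_rpow_enorm_toReal (by norm_num) (by norm_num)]
  gcongr ?_ ^ _
  simp only [ENNReal.toReal_ofNat, ENNReal.rpow_ofNat]
  refine (lintegral_mono hpt).trans ?_
  rw [lintegral_lintegral_swap]
  · have : ∀ w : Plane, ∫⁻ z, ‖G (z - w)‖ₑ ^ 2 = ∫⁻ z, ‖G z‖ₑ ^ 2 := fun w =>
      lintegral_sub_right_eq_self (fun z => ‖G z‖ₑ ^ 2) w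
    simp_rw [this]
    simp
  · exact ((hG.comp (by fun_prop : Measurable fun p : Plane × Plane => p.1 - p.2)).enorm.pow_const
      2).aemeasurable

end
end BSQuad

namespace BSQuad
noncomputable section

open MeasureTheory Set Filter Topology

/-! ### Approximation by mollification after a dilation -/

lemma moll_sub (φ : ContDiffBump (0 : Plane)) {D : Set Plane} (hDo : IsOpen D)
    (hDb : Bornology.IsBounded D) {G H : Plane → ℝ} (hG : MemLp G 2 (volume.restrict D))
    (hH : MemLp H 2 (volume.restrict D)) (z : Plane) :
    moll φ D (fun x => G x - H x) z = moll φ D G z - moll φ D H z := by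
  have hc : ∀ {F : Plane → ℝ}, MemLp F 2 (volume.restrict D) →
      Integrable fun w => φ.normed volume w * D.indicator F (z - w) := fun hF =>
    φ.hasCompactSupport_normed.convolutionExists_left (ContinuousLinearMap.lsmul ℝ ℝ)
      φ.continuous_normed (integrable_indicator_of_memLp hDo hDb hF).locallyIntegrable z
  rw [moll_apply, moll_apply, moll_apply, ← integral_sub (hc hG) (hc hH)]
  congr 1; ext w
  by_cases hw : z - w ∈ D <;> simp [hw, mul_sub]

/-- The mollifiers used for a convex set containing the ball of radius `r` around the centre of
the dilations. -/
def bumpSeq {r : ℝ} (hr : 0 < r) (n : ℕ) : ContDiffBump (0 : Plane) where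
  rIn := r / 4 * (1 / (n + 2))
  rOut := r / 2 * (1 / (n + 2))
  rIn_pos := by positivity
  rIn_lt_rOut := by
    have : (0 : ℝ) < 1 / (n + 2) := by positivity
    nlinarith

/-- The dilation factors. -/
def dilSeq (n : ℕ) : ℝ := 1 - 1 / ((n : ℝ) + 2)

lemma dilSeq_pos (n : ℕ) : 0 < dilSeq n := by
  have : 1 / ((n : ℝ) + 2) < 1 := by
    rw [div_lt_one (by positivity)]; linarith [(Nat.cast_nonneg n : (0 : ℝ) ≤ n)]
  unfold dilSeq; linarith

lemma dilSeq_le_one (n : ℕ) : dilSeq n ≤ 1 := by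
  have : (0 : ℝ) < 1 / (n + 2) := by positivity
  unfold dilSeq; linarith

lemma tendsto_one_div_add_two : Tendsto (fun n : ℕ => 1 / ((n : ℝ) + 2)) atTop (𝓝 0) := by
  simpa using ((tendsto_const_nhds (x := (1 : ℝ))).div_atTop
    (tendsto_atTop_add_const_right _ 2 (tendsto_natCast_atTop_atTop (R := ℝ))))

lemma tendsto_dilSeq : Tendsto dilSeq atTop (𝓝 1) := by
  have := (tendsto_const_nhds (x := (1 : ℝ)) (f := atTop)).sub tendsto_one_div_add_two
  rw [sub_zero] at this
  exact this

/-- Smooth approximations of `G` on a neighbourhood of `closure D`. -/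
def approx {r : ℝ} (hr : 0 < r) (c : Plane) (D : Set Plane) (G : Plane → ℝ) (n : ℕ) (x : Plane) :
    ℝ :=
  moll (bumpSeq hr n) D G (c + dilSeq n • (x - c))

/-- With `e = 1 / (n + 2)`, every point of the small ball has the form `(1 - e) x + e p` with `p` in
the ball of radius `r` around `c`: the bump radius is only `e r / 2`. Such a combination of an
interior point and a point of the closure is interior. -/
lemma closedBall_dil_subset {D : Set Plane} (hD : Convex ℝ D) (hDo : IsOpen D) {r : ℝ} (hr : 0 < r)
    {c : Plane} (hc : Metric.ball c r ⊆ D) (n : ℕ) {x : Plane} (hx : x ∈ closure D) :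
    Metric.closedBall (c + dilSeq n • (x - c)) (bumpSeq hr n).rOut ⊆ D := by
  intro y hy
  have he : (0 : ℝ) < 1 / (n + 2) := by positivity
  set e : ℝ := 1 / ((n : ℝ) + 2) with hedef
  have ht : dilSeq n = 1 - e := rfl
  set p : Plane := c + e⁻¹ • (y - (c + dilSeq n • (x - c))) with hp
  have hpD : p ∈ D := hc (by
    rw [mem_ball_iff_norm, hp, add_sub_cancel_left, norm_smul, norm_inv, Real.norm_of_nonneg he.le]
    rw [mem_closedBall_iff_norm] at hy
    have : (bumpSeq hr n).rOut = r / 2 * e := rfl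
    rw [this] at hy
    calc e⁻¹ * ‖y - (c + dilSeq n • (x - c))‖ ≤ e⁻¹ * (r / 2 * e) := by gcongr
      _ = r / 2 := by field_simp
      _ < r := by linarith)
  have := hD.combo_interior_closure_mem_interior (x := p) (y := x) (by rwa [hDo.interior_eq]) hx he
    (dilSeq_pos n).le (by rw [ht]; ring)
  rw [hDo.interior_eq] at this
  convert this using 1
  rw [hp, smul_add, smul_smul, mul_inv_cancel₀ he.ne', ht]
  module

section approx
variable {D : Set Plane} {r : ℝ} (hr : 0 < r) (c : Plane)

lemma continuous_approx (hDo : IsOpen D) (hDb : Bornology.IsBounded D) {G : Plane → ℝ}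
    (hG : MemLp G 2 (volume.restrict D)) (n : ℕ) : Continuous (approx hr c D G n) :=
  (continuous_moll _ hDo hDb hG).comp (by fun_prop)

lemma abs_approx_le (hDo : IsOpen D) {G : Plane → ℝ} {B : ℝ} (hB0 : 0 ≤ B)
    (hB : ∀ᵐ x ∂volume.restrict D, |G x| ≤ B) (n : ℕ) (x : Plane) : |approx hr c D G n x| ≤ B :=
  abs_moll_le _ hDo hB0 hB _

lemma hasFDerivAt_approx (hD : Convex ℝ D) (hDo : IsOpen D) (hDb : Bornology.IsBounded D)
    (hc : Metric.ball c r ⊆ D) {G : Plane → ℝ} (hG : MemLp G 2 (volume.restrict D))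
    {G1 : Fin 2 → Plane → ℝ}
    (h : ∀ k, ∀ η, IsTest D η →
      ∫ x in D, G x * pderivWithin univ k η x = -∫ x in D, G1 k x * η x)
    (n : ℕ) {x : Plane} (hx : x ∈ closure D) :
    HasFDerivAt (approx hr c D G n) (gradL fun k => dilSeq n * approx hr c D (G1 k) n x) x := by
  have h1 := hasFDerivAt_moll (bumpSeq hr n) hDo hDb hG h (closedBall_dil_subset hD hDo hr hc n hx)
  have h2 : HasFDerivAt (fun x : Plane => c + dilSeq n • (x - c))
      (dilSeq n • ContinuousLinearMap.id ℝ Plane) x :=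
    (((hasFDerivAt_id x).sub_const c).const_smul (dilSeq n)).const_add c
  refine HasFDerivAt.congr_fderiv (h1.comp x h2) ?_
  ext v
  simp only [ContinuousLinearMap.comp_apply, smul_apply,
    ContinuousLinearMap.id_apply, gradL_apply, PiLp.smul_apply, smul_eq_mul, approx]
  exact Finset.sum_congr rfl fun k _ => by ring

lemma eLpNorm_approx_le (hD : Convex ℝ D) (hDo : IsOpen D) (hDb : Bornology.IsBounded D)
    (hc : c ∈ closure D) {G : Plane → ℝ} (hGm : Measurable G)
    (hG : MemLp G 2 (volume.restrict D)) (n : ℕ) :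
    eLpNorm (approx hr c D G n) 2 (volume.restrict D) ≤
      ENNReal.ofReal (dilSeq n)⁻¹ * eLpNorm G 2 (volume.restrict D) := by
  refine (eLpNorm_comp_homothety_le hD hDo hc (dilSeq_pos n) (dilSeq_le_one n)
    (continuous_moll _ hDo hDb hG)).trans ?_
  gcongr
  refine (eLpNorm_mono_measure _ Measure.restrict_le_self).trans ?_
  have := eLpNorm_convolution_normed_le (bumpSeq hr n) (hGm.indicator hDo.measurableSet)
  rwa [eLpNorm_indicator_eq_eLpNorm_restrict hDo.measurableSet] at this

lemma dilSeq_inv_le (n : ℕ) : (dilSeq n)⁻¹ ≤ 2 := by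
  rw [inv_le_comm₀ (dilSeq_pos n) (by norm_num)]
  have : 1 / ((n : ℝ) + 2) ≤ 1 / 2 := by
    apply one_div_le_one_div_of_le <;> linarith [(Nat.cast_nonneg n : (0 : ℝ) ≤ n)]
  unfold dilSeq; linarith

/-- Density argument: the approximation operators are bounded by `2` on `L²(D)`, uniformly in `n`,
and for a continuous `H` of compact support they converge uniformly on `D`. The three errors are at
most `2 δ`, `δ` and `δ`, whence `δ = ε / 4`. -/
lemma tendsto_eLpNorm_approx_sub (hD : Convex ℝ D) (hDo : IsOpen D) (hDb : Bornology.IsBounded D)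
    (hc : Metric.ball c r ⊆ D) {G : Plane → ℝ} (hGm : Measurable G)
    (hG : MemLp G 2 (volume.restrict D)) :
    Tendsto (fun n => eLpNorm (fun x => approx hr c D G n x - G x) 2 (volume.restrict D)) atTop
      (𝓝 0) := by
  have hfin : IsFiniteMeasure (volume.restrict D) := ⟨by simpa using hDb.measure_lt_top⟩
  have hcD : c ∈ closure D := subset_closure (hc (Metric.mem_ball_self hr))
  rw [ENNReal.tendsto_nhds_zero]
  intro ε hε
  obtain ⟨δ, hδ, hδε⟩ : ∃ δ : ℝ≥0∞, 0 < δ ∧ δ * 3 + δ ≤ ε := by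
    refine ⟨ε / 4, ENNReal.div_pos hε.ne' (by norm_num), le_of_eq ?_⟩
    rw [show ε / 4 * 3 + ε / 4 = (ε / 4) * 4 by ring]
    exact ENNReal.div_mul_cancel (by norm_num) (by norm_num)
  obtain ⟨H, hHs, hHle, hHc, hHm⟩ :=
    (show MemLp (D.indicator G) 2 volume from
      (memLp_indicator_iff_restrict hDo.measurableSet).2 hG).exists_hasCompactSupport_eLpNorm_sub_le
      (by norm_num) hδ.ne'
  have hHD : MemLp H 2 (volume.restrict D) := hHm.restrict D
  have hGH : eLpNorm (fun x => G x - H x) 2 (volume.restrict D) ≤ δ := by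
    refine le_trans (le_of_eq ?_) ((eLpNorm_mono_measure _ (Measure.restrict_le_self (s := D))).trans hHle)
    refine eLpNorm_congr_ae ?_
    filter_upwards [ae_restrict_mem hDo.measurableSet] with x hx
    simp [hx]
  -- uniform convergence for `H`
  obtain ⟨R, hR⟩ := hDb.subset_closedBall c
  have hR' : ∀ x ∈ D, ‖x - c‖ ≤ |R| := fun x hx =>
    ((mem_closedBall_iff_norm.1 (hR hx))).trans (le_abs_self R)
  have hHu := hHs.uniformContinuous_of_continuous hHc
  obtain ⟨θ, hθ, hθδ⟩ : ∃ θ : ℝ, 0 < θ ∧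
      ENNReal.ofReal (θ + θ) * volume D ^ (1 / 2 : ℝ) ≤ δ := by
    have hV : volume D ^ (1 / 2 : ℝ) ≠ ∞ :=
      ENNReal.rpow_ne_top_of_nonneg (by norm_num) hDb.measure_lt_top.ne
    have ht : Tendsto (fun θ : ℝ => ENNReal.ofReal (θ + θ) * volume D ^ (1 / 2 : ℝ)) (𝓝[>] 0)
        (𝓝 0) := by
      have : Tendsto (fun θ : ℝ => ENNReal.ofReal (θ + θ) * volume D ^ (1 / 2 : ℝ)) (𝓝 0)
          (𝓝 (ENNReal.ofReal (0 + 0) * volume D ^ (1 / 2 : ℝ))) :=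
        ENNReal.Tendsto.mul_const (ENNReal.tendsto_ofReal (tendsto_id.add tendsto_id)) (Or.inr hV)
      simp only [add_zero, ENNReal.ofReal_zero, zero_mul] at this
      exact this.mono_left nhdsWithin_le_nhds
    obtain ⟨θ, h1, h2⟩ := ((ht.eventually (ge_mem_nhds hδ)).and self_mem_nhdsWithin).exists
    exact ⟨θ, h2, h1⟩
  obtain ⟨τ, hτ, hτθ⟩ := Metric.uniformContinuous_iff.1 hHu θ hθ
  have hev : ∀ᶠ n : ℕ in atTop, (r / 2 + |R|) * (1 / ((n : ℝ) + 2)) < τ := by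
    have := tendsto_one_div_add_two.const_mul (r / 2 + |R|)
    rw [mul_zero] at this
    exact this.eventually (gt_mem_nhds hτ)
  filter_upwards [hev] with n hn
  have he : (0 : ℝ) < 1 / (n + 2) := by positivity
  -- the three parts
  have hA : eLpNorm (approx hr c D (fun x => G x - H x) n) 2 (volume.restrict D) ≤ δ * 2 := by
    refine (eLpNorm_approx_le hr c hD hDo hDb hcD (hGm.sub hHc.measurable) (hG.sub hHD) n).trans ?_
    rw [mul_comm]
    refine mul_le_mul' hGH ?_
    rw [show (2 : ℝ≥0∞) = ENNReal.ofReal 2 by simp]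
    exact ENNReal.ofReal_le_ofReal (dilSeq_inv_le n)
  have hB : eLpNorm (fun x => approx hr c D H n x - H x) 2 (volume.restrict D) ≤ δ := by
    refine (eLpNorm_le_of_ae_bound (C := θ + θ) ?_).trans ?_
    · refine (ae_restrict_iff' hDo.measurableSet).2 (ae_of_all _ fun x hx => ?_)
      set z := c + dilSeq n • (x - c) with hz
      have hzD := closedBall_dil_subset hD hDo hr hc n (subset_closure hx)
      have hzmem : z ∈ D := hzD (Metric.mem_closedBall_self (bumpSeq hr n).rOut_pos.le)
      have hrO : (bumpSeq hr n).rOut = r / 2 * (1 / ((n : ℝ) + 2)) := rfl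
      have h1 : dist (approx hr c D H n x) (D.indicator H z) ≤ θ := by
        refine (bumpSeq hr n).dist_normed_convolution_le
          (hHc.measurable.indicator hDo.measurableSet).aestronglyMeasurable fun y hy => ?_
        have hyD := hzD (Metric.ball_subset_closedBall hy)
        rw [indicator_of_mem hyD, indicator_of_mem hzmem]
        refine (hτθ ((Metric.mem_ball.1 hy).trans_le (le_trans ?_ hn.le))).le
        rw [hrO]
        have := abs_nonneg R
        gcongr
        linarith
      have h2 : dist (H z) (H x) ≤ θ := by
        refine (hτθ (lt_of_le_of_lt ?_ hn)).le
        have hzx : z - x = (1 / ((n : ℝ) + 2)) • (c - x) := by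
          rw [hz, dilSeq]; module
        rw [dist_eq_norm, hzx, norm_smul, Real.norm_of_nonneg he.le, norm_sub_rev, mul_comm]
        have := hR' x hx
        gcongr
        linarith
      rw [indicator_of_mem hzmem] at h1
      have := dist_triangle (approx hr c D H n x) (H z) (H x)
      rw [← dist_eq_norm]; linarith
    · rw [Measure.restrict_apply_univ, mul_comm]
      have e : ((2 : ℝ≥0∞).toReal)⁻¹ = 1 / 2 := by norm_num
      rw [e]
      exact hθδ
  have hC : eLpNorm (fun x => H x - G x) 2 (volume.restrict D) ≤ δ :=
    (eLpNorm_sub_comm H G 2 _).trans_le hGH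
  have hsplit : (fun x => approx hr c D G n x - G x) =
      (approx hr c D (fun x => G x - H x) n) +
        ((fun x => approx hr c D H n x - H x) + fun x => H x - G x) := by
    ext x
    have : approx hr c D (fun x => G x - H x) n x = approx hr c D G n x - approx hr c D H n x :=
      moll_sub _ hDo hDb hG hHD _
    simp only [Pi.add_apply, this]; ring
  have m1 := (continuous_approx hr c hDo hDb (hG.sub hHD) n).aestronglyMeasurable
    (μ := volume.restrict D)
  have m2 := (continuous_approx hr c hDo hDb hHD n).aestronglyMeasurable (μ := volume.restrict D)
  have m3 := hHc.aestronglyMeasurable (μ := volume.restrict D)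
  rw [hsplit]
  refine (eLpNorm_add_le m1 ((m2.sub m3).add (m3.sub hG.1)) (by norm_num)).trans ?_
  refine (add_le_add hA ((eLpNorm_add_le (m2.sub m3) (m3.sub hG.1) (by norm_num)).trans
    (add_le_add hB hC))).trans (le_trans (le_of_eq ?_) hδε)
  ring

lemma tendsto_l2norm_approx_sub (hD : Convex ℝ D) (hDo : IsOpen D) (hDb : Bornology.IsBounded D)
    (hc : Metric.ball c r ⊆ D) {G : Plane → ℝ} (hGm : Measurable G)
    (hG : MemLp G 2 (volume.restrict D)) :
    Tendsto (fun n => l2norm D (fun x => approx hr c D G n x - G x)) atTop (𝓝 0) := by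
  have := (ENNReal.tendsto_toReal ENNReal.zero_ne_top).comp
    (tendsto_eLpNorm_approx_sub hr c hD hDo hDb hc hGm hG)
  rw [ENNReal.toReal_zero] at this
  exact this

end approx

end
end BSQuad

namespace BSQuad
noncomputable section

open MeasureTheory Set Filter Topology

/-! ### Jets -/

/-- The multi-index with the `k`-th entry raised by one. -/
def inc (k : Fin 2) (α : ℕ × ℕ) : ℕ × ℕ := if k = 0 then (α.1 + 1, α.2) else (α.1, α.2 + 1)

@[simp] lemma inc_zero (α : ℕ × ℕ) : inc 0 α = (α.1 + 1, α.2) := rfl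
@[simp] lemma inc_one (α : ℕ × ℕ) : inc 1 α = (α.1, α.2 + 1) := rfl

lemma order_inc (k : Fin 2) (α : ℕ × ℕ) : (inc k α).1 + (inc k α).2 = α.1 + α.2 + 1 := by
  unfold inc; split_ifs <;> dsimp only <;> omega

/-- A family of weak derivatives up to order `m`. -/
structure WeakJet (D : Set Plane) (m : ℕ) (g : ℕ × ℕ → Plane → ℝ) : Prop where
  meas : ∀ α, Measurable (g α)
  mem : ∀ α : ℕ × ℕ, α.1 + α.2 ≤ m → MemLp (g α) 2 (volume.restrict D)
  der : ∀ α : ℕ × ℕ, α.1 + α.2 < m → ∀ k, ∀ η, IsTest D η →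
    ∫ x in D, g α x * pderivWithin univ k η x = -∫ x in D, g (inc k α) x * η x

/-- A family of classical derivatives up to order `N`, one-sided at boundary points of `K`. -/
structure Jet (K : Set Plane) (N : ℕ) (ψ : ℕ × ℕ → Plane → ℝ) : Prop where
  cont : ∀ α : ℕ × ℕ, α.1 + α.2 ≤ N → ContinuousOn (ψ α) K
  der : ∀ α : ℕ × ℕ, α.1 + α.2 < N → ∀ x ∈ K,
    HasFDerivWithinAt (ψ α) (gradL fun k => ψ (inc k α) x) K x

lemma gradL_sub (a b : Fin 2 → ℝ) : gradL a - gradL b = gradL fun k => a k - b k := by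
  ext v; simp [sub_mul, add_sub_add_comm]

lemma gradL_smul (r : ℝ) (a : Fin 2 → ℝ) : r • gradL a = gradL fun k => r * a k := by
  ext v; simp [mul_add, mul_assoc]

lemma Jet.sub {K : Set Plane} {N : ℕ} {ψ χ : ℕ × ℕ → Plane → ℝ} (h : Jet K N ψ) (h' : Jet K N χ) :
    Jet K N fun α x => ψ α x - χ α x where
  cont α hα := (h.cont α hα).sub (h'.cont α hα)
  der α hα x hx := by
    have := (h.der α hα x hx).sub (h'.der α hα x hx)
    rw [gradL_sub] at this
    exact this

/-- The mean value estimate along a jet. -/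
lemma Jet.abs_sub_le {K : Set Plane} (hK : Convex ℝ K) {N : ℕ} {ψ : ℕ × ℕ → Plane → ℝ}
    (h : Jet K N ψ) {α : ℕ × ℕ} (hα : α.1 + α.2 < N) {B : ℝ}
    (hB : ∀ k, ∀ x ∈ K, |ψ (inc k α) x| ≤ B) {x y : Plane} (hx : x ∈ K) (hy : y ∈ K) :
    |ψ α y - ψ α x| ≤ 2 * B * ‖y - x‖ := by
  rw [← Real.norm_eq_abs]
  refine hK.norm_image_sub_le_of_norm_hasFDerivWithin_le (fun z hz => h.der α hα z hz)
    (fun z hz => (norm_gradL_le _).trans ?_) hx hy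
  rw [Fin.sum_univ_two]
  linarith [hB 0 z hz, hB 1 z hz]

/-- Descent from the top order: a derivative that vanishes at `c` is bounded by the next order times
`2 d`, by the mean value estimate. -/
lemma Jet.abs_le_of_eq_zero {K : Set Plane} (hK : Convex ℝ K) {N : ℕ} {ψ : ℕ × ℕ → Plane → ℝ}
    (h : Jet K N ψ) {c : Plane} (hc : c ∈ K) {d : ℝ} (hd : ∀ x ∈ K, ‖x - c‖ ≤ d)
    (h0 : ∀ α : ℕ × ℕ, α.1 + α.2 < N → ψ α c = 0) {B : ℝ}
    (hB : ∀ α : ℕ × ℕ, α.1 + α.2 = N → ∀ x ∈ K, |ψ α x| ≤ B) :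
    ∀ j ≤ N, ∀ α : ℕ × ℕ, α.1 + α.2 + j = N → ∀ x ∈ K, |ψ α x| ≤ (2 * d) ^ j * B := by
  intro j
  induction j with
  | zero => intro _ α hα x hx; simpa using hB α hα x hx
  | succ j ih =>
    intro hj α hα x hx
    have hd0 : 0 ≤ d := (norm_nonneg _).trans (hd c hc)
    have hb : ∀ k, ∀ x ∈ K, |ψ (inc k α) x| ≤ (2 * d) ^ j * B := fun k x hx =>
      ih (by omega) (inc k α) (by rw [order_inc]; omega) x hx
    have h1 := h.abs_sub_le hK (α := α) (by omega) hb hc hx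
    rw [h0 α (by omega), sub_zero] at h1
    have hBn : 0 ≤ (2 * d) ^ j * B := (abs_nonneg _).trans (hb 0 x hx)
    calc |ψ α x| ≤ 2 * ((2 * d) ^ j * B) * ‖x - c‖ := h1
      _ ≤ 2 * ((2 * d) ^ j * B) * d := mul_le_mul_of_nonneg_left (hd x hx) (by positivity)
      _ = _ := by ring

/-! ### Polynomials in the plane -/

/-- The `i`-th derivative of `t ^ n / n!`. -/
def monoD (i n : ℕ) (t : ℝ) : ℝ := if i ≤ n then t ^ (n - i) / (n - i).factorial else 0

lemma hasDerivAt_monoD (i n : ℕ) (t : ℝ) : HasDerivAt (monoD i n) (monoD (i + 1) n t) t := by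
  unfold monoD
  rcases lt_trichotomy i n with h | h | h
  · obtain ⟨j, rfl⟩ := Nat.exists_eq_add_of_lt h
    simp only [show i ≤ i + j + 1 by omega, show i + 1 ≤ i + j + 1 by omega, if_true,
      show i + j + 1 - i = j + 1 by omega, show i + j + 1 - (i + 1) = j by omega]
    refine ((hasDerivAt_pow (j + 1) t).div_const _).congr_deriv ?_
    rw [Nat.factorial_succ]
    push_cast
    field_simp
  · subst h
    simpa using hasDerivAt_const t (1 : ℝ)
  · simpa [show ¬ i ≤ n by omega, show ¬ i + 1 ≤ n by omega] using hasDerivAt_const t (0 : ℝ)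

/-- The multi-indices of order at most `M`. -/
def indexSet (M : ℕ) : Finset (ℕ × ℕ) :=
  (Finset.range (M + 1) ×ˢ Finset.range (M + 1)).filter fun γ => γ.1 + γ.2 ≤ M

lemma mem_indexSet {M : ℕ} {γ : ℕ × ℕ} : γ ∈ indexSet M ↔ γ.1 + γ.2 ≤ M := by
  simp [indexSet]; omega

/-- The derivatives of the polynomial of degree at most `M` with Taylor coefficients `a` at `c`. -/
def polyJet (c : Plane) (a : ℕ × ℕ → ℝ) (M : ℕ) (α : ℕ × ℕ) (x : Plane) : ℝ :=
  ∑ γ ∈ indexSet M, a γ * (monoD α.1 γ.1 (x 0 - c 0) * monoD α.2 γ.2 (x 1 - c 1))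

lemma hasFDerivAt_polyJet (c : Plane) (a : ℕ × ℕ → ℝ) (M : ℕ) (α : ℕ × ℕ) (x : Plane) :
    HasFDerivAt (polyJet c a M α) (gradL fun k => polyJet c a M (inc k α) x) x := by
  have hk : ∀ k : Fin 2, HasFDerivAt (fun x : Plane => x k - c k)
      (EuclideanSpace.proj k : Plane →L[ℝ] ℝ) x := fun k =>
    (EuclideanSpace.proj k : Plane →L[ℝ] ℝ).hasFDerivAt.sub_const _
  have e1 := fun γ : ℕ × ℕ =>
    (hasDerivAt_monoD α.1 γ.1 (x 0 - c 0)).comp_hasFDerivAt x (hk 0)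
  have e2 := fun γ : ℕ × ℕ =>
    (hasDerivAt_monoD α.2 γ.2 (x 1 - c 1)).comp_hasFDerivAt x (hk 1)
  have h : HasFDerivAt (polyJet c a M α) _ x := HasFDerivAt.fun_sum fun γ _ =>
    ((e1 γ).mul (e2 γ)).const_mul (a γ)
  refine h.congr_fderiv ?_
  ext v
  simp only [polyJet, gradL_apply, Fin.sum_univ_two, inc_zero, inc_one, Finset.sum_mul,
    ← Finset.sum_add_distrib, sum_apply]
  refine Finset.sum_congr rfl fun γ _ => ?_
  simp
  ring

lemma continuous_polyJet (c : Plane) (a : ℕ × ℕ → ℝ) (M : ℕ) (α : ℕ × ℕ) :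
    Continuous (polyJet c a M α) :=
  continuous_iff_continuousAt.2 fun x => (hasFDerivAt_polyJet c a M α x).continuousAt

lemma jet_polyJet (K : Set Plane) (N : ℕ) (c : Plane) (a : ℕ × ℕ → ℝ) (M : ℕ) :
    Jet K N (polyJet c a M) where
  cont α _ := (continuous_polyJet c a M α).continuousOn
  der α _ x _ := (hasFDerivAt_polyJet c a M α x).hasFDerivWithinAt

lemma polyJet_center (c : Plane) (a : ℕ × ℕ → ℝ) (M : ℕ) {α : ℕ × ℕ} (hα : α.1 + α.2 ≤ M) :
    polyJet c a M α c = a α := by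
  have h0 : ∀ i n, monoD i n 0 = if n = i then 1 else 0 := by
    intro i n
    unfold monoD
    rcases lt_trichotomy i n with h | h | h
    · simp [h.le, h.ne', show n - i ≠ 0 by omega]
    · simp [h]
    · simp [show ¬ i ≤ n by omega, h.ne]
  unfold polyJet
  rw [Finset.sum_eq_single_of_mem α (mem_indexSet.2 hα)]
  · simp [h0]
  · intro γ _ hγ
    simp only [sub_self, h0]
    by_cases h1 : γ.1 = α.1
    · have : γ.2 ≠ α.2 := fun h2 => hγ (Prod.ext h1 h2)
      simp [this]
    · simp [h1]

lemma polyJet_top (c : Plane) (a : ℕ × ℕ → ℝ) (M : ℕ) {α : ℕ × ℕ} (hα : α.1 + α.2 = M)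
    (x : Plane) : polyJet c a M α x = a α := by
  unfold polyJet
  rw [Finset.sum_eq_single_of_mem α (mem_indexSet.2 hα.le)]
  · simp [monoD]
  · intro γ hγ hne
    have h := mem_indexSet.1 hγ
    by_cases h1 : α.1 ≤ γ.1
    · have : ¬ α.2 ≤ γ.2 := fun h2 => hne (Prod.ext (by omega) (by omega))
      simp [monoD, this]
    · simp [monoD, h1]

/-- Both sides have the same constant gradient and agree at `c`. -/
lemma polyJet_subtop (c : Plane) (a : ℕ × ℕ → ℝ) (M : ℕ) {α : ℕ × ℕ} (hα : α.1 + α.2 + 1 = M)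
    (x : Plane) : polyJet c a M α x = a α + ∑ k, a (inc k α) * (x - c) k := by
  have hd : ∀ y, HasFDerivAt (fun y => polyJet c a M α y - gradL (fun k => a (inc k α)) y)
      (0 : Plane →L[ℝ] ℝ) y := fun y => by
    have := (hasFDerivAt_polyJet c a M α y).sub (gradL fun k => a (inc k α)).hasFDerivAt
    refine this.congr_fderiv ?_
    rw [gradL_sub]
    ext v
    simp [polyJet_top c a M (show (inc 0 α).1 + (inc 0 α).2 = M by rw [order_inc]; omega),
      polyJet_top c a M (show (inc 1 α).1 + (inc 1 α).2 = M by rw [order_inc]; omega),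
      -inc_zero, -inc_one]
  have := is_const_of_fderiv_eq_zero (fun y => (hd y).differentiableAt) (fun y => (hd y).fderiv) x c
  rw [polyJet_center c a M (by omega)] at this
  simp only [gradL_apply] at this
  rw [show polyJet c a M α x = a α - ∑ k, a (inc k α) * c k + ∑ k, a (inc k α) * x k by linarith]
  simp only [PiLp.sub_apply, mul_sub, Finset.sum_sub_distrib]
  ring

/-! ### Limits of jets -/

/-- On the convex intersection of `K` with a small ball, the mean value inequality bounds the
remainder of `V n` uniformly in `n`, and the bound survives the limit. Boundary points of `K` need
no special treatment. -/
lemma hasFDerivWithinAt_of_tendstoUniformlyOn {K : Set Plane} (hK : Convex ℝ K)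
    {V : ℕ → Plane → ℝ} {V1 : Fin 2 → ℕ → Plane → ℝ} {ψ : Plane → ℝ} {ψ1 : Fin 2 → Plane → ℝ}
    (hV : ∀ n, ∀ x ∈ K, HasFDerivWithinAt (V n) (gradL fun k => V1 k n x) K x)
    (h0 : TendstoUniformlyOn V ψ atTop K) (h1 : ∀ k, TendstoUniformlyOn (V1 k) (ψ1 k) atTop K)
    (hc : ∀ k, ContinuousOn (ψ1 k) K) {x : Plane} (hx : x ∈ K) :
    HasFDerivWithinAt ψ (gradL fun k => ψ1 k x) K x := by
  refine .of_isLittleO (Asymptotics.isLittleO_iff.2 fun ε hε => ?_)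
  have hnear : ∀ᶠ y in 𝓝[K] x, ∀ k, |ψ1 k y - ψ1 k x| < ε / 4 := by
    refine eventually_all.2 fun k => ?_
    exact (Metric.tendsto_nhds.1 (hc k x hx)) (ε / 4) (by positivity)
  obtain ⟨δ, hδ, hδK⟩ := Metric.mem_nhdsWithin_iff.1 hnear
  filter_upwards [inter_mem_nhdsWithin K (Metric.ball_mem_nhds x hδ)] with y hy
  have hconv : Convex ℝ (K ∩ Metric.ball x δ) := hK.inter (convex_ball x δ)
  have hev : ∀ᶠ n in atTop, ‖V n y - V n x - gradL (fun k => ψ1 k x) (y - x)‖ ≤ ε * ‖y - x‖ := by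
    have h2 : ∀ᶠ n in atTop, ∀ k, ∀ z ∈ K, dist (ψ1 k z) (V1 k n z) < ε / 4 :=
      eventually_all.2 fun k => Metric.tendstoUniformlyOn_iff.1 (h1 k) (ε / 4) (by positivity)
    filter_upwards [h2] with n hn
    refine hconv.norm_image_sub_le_of_norm_hasFDerivWithin_le'
      (fun z hz => (hV n z hz.1).mono inter_subset_left) (fun z hz => ?_)
      ⟨hx, Metric.mem_ball_self hδ⟩ hy
    rw [gradL_sub]
    refine (norm_gradL_le _).trans ?_
    have h3 : ∀ k, |V1 k n z - ψ1 k x| ≤ ε / 2 := fun k => by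
      have e1 := hn k z hz.1
      have e2 : |ψ1 k z - ψ1 k x| < ε / 4 := hδK ⟨hz.2, hz.1⟩ k
      rw [dist_comm, Real.dist_eq] at e1
      have := abs_sub_le (V1 k n z) (ψ1 k z) (ψ1 k x)
      linarith
    rw [Fin.sum_univ_two]
    linarith [h3 0, h3 1]
  have hlim : Tendsto (fun n => ‖V n y - V n x - gradL (fun k => ψ1 k x) (y - x)‖) atTop
      (𝓝 ‖ψ y - ψ x - gradL (fun k => ψ1 k x) (y - x)‖) :=
    (((h0.tendsto_at hy.1).sub (h0.tendsto_at hx)).sub_const _).norm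
  exact le_of_tendsto hlim hev

lemma uniformCauchySeqOn_of_le {K : Set Plane} {V : ℕ → Plane → ℝ} {b : ℕ → ℝ}
    (hb : Tendsto b atTop (𝓝 0)) (h : ∀ n j, ∀ x ∈ K, |V n x - V j x| ≤ b n + b j) :
    UniformCauchySeqOn V atTop K := by
  rw [Metric.uniformCauchySeqOn_iff]
  intro ε hε
  obtain ⟨N, hN⟩ := eventually_atTop.1 (hb.eventually (gt_mem_nhds (half_pos hε)))
  exact ⟨N, fun n hn j hj x hx => (h n j x hx).trans_lt (by linarith [hN n hn, hN j hj])⟩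

/-- The factor `t n` is the one that the chain rule for the dilations produces. It tends to `1` and
the limits are bounded on the compact set, so it does not disturb uniform convergence of the
derivatives. -/
lemma exists_jet_of_uniformCauchySeqOn {K : Set Plane} (hK : Convex ℝ K) {N : ℕ}
    {V : ℕ × ℕ → ℕ → Plane → ℝ} {t : ℕ → ℝ} (ht : Tendsto t atTop (𝓝 1))
    (hKc : IsCompact K)
    (hVc : ∀ α : ℕ × ℕ, α.1 + α.2 ≤ N → ∀ n, Continuous (V α n))
    (hV : ∀ α : ℕ × ℕ, α.1 + α.2 < N → ∀ n, ∀ x ∈ K,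
      HasFDerivAt (V α n) (gradL fun k => t n * V (inc k α) n x) x)
    (hcau : ∀ α : ℕ × ℕ, α.1 + α.2 ≤ N → UniformCauchySeqOn (V α) atTop K) :
    ∃ ψ : ℕ × ℕ → Plane → ℝ, Jet K N ψ ∧
      ∀ α : ℕ × ℕ, α.1 + α.2 ≤ N → TendstoUniformlyOn (V α) (ψ α) atTop K := by
  have hex : ∀ α : ℕ × ℕ, ∀ x, ∃ l, α.1 + α.2 ≤ N → x ∈ K →
      Tendsto (fun n => V α n x) atTop (𝓝 l) := by
    intro α x
    by_cases h : α.1 + α.2 ≤ N ∧ x ∈ K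
    · obtain ⟨l, hl⟩ := cauchySeq_tendsto_of_complete ((hcau α h.1).cauchySeq h.2)
      exact ⟨l, fun _ _ => hl⟩
    · exact ⟨0, fun h1 h2 => absurd ⟨h1, h2⟩ h⟩
  choose ψ hψ using hex
  have hu : ∀ α : ℕ × ℕ, α.1 + α.2 ≤ N → TendstoUniformlyOn (V α) (ψ α) atTop K := fun α hα =>
    (hcau α hα).tendstoUniformlyOn_of_tendsto fun x hx => hψ α x hα hx
  have hcont : ∀ α : ℕ × ℕ, α.1 + α.2 ≤ N → ContinuousOn (ψ α) K := fun α hα =>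
    (hu α hα).continuousOn (Frequently.of_forall fun n => (hVc α hα n).continuousOn)
  refine ⟨ψ, ⟨hcont, fun α hα x hx => ?_⟩, hu⟩
  refine hasFDerivWithinAt_of_tendstoUniformlyOn hK
    (V1 := fun k n x => t n * V (inc k α) n x)
    (fun n x hx => (hV α hα n x hx).hasFDerivWithinAt) (hu α hα.le) (fun k => ?_)
    (fun k => hcont _ (by rw [order_inc]; omega)) hx
  have hk : (inc k α).1 + (inc k α).2 ≤ N := by rw [order_inc]; omega
  obtain ⟨C, hC⟩ := hKc.exists_bound_of_continuousOn (hcont _ hk)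
  rw [Metric.tendstoUniformlyOn_iff]
  intro ε hε
  have h1 := Metric.tendstoUniformlyOn_iff.1 (hu _ hk) (ε / 4) (by positivity)
  have h2 : ∀ᶠ n in atTop, |t n - 1| * |C| < ε / 4 := by
    have : Tendsto (fun n => |t n - 1| * |C|) atTop (𝓝 (|1 - 1| * |C|)) :=
      ((ht.sub_const 1).abs).mul_const _
    rw [sub_self, abs_zero, zero_mul] at this
    exact this.eventually (gt_mem_nhds (by positivity))
  have h3 : ∀ᶠ n in atTop, |t n| < 2 := by
    have : Tendsto (fun n => |t n|) atTop (𝓝 |1|) := ht.abs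
    exact this.eventually (gt_mem_nhds (by norm_num))
  filter_upwards [h1, h2, h3] with n h1 h2 h3 y hy
  have e1 := h1 y hy
  rw [Real.dist_eq, abs_sub_comm] at e1 ⊢
  have e2 : t n * V (inc k α) n y - ψ (inc k α) y =
      t n * (V (inc k α) n y - ψ (inc k α) y) + (t n - 1) * ψ (inc k α) y := by ring
  rw [e2]
  refine (abs_add_le _ _).trans_lt ?_
  rw [abs_mul, abs_mul]
  have e3 : |t n - 1| * |ψ (inc k α) y| ≤ |t n - 1| * |C| :=
    mul_le_mul_of_nonneg_left ((hC y hy).trans (le_abs_self C)) (abs_nonneg _)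
  have e4 : |t n| * |V (inc k α) n y - ψ (inc k α) y| ≤ 2 * (ε / 4) :=
    mul_le_mul h3.le e1.le (abs_nonneg _) (by norm_num)
  linarith

end
end BSQuad

namespace BSQuad
noncomputable section

open MeasureTheory Set Filter Topology

/-! ### Sobolev embedding on convex sets -/

section sobolev
variable {D : Set Plane} {r : ℝ} {c : Plane} {d : ℝ}

lemma abs_mul_volume_le_of_l2norm (hD : Convex ℝ D) (hDo : IsOpen D)
    (hDb : Bornology.IsBounded D) (hd : ∀ x ∈ closure D, ∀ z ∈ D, ‖z - x‖ ≤ d)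
    {v : Plane → ℝ} {v1 : Fin 2 → Plane → ℝ} {v2 : Fin 2 → Fin 2 → Plane → ℝ}
    (hv : Continuous v) (hv1 : ∀ k, Continuous (v1 k)) (hv2 : ∀ k l, Continuous (v2 k l))
    (h1 : ∀ x ∈ closure D, HasFDerivAt v (gradL fun k => v1 k x) x)
    (h2 : ∀ k, ∀ x ∈ closure D, HasFDerivAt (v1 k) (gradL fun l => v2 k l x) x)
    {x : Plane} (hx : x ∈ closure D) :
    |v x| * volume.real D ≤ Real.sqrt (volume.real D) *
      (l2norm D v + d * ∑ k, l2norm D (v1 k) + d ^ 2 * ∑ k, ∑ l, l2norm D (v2 k l)) := by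
  have e1 := abs_sub_average_taylor_le hD hDo hDb hd hv hv1 hv2 h1 h2 hx
  have e2 := abs_integral_taylor_le hDo hDb (hd x hx) (memLp_of_continuous hDb hv 2)
    fun k => memLp_of_continuous hDb (hv1 k) 2
  have e3 : |v x| * volume.real D = |v x * volume.real D| := by
    rw [abs_mul, abs_of_nonneg (measureReal_nonneg (μ := volume) (s := D))]
  have e4 := abs_sub_abs_le_abs_sub (v x * volume.real D)
    (∫ z in D, (v z + ∑ k, v1 k z * (x - z) k))
  rw [e3]
  linarith

/-- The power `i` counts how often the approximation was differentiated. -/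
lemma tendsto_l2norm_dil_approx_sub (hr : 0 < r) (hD : Convex ℝ D) (hDo : IsOpen D)
    (hDb : Bornology.IsBounded D) (hc : Metric.ball c r ⊆ D) {G : Plane → ℝ} (hGm : Measurable G)
    (hG : MemLp G 2 (volume.restrict D)) (i : ℕ) :
    Tendsto (fun n => l2norm D (fun x => dilSeq n ^ i * approx hr c D G n x - G x)) atTop
      (𝓝 0) := by
  have hbound : ∀ n, l2norm D (fun x => dilSeq n ^ i * approx hr c D G n x - G x) ≤
      |dilSeq n ^ i| * l2norm D (fun x => approx hr c D G n x - G x) +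
        |dilSeq n ^ i - 1| * l2norm D G := fun n => by
    have hV := memLp_of_continuous hDb (continuous_approx hr c hDo hDb hG n) 2
    rw [← l2norm_const_mul, ← l2norm_const_mul]
    refine le_trans (le_of_eq ?_) (l2norm_add_le ((hV.sub hG).const_mul _) (hG.const_mul _))
    congr 1; ext x; ring_nf
  refine squeeze_zero (fun n => l2norm_nonneg _ _) hbound ?_
  have h1 : Tendsto (fun n => dilSeq n ^ i) atTop (𝓝 1) := by
    have := tendsto_dilSeq.pow i
    rwa [one_pow] at this
  have h2 := (h1.abs.mul (tendsto_l2norm_approx_sub hr c hD hDo hDb hc hGm hG)).add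
    (((h1.sub_const 1).abs).mul_const (l2norm D G))
  simp only [sub_self, abs_zero, zero_mul, mul_zero, add_zero] at h2
  exact h2

variable {m : ℕ} {g : ℕ × ℕ → Plane → ℝ}

lemma l2norm_dil_approx_sub_le (hr : 0 < r) (hDo : IsOpen D) (hDb : Bornology.IsBounded D)
    {G : Plane → ℝ} (hG : MemLp G 2 (volume.restrict D)) (i n j : ℕ) :
    l2norm D (fun x => dilSeq n ^ i * approx hr c D G n x - dilSeq j ^ i * approx hr c D G j x) ≤
      l2norm D (fun x => dilSeq n ^ i * approx hr c D G n x - G x) +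
        l2norm D (fun x => dilSeq j ^ i * approx hr c D G j x - G x) := by
  have hV : ∀ n, MemLp (fun x => dilSeq n ^ i * approx hr c D G n x - G x) 2
      (volume.restrict D) := fun n =>
    ((memLp_of_continuous hDb (continuous_approx hr c hDo hDb hG n) 2).const_mul _).sub hG
  refine le_trans (le_of_eq ?_) (l2norm_sub_le (hV n) (hV j))
  congr 1; ext x; ring

lemma WeakJet.hasFDerivAt_approx (h : WeakJet D m g) (hr : 0 < r) (hD : Convex ℝ D)
    (hDo : IsOpen D) (hDb : Bornology.IsBounded D) (hc : Metric.ball c r ⊆ D) {α : ℕ × ℕ}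
    (hα : α.1 + α.2 < m) (n : ℕ) {x : Plane} (hx : x ∈ closure D) :
    HasFDerivAt (approx hr c D (g α) n)
      (gradL fun k => dilSeq n * approx hr c D (g (inc k α)) n x) x :=
  BSQuad.hasFDerivAt_approx hr c hD hDo hDb hc (h.mem α hα.le) (h.der α hα) n hx

lemma order_inc_le {α : ℕ × ℕ} {m : ℕ} (h : α.1 + α.2 + 1 ≤ m) (k : Fin 2) :
    (inc k α).1 + (inc k α).2 ≤ m := by rw [order_inc]; exact h

lemma order_inc_inc_le {α : ℕ × ℕ} {m : ℕ} (h : α.1 + α.2 + 2 ≤ m) (k l : Fin 2) :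
    (inc l (inc k α)).1 + (inc l (inc k α)).2 ≤ m := by rw [order_inc, order_inc]; exact h

/-- The bound of the maximum by `L²` norms is applied to differences of two approximations:
convergence in `L²` of the orders `|α|`, `|α| + 1` and `|α| + 2` becomes uniform convergence of the
order `|α|`. -/
lemma WeakJet.uniformCauchySeqOn_of_two_le (h : WeakJet D m g) (hr : 0 < r) (hD : Convex ℝ D)
    (hDo : IsOpen D) (hDb : Bornology.IsBounded D) (hc : Metric.ball c r ⊆ D)
    (hd : ∀ x ∈ closure D, ∀ z ∈ D, ‖z - x‖ ≤ d) (hvol : 0 < volume.real D) {α : ℕ × ℕ}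
    (hα : α.1 + α.2 + 2 ≤ m) :
    UniformCauchySeqOn (fun n => approx hr c D (g α) n) atTop (closure D) := by
  set e : ℕ → ℕ × ℕ → ℕ → ℝ := fun i β n =>
    l2norm D (fun x => dilSeq n ^ i * approx hr c D (g β) n x - g β x) with he
  have het : ∀ i, ∀ β : ℕ × ℕ, β.1 + β.2 ≤ m → Tendsto (e i β) atTop (𝓝 0) := fun i β hβ =>
    tendsto_l2norm_dil_approx_sub hr hD hDo hDb hc (h.meas β) (h.mem β hβ) i
  have hcont : ∀ i, ∀ β : ℕ × ℕ, β.1 + β.2 ≤ m → ∀ n j, Continuous fun x =>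
      dilSeq n ^ i * approx hr c D (g β) n x - dilSeq j ^ i * approx hr c D (g β) j x :=
    fun i β hβ n j => (continuous_const.mul (continuous_approx hr c hDo hDb (h.mem β hβ) n)).sub
      (continuous_const.mul (continuous_approx hr c hDo hDb (h.mem β hβ) j))
  have hder : ∀ i, ∀ β : ℕ × ℕ, β.1 + β.2 < m → ∀ n j, ∀ x ∈ closure D, HasFDerivAt
      (fun x => dilSeq n ^ i * approx hr c D (g β) n x - dilSeq j ^ i * approx hr c D (g β) j x)
      (gradL fun k => dilSeq n ^ (i + 1) * approx hr c D (g (inc k β)) n x -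
        dilSeq j ^ (i + 1) * approx hr c D (g (inc k β)) j x) x := fun i β hβ n j x hx => by
    have := ((h.hasFDerivAt_approx hr hD hDo hDb hc hβ n hx).const_mul (dilSeq n ^ i)).sub
      ((h.hasFDerivAt_approx hr hD hDo hDb hc hβ j hx).const_mul (dilSeq j ^ i))
    refine HasFDerivAt.congr_fderiv this ?_
    rw [gradL_smul, gradL_smul, gradL_sub]
    congr 1; ext k; ring
  set S : ℕ → ℝ := fun n => e 0 α n + d * ∑ k, e 1 (inc k α) n +
    d ^ 2 * ∑ k, ∑ l, e 2 (inc l (inc k α)) n with hS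
  have hSt : Tendsto S atTop (𝓝 0) := by
    have h1 := het 0 α (by omega)
    have h2 := tendsto_finsetSum Finset.univ fun k _ => het 1 (inc k α) (order_inc_le (by omega) k)
    have h3 := tendsto_finsetSum Finset.univ fun k _ =>
      tendsto_finsetSum Finset.univ fun l _ => het 2 (inc l (inc k α)) (order_inc_inc_le hα k l)
    have := (h1.add (h2.const_mul d)).add (h3.const_mul (d ^ 2))
    simp only [Finset.sum_const_zero, mul_zero, add_zero] at this
    exact this
  refine uniformCauchySeqOn_of_le (b := fun n => Real.sqrt (volume.real D) * S n / volume.real D)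
    (by simpa using (hSt.const_mul (Real.sqrt (volume.real D))).div_const (volume.real D)) ?_
  intro n j x hx
  have key := abs_mul_volume_le_of_l2norm hD hDo hDb hd
    (hcont 0 α (by omega) n j) (fun k => hcont 1 (inc k α) (order_inc_le (by omega) k) n j)
    (fun k l => hcont 2 (inc l (inc k α)) (order_inc_inc_le hα k l) n j)
    (hder 0 α (by omega) n j)
    (fun k => hder 1 (inc k α) (by rw [order_inc]; omega) n j) hx
  simp only [pow_zero, one_mul] at key
  rw [← add_div, le_div_iff₀ hvol]
  refine key.trans ?_
  rw [← mul_add]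
  refine mul_le_mul_of_nonneg_left ?_ (Real.sqrt_nonneg _)
  have hd0 : 0 ≤ d := by
    obtain ⟨z, hz⟩ : D.Nonempty := ⟨c, hc (Metric.mem_ball_self hr)⟩
    exact (norm_nonneg _).trans (hd z (subset_closure hz) z hz)
  have b0 : l2norm D (fun x => approx hr c D (g α) n x - approx hr c D (g α) j x) ≤
      e 0 α n + e 0 α j := by
    simpa [he] using l2norm_dil_approx_sub_le (c := c) hr hDo hDb (h.mem α (by omega)) 0 n j
  have b1 : ∀ k, _ ≤ e 1 (inc k α) n + e 1 (inc k α) j := fun k =>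
    l2norm_dil_approx_sub_le (c := c) hr hDo hDb (h.mem (inc k α) (order_inc_le (by omega) k)) 1 n j
  have b2 : ∀ k l, _ ≤ e 2 (inc l (inc k α)) n + e 2 (inc l (inc k α)) j := fun k l =>
    l2norm_dil_approx_sub_le (c := c) hr hDo hDb
      (h.mem (inc l (inc k α)) (order_inc_inc_le hα k l)) 2 n j
  have s1 := mul_le_mul_of_nonneg_left (Finset.sum_le_sum fun k (_ : k ∈ Finset.univ) => b1 k) hd0
  have s2 := mul_le_mul_of_nonneg_left (Finset.sum_le_sum fun k (_ : k ∈ Finset.univ) =>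
    Finset.sum_le_sum fun l (_ : l ∈ Finset.univ) => b2 k l) (sq_nonneg d)
  simp only [Finset.sum_add_distrib, mul_add] at s1 s2
  simp only [hS]
  linarith

/-- Mollification preserves an essential bound and the dilation factor is at most `1`, so the
Lipschitz constant does not depend on `n`. -/
lemma WeakJet.approx_lipschitz (h : WeakJet D m g) (hr : 0 < r) (hD : Convex ℝ D)
    (hDo : IsOpen D) (hDb : Bornology.IsBounded D) (hc : Metric.ball c r ⊆ D) {α : ℕ × ℕ}
    (hα : α.1 + α.2 < m) {B : ℝ} (hB0 : 0 ≤ B)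
    (hB : ∀ k, ∀ᵐ x ∂volume.restrict D, |g (inc k α) x| ≤ B) (n : ℕ) {x y : Plane}
    (hx : x ∈ closure D) (hy : y ∈ closure D) :
    |approx hr c D (g α) n y - approx hr c D (g α) n x| ≤ 2 * B * ‖y - x‖ := by
  rw [← Real.norm_eq_abs]
  refine hD.closure.norm_image_sub_le_of_norm_hasFDerivWithin_le
    (fun z hz => (h.hasFDerivAt_approx hr hD hDo hDb hc hα n hz).hasFDerivWithinAt)
    (fun z hz => (norm_gradL_le _).trans ?_) hx hy
  have : ∀ k, |dilSeq n * approx hr c D (g (inc k α)) n z| ≤ B := fun k => by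
    rw [abs_mul, abs_of_pos (dilSeq_pos n)]
    calc _ ≤ 1 * B := mul_le_mul (dilSeq_le_one n) (abs_approx_le hr c hDo hB0 (hB k) n z)
          (abs_nonneg _) zero_le_one
      _ = B := one_mul B
  rw [Fin.sum_univ_two]
  linarith [this 0, this 1]

lemma WeakJet.uniformCauchySeqOn_of_bounded (h : WeakJet D m g) (hr : 0 < r) (hD : Convex ℝ D)
    (hDo : IsOpen D) (hDb : Bornology.IsBounded D) (hc : Metric.ball c r ⊆ D)
    (hd : ∀ x ∈ closure D, ∀ z ∈ D, ‖z - x‖ ≤ d) (hvol : 0 < volume.real D) {α : ℕ × ℕ}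
    (hα : α.1 + α.2 < m) {B : ℝ} (hB0 : 0 ≤ B)
    (hB : ∀ k, ∀ᵐ x ∂volume.restrict D, |g (inc k α) x| ≤ B) :
    UniformCauchySeqOn (fun n => approx hr c D (g α) n) atTop (closure D) := by
  have hd0 : 0 ≤ d := by
    obtain ⟨z, hz⟩ : D.Nonempty := ⟨c, hc (Metric.mem_ball_self hr)⟩
    exact (norm_nonneg _).trans (hd z (subset_closure hz) z hz)
  have hα' := h.mem α hα.le
  rw [Metric.uniformCauchySeqOn_iff]
  intro ε hε
  -- First `s` makes the Lipschitz contribution at most `ε / 2`; then `n` and `j` are taken so large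
  -- that each of the two `L²` contributions is below `ε / 4`. The summand `1` in the denominator
  -- covers `B d = 0`.
  obtain ⟨s, hs, hs1, hsε⟩ : ∃ s : ℝ, 0 < s ∧ s ≤ 1 ∧ 4 * B * s * d ≤ ε / 2 := by
    refine ⟨min 1 (ε / (8 * B * d + 1)), by positivity, min_le_left _ _, ?_⟩
    have h1 : min 1 (ε / (8 * B * d + 1)) * (8 * B * d + 1) ≤ ε :=
      (le_div_iff₀ (by positivity)).1 (min_le_right _ _)
    have h2 : 0 < min 1 (ε / (8 * B * d + 1)) := by positivity
    nlinarith
  have ht := ((tendsto_l2norm_approx_sub hr c hD hDo hDb hc (h.meas α) hα').const_mul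
    (s⁻¹ * Real.sqrt (volume.real D))).div_const (volume.real D)
  rw [mul_zero, zero_div] at ht
  obtain ⟨N, hN⟩ := eventually_atTop.1 (ht.eventually (gt_mem_nhds (by positivity : 0 < ε / 4)))
  refine ⟨N, fun n hn j hj x hx => ?_⟩
  have hcn := fun n => continuous_approx hr c hDo hDb hα' n
  have key := abs_mul_volume_le_of_lipschitz hD hDo hDb hx (hd x hx) ((hcn n).sub (hcn j))
    (L := 4 * B) (by positivity) (fun y hy => by
      have e1 := h.approx_lipschitz hr hD hDo hDb hc hα hB0 hB n hx hy
      have e2 := h.approx_lipschitz hr hD hDo hDb hc hα hB0 hB j hx hy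
      have e3 := abs_sub (approx hr c D (g α) n y - approx hr c D (g α) n x)
        (approx hr c D (g α) j y - approx hr c D (g α) j x)
      simp only [Pi.sub_apply]
      rw [sub_sub_sub_comm]
      linarith) hs hs1
  have b0 := l2norm_dil_approx_sub_le (c := c) hr hDo hDb hα' 0 n j
  simp only [pow_zero, one_mul] at b0
  have n1 := hN n hn
  have n2 := hN j hj
  rw [div_lt_iff₀ hvol] at n1 n2
  rw [Real.dist_eq]
  refine lt_of_mul_lt_mul_right (key.trans_lt ?_) hvol.le
  have b1 := mul_le_mul_of_nonneg_left b0
    (by positivity : 0 ≤ s⁻¹ * Real.sqrt (volume.real D))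
  have b2 := mul_le_mul_of_nonneg_right hsε hvol.le
  have e4 : l2norm D (fun x => approx hr c D (g α) n x - approx hr c D (g α) j x) =
    l2norm D (approx hr c D (g α) n - approx hr c D (g α) j) := rfl
  rw [e4] at b1
  linarith

lemma ae_eq_of_tendstoUniformlyOn_approx (hr : 0 < r) (hD : Convex ℝ D) (hDo : IsOpen D)
    (hDb : Bornology.IsBounded D) (hc : Metric.ball c r ⊆ D) {G ψ : Plane → ℝ} (hGm : Measurable G)
    (hG : MemLp G 2 (volume.restrict D))
    (hψ : TendstoUniformlyOn (fun n => approx hr c D G n) ψ atTop (closure D)) :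
    ψ =ᵐ[volume.restrict D] G := by
  have h1 : TendstoInMeasure (volume.restrict D) (fun n => approx hr c D G n) atTop G :=
    tendstoInMeasure_of_tendsto_eLpNorm (p := 2) (by norm_num)
      (fun n => (continuous_approx hr c hDo hDb hG n).aestronglyMeasurable) hG.1
      (tendsto_eLpNorm_approx_sub hr c hD hDo hDb hc hGm hG)
  obtain ⟨ns, hns, hae⟩ := h1.exists_seq_tendsto_ae
  filter_upwards [hae, ae_restrict_mem hDo.measurableSet] with x hx hxD
  exact tendsto_nhds_unique ((hψ.tendsto_at (subset_closure hxD)).comp hns.tendsto_atTop) hx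

/-- Sobolev embedding and polynomial approximation for bounded derivatives of order `N + 1`. -/
theorem WeakJet.exists_jet_of_bounded {N : ℕ} (h : WeakJet D (N + 1) g) (hr : 0 < r)
    (hD : Convex ℝ D) (hDo : IsOpen D) (hDb : Bornology.IsBounded D) (hc : Metric.ball c r ⊆ D)
    (hd : ∀ x ∈ closure D, ∀ z ∈ D, ‖z - x‖ ≤ d) (hvol : 0 < volume.real D)
    (hB' : ∀ α : ℕ × ℕ, α.1 + α.2 ≤ N + 1 → ∃ B, ∀ᵐ x ∂volume.restrict D, |g α x| ≤ B)
    {B : ℝ} (hB0 : 0 ≤ B)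
    (hB : ∀ α : ℕ × ℕ, α.1 + α.2 = N + 1 → ∀ᵐ x ∂volume.restrict D, |g α x| ≤ B) :
    ∃ (ψ : ℕ × ℕ → Plane → ℝ) (a : ℕ × ℕ → ℝ), Jet (closure D) N ψ ∧
      (∀ α : ℕ × ℕ, α.1 + α.2 ≤ N → ψ α =ᵐ[volume.restrict D] g α) ∧
      ∀ α : ℕ × ℕ, α.1 + α.2 ≤ N → ∀ x ∈ closure D,
        |ψ α x - polyJet c a N α x| ≤ (2 * d) ^ (N - (α.1 + α.2)) * (2 * d * B) := by
  have hcD : c ∈ closure D := subset_closure (hc (Metric.mem_ball_self hr))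
  have hcau : ∀ α : ℕ × ℕ, α.1 + α.2 ≤ N →
      UniformCauchySeqOn (fun n => approx hr c D (g α) n) atTop (closure D) := fun α hα => by
    obtain ⟨B0, h0⟩ := hB' (inc 0 α) (order_inc_le (by omega) 0)
    obtain ⟨B1, h1⟩ := hB' (inc 1 α) (order_inc_le (by omega) 1)
    refine h.uniformCauchySeqOn_of_bounded hr hD hDo hDb hc hd hvol (by omega)
      (B := |B0| + |B1|) (by positivity) fun k => ?_
    fin_cases k
    · filter_upwards [h0] with x hx
      exact hx.trans ((le_abs_self _).trans (le_add_of_nonneg_right (abs_nonneg _)))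
    · filter_upwards [h1] with x hx
      exact hx.trans ((le_abs_self _).trans (le_add_of_nonneg_left (abs_nonneg _)))
  obtain ⟨ψ, hψ, hu⟩ := exists_jet_of_uniformCauchySeqOn hD.closure tendsto_dilSeq
    hDb.isCompact_closure (V := fun α n => approx hr c D (g α) n)
    (fun α hα n => continuous_approx hr c hDo hDb (h.mem α (by omega)) n)
    (fun α hα n x hx => h.hasFDerivAt_approx hr hD hDo hDb hc (by omega) n hx) hcau
  refine ⟨ψ, fun α => ψ α c, hψ, fun α hα => ae_eq_of_tendstoUniformlyOn_approx hr hD hDo hDb hc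
    (h.meas α) (h.mem α (by omega)) (hu α hα), fun α hα x hx => ?_⟩
  have hdc : ∀ x ∈ closure D, ‖x - c‖ ≤ d := fun x hx => by
    rw [norm_sub_rev]; exact hd x hx c (hc (Metric.mem_ball_self hr))
  -- Subtracting the Taylor polynomial at `c` removes all orders below `N` at `c`. In the order `N`
  -- the polynomial is the constant `ψ α c`, and the uniform Lipschitz bound of the approximations
  -- passes to the limit.
  refine (hψ.sub (jet_polyJet (closure D) N c (fun α => ψ α c) N)).abs_le_of_eq_zero hD.closure hcD
    hdc (fun α hα => ?_) (fun α hα x hx => ?_) (N - (α.1 + α.2)) (by omega) α (by omega) x hx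
  · rw [polyJet_center _ _ _ hα.le, sub_self]
  · rw [polyJet_top _ _ _ hα]
    have h1 : ∀ n, |approx hr c D (g α) n x - approx hr c D (g α) n c| ≤ 2 * d * B := fun n => by
      refine (h.approx_lipschitz hr hD hDo hDb hc (by omega) hB0
        (fun k => hB _ (by rw [order_inc, hα])) n hcD hx).trans ?_
      nlinarith [hdc x hx]
    exact le_of_tendsto (((hu α hα.le).tendsto_at hx).sub ((hu α hα.le).tendsto_at hcD)).abs
      (Eventually.of_forall h1)

/-- Sobolev embedding and polynomial approximation for square integrable derivatives of order
`N + 2`. -/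
theorem WeakJet.exists_jet_of_l2 {N : ℕ} (h : WeakJet D (N + 2) g) (hr : 0 < r)
    (hD : Convex ℝ D) (hDo : IsOpen D) (hDb : Bornology.IsBounded D) (hc : Metric.ball c r ⊆ D)
    (hd : ∀ x ∈ closure D, ∀ z ∈ D, ‖z - x‖ ≤ d) (hvol : 0 < volume.real D)
    {B : ℝ} (hB : ∀ α : ℕ × ℕ, α.1 + α.2 = N + 2 → l2norm D (g α) ≤ B) :
    ∃ (ψ : ℕ × ℕ → Plane → ℝ) (a : ℕ × ℕ → ℝ), Jet (closure D) N ψ ∧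
      (∀ α : ℕ × ℕ, α.1 + α.2 ≤ N → ψ α =ᵐ[volume.restrict D] g α) ∧
      ∀ α : ℕ × ℕ, α.1 + α.2 ≤ N → ∀ x ∈ closure D,
        |ψ α x - polyJet c a (N + 1) α x| ≤
          (2 * d) ^ (N - (α.1 + α.2)) * (4 * d ^ 2 * B / Real.sqrt (volume.real D)) := by
  have hcD : c ∈ closure D := subset_closure (hc (Metric.mem_ball_self hr))
  have hfin : IsFiniteMeasure (volume.restrict D) := ⟨by simpa using hDb.measure_lt_top⟩
  obtain ⟨ψ, hψ, hu⟩ := exists_jet_of_uniformCauchySeqOn hD.closure tendsto_dilSeq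
    hDb.isCompact_closure (N := N) (V := fun α n => approx hr c D (g α) n)
    (fun α hα n => continuous_approx hr c hDo hDb (h.mem α (by omega)) n)
    (fun α hα n x hx => h.hasFDerivAt_approx hr hD hDo hDb hc (by omega) n hx)
    (fun α hα => h.uniformCauchySeqOn_of_two_le hr hD hDo hDb hc hd hvol (by omega))
  -- Below order `N` these are the Taylor coefficients of `ψ` at `c`. The orders `N` and `N + 1` are
  -- chosen so that each derivative of order `N` of the polynomial is the averaged first order
  -- Taylor polynomial of `g α`; this is `hpoly`.
  set a : ℕ × ℕ → ℝ := fun α =>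
    if α.1 + α.2 < N then ψ α c
    else if α.1 + α.2 = N then
      (volume.real D)⁻¹ * ∫ z in D, (g α z + ∑ k, g (inc k α) z * (c - z) k)
    else (volume.real D)⁻¹ * ∫ z in D, g α z with ha
  refine ⟨ψ, a, hψ, fun α hα => ae_eq_of_tendstoUniformlyOn_approx hr hD hDo hDb hc
    (h.meas α) (h.mem α (by omega)) (hu α hα), fun α hα x hx => ?_⟩
  have hdc : ∀ x ∈ closure D, ‖x - c‖ ≤ d := fun x hx => by
    rw [norm_sub_rev]; exact hd x hx c (hc (Metric.mem_ball_self hr))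
  refine (hψ.sub (jet_polyJet (closure D) N c a (N + 1))).abs_le_of_eq_zero hD.closure hcD
    hdc (fun α hα => ?_) (fun α hα x hx => ?_) (N - (α.1 + α.2)) (by omega) α (by omega) x hx
  · rw [polyJet_center _ _ _ (by omega)]
    simp [ha, hα]
  -- the top order: pass to the limit in the averaged Taylor formula
  have hm0 := h.mem α (by omega)
  have hm1 : ∀ k, MemLp (g (inc k α)) 2 (volume.restrict D) := fun k =>
    h.mem _ (order_inc_le (by omega) k)
  have i0 := hm0.integrable (by norm_num)
  have i1 : ∀ k, Integrable (g (inc k α)) (volume.restrict D) := fun k =>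
    (hm1 k).integrable (by norm_num)
  have i2 : ∀ (y : Plane) (k), Integrable (fun z => g (inc k α) z * (y - z) k)
      (volume.restrict D) := fun y k => by
    obtain ⟨C, hC⟩ := hDb.isCompact_closure.exists_bound_of_continuousOn
      (f := fun z : Plane => (y - z) k) (by fun_prop)
    refine (i1 k).mul_bdd (c := C) (by fun_prop : Continuous fun z : Plane =>
      (y - z) k).aestronglyMeasurable ?_
    filter_upwards [ae_restrict_mem hDo.measurableSet] with z hz
    exact hC z (subset_closure hz)
  have hpoly : polyJet c a (N + 1) α x * volume.real D =
      ∫ z in D, (g α z + ∑ k, g (inc k α) z * (x - z) k) := by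
    rw [polyJet_subtop _ _ _ (by omega)]
    have a0 : a α = (volume.real D)⁻¹ *
        ∫ z in D, (g α z + ∑ k, g (inc k α) z * (c - z) k) := by simp [ha, hα]
    have a1 : ∀ k, a (inc k α) = (volume.real D)⁻¹ * ∫ z in D, g (inc k α) z := fun k => by
      have e := order_inc k α
      simp only [ha, e, hα]
      simp
    have e : ∫ z in D, (g α z + ∑ k, g (inc k α) z * (x - z) k) =
        (∫ z in D, (g α z + ∑ k, g (inc k α) z * (c - z) k)) +
          ∑ k, (∫ z in D, g (inc k α) z) * (x - c) k := by
      simp_rw [← integral_mul_const]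
      have hI : Integrable (fun z => g α z + ∑ k, g (inc k α) z * (c - z) k)
          (volume.restrict D) := i0.add (integrable_finsetSum _ fun k _ => i2 c k)
      rw [← integral_finsetSum _ fun k _ => (i1 k).mul_const _, ← integral_add hI
        (integrable_finsetSum _ fun k _ => (i1 k).mul_const _)]
      refine integral_congr_ae (ae_of_all _ fun z => ?_)
      simp only [Fin.sum_univ_two, PiLp.sub_apply]
      ring
    rw [e, a0]
    simp_rw [a1]
    simp only [Fin.sum_univ_two]
    field_simp
  have hineq : ∀ n, |approx hr c D (g α) n x * volume.real D - ∫ z in D, (approx hr c D (g α) n z +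
      ∑ k, dilSeq n * approx hr c D (g (inc k α)) n z * (x - z) k)| ≤
      d ^ 2 * Real.sqrt (volume.real D) * ∑ k, ∑ l, l2norm D (fun z =>
        dilSeq n * (dilSeq n * approx hr c D (g (inc l (inc k α))) n z)) := fun n => by
    refine abs_sub_average_taylor_le hD hDo hDb hd (continuous_approx hr c hDo hDb hm0 n)
      (v1 := fun k z => dilSeq n * approx hr c D (g (inc k α)) n z)
      (v2 := fun k l z => dilSeq n * (dilSeq n * approx hr c D (g (inc l (inc k α))) n z))
      (fun k => continuous_const.mul (continuous_approx hr c hDo hDb (hm1 k) n))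
      (fun k l => continuous_const.mul (continuous_const.mul (continuous_approx hr c hDo hDb
        (h.mem _ (order_inc_inc_le (by omega) k l)) n)))
      (fun y hy => h.hasFDerivAt_approx hr hD hDo hDb hc (by omega) n hy)
      (fun k y hy => ?_) hx
    have := (h.hasFDerivAt_approx hr hD hDo hDb hc (α := inc k α) (by rw [order_inc]; omega)
      n hy).const_mul (dilSeq n)
    rwa [gradL_smul] at this
  have hnorm : ∀ (i : ℕ) (β : ℕ × ℕ), β.1 + β.2 ≤ N + 2 → Tendsto (fun n => l2norm D (fun z =>
      dilSeq n ^ i * approx hr c D (g β) n z)) atTop (𝓝 (l2norm D (g β))) := fun i β hβ => by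
    have h1 := tendsto_l2norm_dil_approx_sub hr hD hDo hDb hc (h.meas β) (h.mem β hβ) i
    refine tendsto_iff_norm_sub_tendsto_zero.2 (squeeze_zero (fun n => norm_nonneg _) (fun n => ?_)
      h1)
    have hV := (memLp_of_continuous hDb (continuous_approx hr c hDo hDb (h.mem β hβ) n) 2).const_mul
      (dilSeq n ^ i)
    have e1 := l2norm_add_le (hV.sub (h.mem β hβ)) (h.mem β hβ)
    have e2 := l2norm_sub_le hV (hV.sub (h.mem β hβ))
    simp only [Pi.sub_apply, sub_add_cancel, sub_sub_cancel] at e1 e2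
    rw [Real.norm_eq_abs, abs_le]
    constructor
    · have e3 : l2norm D (g β) ≤ l2norm D (fun z => dilSeq n ^ i * approx hr c D (g β) n z) +
        l2norm D (fun z => dilSeq n ^ i * approx hr c D (g β) n z - g β z) := e2
      linarith
    · have e3 : l2norm D (fun z => dilSeq n ^ i * approx hr c D (g β) n z) ≤
        l2norm D (fun z => dilSeq n ^ i * approx hr c D (g β) n z - g β z) + l2norm D (g β) := e1
      linarith
  have hlimI : Tendsto (fun n => ∫ z in D, (approx hr c D (g α) n z +
      ∑ k, dilSeq n * approx hr c D (g (inc k α)) n z * (x - z) k)) atTop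
      (𝓝 (polyJet c a (N + 1) α x * volume.real D)) := by
    rw [hpoly]
    refine tendsto_iff_norm_sub_tendsto_zero.2 ?_
    have hlim0 : Tendsto (fun n => Real.sqrt (volume.real D) *
        (l2norm D (fun z => dilSeq n ^ 0 * approx hr c D (g α) n z - g α z) +
          d * ∑ k, l2norm D (fun z => dilSeq n ^ 1 * approx hr c D (g (inc k α)) n z -
            g (inc k α) z))) atTop (𝓝 0) := by
      have := ((tendsto_l2norm_dil_approx_sub hr hD hDo hDb hc (h.meas α) hm0 0).add
        ((tendsto_finsetSum Finset.univ fun k _ => tendsto_l2norm_dil_approx_sub hr hD hDo hDb hc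
          (h.meas (inc k α)) (hm1 k) 1).const_mul d)).const_mul (Real.sqrt (volume.real D))
      simpa using this
    refine squeeze_zero (fun n => norm_nonneg _) (fun n => ?_) hlim0
    have hV0 := (memLp_of_continuous hDb (continuous_approx hr c hDo hDb hm0 n) 2)
    have hV1 := fun k => ((memLp_of_continuous hDb
      (continuous_approx hr c hDo hDb (hm1 k) n) 2).const_mul (dilSeq n ^ 1))
    have := abs_integral_taylor_le hDo hDb (hd x hx) ((hV0.const_mul (dilSeq n ^ 0)).sub hm0)
      (u1 := fun k z => dilSeq n ^ 1 * approx hr c D (g (inc k α)) n z - g (inc k α) z)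
      (fun k => (hV1 k).sub (hm1 k))
    refine le_trans (le_of_eq ?_) this
    rw [Real.norm_eq_abs, ← integral_sub]
    · congr 1
      refine integral_congr_ae (ae_of_all _ fun z => ?_)
      simp only [Fin.sum_univ_two, Pi.sub_apply]
      ring
    · have hcI : Continuous fun z => approx hr c D (g α) n z +
          ∑ k, dilSeq n * approx hr c D (g (inc k α)) n z * (x - z) k := by
        have := continuous_approx hr c hDo hDb hm0 n
        have := fun k => continuous_approx hr c hDo hDb (hm1 k) n
        fun_prop
      exact (memLp_of_continuous hDb hcI 1).integrable le_rfl
    · exact i0.add (integrable_finsetSum _ fun k _ => i2 x k)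
  have hlimR : Tendsto (fun n => d ^ 2 * Real.sqrt (volume.real D) * ∑ k, ∑ l, l2norm D (fun z =>
        dilSeq n * (dilSeq n * approx hr c D (g (inc l (inc k α))) n z))) atTop
      (𝓝 (d ^ 2 * Real.sqrt (volume.real D) * ∑ k, ∑ l, l2norm D (g (inc l (inc k α))))) := by
    refine (tendsto_finsetSum Finset.univ fun k _ => tendsto_finsetSum Finset.univ fun l _ =>
      ?_).const_mul _
    have := hnorm 2 (inc l (inc k α)) (order_inc_inc_le (by omega) k l)
    simpa only [pow_two, mul_assoc] using this
  have hfinal := le_of_tendsto_of_tendsto' ((((hu α hα.le).tendsto_at hx).mul_const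
    (volume.real D)).sub hlimI).abs hlimR hineq
  rw [← sub_mul, abs_mul, abs_of_pos hvol] at hfinal
  have hsum : ∑ k, ∑ l, l2norm D (g (inc l (inc k α))) ≤ 4 * B := by
    have : ∀ k l, l2norm D (g (inc l (inc k α))) ≤ B := fun k l =>
      hB _ (by rw [order_inc, order_inc]; omega)
    simp only [Fin.sum_univ_two]
    linarith [this 0 0, this 0 1, this 1 0, this 1 1]
  have hsq : Real.sqrt (volume.real D) * Real.sqrt (volume.real D) = volume.real D :=
    Real.mul_self_sqrt hvol.le
  have hsp : 0 < Real.sqrt (volume.real D) := Real.sqrt_pos.2 hvol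
  rw [le_div_iff₀ hsp]
  refine le_of_mul_le_mul_right ?_ hsp
  rw [mul_assoc, hsq]
  refine hfinal.trans ?_
  calc _ ≤ d ^ 2 * Real.sqrt (volume.real D) * (4 * B) := by gcongr
    _ = _ := by ring

end sobolev

end
end BSQuad

namespace BSQuad
noncomputable section

open MeasureTheory Set Filter Topology

/-! ### Weak derivatives -/

lemma pderivWithin_univ (k : Fin 2) (η : Plane → ℝ) (x : Plane) :
    pderivWithin univ k η x = fderiv ℝ η x (EuclideanSpace.single k 1) := by
  rw [pderivWithin, fderivWithin_univ]

lemma IsTest.pderiv {D : Set Plane} {η : Plane → ℝ} (h : IsTest D η) (k : Fin 2) :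
    IsTest D (pderivWithin univ k η) := by
  have e : pderivWithin univ k η = fun x => fderiv ℝ η x (EuclideanSpace.single k 1) :=
    funext fun x => pderivWithin_univ k η x
  rw [e]
  exact ⟨(h.1.fderiv_right (m := ((⊤ : ℕ∞) : WithTop ℕ∞)) (by simp)).clm_apply contDiff_const,
    h.2.1.fderiv_apply (𝕜 := ℝ) _, (tsupport_fderiv_apply_subset ℝ _).trans h.2.2⟩

lemma pderiv_comm {η : Plane → ℝ} (h : ContDiff ℝ ((⊤ : ℕ∞) : WithTop ℕ∞) η) (k l : Fin 2) :
    pderivWithin univ k (pderivWithin univ l η) = pderivWithin univ l (pderivWithin univ k η) := by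
  have e : ∀ l, pderivWithin univ l η = fun x => fderiv ℝ η x (EuclideanSpace.single l 1) :=
    fun l => funext fun x => pderivWithin_univ l η x
  have hd : Differentiable ℝ (fderiv ℝ η) :=
    (h.fderiv_right (m := 1) (by norm_cast)).differentiable (by simp)
  have e2 : ∀ k l x, pderivWithin univ k (pderivWithin univ l η) x =
      fderiv ℝ (fderiv ℝ η) x (EuclideanSpace.single k 1) (EuclideanSpace.single l 1) := by
    intro k l x
    rw [pderivWithin_univ, e]
    have := (hd x).hasFDerivAt.clm_apply (hasFDerivAt_const (EuclideanSpace.single l (1 : ℝ)) x)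
    rw [this.fderiv]
    simp
  funext x
  rw [e2, e2]
  exact (h.contDiffAt.isSymmSndFDerivAt (by
    rw [minSmoothness_of_isRCLikeNormedField]; exact WithTop.coe_le_coe.2 le_top)).eq _ _

/-- `mderivWithin` applies the second coordinate derivatives first; symmetry of second derivatives
lets an extra derivative be absorbed in either coordinate. -/
lemma mderiv_pderiv {D : Set Plane} {η : Plane → ℝ} (h : IsTest D η) (k : Fin 2) (α : ℕ × ℕ) :
    mderivWithin univ α (pderivWithin univ k η) = mderivWithin univ (inc k α) η := by
  have h1 : ∀ b : ℕ, ∀ η : Plane → ℝ, IsTest D η → (pderivWithin univ 1)^[b]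
      (pderivWithin univ 0 η) = pderivWithin univ 0 ((pderivWithin univ 1)^[b] η) := by
    intro b
    induction b with
    | zero => intro η _; rfl
    | succ b ih =>
      intro η hη
      rw [Function.iterate_succ_apply, Function.iterate_succ_apply, pderiv_comm hη.1,
        ih _ (hη.pderiv 1)]
  fin_cases k
  · simp only [mderivWithin, Fin.zero_eta, inc_zero]
    rw [h1 _ _ h, ← Function.iterate_succ_apply]
  · simp only [mderivWithin, Fin.mk_one, inc_one]
    rw [← Function.iterate_succ_apply]

lemma integrableOn_mul_test {U : Set Plane} {f η : Plane → ℝ}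
    (hf : LocallyIntegrableOn f U) (hη : IsTest U η) : IntegrableOn (fun x => f x * η x) U := by
  have h1 : IntegrableOn f (tsupport η) := hf.integrableOn_compact_subset hη.2.2 hη.2.1
  have h2 : IntegrableOn (fun x => f x * η x) (tsupport η) :=
    h1.mul_continuousOn hη.1.continuous.continuousOn hη.2.1
  have h3 : Integrable (fun x => f x * η x) := by
    refine (integrableOn_iff_integrable_of_support_subset fun x hx => ?_).1 h2
    refine subset_tsupport η fun h => hx ?_
    simp [h]
  exact h3.integrableOn

/-- The difference integrates to zero against every test function, so it vanishes almost everywhere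
by the fundamental lemma of the calculus of variations. -/
lemma HasWeakDeriv.ae_eq {U : Set Plane} (hU : IsOpen U) {α : ℕ × ℕ} {f g g' : Plane → ℝ}
    (h : HasWeakDeriv U α f g) (h' : HasWeakDeriv U α f g') : g =ᵐ[volume.restrict U] g' := by
  have h0 : LocallyIntegrableOn (fun x => g x - g' x) U := h.2.1.sub h'.2.1
  have key := hU.ae_eq_zero_of_integral_contDiff_smul_eq_zero h0 fun η h1 h2 h3 => by
    have hη : IsTest U η := ⟨h1, h2, h3⟩
    have e := (h.2.2 η h1 h2 h3).symm.trans (h'.2.2 η h1 h2 h3)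
    have hs : ((-1 : ℝ) ^ (α.1 + α.2)) ≠ 0 := by positivity
    have e' := mul_left_cancel₀ hs e
    have e3 : ∫ x, η x • (g x - g' x) = ∫ x in U, (g x * η x - g' x * η x) := by
      rw [setIntegral_eq_integral_of_forall_compl_eq_zero]
      · congr 1; ext x; simp only [smul_eq_mul]; ring
      · intro x hx
        have : η x = 0 := image_eq_zero_of_notMem_tsupport fun h => hx (h3 h)
        simp [this]
    rw [e3, integral_sub (integrableOn_mul_test h.2.1 hη) (integrableOn_mul_test h'.2.1 hη),
      e', sub_self]
  refine (ae_restrict_iff' hU.measurableSet).2 ?_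
  filter_upwards [key] with x hx hxU
  exact sub_eq_zero.1 (hx hxU)

lemma HasWeakDeriv.weakDerivNorm_eq {U : Set Plane} (hU : IsOpen U) {α : ℕ × ℕ} {f g : Plane → ℝ}
    (h : HasWeakDeriv U α f g) (q : ℝ≥0∞) :
    weakDerivNorm q U α f = eLpNorm g q (volume.restrict U) := by
  refine le_antisymm (iInf₂_le g h) (le_iInf₂ fun g' h' => le_of_eq ?_)
  exact eLpNorm_congr_ae (h.ae_eq hU h')

/-- Testing the identity of order `α` with `∂ₖ η` and the identity of order `inc k α` with `η` gives
the same integral of `f`; comparing the signs shows that neighbouring weak derivatives are weak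
derivatives of each other. -/
lemma MemSobolev.exists_weakJet {q : ℝ≥0∞} (hq : 2 ≤ q) {m : ℕ} {U : Set Plane}
    (hUb : Bornology.IsBounded U) {f : Plane → ℝ} (hf : MemSobolev q m U f) :
    ∃ g : ℕ × ℕ → Plane → ℝ, WeakJet U m g ∧ ∀ α : ℕ × ℕ, α.1 + α.2 ≤ m →
      HasWeakDeriv U α f (g α) ∧ MemLp (g α) q (volume.restrict U) := by
  have hfin : IsFiniteMeasure (volume.restrict U) := ⟨by simpa using hUb.measure_lt_top⟩
  have hex : ∀ α : ℕ × ℕ, ∃ g : Plane → ℝ, Measurable g ∧ (α.1 + α.2 ≤ m →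
      HasWeakDeriv U α f g ∧ MemLp g q (volume.restrict U)) := by
    intro α
    by_cases hα : α.1 + α.2 ≤ m
    · obtain ⟨g, hg, hgq⟩ := hf α hα
      set g' := hgq.1.mk g
      have hae : g =ᵐ[volume.restrict U] g' := hgq.1.ae_eq_mk
      refine ⟨g', hgq.1.stronglyMeasurable_mk.measurable, fun _ => ⟨⟨hg.1, ?_, ?_⟩,
        (memLp_congr_ae hae).1 hgq⟩⟩
      · have hi : IntegrableOn g' U :=
          ((memLp_congr_ae hae).1 hgq).integrable (le_trans (by norm_num) hq)
        exact hi.locallyIntegrableOn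
      · intro η h1 h2 h3
        rw [hg.2.2 η h1 h2 h3]
        congr 1
        refine integral_congr_ae ?_
        filter_upwards [hae] with x hx
        rw [hx]
    · exact ⟨0, measurable_zero, fun h => absurd h hα⟩
  choose g hgm hg using hex
  refine ⟨g, ⟨hgm, fun α hα => (hg α hα).2.mono_exponent hq, fun α hα k η hη => ?_⟩, hg⟩
  have hk : (inc k α).1 + (inc k α).2 ≤ m := by rw [order_inc]; omega
  have e1 := (hg α hα.le).1.2.2 _ (hη.pderiv k).1 (hη.pderiv k).2.1 (hη.pderiv k).2.2
  have e2 := (hg _ hk).1.2.2 η hη.1 hη.2.1 hη.2.2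
  rw [mderiv_pderiv hη, e2, order_inc, pow_succ, mul_assoc] at e1
  have hs : ((-1 : ℝ) ^ (α.1 + α.2)) ≠ 0 := by positivity
  have := mul_left_cancel₀ hs e1
  linarith

/-! ### Weak derivatives of Lipschitz functions -/

/-- The function is extended to a Lipschitz function on the plane, whose line derivatives satisfy
integration by parts against test functions. The choice of the extension does not matter, since test
functions are supported in `U`. -/
lemma exists_weak_gradient_of_lipschitzOnWith {U : Set Plane} (hU : IsOpen U) {K : NNReal}
    {v : Plane → ℝ} (hv : LipschitzOnWith K v U) :
    ∃ h : Fin 2 → Plane → ℝ, (∀ k, Measurable (h k)) ∧ (∀ k x, |h k x| ≤ K) ∧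
      (∀ k, ∀ x ∈ U, ∀ L : Plane →L[ℝ] ℝ, HasFDerivAt v L x →
        h k x = L (EuclideanSpace.single k 1)) ∧
      ∀ k, ∀ η, IsTest U η →
        ∫ x in U, v x * pderivWithin univ k η x = -∫ x in U, h k x * η x := by
  obtain ⟨w, hw, hvw⟩ := hv.extend_real
  refine ⟨fun k x => lineDeriv ℝ w x (EuclideanSpace.single k 1), fun k =>
    measurable_lineDeriv hw.continuous, fun k x => ?_, fun k x hx L hL => ?_, fun k η hη => ?_⟩
  · have := norm_lineDeriv_le_of_lipschitz ℝ hw (x₀ := x) (v := EuclideanSpace.single k (1 : ℝ))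
    simpa using this
  · have : HasFDerivAt w L x := hL.congr_of_eventuallyEq
      (by filter_upwards [hU.mem_nhds hx] with y hy using (hvw hy).symm)
    change lineDeriv ℝ w x _ = _
    rw [this.differentiableAt.lineDeriv_eq_fderiv, this.fderiv]
  · obtain ⟨K', hη'⟩ := hη.1.lipschitzWith_of_hasCompactSupport hη.2.1 (by simp)
    have h1 := LipschitzWith.integral_lineDeriv_mul_eq (μ := volume) hw hη' hη.2.1
      (EuclideanSpace.single k (1 : ℝ))
    have hz : ∀ x ∉ U, η x = 0 := fun x hx =>
      image_eq_zero_of_notMem_tsupport fun h => hx (hη.2.2 h)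
    have hz' : ∀ x ∉ U, pderivWithin univ k η x = 0 := fun x hx =>
      image_eq_zero_of_notMem_tsupport fun h => hx ((hη.pderiv k).2.2 h)
    have h2 : ∫ x in U, v x * pderivWithin univ k η x = ∫ x, w x * pderivWithin univ k η x := by
      rw [← setIntegral_eq_integral_of_forall_compl_eq_zero (s := U) (μ := volume)]
      · exact setIntegral_congr_fun hU.measurableSet fun x hx => by rw [hvw hx]
      · intro x hx; simp [hz' x hx]
    have h3 : ∫ x in U, lineDeriv ℝ w x (EuclideanSpace.single k 1) * η x =
        ∫ x, lineDeriv ℝ w x (EuclideanSpace.single k 1) * η x :=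
      setIntegral_eq_integral_of_forall_compl_eq_zero fun x hx => by simp [hz x hx]
    rw [h2, h3, h1, ← integral_neg]
    congr 1; ext x
    rw [((hη.1.differentiable (by simp)) x).lineDeriv_eq_fderiv, pderivWithin_univ, map_neg]
    ring

lemma hasWeakDeriv_of_bound {U : Set Plane} (hU : IsOpen U) (hUb : Bornology.IsBounded U)
    {α : ℕ × ℕ} {f E h : Plane → ℝ} (hfE : f =ᵐ[volume.restrict U] E) (hE : ContinuousOn E U)
    {B K : ℝ} (hEB : ∀ x ∈ U, |E x| ≤ B)
    (hm : AEStronglyMeasurable h (volume.restrict U)) (hK : ∀ x ∈ U, |h x| ≤ K)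
    (hi : ∀ η, IsTest U η → ∫ x in U, E x * mderivWithin univ α η x =
      (-1) ^ (α.1 + α.2) * ∫ x in U, h x * η x) : HasWeakDeriv U α f h := by
  have hfin : IsFiniteMeasure (volume.restrict U) := ⟨by simpa using hUb.measure_lt_top⟩
  have hEi : IntegrableOn E U := (Integrable.of_bound (hE.aestronglyMeasurable hU.measurableSet) B
    ((ae_restrict_iff' hU.measurableSet).2 (ae_of_all _ hEB)))
  have hhi : IntegrableOn h U := (Integrable.of_bound hm K
    ((ae_restrict_iff' hU.measurableSet).2 (ae_of_all _ hK)))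
  refine ⟨(show IntegrableOn f U from hEi.congr_fun_ae hfE.symm).locallyIntegrableOn,
    hhi.locallyIntegrableOn, fun η h1 h2 h3 => ?_⟩
  rw [← hi η ⟨h1, h2, h3⟩]
  refine integral_congr_ae ?_
  filter_upwards [hfE] with x hx
  rw [hx]

/-- The factor `3` is a convenient majorant of the square root of the number `l + 1 ≤ 3` of
multi-indices. -/
lemma sobolevSeminorm_two_le {U : Set Plane} (hU : IsOpen U) {f : Plane → ℝ} {l : ℕ} (hl : l ≤ 2)
    {K : ℝ}
    (h : ∀ α : ℕ × ℕ, α.1 + α.2 = l → ∃ g : Plane → ℝ, HasWeakDeriv U α f g ∧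
      ∀ x ∈ U, |g x| ≤ K) :
    sobolevSeminorm 2 l U f ≤ 3 * (ENNReal.ofReal K * volume U ^ (1 / 2 : ℝ)) := by
  have hw : ∀ α ∈ Finset.HasAntidiagonal.antidiagonal l,
      weakDerivNorm 2 U α f ^ (2 : ℝ≥0∞).toReal ≤ (ENNReal.ofReal K * volume U ^ (1 / 2 : ℝ)) ^ 2 := by
    intro α hα
    obtain ⟨g, hg, hgK⟩ := h α (Finset.HasAntidiagonal.mem_antidiagonal.1 hα)
    rw [hg.weakDerivNorm_eq hU, ENNReal.toReal_ofNat, ENNReal.rpow_ofNat]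
    refine pow_le_pow_left' ((eLpNorm_le_of_ae_bound (C := K)
      ((ae_restrict_iff' hU.measurableSet).2 (ae_of_all _ hgK))).trans (le_of_eq ?_)) 2
    rw [Measure.restrict_apply_univ, mul_comm, ENNReal.toReal_ofNat, one_div]
  set X := ENNReal.ofReal K * volume U ^ (1 / 2 : ℝ)
  rw [sobolevSeminorm, if_neg (by norm_num)]
  have hsum : ∑ α ∈ Finset.HasAntidiagonal.antidiagonal l,
      weakDerivNorm 2 U α f ^ (2 : ℝ≥0∞).toReal ≤ (3 * X) ^ 2 := by
    refine (Finset.sum_le_card_nsmul _ _ _ hw).trans ?_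
    rw [Finset.Nat.card_antidiagonal, nsmul_eq_mul, mul_pow 3 X]
    refine mul_le_mul' ?_ le_rfl
    have : ((l + 1 : ℕ) : ℝ≥0∞) ≤ ((3 ^ 2 : ℕ) : ℝ≥0∞) := by
      exact_mod_cast (by omega : l + 1 ≤ 9)
    rwa [Nat.cast_pow, Nat.cast_ofNat] at this
  refine (ENNReal.rpow_le_rpow hsum (by norm_num)).trans (le_of_eq ?_)
  rw [← ENNReal.rpow_natCast, ← ENNReal.rpow_mul]
  simp

/-- The seminorms of a function whose first derivatives are bounded and Lipschitz. -/
lemma sobolevSeminorm_two_le_of_lipschitz {U : Set Plane} (hU : IsOpen U) (hUc : Convex ℝ U)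
    (hUb : Bornology.IsBounded U) {f E : Plane → ℝ} {E1 : Fin 2 → Plane → ℝ}
    (hfE : f =ᵐ[volume.restrict U] E)
    (hE1 : ∀ x ∈ U, HasFDerivAt E (gradL fun k => E1 k x) x) {K : ℕ → ℝ}
    (hK0 : ∀ x ∈ U, |E x| ≤ K 0) (hK1 : ∀ k, ∀ x ∈ U, |E1 k x| ≤ K 1)
    (hK2 : ∀ k, ∀ x ∈ U, ∀ y ∈ U, |E1 k x - E1 k y| ≤ K 2 * ‖x - y‖) {l : ℕ} (hl : l ≤ 2) :
    sobolevSeminorm 2 l U f ≤ 3 * (ENNReal.ofReal (K l) * volume U ^ (1 / 2 : ℝ)) := by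
  rcases U.eq_empty_or_nonempty with rfl | ⟨x0, hx0⟩
  · have h0 : ∀ α : ℕ × ℕ, HasWeakDeriv ∅ α f 0 := fun α =>
      ⟨fun x hx => hx.elim, fun x hx => hx.elim, fun η _ _ _ => by simp⟩
    exact sobolevSeminorm_two_le hU hl fun α _ => ⟨0, h0 α, fun x hx => hx.elim⟩
  have hEc : ContinuousOn E U := fun x hx => (hE1 x hx).continuousAt.continuousWithinAt
  have hK1n : 0 ≤ K 1 := (abs_nonneg _).trans (hK1 0 x0 hx0)
  have hL : LipschitzOnWith (Real.toNNReal (2 * K 1)) E U := by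
    refine LipschitzOnWith.of_dist_le_mul fun x hx y hy => ?_
    rw [Real.coe_toNNReal _ (by positivity), dist_comm, dist_comm x y, dist_eq_norm, dist_eq_norm]
    refine hUc.norm_image_sub_le_of_norm_hasFDerivWithin_le
      (fun z hz => (hE1 z hz).hasFDerivWithinAt) (fun z hz => (norm_gradL_le _).trans ?_) hx hy
    rw [Fin.sum_univ_two]; linarith [hK1 0 z hz, hK1 1 z hz]
  obtain ⟨h, hm, -, hder, hint⟩ := exists_weak_gradient_of_lipschitzOnWith hU hL
  have hE1h : ∀ k, ∀ x ∈ U, h k x = E1 k x := fun k x hx => by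
    rw [hder k x hx _ (hE1 x hx), gradL_apply, Finset.sum_eq_single k] <;> simp +contextual
  have hint' : ∀ k η, IsTest U η →
      ∫ x in U, E x * pderivWithin univ k η x = -∫ x in U, E1 k x * η x := fun k η hη => by
    rw [hint k η hη]
    congr 1
    exact setIntegral_congr_fun hU.measurableSet fun x hx => by rw [hE1h k x hx]
  refine sobolevSeminorm_two_le hU hl fun α hα => ?_
  interval_cases l
  · refine ⟨E, hasWeakDeriv_of_bound hU hUb hfE hEc hK0 (hEc.aestronglyMeasurable hU.measurableSet)
      hK0 fun η hη => ?_, hK0⟩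
    obtain ⟨rfl⟩ : α = (0, 0) := Prod.ext (by simp; omega) (by simp; omega)
    simp [mderivWithin]
  · have first : ∀ k, HasWeakDeriv U (inc k (0, 0)) f (h k) := fun k => by
      refine hasWeakDeriv_of_bound hU hUb hfE hEc hK0 (hm k).aestronglyMeasurable (K := K 1)
        (fun x hx => by rw [hE1h k x hx]; exact hK1 k x hx) fun η hη => ?_
      rw [← mderiv_pderiv hη, order_inc]
      simpa [mderivWithin] using hint k η hη
    have hb : ∀ k, ∀ x ∈ U, |h k x| ≤ K 1 := fun k x hx => by
      rw [hE1h k x hx]; exact hK1 k x hx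
    have : α = inc 0 (0, 0) ∨ α = inc 1 (0, 0) := by
      obtain ⟨a, b⟩ := α
      simp at hα ⊢
      omega
    rcases this with rfl | rfl
    · exact ⟨h 0, first 0, hb 0⟩
    · exact ⟨h 1, first 1, hb 1⟩
  · have hK2n : 0 ≤ K 2 ∨ K 2 < 0 := le_or_gt 0 (K 2)
    have hL2 : ∀ k, LipschitzOnWith (Real.toNNReal (K 2)) (E1 k) U := fun k =>
      LipschitzOnWith.of_dist_le_mul fun x hx y hy => by
        rw [Real.dist_eq, dist_eq_norm]
        exact (hK2 k x hx y hy).trans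
          (mul_le_mul_of_nonneg_right (Real.le_coe_toNNReal _) (norm_nonneg _))
    -- The sign follows from the Lipschitz estimate at two distinct points of the nonempty open set.
    have hK2n : 0 ≤ K 2 := by
      obtain ⟨ε, hε, hball⟩ := Metric.isOpen_iff.1 hU x0 hx0
      have hy : x0 + (ε / 2) • EuclideanSpace.single (0 : Fin 2) (1 : ℝ) ∈ U := hball (by
        rw [mem_ball_iff_norm, add_sub_cancel_left, norm_smul]
        simp [abs_of_pos hε]; linarith)
      have := (abs_nonneg _).trans (hK2 0 _ hy x0 hx0)
      rw [add_sub_cancel_left, norm_smul] at this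
      simp [abs_of_pos hε] at this
      nlinarith
    -- The second weak derivatives of `E` are the weak gradients of its Lipschitz first derivatives;
    -- classical second derivatives are not assumed.
    choose h2 hm2 hb2 hder2 hint2 using fun k => exists_weak_gradient_of_lipschitzOnWith hU (hL2 k)
    have second : ∀ k l, HasWeakDeriv U (inc k (inc l (0, 0))) f (h2 k l) := fun k l => by
      refine hasWeakDeriv_of_bound hU hUb hfE hEc hK0 (hm2 k l).aestronglyMeasurable (K := K 2)
        (fun x hx => by simpa [hK2n] using hb2 k l x) fun η hη => ?_
      rw [← mderiv_pderiv hη, ← mderiv_pderiv (hη.pderiv k), order_inc, order_inc]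
      have := hint' k _ (hη.pderiv l)
      rw [hint2 k l η hη] at this
      rw [pderiv_comm hη.1]
      simpa [mderivWithin] using this
    have hb : ∀ k l, ∀ x ∈ U, |h2 k l x| ≤ K 2 := fun k l x hx => by
      simpa [hK2n] using hb2 k l x
    have : α = inc 0 (inc 0 (0, 0)) ∨ α = inc 0 (inc 1 (0, 0)) ∨ α = inc 1 (inc 1 (0, 0)) := by
      obtain ⟨a, b⟩ := α
      simp at hα ⊢
      omega
    rcases this with rfl | rfl | rfl
    · exact ⟨_, second 0 0, hb 0 0⟩
    · exact ⟨_, second 0 1, hb 0 1⟩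
    · exact ⟨_, second 1 1, hb 1 1⟩

end
end BSQuad

namespace BSQuad
noncomputable section

open MeasureTheory Set Filter Topology

/-! ### Determinants -/

lemma det2_add_left (a b c : Plane) : det2 (a + b) c = det2 a c + det2 b c := by
  simp [det2]; ring
lemma det2_add_right (a b c : Plane) : det2 a (b + c) = det2 a b + det2 a c := by
  simp [det2]; ring
lemma det2_smul_left (r : ℝ) (a b : Plane) : det2 (r • a) b = r * det2 a b := by
  simp [det2]; ring
lemma det2_smul_right (r : ℝ) (a b : Plane) : det2 a (r • b) = r * det2 a b := by
  simp [det2]; ring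

lemma plane_inner (a b : Plane) : inner ℝ a b = a 0 * b 0 + a 1 * b 1 := by
  simp [PiLp.inner_apply, Fin.sum_univ_two, mul_comm]

lemma plane_norm_sq (a : Plane) : ‖a‖ ^ 2 = a 0 ^ 2 + a 1 ^ 2 := by
  rw [EuclideanSpace.real_norm_sq_eq, Fin.sum_univ_two]

lemma det2_sq_add_inner_sq (a b : Plane) :
    det2 a b ^ 2 + (a 0 * b 0 + a 1 * b 1) ^ 2 = (‖a‖ * ‖b‖) ^ 2 := by
  rw [mul_pow, plane_norm_sq, plane_norm_sq, det2]; ring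

lemma abs_det2_le (a b : Plane) : |det2 a b| ≤ ‖a‖ * ‖b‖ := by
  refine abs_le_of_sq_le_sq ?_ (by positivity)
  nlinarith [det2_sq_add_inner_sq a b, sq_nonneg (a 0 * b 0 + a 1 * b 1)]

lemma abs_dot_le (a b : Plane) : |a 0 * b 0 + a 1 * b 1| ≤ ‖a‖ * ‖b‖ := by
  refine abs_le_of_sq_le_sq ?_ (by positivity)
  nlinarith [det2_sq_add_inner_sq a b, sq_nonneg (det2 a b)]

namespace ConvexQuad

variable (Q : ConvexQuad)

/-! ### The bilinear parametrization -/

/-- The derivative of `param` in the first parameter. -/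
def colS (t : ℝ) : Plane :=
  (1 - t) • (Q.vertex 1 - Q.vertex 0) + t • (Q.vertex 2 - Q.vertex 3)

/-- The derivative of `param` in the second parameter. -/
def colT (s : ℝ) : Plane :=
  (1 - s) • (Q.vertex 3 - Q.vertex 0) + s • (Q.vertex 2 - Q.vertex 1)

/-- The Jacobian determinant of `param`. -/
def jac (s t : ℝ) : ℝ := det2 (Q.colS t) (Q.colT s)

/-- Twice the area of the triangle formed by the vertex `i` and its neighbours. -/
def corner (i : Fin 4) : ℝ := det2 (Q.vertex i - Q.vertex (i - 1)) (Q.vertex (i + 1) - Q.vertex i)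

lemma corner_pos (i : Fin 4) : 0 < Q.corner i := Q.left_turn i

/-- The weights are nonnegative on the square and sum to one, so every lower bound for the four
corners is a lower bound for the Jacobian. -/
lemma jac_eq (s t : ℝ) : Q.jac s t = (1 - s) * (1 - t) * Q.corner 0 + s * (1 - t) * Q.corner 1 +
    s * t * Q.corner 2 + (1 - s) * t * Q.corner 3 := by
  simp only [jac, corner, colS, colT, det2, show (0 : Fin 4) - 1 = 3 from rfl,
    show (1 : Fin 4) - 1 = 0 from rfl, show (2 : Fin 4) - 1 = 1 from rfl,
    show (3 : Fin 4) - 1 = 2 from rfl, show (0 : Fin 4) + 1 = 1 from rfl,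
    show (1 : Fin 4) + 1 = 2 from rfl, show (2 : Fin 4) + 1 = 3 from rfl,
    show (3 : Fin 4) + 1 = 0 from rfl, PiLp.add_apply, PiLp.sub_apply, PiLp.smul_apply, smul_eq_mul]
  ring

lemma le_jac {m : ℝ} (hm : ∀ i, m ≤ Q.corner i) {s t : ℝ} (hs : s ∈ Icc (0 : ℝ) 1)
    (ht : t ∈ Icc (0 : ℝ) 1) : m ≤ Q.jac s t := by
  rw [jac_eq]
  have h1 := mul_le_mul_of_nonneg_left (hm 0)
    (mul_nonneg (sub_nonneg.2 hs.2) (sub_nonneg.2 ht.2))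
  have h2 := mul_le_mul_of_nonneg_left (hm 1) (mul_nonneg hs.1 (sub_nonneg.2 ht.2))
  have h3 := mul_le_mul_of_nonneg_left (hm 2) (mul_nonneg hs.1 ht.1)
  have h4 := mul_le_mul_of_nonneg_left (hm 3) (mul_nonneg (sub_nonneg.2 hs.2) ht.1)
  nlinarith

lemma jac_pos {s t : ℝ} (hs : s ∈ Icc (0 : ℝ) 1) (ht : t ∈ Icc (0 : ℝ) 1) : 0 < Q.jac s t := by
  obtain ⟨m, hm, hmi⟩ : ∃ m, 0 < m ∧ ∀ i, m ≤ Q.corner i := by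
    obtain ⟨i, hi⟩ := Finite.exists_min Q.corner
    exact ⟨_, Q.corner_pos i, hi⟩
  exact hm.trans_le (Q.le_jac hmi hs ht)

/-- For a bilinear map the increment is exact, without remainder, if the derivative is taken at the
midpoint of the parameters. -/
lemma param_sub (s t s' t' : ℝ) : Q.param s t - Q.param s' t' =
    (s - s') • Q.colS ((t + t') / 2) + (t - t') • Q.colT ((s + s') / 2) := by
  simp only [param, colS, colT]
  module

lemma param_eq_line (s t : ℝ) : Q.param s t =
    ((1 - t) • Q.vertex 0 + t • Q.vertex 3) + s • Q.colS t := by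
  simp only [param, colS]; module

/-- The unit square. -/
def _root_.BSQuad.square : Set (ℝ × ℝ) := Icc 0 1 ×ˢ Icc 0 1

lemma edgeVec_det_vertex (i j : Fin 4) : 0 ≤ det2 (Q.edgeVec i) (Q.vertex j - Q.vertex i) := by
  have h1 := Q.left_turn i
  have h2 := Q.left_turn (i + 1)
  have : ∀ i j : Fin 4, j = i ∨ j = i + 1 ∨ j = i + 1 + 1 ∨ j = i - 1 := by decide
  rcases this i j with rfl | rfl | rfl | rfl
  · simp [det2]
  · simp only [edgeVec, det2]; linarith
  · rw [add_sub_cancel_right] at h2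
    simp only [edgeVec, det2, PiLp.sub_apply] at h2 ⊢
    linarith
  · simp only [edgeVec, det2, PiLp.sub_apply] at h1 ⊢
    linarith

lemma det_nonneg_of_mem {y : Plane} (hy : y ∈ Q.closed) (i : Fin 4) :
    0 ≤ det2 (Q.edgeVec i) (y - Q.vertex i) := by
  have hconv : Convex ℝ {y : Plane | 0 ≤ det2 (Q.edgeVec i) (y - Q.vertex i)} := by
    intro a ha b hb u v hu hv huv
    simp only [mem_ofPred_eq] at ha hb ⊢
    have : u • a + v • b - Q.vertex i = u • (a - Q.vertex i) + v • (b - Q.vertex i) := by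
      rw [smul_sub, smul_sub, sub_add_sub_comm, ← add_smul, huv, one_smul]
    rw [this, det2_add_right, det2_smul_right, det2_smul_right]
    positivity
  exact convexHull_min (by rintro _ ⟨j, rfl⟩; exact Q.edgeVec_det_vertex i j) hconv hy

/-- The line of constant `t` moves from the edge `0` to the edge `2`. The side conditions for these
two edges give a change of sign, so some line passes through `y` by the intermediate value theorem.
Cramer's rule yields `s`, and the other two side conditions put it in `[0,1]`. -/
lemma exists_param_eq {y : Plane} (hy : ∀ i, 0 ≤ det2 (Q.edgeVec i) (y - Q.vertex i)) :
    ∃ ξ ∈ square, Q.param ξ.1 ξ.2 = y := by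
  set A : ℝ → Plane := fun t => (1 - t) • Q.vertex 0 + t • Q.vertex 3 with hA
  have e0 : Q.edgeVec 0 = Q.vertex 1 - Q.vertex 0 := rfl
  have e1 : Q.edgeVec 1 = Q.vertex 2 - Q.vertex 1 := rfl
  have e2 : Q.edgeVec 2 = Q.vertex 3 - Q.vertex 2 := rfl
  have e3 : Q.edgeVec 3 = Q.vertex 0 - Q.vertex 3 := rfl
  have hcont : ContinuousOn (fun t => det2 (Q.colS t) (y - A t)) (Icc 0 1) := by
    simp only [det2, colS, hA, PiLp.add_apply, PiLp.sub_apply, PiLp.smul_apply, smul_eq_mul]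
    fun_prop
  have h0 : 0 ≤ det2 (Q.colS 0) (y - A 0) := by
    have := hy 0
    simpa [colS, hA, e0] using this
  have h1 : det2 (Q.colS 1) (y - A 1) ≤ 0 := by
    have := hy 2
    rw [e2] at this
    simp only [colS, hA, det2, sub_self, zero_smul, one_smul, zero_add, PiLp.sub_apply] at this ⊢
    linarith
  obtain ⟨t, ht, htz⟩ := intermediate_value_Icc' zero_le_one hcont ⟨h1, h0⟩
  simp only at htz
  -- the point is on the line through `A t` in direction `colS t`
  have hD0 := Q.jac_pos (left_mem_Icc.2 zero_le_one) ht
  have hD1 := Q.jac_pos (right_mem_Icc.2 zero_le_one) ht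
  have hT0 : Q.colT 0 = Q.vertex 3 - Q.vertex 0 := by simp [colT]
  have hT1 : Q.colT 1 = Q.vertex 2 - Q.vertex 1 := by simp [colT]
  set s : ℝ := det2 (y - A t) (Q.colT 0) / Q.jac 0 t with hs
  have hy' : y - A t = s • Q.colS t := by
    have hD : Q.colS t 0 * Q.colT 0 1 - Q.colS t 1 * Q.colT 0 0 ≠ 0 := hD0.ne'
    simp only [det2] at htz
    ext k
    rw [PiLp.smul_apply, smul_eq_mul, hs, jac, det2, det2, div_mul_eq_mul_div, eq_div_iff hD]
    fin_cases k
    · simp only [Fin.zero_eta]; linear_combination (Q.colT 0 0) * htz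
    · simp only [Fin.mk_one]; linear_combination (Q.colT 0 1) * htz
  have hyp : Q.param s t = y := by
    rw [param_eq_line, ← hy']
    simp [hA]
  refine ⟨(s, t), ⟨⟨?_, ?_⟩, ht⟩, hyp⟩
  · have h3 := hy 3
    rw [← hyp, param_eq_line, e3] at h3
    have : det2 (Q.vertex 0 - Q.vertex 3) ((1 - t) • Q.vertex 0 + t • Q.vertex 3 + s • Q.colS t -
        Q.vertex 3) = s * Q.jac 0 t := by
      rw [jac, hT0]
      simp only [det2, PiLp.add_apply, PiLp.sub_apply, PiLp.smul_apply, smul_eq_mul]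
      ring
    rw [this] at h3
    exact nonneg_of_mul_nonneg_left h3 hD0
  · have h3 := hy 1
    rw [← hyp, param_eq_line, e1] at h3
    have : det2 (Q.vertex 2 - Q.vertex 1) ((1 - t) • Q.vertex 0 + t • Q.vertex 3 + s • Q.colS t -
        Q.vertex 1) = (1 - s) * Q.jac 1 t := by
      rw [jac, hT1]
      simp only [colS, det2, PiLp.add_apply, PiLp.sub_apply, PiLp.smul_apply, smul_eq_mul]
      ring
    rw [this] at h3
    have := nonneg_of_mul_nonneg_left h3 hD1
    simp only; linarith

lemma param_mem {s t : ℝ} (hs : s ∈ Icc (0 : ℝ) 1) (ht : t ∈ Icc (0 : ℝ) 1) :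
    Q.param s t ∈ Q.closed := by
  have hv : ∀ i, Q.vertex i ∈ Q.closed := fun i => subset_convexHull ℝ _ (mem_range_self i)
  have hc : Convex ℝ Q.closed := convex_convexHull ℝ _
  have h1 := hc (hv 0) (hv 1) (sub_nonneg.2 hs.2) hs.1 (by ring)
  have h2 := hc (hv 3) (hv 2) (sub_nonneg.2 hs.2) hs.1 (by ring)
  have h3 := hc h1 h2 (sub_nonneg.2 ht.2) ht.1 (by ring)
  rw [show Q.param s t = (1 - t) • ((1 - s) • Q.vertex 0 + s • Q.vertex 1) +
    t • ((1 - s) • Q.vertex 3 + s • Q.vertex 2) by simp only [param]; module]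
  exact h3

lemma mem_closed_iff {y : Plane} :
    y ∈ Q.closed ↔ ∀ i, 0 ≤ det2 (Q.edgeVec i) (y - Q.vertex i) := by
  refine ⟨fun h i => Q.det_nonneg_of_mem h i, fun h => ?_⟩
  obtain ⟨ξ, hξ, rfl⟩ := Q.exists_param_eq h
  exact Q.param_mem hξ.1 hξ.2

/-- Taking the determinant with a midpoint column isolates one parameter difference. With the
positivity of the Jacobian this and its counterpart give injectivity and also the Lipschitz bound of
the inverse. -/
lemma det_param_sub_colT (s t s' t' : ℝ) :
    det2 (Q.param s t - Q.param s' t') (Q.colT ((s + s') / 2)) =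
      (s - s') * Q.jac ((s + s') / 2) ((t + t') / 2) := by
  rw [param_sub, det2_add_left, det2_smul_left, det2_smul_left, jac]
  simp only [det2]; ring

lemma det_colS_param_sub (s t s' t' : ℝ) :
    det2 (Q.colS ((t + t') / 2)) (Q.param s t - Q.param s' t') =
      (t - t') * Q.jac ((s + s') / 2) ((t + t') / 2) := by
  rw [param_sub, det2_add_right, det2_smul_right, det2_smul_right, jac]
  simp only [det2]; ring

lemma mid_mem {s s' : ℝ} (hs : s ∈ Icc (0 : ℝ) 1) (hs' : s' ∈ Icc (0 : ℝ) 1) :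
    (s + s') / 2 ∈ Icc (0 : ℝ) 1 := ⟨by linarith [hs.1, hs'.1], by linarith [hs.2, hs'.2]⟩

lemma param_injOn : InjOn (fun ξ : ℝ × ℝ => Q.param ξ.1 ξ.2) square := by
  rintro ⟨s, t⟩ ⟨hs, ht⟩ ⟨s', t'⟩ ⟨hs', ht'⟩ h
  simp only at h hs ht hs' ht'
  have hD := Q.jac_pos (mid_mem hs hs') (mid_mem ht ht')
  have h1 := Q.det_param_sub_colT s t s' t'
  have h2 := Q.det_colS_param_sub s t s' t'
  rw [h, sub_self] at h1 h2
  have e1 : s - s' = 0 := by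
    have : (s - s') * Q.jac ((s + s') / 2) ((t + t') / 2) = 0 := by rw [← h1]; simp [det2]
    exact (mul_eq_zero.1 this).resolve_right hD.ne'
  have e2 : t - t' = 0 := by
    have : (t - t') * Q.jac ((s + s') / 2) ((t + t') / 2) = 0 := by rw [← h2]; simp [det2]
    exact (mul_eq_zero.1 this).resolve_right hD.ne'
  exact Prod.ext (by simpa using sub_eq_zero.1 e1) (by simpa using sub_eq_zero.1 e2)

/-- The inverse of `param` on the closed quadrilateral. -/
def inv : Plane → ℝ × ℝ := Function.invFunOn (fun ξ : ℝ × ℝ => Q.param ξ.1 ξ.2) square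

lemma inv_mem {y : Plane} (hy : y ∈ Q.closed) : Q.inv y ∈ square :=
  Function.invFunOn_mem (Q.exists_param_eq (Q.mem_closed_iff.1 hy))

lemma param_inv {y : Plane} (hy : y ∈ Q.closed) : Q.param (Q.inv y).1 (Q.inv y).2 = y :=
  Function.invFunOn_eq (f := fun ξ : ℝ × ℝ => Q.param ξ.1 ξ.2)
    (Q.exists_param_eq (Q.mem_closed_iff.1 hy))

lemma inv_param {s t : ℝ} (hs : s ∈ Icc (0 : ℝ) 1) (ht : t ∈ Icc (0 : ℝ) 1) :
    Q.inv (Q.param s t) = (s, t) :=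
  Q.param_injOn (Q.inv_mem (Q.param_mem hs ht)) ⟨hs, ht⟩ (Q.param_inv (Q.param_mem hs ht))

/-! ### Sizes -/

lemma norm_edgeVec_le (i : Fin 4) : ‖Q.edgeVec i‖ ≤ Q.size :=
  le_ciSup (f := fun i => ‖Q.edgeVec i‖) (Set.finite_range _).bddAbove i

lemma edgeVec_pos (i : Fin 4) : 0 < ‖Q.edgeVec i‖ := by
  refine norm_pos_iff.2 fun h => (Q.corner_pos i).ne' ?_
  rw [corner, show Q.vertex (i + 1) - Q.vertex i = 0 from h]
  simp [det2]

lemma size_pos : 0 < Q.size := (Q.edgeVec_pos 0).trans_le (Q.norm_edgeVec_le 0)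

lemma norm_colS_le {t : ℝ} (ht : t ∈ Icc (0 : ℝ) 1) : ‖Q.colS t‖ ≤ Q.size := by
  have h0 : ‖Q.vertex 1 - Q.vertex 0‖ ≤ Q.size := Q.norm_edgeVec_le 0
  have h2 : ‖Q.vertex 2 - Q.vertex 3‖ ≤ Q.size := by
    rw [norm_sub_rev]; exact Q.norm_edgeVec_le 2
  have := convex_closedBall (0 : Plane) Q.size (by simpa using h0) (by simpa using h2)
    (sub_nonneg.2 ht.2) ht.1 (by ring)
  simpa [colS] using this

lemma norm_colT_le {s : ℝ} (hs : s ∈ Icc (0 : ℝ) 1) : ‖Q.colT s‖ ≤ Q.size := by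
  have h0 : ‖Q.vertex 3 - Q.vertex 0‖ ≤ Q.size := by
    rw [norm_sub_rev]; exact Q.norm_edgeVec_le 3
  have h2 : ‖Q.vertex 2 - Q.vertex 1‖ ≤ Q.size := Q.norm_edgeVec_le 1
  have := convex_closedBall (0 : Plane) Q.size (by simpa using h0) (by simpa using h2)
    (sub_nonneg.2 hs.2) hs.1 (by ring)
  simpa [colT] using this

/-- Quantitative shape regularity with constant `κ`. -/
structure Shape (κ : ℝ) : Prop where
  pos : 0 < κ
  edge : ∀ i, κ * Q.size ≤ ‖Q.edgeVec i‖
  area : ∀ i, κ * Q.size ^ 2 ≤ Q.corner i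

lemma closed_convex : Convex ℝ Q.closed := convex_convexHull ℝ _

lemma closed_compact : IsCompact Q.closed := (Set.finite_range _).isCompact_convexHull (𝕜 := ℝ)

lemma norm_sub_le_of_mem {x y : Plane} (hx : x ∈ Q.closed) (hy : y ∈ Q.closed) :
    ‖x - y‖ ≤ 2 * Q.size := by
  obtain ⟨ξ, hξ, rfl⟩ := Q.exists_param_eq (Q.mem_closed_iff.1 hx)
  obtain ⟨ζ, hζ, rfl⟩ := Q.exists_param_eq (Q.mem_closed_iff.1 hy)
  rw [param_sub]
  have h1 := Q.norm_colS_le (mid_mem hξ.2 hζ.2)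
  have h2 := Q.norm_colT_le (mid_mem hξ.1 hζ.1)
  refine (norm_add_le _ _).trans ?_
  rw [norm_smul, norm_smul, Real.norm_eq_abs, Real.norm_eq_abs]
  have a1 : |ξ.1 - ζ.1| ≤ 1 := abs_le.2 ⟨by linarith [hξ.1.1, hζ.1.2], by linarith [hξ.1.2, hζ.1.1]⟩
  have a2 : |ξ.2 - ζ.2| ≤ 1 := abs_le.2 ⟨by linarith [hξ.2.1, hζ.2.2], by linarith [hξ.2.2, hζ.2.1]⟩
  have := Q.size_pos
  nlinarith [abs_nonneg (ξ.1 - ζ.1), abs_nonneg (ξ.2 - ζ.2)]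

/-- The centre of the quadrilateral. -/
def center : Plane := Q.param (1 / 2) (1 / 2)

-- With respect to the edge `i`, the centre has determinant `(corner i + corner (i + 1)) / 4 ≥ κ h²
-- / 2`. A displacement of length `κ h / 2` changes this by at most `κ h² / 2`, so no edge is
-- crossed.
variable {Q} in
lemma Shape.ball_subset {κ : ℝ} (h : Q.Shape κ) :
    Metric.ball Q.center (κ * Q.size / 2) ⊆ Q.closed := by
  intro y hy
  rw [mem_ball_iff_norm] at hy
  refine Q.mem_closed_iff.2 fun i => ?_
  have e : y - Q.vertex i = (y - Q.center) + (Q.center - Q.vertex i) := by abel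
  rw [e, det2_add_right]
  have h1 := abs_det2_le (Q.edgeVec i) (y - Q.center)
  have h2 : κ * Q.size ^ 2 / 2 ≤ det2 (Q.edgeVec i) (Q.center - Q.vertex i) := by
    have : det2 (Q.edgeVec i) (Q.center - Q.vertex i) = (Q.corner i + Q.corner (i + 1)) / 4 := by
      fin_cases i <;>
      simp only [Fin.zero_eta, Fin.mk_one, Fin.reduceFinMk, edgeVec, center, param, corner, det2,
        show (0 : Fin 4) - 1 = 3 from rfl,
        show (1 : Fin 4) - 1 = 0 from rfl, show (2 : Fin 4) - 1 = 1 from rfl,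
        show (3 : Fin 4) - 1 = 2 from rfl, show (0 : Fin 4) + 1 = 1 from rfl,
        show (1 : Fin 4) + 1 = 2 from rfl, show (2 : Fin 4) + 1 = 3 from rfl,
        show (3 : Fin 4) + 1 = 0 from rfl, PiLp.add_apply, PiLp.sub_apply, PiLp.smul_apply,
        smul_eq_mul] <;> ring
    rw [this]
    linarith [h.area i, h.area (i + 1)]
  have h3 : ‖Q.edgeVec i‖ * ‖y - Q.center‖ ≤ Q.size * (κ * Q.size / 2) :=
    mul_le_mul (Q.norm_edgeVec_le i) hy.le (norm_nonneg _) Q.size_pos.le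
  nlinarith [neg_abs_le (det2 (Q.edgeVec i) (y - Q.center))]

variable {Q} in
lemma Shape.inv_lipschitz {κ : ℝ} (h : Q.Shape κ) {x y : Plane} (hx : x ∈ Q.closed)
    (hy : y ∈ Q.closed) : |(Q.inv x).1 - (Q.inv y).1| ≤ ‖x - y‖ / (κ * Q.size) ∧
      |(Q.inv x).2 - (Q.inv y).2| ≤ ‖x - y‖ / (κ * Q.size) := by
  have hx' := Q.inv_mem hx
  have hy' := Q.inv_mem hy
  have hJ := Q.le_jac h.area (mid_mem hx'.1 hy'.1) (mid_mem hx'.2 hy'.2)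
  have h1 := Q.det_param_sub_colT (Q.inv x).1 (Q.inv x).2 (Q.inv y).1 (Q.inv y).2
  have h2 := Q.det_colS_param_sub (Q.inv x).1 (Q.inv x).2 (Q.inv y).1 (Q.inv y).2
  rw [Q.param_inv hx, Q.param_inv hy] at h1 h2
  have b1 := (abs_det2_le (x - y) (Q.colT (((Q.inv x).1 + (Q.inv y).1) / 2))).trans
    (mul_le_mul_of_nonneg_left (Q.norm_colT_le (mid_mem hx'.1 hy'.1)) (norm_nonneg _))
  have b2 := (abs_det2_le (Q.colS (((Q.inv x).2 + (Q.inv y).2) / 2)) (x - y)).trans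
    (mul_le_mul_of_nonneg_right (Q.norm_colS_le (mid_mem hx'.2 hy'.2)) (norm_nonneg _))
  have hp : 0 < κ * Q.size ^ 2 := mul_pos h.pos (pow_pos Q.size_pos 2)
  rw [h1, abs_mul, abs_of_pos (hp.trans_le hJ)] at b1
  rw [h2, abs_mul, abs_of_pos (hp.trans_le hJ)] at b2
  have hκ := h.pos
  have hs := Q.size_pos
  constructor
  · rw [le_div_iff₀ (by positivity)]
    have := mul_le_mul_of_nonneg_left hJ (abs_nonneg ((Q.inv x).1 - (Q.inv y).1))
    refine le_of_mul_le_mul_right ?_ hs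
    nlinarith
  · rw [le_div_iff₀ (by positivity)]
    have := mul_le_mul_of_nonneg_left hJ (abs_nonneg ((Q.inv x).2 - (Q.inv y).2))
    refine le_of_mul_le_mul_right ?_ hs
    nlinarith

/-- A single quadrilateral needs no angle condition: this serves the qualitative facts, where the
constant does not matter. -/
lemma exists_shape : ∃ κ, Q.Shape κ := by
  obtain ⟨i, hi⟩ := Finite.exists_min Q.corner
  obtain ⟨j, hj⟩ := Finite.exists_min fun i => ‖Q.edgeVec i‖
  have hs := Q.size_pos
  have h1 := Q.corner_pos i
  have h2 := Q.edgeVec_pos j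
  refine ⟨min (Q.corner i / Q.size ^ 2) (‖Q.edgeVec j‖ / Q.size), by positivity, fun l => ?_,
    fun l => ?_⟩
  · refine (mul_le_mul_of_nonneg_right (min_le_right _ _) hs.le).trans ?_
    rw [div_mul_cancel₀ _ hs.ne']; exact hj l
  · refine (mul_le_mul_of_nonneg_right (min_le_left _ _) (by positivity)).trans ?_
    rw [div_mul_cancel₀ _ (by positivity)]; exact hi l

lemma inv_continuousOn : ContinuousOn Q.inv Q.closed := by
  obtain ⟨κ, h⟩ := Q.exists_shape
  have hp : 0 < κ * Q.size := mul_pos h.pos Q.size_pos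
  have hl : LipschitzOnWith (Real.toNNReal (1 / (κ * Q.size))) Q.inv Q.closed := by
    refine LipschitzOnWith.of_dist_le_mul fun x hx y hy => ?_
    rw [Real.coe_toNNReal _ (by positivity), Prod.dist_eq, Real.dist_eq, Real.dist_eq, dist_eq_norm,
      one_div_mul_eq_div]
    exact max_le (h.inv_lipschitz hx hy).1 (h.inv_lipschitz hx hy).2
  exact hl.continuousOn

/-! ### Smoothness of the inverse -/

/-- The derivative of `param`. -/
def paramDeriv (s t : ℝ) : ℝ × ℝ →L[ℝ] Plane :=
  (ContinuousLinearMap.fst ℝ ℝ ℝ).smulRight (Q.colS t) +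
    (ContinuousLinearMap.snd ℝ ℝ ℝ).smulRight (Q.colT s)

lemma contDiff_param {n : WithTop ℕ∞} : ContDiff ℝ n fun ξ : ℝ × ℝ => Q.param ξ.1 ξ.2 := by
  unfold param; fun_prop

lemma hasFDerivAt_param (s t : ℝ) :
    HasFDerivAt (fun ξ : ℝ × ℝ => Q.param ξ.1 ξ.2) (Q.paramDeriv s t) (s, t) := by
  have h1 : HasFDerivAt (fun ξ : ℝ × ℝ => ξ.1) (ContinuousLinearMap.fst ℝ ℝ ℝ) (s, t) :=
    hasFDerivAt_fst
  have h2 : HasFDerivAt (fun ξ : ℝ × ℝ => ξ.2) (ContinuousLinearMap.snd ℝ ℝ ℝ) (s, t) :=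
    hasFDerivAt_snd
  have h := (((((h1.const_sub 1).mul (h2.const_sub 1)).smul_const (Q.vertex 0)).add
    ((h1.mul (h2.const_sub 1)).smul_const (Q.vertex 1))).add
    ((h1.mul h2).smul_const (Q.vertex 2))).add (((h1.const_sub 1).mul h2).smul_const (Q.vertex 3))
  refine HasFDerivAt.congr_fderiv h ?_
  ext1 <;> ext1 <;> simp [paramDeriv, colS, colT] <;> module

/-- The derivative of `param` as an isomorphism, at points of positive Jacobian. -/
def paramEquiv {s t : ℝ} (h : 0 < Q.jac s t) : (ℝ × ℝ) ≃L[ℝ] Plane :=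
  ContinuousLinearEquiv.equivOfInverse (Q.paramDeriv s t)
    (((Q.jac s t)⁻¹ • gradL ![Q.colT s 1, -Q.colT s 0]).prod
      ((Q.jac s t)⁻¹ • gradL ![-Q.colS t 1, Q.colS t 0]))
    (by
      have hne : Q.colS t 0 * Q.colT s 1 - Q.colS t 1 * Q.colT s 0 ≠ 0 := h.ne'
      rintro ⟨a, b⟩
      simp only [paramDeriv, jac, det2]
      ext <;> simp <;> field_simp <;> ring)
    (by
      have hne : Q.colS t 0 * Q.colT s 1 - Q.colS t 1 * Q.colT s 0 ≠ 0 := h.ne'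
      intro v
      simp only [paramDeriv, jac, det2]
      ext k
      fin_cases k <;> simp <;> field_simp <;> ring)

/-- The bilinear map is defined on the whole plane and has positive Jacobian up to the boundary of
the square, so it has a smooth local inverse near every point of the closed quadrilateral.
Continuity of `inv` keeps it on this branch. The inverse function theorem asks for a positive order;
order `0` is obtained from order `1`. -/
lemma contDiffOn_inv (n : ℕ) : ContDiffOn ℝ n Q.inv Q.closed := by
  suffices h : ∀ n : ℕ, n ≠ 0 → ContDiffOn ℝ n Q.inv Q.closed from
    (h (n + 1) (by omega)).of_le (by exact_mod_cast Nat.le_succ n)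
  intro n hn y hy
  have hξ := Q.inv_mem hy
  set ξ := Q.inv y with hξdef
  have hpos := Q.jac_pos hξ.1 hξ.2
  have hf : ContDiffAt ℝ n (fun ξ : ℝ × ℝ => Q.param ξ.1 ξ.2) ξ := Q.contDiff_param.contDiffAt
  have hf' : HasFDerivAt (fun ξ : ℝ × ℝ => Q.param ξ.1 ξ.2)
      (Q.paramEquiv hpos : ℝ × ℝ →L[ℝ] Plane) ξ := Q.hasFDerivAt_param ξ.1 ξ.2
  have hn' : (n : WithTop ℕ∞) ≠ 0 := by exact_mod_cast hn
  have hloc := hf.to_localInverse hf' hn'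
  have hleft := (hf.hasStrictFDerivAt' hf' hn').eventually_left_inverse
  have hFξ : Q.param ξ.1 ξ.2 = y := Q.param_inv hy
  rw [hFξ] at hloc
  refine (hloc.contDiffWithinAt (s := Q.closed)).congr_of_eventuallyEq_of_mem ?_ hy
  have ht : Tendsto Q.inv (𝓝[Q.closed] y) (𝓝 ξ) := Q.inv_continuousOn y hy
  filter_upwards [ht.eventually hleft, self_mem_nhdsWithin] with z hz hzQ
  rw [Q.param_inv hzQ] at hz
  exact hz.symm

lemma interior_nonempty : (interior Q.closed).Nonempty := by
  obtain ⟨κ, h⟩ := Q.exists_shape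
  exact ⟨Q.center, interior_maximal h.ball_subset Metric.isOpen_ball
    (Metric.mem_ball_self (by have := h.pos; have := Q.size_pos; positivity))⟩

lemma uniqueDiffOn_closed : UniqueDiffOn ℝ Q.closed :=
  uniqueDiffOn_convex Q.closed_convex Q.interior_nonempty

lemma closure_opened : closure Q.opened = Q.closed := by
  rw [opened, Q.closed_convex.closure_interior_eq_closure_of_nonempty_interior Q.interior_nonempty,
    Q.closed_compact.isClosed.closure_eq]

/-! ### Shape regularity from the angle condition -/

lemma sin_le_sin_of_mem {δ θ : ℝ} (h0 : 0 < δ) (hl : δ ≤ θ) (hu : θ ≤ Real.pi - δ) :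
    Real.sin δ ≤ Real.sin θ := by
  have hpi := Real.pi_gt_three
  rcases le_total θ (Real.pi / 2) with h | h
  · exact Real.sin_le_sin_of_le_of_le_pi_div_two (by linarith) h hl
  · rw [← Real.sin_pi_sub θ]
    exact Real.sin_le_sin_of_le_of_le_pi_div_two (by linarith) (by linarith) (by linarith)

-- The three angles sum to `π` and each is at least `δ`, so each is also at most `π - δ` and has
-- sine at least `sin δ`. The law of sines compares the sides, and the determinant is the product of
-- two sides and the sine between them.
open EuclideanGeometry in
lemma triangle_bounds {δ : ℝ} (h0 : 0 < δ) {a b c : Plane}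
    (hdet : 0 < det2 (b - a) (c - b)) (ha : δ ≤ ∠ c a b) (hb : δ ≤ ∠ a b c) (hc : δ ≤ ∠ b c a) :
    Real.sin δ * ‖b - a‖ ≤ ‖c - b‖ ∧ Real.sin δ * ‖c - b‖ ≤ ‖b - a‖ ∧
      Real.sin δ * (‖b - a‖ * ‖c - b‖) ≤ det2 (b - a) (c - b) := by
  have hab : b ≠ a := by
    rintro rfl; simp [det2] at hdet
  have hsum := angle_add_angle_add_angle_eq_pi c hab
  have sa := sin_le_sin_of_mem h0 ha (by linarith)
  have sb := sin_le_sin_of_mem h0 hb (by linarith)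
  have sc := sin_le_sin_of_mem h0 hc (by linarith)
  have law := law_sin c a b
  rw [dist_comm a b, dist_eq_norm, dist_comm b c, dist_eq_norm] at law
  refine ⟨?_, ?_, ?_⟩
  · have e1 := mul_le_mul_of_nonneg_right sa (norm_nonneg (b - a))
    have e2 := mul_le_mul_of_nonneg_right (Real.sin_le_one (∠ b c a)) (norm_nonneg (c - b))
    linarith
  · have e1 := mul_le_mul_of_nonneg_right sc (norm_nonneg (c - b))
    have e2 := mul_le_mul_of_nonneg_right (Real.sin_le_one (∠ c a b)) (norm_nonneg (b - a))
    linarith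
  · have key := InnerProductGeometry.sin_angle_mul_norm_mul_norm (a - b) (c - b)
    rw [plane_inner, plane_inner, plane_inner, show ((a - b) 0 * (a - b) 0 + (a - b) 1 * (a - b) 1) *
      ((c - b) 0 * (c - b) 0 + (c - b) 1 * (c - b) 1) - ((a - b) 0 * (c - b) 0 +
      (a - b) 1 * (c - b) 1) * ((a - b) 0 * (c - b) 0 + (a - b) 1 * (c - b) 1) =
      det2 (b - a) (c - b) ^ 2 by simp only [det2, PiLp.sub_apply]; ring,
      Real.sqrt_sq hdet.le, norm_sub_rev a b] at key
    rw [← key]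
    exact mul_le_mul_of_nonneg_right sb (by positivity)

lemma exists_shape_of_minAngle {ρ : ℝ} (hρ : 0 < ρ) :
    ∃ κ, 0 < κ ∧ ∀ Q : ConvexQuad, ρ ≤ Q.minAngle → Q.Shape κ := by
  set δ := min ρ 1
  have h0 : 0 < δ := lt_min hρ one_pos
  have h1 : δ ≤ 1 := min_le_right _ _
  set S := Real.sin δ
  have hS : 0 < S := Real.sin_pos_of_pos_of_lt_pi h0 (by linarith [Real.pi_gt_three])
  have hS1 : S ≤ 1 := Real.sin_le_one δ
  -- Adjacent edges compare with the factor `S` and any two edges with `S²`, so each edge is at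
  -- least `S² h`. A corner is at least `S` times the product of two edges, which gives the exponent
  -- `5`.
  refine ⟨S ^ 5, by positivity, fun Q hQ => ?_⟩
  have htri : ∀ i, S * ‖Q.edgeVec i‖ ≤ ‖Q.edgeVec (i + 1)‖ ∧ S * ‖Q.edgeVec (i + 1)‖ ≤ ‖Q.edgeVec i‖ ∧
      S * (‖Q.edgeVec i‖ * ‖Q.edgeVec (i + 1)‖) ≤ Q.corner (i + 1) := by
    intro i
    have hi := (min_le_left ρ 1).trans (hQ.trans (ciInf_le (Set.finite_range _).bddBelow i))
    obtain ⟨hb, hca⟩ := le_min_iff.1 hi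
    obtain ⟨hc, ha⟩ := le_min_iff.1 hca
    have e : i + 1 + 1 = i + 2 := by rw [add_assoc]; rfl
    have hl := Q.left_turn (i + 1)
    rw [add_sub_cancel_right, e] at hl
    have := triangle_bounds h0 hl ha hb hc
    rw [corner, add_sub_cancel_right, edgeVec, edgeVec, e]
    exact this
  have hadj : ∀ i j, S ^ 2 * ‖Q.edgeVec i‖ ≤ ‖Q.edgeVec j‖ := by
    intro i j
    have n0 := Q.edgeVec_pos i
    have : ∀ i j : Fin 4, j = i ∨ j = i + 1 ∨ j = i + 1 + 1 ∨ j + 1 = i := by decide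
    have hS2 : S ^ 2 ≤ S := by nlinarith
    have hS3 : S ^ 2 ≤ 1 := by nlinarith
    rcases this i j with rfl | rfl | rfl | rfl
    · nlinarith
    · nlinarith [(htri i).1]
    · nlinarith [(htri i).1, (htri (i + 1)).1]
    · nlinarith [(htri j).2.1]
  have hedge : ∀ j, S ^ 2 * Q.size ≤ ‖Q.edgeVec j‖ := fun j => by
    have : Q.size ≤ ‖Q.edgeVec j‖ / S ^ 2 := ciSup_le fun i => by
      rw [le_div_iff₀ (by positivity), mul_comm]; exact hadj i j
    rw [le_div_iff₀ (by positivity)] at this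
    linarith
  have hs := Q.size_pos
  refine ⟨by positivity, fun i => ?_, fun i => ?_⟩
  · have : S ^ 5 ≤ S ^ 2 := pow_le_pow_of_le_one hS.le hS1 (by norm_num)
    exact (mul_le_mul_of_nonneg_right this hs.le).trans (hedge i)
  · have h := (htri (i - 1)).2.2
    rw [sub_add_cancel] at h
    have h2 := mul_le_mul (hedge (i - 1)) (hedge i) (by positivity) (norm_nonneg _)
    have := mul_le_mul_of_nonneg_left h2 hS.le
    nlinarith

end ConvexQuad

end
end BSQuad

namespace BSQuad
noncomputable section

open MeasureTheory Set Filter Topology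

/-! ### Hermite data of polynomials and truncated powers -/

open Polynomial in
/-- A polynomial that vanishes to order `m` at `0` and `1` and at enough points in between is
zero. -/
lemma polynomial_eq_zero_of_hermite {P : ℝ[X]} {d m : ℕ} (hd : P.natDegree ≤ d)
    (h0 : ∀ n < m, (derivative^[n] P).eval 0 = 0) (h1 : ∀ n < m, (derivative^[n] P).eval 1 = 0)
    {F : Finset ℝ} (hF : ∀ x ∈ F, x ≠ 0 ∧ x ≠ 1 ∧ P.eval x = 0) (hcard : d < 2 * m + F.card) :
    P = 0 := by
  by_contra hP
  have mult : ∀ x, (∀ n < m, (derivative^[n] P).eval x = 0) → m ≤ P.roots.count x := by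
    intro x hx
    rcases m with _ | m
    · exact Nat.zero_le _
    rw [count_roots]
    exact (lt_rootMultiplicity_iff_isRoot_iterate_derivative hP).2 fun n hn =>
      hx n (Nat.lt_succ_of_le hn)
  have hsum : ∑ x ∈ insert 0 (insert 1 F), P.roots.count x ≤ P.natDegree := by
    refine le_trans ?_ (card_roots' P)
    rw [← Multiset.toFinset_sum_count_eq]
    refine (Finset.sum_le_sum_of_ne_zero fun x _ hx => ?_)
    rw [Multiset.mem_toFinset]
    exact Multiset.count_ne_zero.1 hx
  have n1 : (1 : ℝ) ∉ F := fun h => (hF 1 h).2.1 rfl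
  have n0 : (0 : ℝ) ∉ insert 1 F := by
    rw [Finset.mem_insert]
    rintro (h | h)
    · norm_num at h
    · exact (hF 0 h).1 rfl
  rw [Finset.sum_insert n0, Finset.sum_insert n1] at hsum
  have hFc : F.card ≤ ∑ x ∈ F, P.roots.count x := by
    rw [Finset.card_eq_sum_ones]
    refine Finset.sum_le_sum fun x hx => ?_
    exact Multiset.one_le_count_iff_mem.2 ((mem_roots hP).2 (hF x hx).2.2)
  have := mult 0 h0
  have := mult 1 h1
  omega

lemma hasDerivAt_truncPow (n : ℕ) (x s : ℝ) :
    HasDerivAt (fun s => (max (s - x) 0) ^ (n + 2)) ((n + 2 : ℕ) * (max (s - x) 0) ^ (n + 1)) s := by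
  have hp : ∀ s : ℝ, HasDerivAt (fun s => (s - x) ^ (n + 2)) ((n + 2 : ℕ) * (s - x) ^ (n + 1)) s := by
    intro s
    refine HasDerivAt.congr_deriv (((hasDerivAt_id s).sub_const x).pow (n + 2)) ?_
    simp
  rcases lt_trichotomy s x with h | h | h
  · have e : (fun s => (max (s - x) 0) ^ (n + 2)) =ᶠ[𝓝 s] fun _ => (0 : ℝ) := by
      filter_upwards [Iio_mem_nhds h] with y hy
      rw [max_eq_right (sub_nonpos.2 (le_of_lt hy)), zero_pow (by omega)]
    rw [max_eq_right (sub_nonpos.2 h.le), zero_pow (by omega), mul_zero]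
    exact (hasDerivAt_const s (0 : ℝ)).congr_of_eventuallyEq e
  · subst h
    rw [sub_self, max_self, zero_pow (by omega), mul_zero, ← hasDerivWithinAt_univ, ← Iic_union_Ici]
    refine HasDerivWithinAt.union ?_ ?_
    · refine (hasDerivWithinAt_const s _ (0 : ℝ)).congr (fun y hy => ?_) ?_
      · rw [max_eq_right (sub_nonpos.2 hy), zero_pow (by omega)]
      · simp
    · have h2 := (hp s).hasDerivWithinAt (s := Ici s)
      rw [sub_self, zero_pow (by omega), mul_zero] at h2
      refine h2.congr (fun y hy => ?_) ?_
      · rw [max_eq_left (sub_nonneg.2 hy)]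
      · simp
  · have e : (fun s => (max (s - x) 0) ^ (n + 2)) =ᶠ[𝓝 s] fun s => (s - x) ^ (n + 2) := by
      filter_upwards [Ioi_mem_nhds h] with y hy
      rw [max_eq_left (sub_nonneg.2 (le_of_lt hy))]
    rw [max_eq_left (sub_nonneg.2 h.le)]
    exact (hp s).congr_of_eventuallyEq e

lemma contDiff_truncPow (n : ℕ) (x : ℝ) : ContDiff ℝ n fun s : ℝ => (max (s - x) 0) ^ (n + 1) := by
  induction n with
  | zero =>
    refine contDiff_zero.2 ?_
    fun_prop
  | succ n ih =>
    rw [show ((n + 1 : ℕ) : WithTop ℕ∞) = (n : WithTop ℕ∞) + 1 by norm_cast, contDiff_succ_iff_deriv]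
    refine ⟨fun s => (hasDerivAt_truncPow n x s).differentiableAt, fun h => ?_, ?_⟩
    · exact absurd h (by exact_mod_cast WithTop.natCast_ne_top (α := ℕ∞) n)
    · rw [funext fun s => (hasDerivAt_truncPow n x s).deriv]
      exact contDiff_const.mul ih

/-! ### Splines in one variable -/

/-- Indices of the truncated power basis of the splines of degree `d` and smoothness `r` with
`k` equal intervals on `[0,1]`. -/
abbrev SplineIdx (k d r : ℕ) : Type := Fin (d + 1) ⊕ (Fin (k - 1) × Fin (d - r))

/-- The interior knots. -/
def knot (k a : ℕ) : ℝ := ((a : ℝ) + 1) / k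

/-- The intervals between the knots. -/
def cell (k a : ℕ) : Set ℝ := Icc ((a : ℝ) / k) (((a : ℝ) + 1) / k)

/-- The `n`-th derivatives of the truncated power basis. -/
def splineBasis (k d r n : ℕ) : SplineIdx k d r → ℝ → ℝ
  | Sum.inl j, s => ((j : ℕ).descFactorial n : ℝ) * s ^ ((j : ℕ) - n)
  | Sum.inr (a, e), s =>
      ((r + 1 + e).descFactorial n : ℝ) * (max (s - knot k a) 0) ^ (r + 1 + e - n)

/-- The `n`-th derivative of the spline with coefficients `c`. -/
def spline (k d r n : ℕ) (c : SplineIdx k d r → ℝ) (s : ℝ) : ℝ :=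
  ∑ i, c i * splineBasis k d r n i s

open Polynomial in
/-- The polynomial pieces of the truncated power basis. -/
def splinePiece (k d r a : ℕ) : SplineIdx k d r → ℝ[X]
  | Sum.inl j => X ^ (j : ℕ)
  | Sum.inr (a', e) => if (a' : ℕ) < a then (X - C (knot k a')) ^ (r + 1 + e) else 0

variable {k d r : ℕ}

lemma hasDerivAt_splineBasis {n : ℕ} (hn : n + 1 ≤ r) (i : SplineIdx k d r) (s : ℝ) :
    HasDerivAt (splineBasis k d r n i) (splineBasis k d r (n + 1) i s) s := by
  rcases i with j | ⟨a, e⟩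
  · refine HasDerivAt.congr_deriv ((hasDerivAt_pow ((j : ℕ) - n) s).const_mul _) ?_
    rw [splineBasis, Nat.descFactorial_succ, Nat.sub_sub]
    push_cast
    ring
  · obtain ⟨m, hm⟩ : ∃ m, r + 1 + e - n = m + 2 := ⟨r + 1 + e - n - 2, by omega⟩
    have := (hasDerivAt_truncPow m (knot k a) s).const_mul
      (((r + 1 + e).descFactorial n : ℕ) : ℝ)
    have e1 : splineBasis k d r n (Sum.inr (a, e)) = fun s =>
      ((r + 1 + e).descFactorial n : ℝ) * (max (s - knot k a) 0) ^ (m + 2) := by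
      funext s; rw [splineBasis, hm]
    rw [e1]
    refine HasDerivAt.congr_deriv this ?_
    rw [splineBasis, Nat.descFactorial_succ, hm, show r + 1 + e - (n + 1) = m + 1 by omega]
    push_cast
    ring

lemma hasDerivAt_spline {n : ℕ} (hn : n + 1 ≤ r) (c : SplineIdx k d r → ℝ) (s : ℝ) :
    HasDerivAt (spline k d r n c) (spline k d r (n + 1) c s) s := by
  have := HasDerivAt.fun_sum (u := Finset.univ) (A := fun i s => c i * splineBasis k d r n i s)
    (A' := fun i => c i * splineBasis k d r (n + 1) i s) (x := s)
    fun i _ => (hasDerivAt_splineBasis hn i s).const_mul (c i)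
  exact this

lemma contDiff_splineBasis (i : SplineIdx k d r) : ContDiff ℝ r (splineBasis k d r 0 i) := by
  rcases i with j | ⟨a, e⟩
  · exact contDiff_const.mul (contDiff_id.pow _)
  · refine contDiff_const.mul ?_
    have h := contDiff_truncPow (r + e) (knot k a)
    rw [show r + e + 1 = r + 1 + e - 0 by omega] at h
    exact h.of_le (by exact_mod_cast Nat.le_add_right r e)

lemma contDiff_spline (c : SplineIdx k d r → ℝ) : ContDiff ℝ r (spline k d r 0 c) :=
  ContDiff.sum fun i _ => contDiff_const.mul (contDiff_splineBasis i)

/-- Off the knots splines are smooth to every order. This is used at the parameters `0` and `1`: it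
provides second derivatives at the vertices even if the splines are only `C¹` in general. -/
lemma contDiffAt_splineBasis {s : ℝ} (hs : ∀ a < k - 1, s ≠ knot k a) (n : ℕ)
    (i : SplineIdx k d r) : ContDiffAt ℝ n (splineBasis k d r 0 i) s := by
  rcases i with j | ⟨a, e⟩
  · exact contDiffAt_const.mul (contDiffAt_id.pow _)
  · refine contDiffAt_const.mul (ContDiffAt.pow ?_ _)
    have hs' := hs a a.2
    rcases lt_or_gt_of_ne hs' with h | h
    · refine (contDiffAt_const (c := (0 : ℝ))).congr_of_eventuallyEq ?_
      filter_upwards [Iio_mem_nhds h] with y hy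
      exact max_eq_right (sub_nonpos.2 (le_of_lt hy))
    · refine (contDiffAt_id.sub (contDiffAt_const (c := knot k a))).congr_of_eventuallyEq ?_
      filter_upwards [Ioi_mem_nhds h] with y hy
      exact max_eq_left (sub_nonneg.2 (le_of_lt hy))

lemma knot_pos (k a : ℕ) (hk : 0 < k) : 0 < knot k a := by
  rw [knot]; positivity

lemma knot_lt_one {a : ℕ} (h : a < k - 1) : knot k a < 1 := by
  have hk : 0 < k := by omega
  rw [knot, div_lt_one (by exact_mod_cast hk)]
  have : a + 1 < k := by omega
  exact_mod_cast this

-- The order is limited to `r` so that the exponent of a differentiated truncated power stays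
-- positive; then both formulas vanish at the knot itself, which belongs to two cells.
open Polynomial in
lemma splineBasis_eq_eval {a n : ℕ} (hn : n ≤ r) (i : SplineIdx k d r) {s : ℝ}
    (hs : s ∈ cell k a) :
    splineBasis k d r n i s = (derivative^[n] (splinePiece k d r a i)).eval s := by
  rcases i with j | ⟨a', e⟩
  · rw [splinePiece, iterate_derivative_X_pow_eq_smul, splineBasis]
    simp
  · rw [splineBasis, splinePiece]
    split_ifs with h
    · have hle : knot k a' ≤ s := by
        refine le_trans ?_ hs.1
        rw [knot]
        gcongr
        exact_mod_cast h
      rw [iterate_derivative_X_sub_pow, max_eq_left (sub_nonneg.2 hle)]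
      simp
    · have hle : s ≤ knot k a' := by
        refine hs.2.trans ?_
        rw [knot]
        gcongr
        omega
      rw [iterate_derivative_zero, max_eq_right (sub_nonpos.2 hle), zero_pow (by omega)]
      simp

open Polynomial in
lemma natDegree_splinePiece_le (a : ℕ) (i : SplineIdx k d r) :
    (splinePiece k d r a i).natDegree ≤ d := by
  rcases i with j | ⟨a', e⟩
  · rw [splinePiece, natDegree_X_pow]; omega
  · rw [splinePiece]
    split_ifs
    · refine natDegree_pow_le.trans ?_
      rw [natDegree_X_sub_C]; omega
    · simp

lemma cell_subset {a : ℕ} (h : a < k) : cell k a ⊆ Icc 0 1 := by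
  have hk : (0 : ℝ) < k := by exact_mod_cast (Nat.zero_le a).trans_lt h
  refine Icc_subset_Icc (by positivity) ?_
  rw [div_le_one hk]
  exact_mod_cast h

lemma uniqueDiffOn_cell {a : ℕ} (h : a < k) : UniqueDiffOn ℝ (cell k a) := by
  have hk : (0 : ℝ) < k := by exact_mod_cast (Nat.zero_le a).trans_lt h
  exact uniqueDiffOn_Icc (by gcongr; linarith)

lemma exists_mem_cell (hk : 0 < k) {s : ℝ} (hs : s ∈ Icc (0 : ℝ) 1) :
    ∃ a < k, s ∈ cell k a := by
  have hk' : (0 : ℝ) < k := by exact_mod_cast hk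
  rcases lt_or_eq_of_le hs.2 with h | rfl
  · refine ⟨⌊s * k⌋₊, ?_, ?_, ?_⟩
    · rw [Nat.floor_lt (by have := hs.1; positivity)]
      nlinarith
    · rw [div_le_iff₀ hk']
      exact Nat.floor_le (by have := hs.1; positivity)
    · rw [le_div_iff₀ hk']
      exact (Nat.lt_floor_add_one _).le
  · refine ⟨k - 1, by omega, ?_, ?_⟩
    · rw [div_le_one hk']
      exact_mod_cast Nat.sub_le k 1
    · rw [Nat.cast_sub hk, Nat.cast_one, sub_add_cancel, div_self hk'.ne']

open Polynomial in
lemma contDiff_polynomial_eval (P : ℝ[X]) {n : WithTop ℕ∞} : ContDiff ℝ n fun s => P.eval s := by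
  simp only [eval_eq_sum_range]
  exact ContDiff.sum fun i _ => contDiff_const.mul (contDiff_id.pow i)

open Polynomial in
lemma iteratedDeriv_polynomial (P : ℝ[X]) (n : ℕ) :
    iteratedDeriv n (fun s => P.eval s) = fun s => (derivative^[n] P).eval s := by
  induction n with
  | zero => simp
  | succ n ih =>
    rw [iteratedDeriv_succ, ih, Function.iterate_succ_apply']
    funext s
    exact Polynomial.deriv _

-- The derivatives of a polynomial piece are one-sided derivatives of `v`. At a knot the pieces from
-- both sides therefore have the same derivatives up to order `r`.
open Polynomial in
lemma eval_iterate_derivative_eq {A : Set ℝ} (hA : UniqueDiffOn ℝ A) (hA1 : A ⊆ Icc 0 1) {v : ℝ → ℝ}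
    (hv : ContDiffOn ℝ r v (Icc 0 1)) {P : ℝ[X]} (hP : ∀ s ∈ A, v s = P.eval s) {n : ℕ} (hn : n ≤ r)
    {s : ℝ} (hs : s ∈ A) :
    (derivative^[n] P).eval s = iteratedDerivWithin n v (Icc 0 1) s := by
  have h1 : iteratedDerivWithin n v A s = iteratedDerivWithin n v (Icc 0 1) s := by
    rw [iteratedDerivWithin, iteratedDerivWithin, iteratedFDerivWithin_subset hA1 hA
      (uniqueDiffOn_Icc one_pos) (hv.of_le (by exact_mod_cast hn)) hs]
  rw [← h1, iteratedDerivWithin_congr (g := fun s => P.eval s) hP hs,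
    iteratedDerivWithin_eq_iteratedDeriv hA (contDiff_polynomial_eval P).contDiffAt hs, iteratedDeriv_polynomial]

-- The Taylor expansion at `x` starts with the power `r + 1`. Applied to the jump between
-- neighbouring pieces, it supplies the coefficients of the truncated powers.
open Polynomial in
lemma eval_eq_sum_of_derivative_eq_zero (hr : r ≤ d) {D : ℝ[X]} (hD : D.natDegree ≤ d) {x : ℝ}
    (h : ∀ n ≤ r, (derivative^[n] D).eval x = 0) (s : ℝ) :
    D.eval s = ∑ e : Fin (d - r), (taylor x D).coeff (r + 1 + e) * (s - x) ^ (r + 1 + (e : ℕ)) := by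
  have h0 : ∀ n < r + 1, (taylor x D).coeff n = 0 := by
    intro n hn
    have := h n (by omega)
    rw [← factorial_smul_hasseDeriv] at this
    rw [LinearMap.smul_apply, eval_smul, nsmul_eq_mul] at this
    rw [taylor_coeff]
    exact (mul_eq_zero.1 this).resolve_left (by exact_mod_cast n.factorial_ne_zero)
  have h1 : D.eval s = (taylor x D).eval (s - x) := by rw [taylor_eval, sub_add_cancel]
  rw [h1, eval_eq_sum_range' (n := r + 1 + (d - r)) (by rw [natDegree_taylor]; omega),
    Finset.sum_range_add, Finset.sum_eq_zero, zero_add,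
    ← Fin.sum_univ_eq_sum_range (fun e => (taylor x D).coeff (r + 1 + e) * (s - x) ^ (r + 1 + e))]
  intro n hn
  rw [h0 n (Finset.mem_range.1 hn), zero_mul]

open Polynomial in
/-- A function of smoothness `r` on `[0,1]` that is a polynomial of degree `d` on every cell is a
linear combination of the truncated powers. -/
lemma exists_spline_eq (hk : 0 < k) (hr : r ≤ d) {v : ℝ → ℝ} (hv : ContDiffOn ℝ r v (Icc 0 1))
    (hp : ∀ a < k, IsPolyOn d (cell k a) v) :
    ∃ c : SplineIdx k d r → ℝ, ∀ s ∈ Icc (0 : ℝ) 1, v s = spline k d r 0 c s := by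
  have hp' : ∀ a : ℕ, ∃ P : ℝ[X], P.natDegree ≤ d ∧ (a < k → ∀ s ∈ cell k a, v s = P.eval s) := by
    intro a
    by_cases h : a < k
    · obtain ⟨P, h1, h2⟩ := hp a h
      exact ⟨P, h1, fun _ => h2⟩
    · exact ⟨0, by simp, fun h' => absurd h' h⟩
  choose P hPd hP using hp'
  have hDd : ∀ a, (P (a + 1) - P a).natDegree ≤ d := fun a =>
    (natDegree_sub_le _ _).trans (max_le (hPd _) (hPd _))
  -- The jump at a knot vanishes to order `r`. On a given cell, `v` is the first piece plus all
  -- jumps at the knots to the left, and that telescoping sum is the expansion in truncated powers.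
  have hD : ∀ a < k - 1, ∀ s, (P (a + 1) - P a).eval s =
      ∑ e : Fin (d - r), (taylor (knot k a) (P (a + 1) - P a)).coeff (r + 1 + e) *
        (s - knot k a) ^ (r + 1 + (e : ℕ)) := by
    intro a ha s
    refine eval_eq_sum_of_derivative_eq_zero hr (hDd a) (fun n hn => ?_) s
    have ha1 : a < k := by omega
    have ha2 : a + 1 < k := by omega
    have m1 : knot k a ∈ cell k a := right_mem_Icc.2 (by gcongr; linarith)
    have m2 : knot k a ∈ cell k (a + 1) := by
      rw [cell, Nat.cast_add, Nat.cast_one]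
      exact left_mem_Icc.2 (by gcongr; linarith)
    rw [iterate_derivative_sub, eval_sub,
      eval_iterate_derivative_eq (uniqueDiffOn_cell ha1) (cell_subset ha1) hv (hP a ha1) hn m1,
      eval_iterate_derivative_eq (uniqueDiffOn_cell ha2) (cell_subset ha2) hv (hP (a + 1) ha2) hn m2,
      sub_self]
  refine ⟨fun i => match i with
    | Sum.inl j => (P 0).coeff j
    | Sum.inr (a, e) => (taylor (knot k a) (P (a + 1) - P a)).coeff (r + 1 + e), fun s hs => ?_⟩
  obtain ⟨b, hb, hsb⟩ := exists_mem_cell hk hs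
  rw [hP b hb s hsb, spline]
  simp only [splineBasis_eq_eval (Nat.zero_le r) _ hsb, Function.iterate_zero, id_eq]
  rw [Fintype.sum_sum_type, Fintype.sum_prod_type]
  simp only [splinePiece]
  have e0 : ∑ j : Fin (d + 1), (P 0).coeff j * (X ^ (j : ℕ) : ℝ[X]).eval s = (P 0).eval s := by
    rw [eval_eq_sum_range' (Nat.lt_succ_of_le (hPd 0)),
      ← Fin.sum_univ_eq_sum_range (fun j => (P 0).coeff j * s ^ j)]
    simp
  have e1 : ∀ a : Fin (k - 1), ∑ e : Fin (d - r),
      (taylor (knot k a) (P (a + 1) - P a)).coeff (r + 1 + e) *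
        (if (a : ℕ) < b then (X - C (knot k a)) ^ (r + 1 + (e : ℕ)) else 0 : ℝ[X]).eval s =
      if (a : ℕ) < b then (P (a + 1)).eval s - (P a).eval s else 0 := by
    intro a
    split_ifs
    · rw [← eval_sub, hD a a.2 s]
      simp
    · simp
  rw [e0, Finset.sum_congr rfl fun a _ => e1 a, Fin.sum_univ_eq_sum_range
    (fun a => if a < b then (P (a + 1)).eval s - (P a).eval s else 0) (k - 1), ← Finset.sum_filter,
    show (Finset.range (k - 1)).filter (· < b) = Finset.range b by ext; simp; omega,
    Finset.sum_range_sub (fun a => (P a).eval s)]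
  ring

end
end BSQuad

namespace BSQuad
noncomputable section

open MeasureTheory Set Filter Topology

variable {k d r : ℕ}

/-! ### Unisolvence of Hermite data for splines -/

/-- Splines are determined by their derivatives of order below `m` at `0` and `1` and by their
values at the points of `F`. -/
def SplineUnisolvent (k d r m : ℕ) (F : Finset ℚ) : Prop :=
  ∀ c : SplineIdx k d r → ℝ, (∀ n < m, spline k d r n c 0 = 0) → (∀ n < m, spline k d r n c 1 = 0) →
    (∀ q ∈ F, spline k d r 0 c (q : ℝ) = 0) → c = 0

/-- For `p = 3` and `p = 4` the conditions are square linear systems in the truncated power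
coefficients, solved by elimination: six unknowns for a trace, five for a normal derivative, eight
and seven for a face direction. The remaining split cases below are treated alike. -/
lemma splineUnisolvent_three_trace (F : Finset ℚ) : SplineUnisolvent 3 3 2 3 F := by
  intro c h0 h1 _
  have a0 := h0 0 (by norm_num)
  have a1 := h0 1 (by norm_num)
  have a2 := h0 2 (by norm_num)
  have b0 := h1 0 (by norm_num)
  have b1 := h1 1 (by norm_num)
  have b2 := h1 2 (by norm_num)
  rw [spline, Fintype.sum_sum_type, Fintype.sum_prod_type] at a0 a1 a2 b0 b1 b2
  erw [Fin.sum_univ_four, Fin.sum_univ_two, Fin.sum_univ_one, Fin.sum_univ_one] at a0 a1 a2 b0 b1 b2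
  norm_num [splineBasis, knot, Nat.descFactorial] at a0 a1 a2 b0 b1 b2
  funext i
  rcases i with i | ⟨i, j⟩
  · fin_cases i <;> simp <;> linarith
  · fin_cases i <;> fin_cases j <;> simp <;> linarith

lemma splineUnisolvent_four_trace (F : Finset ℚ) : SplineUnisolvent 2 4 3 3 F := by
  intro c h0 h1 _
  have a0 := h0 0 (by norm_num)
  have a1 := h0 1 (by norm_num)
  have a2 := h0 2 (by norm_num)
  have b0 := h1 0 (by norm_num)
  have b1 := h1 1 (by norm_num)
  have b2 := h1 2 (by norm_num)
  rw [spline, Fintype.sum_sum_type, Fintype.sum_prod_type] at a0 a1 a2 b0 b1 b2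
  erw [Fin.sum_univ_five, Fin.sum_univ_one, Fin.sum_univ_one] at a0 a1 a2 b0 b1 b2
  norm_num [splineBasis, knot, Nat.descFactorial] at a0 a1 a2 b0 b1 b2
  funext i
  rcases i with i | ⟨i, j⟩
  · fin_cases i <;> simp <;> linarith
  · fin_cases i <;> fin_cases j <;> simp <;> linarith

lemma splineUnisolvent_three_normal : SplineUnisolvent 3 2 1 2 {1 / 2} := by
  intro c h0 h1 hF
  have a0 := h0 0 (by norm_num)
  have a1 := h0 1 (by norm_num)
  have b0 := h1 0 (by norm_num)
  have b1 := h1 1 (by norm_num)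
  have f0 := hF (1 / 2) (by simp)
  rw [spline, Fintype.sum_sum_type, Fintype.sum_prod_type] at a0 a1 b0 b1 f0
  erw [Fin.sum_univ_three, Fin.sum_univ_two, Fin.sum_univ_one, Fin.sum_univ_one] at a0 a1 b0 b1 f0
  norm_num [splineBasis, knot, Nat.descFactorial] at a0 a1 b0 b1 f0
  funext i
  rcases i with i | ⟨i, j⟩
  · fin_cases i <;> simp <;> linarith
  · fin_cases i <;> fin_cases j <;> simp <;> linarith

lemma splineUnisolvent_four_normal : SplineUnisolvent 2 3 2 2 {1 / 2} := by
  intro c h0 h1 hF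
  have a0 := h0 0 (by norm_num)
  have a1 := h0 1 (by norm_num)
  have b0 := h1 0 (by norm_num)
  have b1 := h1 1 (by norm_num)
  have f0 := hF (1 / 2) (by simp)
  rw [spline, Fintype.sum_sum_type, Fintype.sum_prod_type] at a0 a1 b0 b1 f0
  erw [Fin.sum_univ_four, Fin.sum_univ_one, Fin.sum_univ_one] at a0 a1 b0 b1 f0
  norm_num [splineBasis, knot, Nat.descFactorial] at a0 a1 b0 b1 f0
  funext i
  rcases i with i | ⟨i, j⟩
  · fin_cases i <;> simp <;> linarith
  · fin_cases i <;> fin_cases j <;> simp <;> linarith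

lemma splineUnisolvent_three_face : SplineUnisolvent 3 3 1 2 {2 / 9, 4 / 9, 5 / 9, 7 / 9} := by
  intro c h0 h1 hF
  have a0 := h0 0 (by norm_num)
  have a1 := h0 1 (by norm_num)
  have b0 := h1 0 (by norm_num)
  have b1 := h1 1 (by norm_num)
  have f0 := hF (2 / 9) (by simp)
  have f1 := hF (4 / 9) (by simp)
  have f2 := hF (5 / 9) (by simp)
  have f3 := hF (7 / 9) (by simp)
  rw [spline, Fintype.sum_sum_type, Fintype.sum_prod_type] at a0 a1 b0 b1 f0 f1 f2 f3
  erw [Fin.sum_univ_four, Fin.sum_univ_two, Fin.sum_univ_two, Fin.sum_univ_two] at a0 a1 b0 b1 f0 f1 f2 f3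
  norm_num [splineBasis, knot, Nat.descFactorial] at a0 a1 b0 b1 f0 f1 f2 f3
  funext i
  rcases i with i | ⟨i, j⟩
  · fin_cases i <;> simp <;> linarith
  · fin_cases i <;> fin_cases j <;> simp <;> linarith

lemma splineUnisolvent_four_face : SplineUnisolvent 2 4 2 2 {1 / 4, 2 / 4, 3 / 4} := by
  intro c h0 h1 hF
  have a0 := h0 0 (by norm_num)
  have a1 := h0 1 (by norm_num)
  have b0 := h1 0 (by norm_num)
  have b1 := h1 1 (by norm_num)
  have f0 := hF (1 / 4) (by simp)
  have f1 := hF (2 / 4) (by simp)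
  have f2 := hF (3 / 4) (by simp)
  rw [spline, Fintype.sum_sum_type, Fintype.sum_prod_type] at a0 a1 b0 b1 f0 f1 f2
  erw [Fin.sum_univ_five, Fin.sum_univ_one, Fin.sum_univ_two] at a0 a1 b0 b1 f0 f1 f2
  norm_num [splineBasis, knot, Nat.descFactorial] at a0 a1 b0 b1 f0 f1 f2
  funext i
  rcases i with i | ⟨i, j⟩
  · fin_cases i <;> simp <;> linarith
  · fin_cases i <;> fin_cases j <;> simp <;> linarith

/-! ### Unisolvence on a single interval, and for every degree -/

open Polynomial in
/-- The polynomial pieces of a spline. -/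
def splinePoly (k d r a : ℕ) (c : SplineIdx k d r → ℝ) : ℝ[X] := ∑ i, c i • splinePiece k d r a i

open Polynomial in
lemma natDegree_splinePoly_le (a : ℕ) (c : SplineIdx k d r → ℝ) :
    (splinePoly k d r a c).natDegree ≤ d :=
  natDegree_sum_le_of_forall_le _ _ fun i _ =>
    (natDegree_smul_le _ _).trans (natDegree_splinePiece_le a i)

open Polynomial in
lemma spline_eq_eval {a n : ℕ} (hn : n ≤ r) (c : SplineIdx k d r → ℝ) {s : ℝ} (hs : s ∈ cell k a) :
    spline k d r n c s = (derivative^[n] (splinePoly k d r a c)).eval s := by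
  rw [splinePoly, iterate_derivative_sum, eval_finsetSum, spline]
  refine Finset.sum_congr rfl fun i _ => ?_
  rw [iterate_derivative_smul, eval_smul, smul_eq_mul, splineBasis_eq_eval hn i hs]

lemma cell_one : cell 1 0 = Icc 0 1 := by simp [cell]

-- Without interior knots the spline is one polynomial, and the conditions prescribe more zeros,
-- with multiplicity, than its degree allows. The bound on `m` keeps all derivatives within the
-- orders where splines and polynomials agree.
open Polynomial in
lemma splineUnisolvent_one {m : ℕ} (hm : m ≤ r + 1) {F : Finset ℚ} (hF : ∀ x ∈ F, 0 < x ∧ x < 1)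
    (hd : d < 2 * m + F.card) : SplineUnisolvent 1 d r m F := by
  intro c h0 h1 hFc
  have m0 : (0 : ℝ) ∈ cell 1 0 := by rw [cell_one]; exact left_mem_Icc.2 zero_le_one
  have m1 : (1 : ℝ) ∈ cell 1 0 := by rw [cell_one]; exact right_mem_Icc.2 zero_le_one
  have hP : splinePoly 1 d r 0 c = 0 := by
    refine polynomial_eq_zero_of_hermite (m := m) (natDegree_splinePoly_le 0 c) (fun n hn => ?_)
      (fun n hn => ?_) (F := F.image fun q : ℚ => (q : ℝ)) (fun x hx => ?_) ?_
    · rw [← spline_eq_eval (by omega) c m0, h0 n hn]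
    · rw [← spline_eq_eval (by omega) c m1, h1 n hn]
    · obtain ⟨q, hq, rfl⟩ := Finset.mem_image.1 hx
      obtain ⟨q0, q1⟩ := hF q hq
      refine ⟨by exact_mod_cast q0.ne', by exact_mod_cast q1.ne, ?_⟩
      have hm : (q : ℝ) ∈ cell 1 0 := by
        rw [cell_one]; exact ⟨by exact_mod_cast q0.le, by exact_mod_cast q1.le⟩
      have := hFc q hq
      rwa [spline_eq_eval (Nat.zero_le _) c hm] at this
    · rw [Finset.card_image_of_injective _ Rat.cast_injective]; exact hd
  funext i
  rcases i with j | ⟨a, e⟩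
  · have := congrArg (fun P => P.coeff j) hP
    rw [splinePoly, Fintype.sum_sum_type] at this
    have hz : ∑ a : Fin (1 - 1) × Fin (d - r), c (Sum.inr a) • splinePiece 1 d r 0 (Sum.inr a) = 0 :=
      Finset.sum_eq_zero fun a _ => a.1.elim0
    rw [hz] at this
    simp only [splinePiece, add_zero, finsetSum_coeff, coeff_smul, coeff_X_pow, coeff_zero,
      smul_eq_mul, mul_ite, mul_one, mul_zero, Fin.val_inj] at this
    rw [Finset.sum_ite_eq] at this
    simpa using this
  · exact a.elim0

lemma numSplit_three : numSplit 3 = 3 := rfl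
lemma numSplit_four : numSplit 4 = 2 := rfl
lemma numSplit_of_five_le {p : ℕ} (hp : 5 ≤ p) : numSplit p = 1 := by rw [numSplit]; omega

lemma numSplit_pos (p : ℕ) : 0 < numSplit p := by rw [numSplit]; omega

/-- For `p ≥ 5` there are `6 + (p - 5) = p + 1` conditions, one more than the degree. The counts for
the normal derivative and the face direction are `4 + (p - 4) = p` and `4 + (p - 3) = p + 1`. -/
lemma splineUnisolvent_trace {p : ℕ} (hp : 3 ≤ p) :
    SplineUnisolvent (numSplit p) p (p - 1) 3 (traceNodes p) := by
  obtain rfl | rfl | h : p = 3 ∨ p = 4 ∨ 5 ≤ p := by omega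
  · exact splineUnisolvent_three_trace _
  · exact splineUnisolvent_four_trace _
  · rw [numSplit_of_five_le h]
    have hp0 : (0 : ℚ) < p := by exact_mod_cast (by omega : 0 < p)
    refine splineUnisolvent_one (by omega) (fun x hx => ?_) ?_
    · obtain ⟨j, hj, rfl⟩ := Finset.mem_image.1 hx
      rw [Finset.mem_Icc] at hj
      refine ⟨div_pos (by exact_mod_cast (by omega : 0 < j)) hp0, ?_⟩
      rw [div_lt_one hp0]
      exact_mod_cast (by omega : j < p)
    · rw [traceNodes, Finset.card_image_of_injective, Nat.card_Icc]
      · omega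
      · intro a b hab
        have := (div_left_inj' hp0.ne').1 hab
        exact_mod_cast this

lemma splineUnisolvent_normal {p : ℕ} (hp : 3 ≤ p) :
    SplineUnisolvent (numSplit p) (p - 1) (p - 2) 2 (normalNodes p) := by
  obtain rfl | rfl | h : p = 3 ∨ p = 4 ∨ 5 ≤ p := by omega
  · exact splineUnisolvent_three_normal
  · exact splineUnisolvent_four_normal
  · rw [numSplit_of_five_le h, normalNodes, if_neg (by omega)]
    have hp0 : (0 : ℚ) < (p : ℚ) - 1 := by
      have : (1 : ℚ) < p := by exact_mod_cast (by omega : 1 < p)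
      linarith
    refine splineUnisolvent_one (by omega) (fun x hx => ?_) ?_
    · obtain ⟨j, hj, rfl⟩ := Finset.mem_image.1 hx
      rw [Finset.mem_Icc] at hj
      refine ⟨div_pos (by exact_mod_cast (by omega : 0 < j)) hp0, ?_⟩
      rw [div_lt_one hp0, lt_sub_iff_add_lt]
      exact_mod_cast (by omega : j + 1 < p)
    · rw [Finset.card_image_of_injective, Nat.card_Icc]
      · omega
      · intro a b hab
        have := (div_left_inj' hp0.ne').1 hab
        exact_mod_cast this

lemma splineUnisolvent_face {p : ℕ} (hp : 3 ≤ p) :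
    SplineUnisolvent (numSplit p) p (p - 2) 2 (faceNodes p) := by
  obtain rfl | rfl | h : p = 3 ∨ p = 4 ∨ 5 ≤ p := by omega
  · exact splineUnisolvent_three_face
  · exact splineUnisolvent_four_face
  · rw [numSplit_of_five_le h, faceNodes, if_neg (by omega), if_neg (by omega)]
    have hp0 : (0 : ℚ) < p := by exact_mod_cast (by omega : 0 < p)
    refine splineUnisolvent_one (by omega) (fun x hx => ?_) ?_
    · obtain ⟨j, hj, rfl⟩ := Finset.mem_image.1 hx
      rw [Finset.mem_Icc] at hj
      refine ⟨div_pos (by exact_mod_cast (by omega : 0 < j)) hp0, ?_⟩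
      rw [div_lt_one hp0]
      exact_mod_cast (by omega : j < p)
    · rw [Finset.card_image_of_injective, Nat.card_Icc]
      · omega
      · intro a b hab
        have := (div_left_inj' hp0.ne').1 hab
        exact_mod_cast this

lemma faceNodes_mem {p : ℕ} (hp : 3 ≤ p) {q : ℚ} (hq : q ∈ faceNodes p) :
    (q : ℝ) ∈ Icc (0 : ℝ) 1 := by
  have : 0 ≤ q ∧ q ≤ 1 := by
    have hp0 : (0 : ℚ) < p := by exact_mod_cast (by omega : 0 < p)
    rw [faceNodes] at hq
    split_ifs at hq
    · simp only [Finset.mem_insert, Finset.mem_singleton] at hq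
      rcases hq with rfl | rfl | rfl | rfl <;> norm_num
    · simp only [Finset.mem_insert, Finset.mem_singleton] at hq
      rcases hq with rfl | rfl | rfl <;> norm_num
    · obtain ⟨j, hj, rfl⟩ := Finset.mem_image.1 hq
      rw [Finset.mem_Icc] at hj
      refine ⟨by positivity, ?_⟩
      rw [div_le_one hp0]
      exact_mod_cast (by omega : j ≤ p)
  exact ⟨by exact_mod_cast this.1, by exact_mod_cast this.2⟩

lemma traceNodes_mem {p : ℕ} (hp : 3 ≤ p) {q : ℚ} (hq : q ∈ traceNodes p) :
    (q : ℝ) ∈ Icc (0 : ℝ) 1 := by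
  have : 0 ≤ q ∧ q ≤ 1 := by
    have hp0 : (0 : ℚ) < p := by exact_mod_cast (by omega : 0 < p)
    obtain ⟨j, hj, rfl⟩ := Finset.mem_image.1 hq
    rw [Finset.mem_Icc] at hj
    refine ⟨by positivity, ?_⟩
    rw [div_le_one hp0]
    exact_mod_cast (by omega : j ≤ p)
  exact ⟨by exact_mod_cast this.1, by exact_mod_cast this.2⟩

lemma normalNodes_mem {p : ℕ} (hp : 3 ≤ p) {q : ℚ} (hq : q ∈ normalNodes p) :
    (q : ℝ) ∈ Icc (0 : ℝ) 1 := by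
  have : 0 ≤ q ∧ q ≤ 1 := by
    have hp0 : (0 : ℚ) < (p : ℚ) - 1 := by
      have : (1 : ℚ) < p := by exact_mod_cast (by omega : 1 < p)
      linarith
    rw [normalNodes] at hq
    split_ifs at hq
    · rw [Finset.mem_singleton] at hq
      subst hq
      norm_num
    · obtain ⟨j, hj, rfl⟩ := Finset.mem_image.1 hq
      rw [Finset.mem_Icc] at hj
      refine ⟨by positivity, ?_⟩
      rw [div_le_one hp0, le_sub_iff_add_le]
      exact_mod_cast (by omega : j + 1 ≤ p)
  exact ⟨by exact_mod_cast this.1, by exact_mod_cast this.2⟩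

/-! ### Coefficient bounds -/

/-- If a family of functionals separates the points of `ℝ^ι`, then the coordinates are linear
combinations of the functionals. -/
lemma exists_coord_combination {ι X : Type*} [Finite ι] (L : X → (ι → ℝ) →ₗ[ℝ] ℝ)
    (h : ∀ c, (∀ x, L x c = 0) → c = 0) (i : ι) :
    ∃ a : X →₀ ℝ, ∀ c, c i = a.sum fun x y => y * L x c := by
  -- Separation of points says that the span has trivial coannihilator, so by finite dimension it is
  -- the whole dual. The family itself may be infinite, for instance all evaluations on `[0,1]`.
  have hspan : Submodule.span ℝ (Set.range L) = ⊤ := by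
    have hb : (Submodule.span ℝ (Set.range L)).dualCoannihilator = ⊥ := by
      rw [eq_bot_iff]
      intro c hc
      rw [Submodule.mem_dualCoannihilator] at hc
      exact h c fun x => hc _ (Submodule.subset_span ⟨x, rfl⟩)
    rw [← Subspace.dualCoannihilator_dualAnnihilator_eq (W := Submodule.span ℝ (Set.range L)), hb,
      Submodule.dualAnnihilator_bot]
  have hm : (LinearMap.proj i : (ι → ℝ) →ₗ[ℝ] ℝ) ∈ Submodule.span ℝ (Set.range L) := by
    rw [hspan]; trivial
  obtain ⟨a, ha⟩ := (Finsupp.mem_span_range_iff_exists_finsupp).1 hm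
  refine ⟨a, fun c => ?_⟩
  have := congrArg (fun f : (ι → ℝ) →ₗ[ℝ] ℝ => f c) ha
  simp only [LinearMap.proj_apply] at this
  rw [← this, Finsupp.sum, Finsupp.sum, LinearMap.sum_apply]
  rfl

/-- This turns unisolvence into a quantitative bound. The constant depends on the functionals only,
and those on the reference interval depend on `p` only. -/
lemma exists_coord_bound {ι X : Type*} [Fintype ι] (L : X → (ι → ℝ) →ₗ[ℝ] ℝ)
    (h : ∀ c, (∀ x, L x c = 0) → c = 0) :
    ∃ C : ℝ, 0 ≤ C ∧ ∀ c M, (∀ x, |L x c| ≤ M) → ∀ i, |c i| ≤ C * M := by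
  choose a ha using exists_coord_combination L h
  refine ⟨∑ i, (a i).sum fun _ y => |y|, Finset.sum_nonneg fun i _ =>
    Finset.sum_nonneg fun _ _ => abs_nonneg _, fun c M hM i => ?_⟩
  have h1 : |c i| ≤ ((a i).sum fun _ y => |y|) * M := by
    rw [ha i c, Finsupp.sum, Finsupp.sum, Finset.sum_mul]
    refine (Finset.abs_sum_le_sum_abs _ _).trans (Finset.sum_le_sum fun x _ => ?_)
    rw [abs_mul]
    exact mul_le_mul_of_nonneg_left (hM x) (abs_nonneg _)
  -- Without functionals `M` could be negative; then all combinations are empty and both sides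
  -- vanish.
  rcases isEmpty_or_nonempty X with hX | ⟨⟨x⟩⟩
  · have : a i = 0 := Subsingleton.elim _ _
    have hci : c i = 0 := by rw [ha i c, this]; simp
    have hc0 : ∀ j, a j = 0 := fun j => Subsingleton.elim _ _
    simp [hci, hc0]
  · have hM0 : 0 ≤ M := (abs_nonneg _).trans (hM x)
    refine h1.trans (mul_le_mul_of_nonneg_right ?_ hM0)
    exact Finset.single_le_sum (f := fun i => (a i).sum fun _ y => |y|)
      (fun j _ => Finset.sum_nonneg fun _ _ => abs_nonneg _) (Finset.mem_univ i)

/-- Evaluation of the `n`-th derivative at `s` as a functional of the coefficients. -/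
def splineEval (k d r n : ℕ) (s : ℝ) : (SplineIdx k d r → ℝ) →ₗ[ℝ] ℝ where
  toFun c := spline k d r n c s
  map_add' c c' := by simp [spline, add_mul, Finset.sum_add_distrib]
  map_smul' y c := by
    simp only [spline, Pi.smul_apply, smul_eq_mul, RingHom.id_apply, Finset.mul_sum, mul_assoc]

lemma pow_unit_mem {x : ℝ} (h : x ∈ Icc (0 : ℝ) 1) (m : ℕ) : x ^ m ∈ Icc (0 : ℝ) 1 :=
  ⟨pow_nonneg h.1 m, pow_le_one₀ h.1 h.2⟩

lemma abs_pow_sub_pow_le_of_unit {x y : ℝ} (hx : x ∈ Icc (0 : ℝ) 1) (hy : y ∈ Icc (0 : ℝ) 1)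
    (m : ℕ) : |x ^ m - y ^ m| ≤ m * |x - y| := by
  induction m with
  | zero => simp
  | succ m ih =>
    have e : x ^ (m + 1) - y ^ (m + 1) = x ^ m * (x - y) + (x ^ m - y ^ m) * y := by ring
    rw [e]
    refine (abs_add_le _ _).trans ?_
    rw [abs_mul, abs_mul, abs_of_nonneg (pow_unit_mem hx m).1, abs_of_nonneg hy.1]
    push_cast
    nlinarith [(pow_unit_mem hx m).2, abs_nonneg (x - y), abs_nonneg (x ^ m - y ^ m), hy.2]

lemma max_sub_knot_mem {s : ℝ} (hs : s ∈ Icc (0 : ℝ) 1) (a : ℕ) :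
    max (s - knot k a) 0 ∈ Icc (0 : ℝ) 1 := by
  refine ⟨le_max_right _ _, max_le ?_ zero_le_one⟩
  have : 0 ≤ knot k a := by rw [knot]; positivity
  linarith [hs.2]

lemma abs_splineBasis_le (n : ℕ) (i : SplineIdx k d r) {s : ℝ} (hs : s ∈ Icc (0 : ℝ) 1) :
    |splineBasis k d r n i s| ≤ d ^ n := by
  have key : ∀ (j m : ℕ) (x : ℝ), j ≤ d → x ∈ Icc (0 : ℝ) 1 →
      |(j.descFactorial n : ℝ) * x ^ m| ≤ d ^ n := by
    intro j m x hj hx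
    have h1 := pow_unit_mem hx m
    rw [abs_mul, abs_of_nonneg h1.1, abs_of_nonneg (Nat.cast_nonneg _)]
    have : (j.descFactorial n : ℝ) ≤ d ^ n := by
      exact_mod_cast (Nat.descFactorial_le_pow j n).trans (Nat.pow_le_pow_left hj n)
    exact (mul_le_of_le_one_right (Nat.cast_nonneg _) h1.2).trans this
  rcases i with j | ⟨a, e⟩
  · exact key _ _ _ (by omega) hs
  · exact key _ _ _ (by omega) (max_sub_knot_mem hs a)

lemma abs_splineBasis_sub_le (n : ℕ) (i : SplineIdx k d r) {s s' : ℝ} (hs : s ∈ Icc (0 : ℝ) 1)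
    (hs' : s' ∈ Icc (0 : ℝ) 1) :
    |splineBasis k d r n i s - splineBasis k d r n i s'| ≤ d ^ (n + 1) * |s - s'| := by
  have key : ∀ (j m : ℕ) (x y : ℝ), j ≤ d → m ≤ d → x ∈ Icc (0 : ℝ) 1 → y ∈ Icc (0 : ℝ) 1 →
      |x - y| ≤ |s - s'| →
      |(j.descFactorial n : ℝ) * x ^ m - (j.descFactorial n : ℝ) * y ^ m| ≤
        d ^ (n + 1) * |s - s'| := by
    intro j m x y hj hm hx hy hxy
    rw [← mul_sub, abs_mul, abs_of_nonneg (Nat.cast_nonneg _), pow_succ, mul_assoc]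
    have h1 : (j.descFactorial n : ℝ) ≤ d ^ n := by
      exact_mod_cast (Nat.descFactorial_le_pow j n).trans (Nat.pow_le_pow_left hj n)
    have h2 : |x ^ m - y ^ m| ≤ d * |s - s'| :=
      (abs_pow_sub_pow_le_of_unit hx hy m).trans
        (mul_le_mul (by exact_mod_cast hm) hxy (abs_nonneg _) (Nat.cast_nonneg _))
    exact mul_le_mul h1 h2 (abs_nonneg _) (by positivity)
  rcases i with j | ⟨a, e⟩
  · exact key _ _ _ _ (by omega) (by omega) hs hs' le_rfl
  · refine key _ _ _ _ (by omega) (by omega) (max_sub_knot_mem hs a) (max_sub_knot_mem hs' a) ?_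
    refine (abs_max_sub_max_le_abs _ _ _).trans ?_
    rw [sub_sub_sub_cancel_right]

lemma abs_spline_le (n : ℕ) {c : SplineIdx k d r → ℝ} {A : ℝ} (hc : ∀ i, |c i| ≤ A) {s : ℝ}
    (hs : s ∈ Icc (0 : ℝ) 1) :
    |spline k d r n c s| ≤ (Fintype.card (SplineIdx k d r) : ℝ) * d ^ n * A := by
  refine (Finset.abs_sum_le_sum_abs _ _).trans ?_
  refine (Finset.sum_le_card_nsmul _ _ (d ^ n * A) fun i _ => ?_).trans ?_
  · rw [abs_mul, mul_comm]
    exact mul_le_mul (abs_splineBasis_le n i hs) (hc i) (abs_nonneg _) (by positivity)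
  · rw [nsmul_eq_mul, Finset.card_univ, mul_assoc]

lemma abs_spline_sub_le (n : ℕ) {c : SplineIdx k d r → ℝ} {A : ℝ} (hc : ∀ i, |c i| ≤ A) {s s' : ℝ}
    (hs : s ∈ Icc (0 : ℝ) 1) (hs' : s' ∈ Icc (0 : ℝ) 1) :
    |spline k d r n c s - spline k d r n c s'| ≤
      (Fintype.card (SplineIdx k d r) : ℝ) * d ^ (n + 1) * A * |s - s'| := by
  rw [spline, spline, ← Finset.sum_sub_distrib]
  refine (Finset.abs_sum_le_sum_abs _ _).trans ?_
  refine (Finset.sum_le_card_nsmul _ _ (A * (d ^ (n + 1) * |s - s'|)) fun i _ => ?_).trans ?_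
  · rw [← mul_sub, abs_mul]
    exact mul_le_mul (hc i) (abs_splineBasis_sub_le n i hs hs') (abs_nonneg _)
      ((abs_nonneg _).trans (hc i))
  · rw [nsmul_eq_mul, Finset.card_univ]
    exact le_of_eq (by ring)

/-- Splines are bounded by their Hermite data. -/
lemma SplineUnisolvent.exists_bound {m : ℕ} {F : Finset ℚ} (h : SplineUnisolvent k d r m F) :
    ∃ C : ℝ, 0 ≤ C ∧ ∀ c M, (∀ n < m, |spline k d r n c 0| ≤ M) →
      (∀ n < m, |spline k d r n c 1| ≤ M) → (∀ q ∈ F, |spline k d r 0 c (q : ℝ)| ≤ M) →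
      ∀ i, |c i| ≤ C * M := by
  obtain ⟨C, hC, hb⟩ := exists_coord_bound
    (Sum.elim (fun n : Fin m => splineEval k d r n 0) (Sum.elim (fun n : Fin m => splineEval k d r n 1)
      (fun q : F => splineEval k d r 0 ((q : ℚ) : ℝ)))) (fun c hc => h c
        (fun n hn => hc (Sum.inl ⟨n, hn⟩)) (fun n hn => hc (Sum.inr (Sum.inl ⟨n, hn⟩)))
        (fun q hq => hc (Sum.inr (Sum.inr ⟨q, hq⟩))))
  refine ⟨C, hC, fun c M h0 h1 hF => hb c M ?_⟩
  rintro (n | n | q)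
  · exact h0 n n.2
  · exact h1 n n.2
  · exact hF q q.2

lemma spline_deriv_eq_zero (hr : 1 ≤ r) {c : SplineIdx k d r → ℝ}
    (h : ∀ s ∈ Icc (0 : ℝ) 1, spline k d r 0 c s = 0) {s : ℝ} (hs : s ∈ Icc (0 : ℝ) 1) :
    spline k d r 1 c s = 0 := by
  have h1 := (hasDerivAt_spline (n := 0) hr c s).hasDerivWithinAt (s := Icc (0 : ℝ) 1)
  have h2 : HasDerivWithinAt (spline k d r 0 c) 0 (Icc 0 1) s :=
    (hasDerivWithinAt_const s _ (0 : ℝ)).congr h (h s hs)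
  exact ((uniqueDiffOn_Icc one_pos).uniqueDiffWithinAt hs).eq_deriv _ h1 h2

lemma eq_zero_of_spline_eq_zero {p : ℕ} (hp : 3 ≤ p) (c : SplineIdx (numSplit p) p (p - 2) → ℝ)
    (h : ∀ s ∈ Icc (0 : ℝ) 1, spline (numSplit p) p (p - 2) 0 c s = 0) : c = 0 := by
  have key : ∀ s ∈ Icc (0 : ℝ) 1, ∀ n < 2, spline (numSplit p) p (p - 2) n c s = 0 := by
    intro s hs n hn
    interval_cases n
    · exact h s hs
    · exact spline_deriv_eq_zero (by omega) h hs
  refine splineUnisolvent_face hp c (key 0 (left_mem_Icc.2 zero_le_one))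
    (key 1 (right_mem_Icc.2 zero_le_one)) fun q hq => h _ (faceNodes_mem hp hq)

end
end BSQuad

namespace BSQuad
noncomputable section

open MeasureTheory Set Filter Topology

/-! ### Tensor product splines -/

/-- Indices of the one-dimensional basis behind the local space. -/
abbrev SIdx (p : ℕ) : Type := SplineIdx (numSplit p) p (p - 2)

/-- Coefficients of tensor product splines. -/
abbrev Coef (p : ℕ) : Type := SIdx p → SIdx p → ℝ

/-- The derivative of order `(n, m)` of a tensor product spline. -/
def surf (p n m : ℕ) (c : Coef p) (s t : ℝ) : ℝ :=
  spline (numSplit p) p (p - 2) n (fun i => spline (numSplit p) p (p - 2) m (c i) t) s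

variable {p : ℕ}

lemma surf_swap (n m : ℕ) (c : Coef p) (s t : ℝ) :
    surf p n m c s t = surf p m n (fun i j => c j i) t s := by
  simp only [surf, spline, Finset.sum_mul]
  rw [Finset.sum_comm]
  exact Finset.sum_congr rfl fun i _ => Finset.sum_congr rfl fun j _ => by ring

lemma surf_eq_sum (n m : ℕ) (c : Coef p) (s t : ℝ) :
    surf p n m c s t = ∑ i, ∑ j, c i j * splineBasis (numSplit p) p (p - 2) n i s *
      splineBasis (numSplit p) p (p - 2) m j t := by
  simp only [surf, spline, Finset.sum_mul]
  exact Finset.sum_congr rfl fun i _ => Finset.sum_congr rfl fun j _ => by ring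

lemma surf_eq_spline_right (n m : ℕ) (c : Coef p) (s t : ℝ) :
    surf p n m c s t = spline (numSplit p) p (p - 2) m
      (fun j => spline (numSplit p) p (p - 2) n (fun i => c i j) s) t := surf_swap n m c s t

lemma contDiff_surf (c : Coef p) :
    ContDiff ℝ (p - 2 : ℕ) fun ξ : ℝ × ℝ => surf p 0 0 c ξ.1 ξ.2 := by
  simp only [surf_eq_sum]
  exact ContDiff.sum fun i _ => ContDiff.sum fun j _ =>
    (contDiff_const.mul ((contDiff_splineBasis i).comp contDiff_fst)).mul
      ((contDiff_splineBasis j).comp contDiff_snd)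

lemma contDiffAt_surf {s t : ℝ} (hs : ∀ a < numSplit p - 1, s ≠ knot (numSplit p) a)
    (ht : ∀ a < numSplit p - 1, t ≠ knot (numSplit p) a) (c : Coef p) (n : ℕ) :
    ContDiffAt ℝ n (fun ξ : ℝ × ℝ => surf p 0 0 c ξ.1 ξ.2) (s, t) := by
  simp only [surf_eq_sum]
  refine ContDiffAt.sum fun i _ => ContDiffAt.sum fun j _ => (contDiffAt_const.mul ?_).mul ?_
  · exact ContDiffAt.comp (s, t) (f := fun ξ : ℝ × ℝ => ξ.1) (contDiffAt_splineBasis hs n i)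
      contDiffAt_fst
  · exact ContDiffAt.comp (s, t) (f := fun ξ : ℝ × ℝ => ξ.2) (contDiffAt_splineBasis ht n j)
      contDiffAt_snd

lemma hasDerivAt_surf_left (hp : 3 ≤ p) (m : ℕ) (c : Coef p) (s t : ℝ) :
    HasDerivAt (fun s => surf p 0 m c s t) (surf p 1 m c s t) s :=
  hasDerivAt_spline (n := 0) (by omega) _ s

lemma hasDerivAt_surf_right (hp : 3 ≤ p) (n : ℕ) (c : Coef p) (s t : ℝ) :
    HasDerivAt (fun t => surf p n 0 c s t) (surf p n 1 c s t) t := by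
  simp only [surf_eq_spline_right]
  exact hasDerivAt_spline (n := 0) (by omega) _ t

/-- Coordinates of a spline in terms of its values on `[0,1]`. -/
lemma exists_sampling (hp : 3 ≤ p) (i : SIdx p) : ∃ a : Icc (0 : ℝ) 1 →₀ ℝ, ∀ c : SIdx p → ℝ,
    c i = a.sum fun x y => y * spline (numSplit p) p (p - 2) 0 c x :=
  exists_coord_combination (fun x : Icc (0 : ℝ) 1 => splineEval (numSplit p) p (p - 2) 0 x)
    (fun c hc => eq_zero_of_spline_eq_zero hp c fun s hs => hc ⟨s, hs⟩) i

/-- The coordinates of a spline in `s` are fixed finite combinations of its values at sample points.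
Each such value is a spline in `t`, so the coordinates are splines in `t` as well. -/
lemma exists_surf_eq (hp : 3 ≤ p) {w : ℝ → ℝ → ℝ}
    (h1 : ∀ t ∈ Icc (0 : ℝ) 1, ∃ c : SIdx p → ℝ, ∀ s ∈ Icc (0 : ℝ) 1,
      w s t = spline (numSplit p) p (p - 2) 0 c s)
    (h2 : ∀ s ∈ Icc (0 : ℝ) 1, ∃ c : SIdx p → ℝ, ∀ t ∈ Icc (0 : ℝ) 1,
      w s t = spline (numSplit p) p (p - 2) 0 c t) :
    ∃ c : Coef p, ∀ s ∈ Icc (0 : ℝ) 1, ∀ t ∈ Icc (0 : ℝ) 1, w s t = surf p 0 0 c s t := by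
  choose a ha using exists_sampling hp
  choose! f hf using h1
  choose! g hg using h2
  refine ⟨fun i j => (a i).sum fun x y => y * g x j, fun s hs t ht => ?_⟩
  rw [hf t ht s hs, surf]
  congr 1
  funext i
  rw [ha i (f t), spline, Finsupp.sum]
  simp only [Finsupp.sum, Finset.sum_mul]
  rw [Finset.sum_comm]
  refine Finset.sum_congr rfl fun x _ => ?_
  rw [← hf t ht x x.2, hg x x.2 t ht, spline, Finset.mul_sum]
  exact Finset.sum_congr rfl fun j _ => by ring

lemma exists_spline_sup_bound (hp : 3 ≤ p) : ∃ C : ℝ, 0 ≤ C ∧ ∀ (c : SIdx p → ℝ) (M : ℝ),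
    (∀ s ∈ Icc (0 : ℝ) 1, |spline (numSplit p) p (p - 2) 0 c s| ≤ M) → ∀ i, |c i| ≤ C * M := by
  obtain ⟨C, hC, h⟩ := exists_coord_bound
    (fun x : Icc (0 : ℝ) 1 => splineEval (numSplit p) p (p - 2) 0 x)
    (fun c hc => eq_zero_of_spline_eq_zero hp c fun s hs => hc ⟨s, hs⟩)
  exact ⟨C, hC, fun c M hM => h c M fun x => hM x x.2⟩

lemma exists_surf_sup_bound (hp : 3 ≤ p) : ∃ C : ℝ, 0 ≤ C ∧ ∀ (c : Coef p) (M : ℝ),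
    (∀ s ∈ Icc (0 : ℝ) 1, ∀ t ∈ Icc (0 : ℝ) 1, |surf p 0 0 c s t| ≤ M) →
    ∀ i j, |c i j| ≤ C * M := by
  obtain ⟨C, hC, h⟩ := exists_spline_sup_bound hp
  refine ⟨C * C, mul_nonneg hC hC, fun c M hM i j => ?_⟩
  rw [mul_assoc]
  exact h (c i) (C * M) (fun t ht => h _ M (fun s hs => hM s hs t ht) i) j

/-- Tensor product splines are bounded by their Hermite data on the boundary of the square and
their values at the face nodes. -/
lemma exists_surf_bound (hp : 3 ≤ p) : ∃ C : ℝ, 0 ≤ C ∧ ∀ (c : Coef p) (M : ℝ),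
    (∀ n < 2, ∀ s ∈ Icc (0 : ℝ) 1, |surf p 0 n c s 0| ≤ M ∧ |surf p 0 n c s 1| ≤ M ∧
      |surf p n 0 c 0 s| ≤ M ∧ |surf p n 0 c 1 s| ≤ M) →
    (∀ q ∈ faceNodes p, ∀ q' ∈ faceNodes p, |surf p 0 0 c (q : ℝ) (q' : ℝ)| ≤ M) →
    ∀ i j, |c i j| ≤ C * M := by
  obtain ⟨C₁, hC₁, h₁⟩ := (splineUnisolvent_face hp).exists_bound
  obtain ⟨C₂, hC₂, h₂⟩ := exists_surf_sup_bound hp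
  set K : ℝ := (Fintype.card (SIdx p) : ℝ)
  have hK0 : 0 ≤ K := Nat.cast_nonneg _
  have hsup : ∀ (a : SIdx p → ℝ) (M : ℝ), (∀ n < 2, |spline _ _ _ n a 0| ≤ M) →
      (∀ n < 2, |spline _ _ _ n a 1| ≤ M) → (∀ q ∈ faceNodes p, |spline _ _ _ 0 a (q : ℝ)| ≤ M) →
      ∀ s ∈ Icc (0 : ℝ) 1, |spline _ _ _ 0 a s| ≤ K * C₁ * M := by
    intro a M h0 h1 hF s hs
    refine (abs_spline_le 0 (h₁ a M h0 h1 hF) hs).trans (le_of_eq ?_)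
    rw [pow_zero]; ring
  refine ⟨C₂ * (K * C₁ * (1 + K * C₁)), by positivity, fun c M hb hF => ?_⟩
  have hM : 0 ≤ M := (abs_nonneg _).trans (hb 0 (by norm_num) 0 (left_mem_Icc.2 zero_le_one)).1
  -- One-dimensional unisolvence is used twice: first along the lines `t = q` through the face
  -- nodes, then for every `s` in the direction of `t`, where the lines just bounded take the part
  -- of the node values.
  have h3 : ∀ q ∈ faceNodes p, ∀ s ∈ Icc (0 : ℝ) 1, |surf p 0 0 c s (q : ℝ)| ≤ K * C₁ * M :=
    fun q hq s hs => hsup _ M (fun n hn => (hb n hn q (faceNodes_mem hp hq)).2.2.1)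
      (fun n hn => (hb n hn q (faceNodes_mem hp hq)).2.2.2) (fun q' hq' => hF q' hq' q hq) s hs
  have hx : 0 ≤ K * C₁ * M := by positivity
  intro i j
  rw [mul_assoc]
  refine h₂ c _ (fun s hs t ht => ?_) i j
  rw [surf_eq_spline_right, mul_assoc (K * C₁)]
  refine hsup _ _ (fun n hn => ?_) (fun n hn => ?_) (fun q hq => ?_) t ht <;>
    rw [← surf_eq_spline_right]
  · exact (hb n hn s hs).1.trans (by nlinarith)
  · exact (hb n hn s hs).2.1.trans (by nlinarith)
  · exact (h3 q hq s hs).trans (by nlinarith)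

lemma abs_surf_le (n m : ℕ) {c : Coef p} {A : ℝ} (hc : ∀ i j, |c i j| ≤ A) {s t : ℝ}
    (hs : s ∈ Icc (0 : ℝ) 1) (ht : t ∈ Icc (0 : ℝ) 1) :
    |surf p n m c s t| ≤ (Fintype.card (SIdx p) : ℝ) ^ 2 * p ^ (n + m) * A := by
  refine (abs_spline_le n (fun i => abs_spline_le m (hc i) ht) hs).trans (le_of_eq ?_)
  ring

lemma abs_surf_sub_le (n m : ℕ) {c : Coef p} {A : ℝ} (hc : ∀ i j, |c i j| ≤ A) {s t s' t' : ℝ}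
    (hs : s ∈ Icc (0 : ℝ) 1) (ht : t ∈ Icc (0 : ℝ) 1) (hs' : s' ∈ Icc (0 : ℝ) 1)
    (ht' : t' ∈ Icc (0 : ℝ) 1) :
    |surf p n m c s t - surf p n m c s' t'| ≤
      (Fintype.card (SIdx p) : ℝ) ^ 2 * p ^ (n + m + 1) * A * (|s - s'| + |t - t'|) := by
  have h1 := abs_spline_sub_le n (fun i => abs_spline_le m (hc i) ht) hs hs'
  have h2 := abs_spline_sub_le m (fun j => abs_spline_le n (fun i => hc i j) hs') ht ht'
  change |surf p n m c s t - surf p n m c s' t| ≤ _ at h1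
  change |surf p m n (fun i j => c j i) t s' - surf p m n (fun i j => c j i) t' s'| ≤ _ at h2
  rw [← surf_swap n m c, ← surf_swap n m c] at h2
  refine (abs_sub_le _ (surf p n m c s' t) _).trans ((add_le_add h1 h2).trans (le_of_eq ?_))
  ring

/-! ### The space without conditions on the edges -/

/-- The conditions of the local space that do not involve the edges. -/
structure MemBase (Q : ConvexQuad) (p : ℕ) (u : Plane → ℝ) : Prop where
  eq_zero_off : ∀ x, x ∉ Q.closed → u x = 0
  smooth : ContDiffOn ℝ (p - 2 : ℕ) u Q.closed
  bipoly : ∀ a b : Fin (numSplit p),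
    IsBiPolyOn p (subInterval p a) (subInterval p b) (fun s t => u (Q.param s t))

open Classical in
/-- The function on the quadrilateral that is represented by a tensor product spline. -/
def lift (Q : ConvexQuad) (p : ℕ) (c : Coef p) : Plane → ℝ :=
  Q.closed.indicator fun x => surf p 0 0 c (Q.inv x).1 (Q.inv x).2

variable {Q : ConvexQuad}

lemma lift_param (c : Coef p) {s t : ℝ} (hs : s ∈ Icc (0 : ℝ) 1) (ht : t ∈ Icc (0 : ℝ) 1) :
    lift Q p c (Q.param s t) = surf p 0 0 c s t := by
  rw [lift, indicator_of_mem (Q.param_mem hs ht), Q.inv_param hs ht]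

open Polynomial in
lemma sum_coeff_splineBasis {k d r a : ℕ} (i : SplineIdx k d r) {s : ℝ} (hs : s ∈ cell k a) :
    splineBasis k d r 0 i s = ∑ m : Fin (d + 1), (splinePiece k d r a i).coeff m * s ^ (m : ℕ) := by
  rw [splineBasis_eq_eval (Nat.zero_le r) i hs, Function.iterate_zero, id,
    eval_eq_sum_range' (Nat.lt_succ_of_le (natDegree_splinePiece_le a i)),
    ← Fin.sum_univ_eq_sum_range (fun m => (splinePiece k d r a i).coeff m * s ^ m)]

lemma contDiffOn_lift (c : Coef p) : ContDiffOn ℝ (p - 2 : ℕ) (lift Q p c) Q.closed :=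
  ((contDiff_surf c).comp_contDiffOn (Q.contDiffOn_inv (p - 2))).congr fun x hx => by
    rw [lift, indicator_of_mem hx]; rfl

lemma memBase_lift (c : Coef p) : MemBase Q p (lift Q p c) where
  eq_zero_off x hx := indicator_of_notMem hx _
  smooth := contDiffOn_lift c
  bipoly a b := by
    refine ⟨fun m n => ∑ i, ∑ j, c i j * (splinePiece _ _ _ a i).coeff m *
      (splinePiece _ _ _ b j).coeff n, fun s hs t ht => ?_⟩
    beta_reduce
    rw [lift_param c (cell_subset a.2 hs) (cell_subset b.2 ht), surf_eq_sum]
    have h : ∀ i j : SIdx p, c i j * splineBasis (numSplit p) p (p - 2) 0 i s *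
        splineBasis (numSplit p) p (p - 2) 0 j t = ∑ m : Fin (p + 1), ∑ n : Fin (p + 1),
        c i j * (splinePiece _ _ _ a i).coeff m * (splinePiece _ _ _ b j).coeff n *
          s ^ (m : ℕ) * t ^ (n : ℕ) := by
      intro i j
      rw [sum_coeff_splineBasis i hs, sum_coeff_splineBasis j ht, mul_assoc,
        Finset.sum_mul_sum, Finset.mul_sum]
      refine Finset.sum_congr rfl fun m _ => ?_
      rw [Finset.mul_sum]
      exact Finset.sum_congr rfl fun n _ => by ring
    simp only [h, Finset.sum_mul]
    rw [Finset.sum_congr rfl fun i _ => Finset.sum_comm]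
    rw [Finset.sum_comm]
    refine Finset.sum_congr rfl fun m _ => ?_
    rw [Finset.sum_congr rfl fun i _ => Finset.sum_comm]
    rw [Finset.sum_comm]

open Polynomial in
lemma IsBiPolyOn.isPolyOn_left {A B : Set ℝ} {w : ℝ → ℝ → ℝ} (h : IsBiPolyOn p A B w) {t : ℝ}
    (ht : t ∈ B) : IsPolyOn p A fun s => w s t := by
  obtain ⟨c, hc⟩ := h
  refine ⟨∑ i : Fin (p + 1), C (∑ j : Fin (p + 1), c i j * t ^ (j : ℕ)) * X ^ (i : ℕ),
    natDegree_sum_le_of_forall_le _ _ fun i _ => (natDegree_C_mul_X_pow_le _ _).trans (by omega),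
    fun s hs => ?_⟩
  beta_reduce
  rw [hc s hs t ht, eval_finsetSum]
  refine Finset.sum_congr rfl fun i _ => ?_
  rw [eval_mul, eval_C, eval_pow, eval_X, Finset.sum_mul]
  exact Finset.sum_congr rfl fun j _ => by ring

lemma IsBiPolyOn.swap {A B : Set ℝ} {w : ℝ → ℝ → ℝ} (h : IsBiPolyOn p A B w) :
    IsBiPolyOn p B A fun s t => w t s := by
  obtain ⟨c, hc⟩ := h
  refine ⟨fun i j => c j i, fun s hs t ht => ?_⟩
  beta_reduce
  rw [hc t ht s hs, Finset.sum_comm]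
  exact Finset.sum_congr rfl fun i _ => Finset.sum_congr rfl fun j _ => by ring

/-- Along each line of constant `s` or `t` the composition with the bilinear map is of class
`C^(p-2)` and piecewise polynomial, hence a spline; a function that is a spline in each variable is
a tensor product spline. -/
lemma MemBase.exists_lift (hp : 3 ≤ p) {u : Plane → ℝ} (h : MemBase Q p u) :
    ∃ c, u = lift Q p c := by
  have hF := Q.contDiff_param (n := (p - 2 : ℕ))
  obtain ⟨c, hc⟩ := exists_surf_eq hp (w := fun s t => u (Q.param s t))
    (fun t ht => exists_spline_eq (numSplit_pos p) (by omega)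
      (h.smooth.comp (f := fun s => Q.param s t)
        (hF.comp (contDiff_id.prodMk contDiff_const)).contDiffOn fun s hs => Q.param_mem hs ht)
      fun a ha => by
        obtain ⟨b, hb, htb⟩ := exists_mem_cell (numSplit_pos p) ht
        exact (h.bipoly ⟨a, ha⟩ ⟨b, hb⟩).isPolyOn_left htb)
    (fun s hs => exists_spline_eq (numSplit_pos p) (by omega)
      (h.smooth.comp (f := fun t => Q.param s t)
        (hF.comp (contDiff_const.prodMk contDiff_id)).contDiffOn fun t ht => Q.param_mem hs ht)
      fun b hb => by
        obtain ⟨a, ha, hsa⟩ := exists_mem_cell (numSplit_pos p) hs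
        exact (h.bipoly ⟨a, ha⟩ ⟨b, hb⟩).swap.isPolyOn_left hsa)
  refine ⟨c, funext fun x => ?_⟩
  by_cases hx : x ∈ Q.closed
  · have hm := Q.inv_mem hx
    rw [lift, indicator_of_mem hx, ← hc _ hm.1 _ hm.2, Q.param_inv hx]
  · rw [h.eq_zero_off x hx, lift, indicator_of_notMem hx]

/-- `lift` as a linear map. -/
def liftLinear (Q : ConvexQuad) (p : ℕ) : Coef p →ₗ[ℝ] (Plane → ℝ) where
  toFun := lift Q p
  map_add' c c' := by
    funext x
    simp only [lift, indicator, Pi.add_apply]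
    split_ifs
    · simp only [surf_eq_sum, Pi.add_apply, add_mul, Finset.sum_add_distrib]
    · simp
  map_smul' y c := by
    funext x
    simp only [lift, indicator, Pi.smul_apply, RingHom.id_apply, smul_eq_mul]
    split_ifs
    · simp only [surf_eq_sum, Pi.smul_apply, smul_eq_mul, Finset.mul_sum, mul_assoc]
    · simp

lemma liftLinear_injective (hp : 3 ≤ p) : Function.Injective (liftLinear Q p) := by
  rw [← LinearMap.ker_eq_bot, LinearMap.ker_eq_bot']
  intro c hc
  obtain ⟨C, -, hC⟩ := exists_surf_sup_bound hp
  funext i j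
  have := hC c 0 (fun s hs t ht => by
    rw [← lift_param (Q := Q) c hs ht, show lift Q p c = 0 from hc]; simp) i j
  rw [mul_zero] at this
  exact abs_nonpos_iff.1 this

end
end BSQuad

namespace BSQuad
noncomputable section

open MeasureTheory Set Filter Topology

variable {p : ℕ} {Q : ConvexQuad} {u : Plane → ℝ}

/-! ### Relabelling the vertices -/

namespace ConvexQuad

/-- The same quadrilateral with the next vertex as first vertex. -/
def rot (Q : ConvexQuad) : ConvexQuad where
  vertex i := Q.vertex (i + 1)
  left_turn i := by
    have := Q.left_turn (i + 1)
    rwa [show i + 1 - 1 = i - 1 + 1 by rw [add_sub_cancel_right, sub_add_cancel]] at this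

lemma rot_closed (Q : ConvexQuad) : Q.rot.closed = Q.closed := by
  rw [closed, closed]
  congr 1
  exact (Equiv.addRight (1 : Fin 4)).surjective.range_comp Q.vertex

lemma rot_size (Q : ConvexQuad) : Q.rot.size = Q.size :=
  (Equiv.addRight (1 : Fin 4)).iSup_congr fun _ => rfl

lemma Shape.rot {κ : ℝ} (h : Q.Shape κ) : Q.rot.Shape κ where
  pos := h.pos
  edge i := by rw [rot_size]; exact h.edge (i + 1)
  area i := by
    rw [rot_size]
    have := h.area (i + 1)
    rw [corner] at this ⊢
    rwa [show i + 1 - 1 = i - 1 + 1 by rw [add_sub_cancel_right, sub_add_cancel]] at this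

/-- A shift of the labels is a quarter turn of the square. It allows all arguments about edges to be
carried out for the edge `0`. -/
lemma rot_param (Q : ConvexQuad) (s t : ℝ) : Q.rot.param s t = Q.param (1 - t) s := by
  have e : ∀ i, Q.rot.vertex i = Q.vertex (i + 1) := fun _ => rfl
  simp only [param, e, show (0 : Fin 4) + 1 = 1 from rfl,
    show (1 : Fin 4) + 1 = 2 from rfl, show (2 : Fin 4) + 1 = 3 from rfl,
    show (3 : Fin 4) + 1 = 0 from rfl]
  module

lemma rot_normalDeriv (Q : ConvexQuad) (i : Fin 4) (u : Plane → ℝ) (x : Plane) :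
    Q.rot.normalDeriv i u x = Q.normalDeriv (i + 1) u x := by
  rw [normalDeriv, rot_closed]; rfl

lemma iterate_rot_closed (Q : ConvexQuad) (n : ℕ) : (rot^[n] Q).closed = Q.closed := by
  induction n with
  | zero => rfl
  | succ n ih => rw [Function.iterate_succ_apply', rot_closed, ih]

lemma iterate_rot_vertex (Q : ConvexQuad) (i j : Fin 4) :
    (rot^[i] Q).vertex j = Q.vertex (j + i) := by
  fin_cases i
  · exact congrArg Q.vertex (add_zero j).symm
  · rfl
  · exact congrArg Q.vertex (add_assoc j 1 1)
  · exact congrArg Q.vertex ((add_assoc (j + 1) 1 1).trans (add_assoc j 1 2))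

lemma iterate_rot_edgeParam (Q : ConvexQuad) (i : Fin 4) (s : ℝ) :
    (rot^[i] Q).edgeParam 0 s = Q.edgeParam i s := by
  simp only [edgeParam, iterate_rot_vertex, zero_add, add_comm (1 : Fin 4) i]

lemma iterate_rot_normalDeriv (Q : ConvexQuad) (i : Fin 4) (u : Plane → ℝ) (x : Plane) :
    (rot^[i] Q).normalDeriv 0 u x = Q.normalDeriv i u x := by
  simp only [normalDeriv, iterate_rot_closed, innerNormal, edgeVec, iterate_rot_vertex,
    zero_add, add_comm (1 : Fin 4) i]

lemma edgeParam_zero (Q : ConvexQuad) (s : ℝ) : Q.edgeParam 0 s = Q.param s 0 := by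
  simp [edgeParam, param]

end ConvexQuad

open Polynomial in
lemma IsBiPolyOn.reflect {A A' B : Set ℝ} {w : ℝ → ℝ → ℝ} (h : IsBiPolyOn p A B w)
    (hA : ∀ s ∈ A', 1 - s ∈ A) : IsBiPolyOn p A' B fun s t => w (1 - s) t := by
  obtain ⟨c, hc⟩ := h
  refine ⟨fun m j => ∑ i : Fin (p + 1), c i j * ((1 - X : ℝ[X]) ^ (i : ℕ)).coeff m,
    fun s hs t ht => ?_⟩
  beta_reduce
  rw [hc _ (hA s hs) t ht]
  have e : ∀ i : Fin (p + 1), (1 - s) ^ (i : ℕ) =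
      ∑ m : Fin (p + 1), ((1 - X : ℝ[X]) ^ (i : ℕ)).coeff m * s ^ (m : ℕ) := by
    intro i
    have hd : ((1 - X : ℝ[X]) ^ (i : ℕ)).natDegree < p + 1 := by
      refine lt_of_le_of_lt natDegree_pow_le ?_
      have : (1 - X : ℝ[X]).natDegree ≤ 1 := (natDegree_sub_le _ _).trans (by simp)
      have := Nat.mul_le_mul_left (i : ℕ) this
      omega
    have := eval_eq_sum_range' hd s
    rw [← Fin.sum_univ_eq_sum_range (fun m => ((1 - X : ℝ[X]) ^ (i : ℕ)).coeff m * s ^ m)] at this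
    rw [← this]
    simp
  simp only [e, Finset.mul_sum, Finset.sum_mul]
  rw [Finset.sum_congr rfl fun i _ => Finset.sum_comm, Finset.sum_comm]
  refine Finset.sum_congr rfl fun m _ => ?_
  rw [Finset.sum_comm]
  exact Finset.sum_congr rfl fun j _ => Finset.sum_congr rfl fun i _ => by ring

/-- The quarter turn reverses one parameter, and the equal subintervals are symmetric under `t ↦ 1 -
t`: the interval with index `b` goes to that with index `b.rev`. -/
lemma MemBase.rot (h : MemBase Q p u) : MemBase Q.rot p u where
  eq_zero_off x hx := h.eq_zero_off x (by rwa [Q.rot_closed] at hx)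
  smooth := by rw [Q.rot_closed]; exact h.smooth
  bipoly a b := by
    simp only [Q.rot_param]
    refine ((h.bipoly b.rev a).reflect (fun t ht => ?_)).swap
    have hk : (0 : ℝ) < numSplit p := by exact_mod_cast numSplit_pos p
    have hv : ((b.rev : ℕ) : ℝ) = numSplit p - (b + 1) := by
      rw [Fin.val_rev, Nat.cast_sub (by omega)]; push_cast; ring
    obtain ⟨h1, h2⟩ := ht
    rw [div_le_iff₀ hk] at h1
    rw [le_div_iff₀ hk] at h2
    constructor
    · rw [hv, div_le_iff₀ hk]; linarith
    · rw [hv, le_div_iff₀ hk]; linarith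

lemma MemBase.iterate_rot (h : MemBase Q p u) (n : ℕ) : MemBase (ConvexQuad.rot^[n] Q) p u := by
  induction n with
  | zero => exact h
  | succ n ih => rw [Function.iterate_succ_apply']; exact ih.rot

/-- Scaled bounds for the degrees of freedom on the boundary. -/
structure BoundaryBound (Q : ConvexQuad) (p : ℕ) (u : Plane → ℝ) (M : ℝ) : Prop where
  vertex : ∀ i, ∀ α ∈ vertexJets,
    |mderivWithin Q.closed α u (Q.vertex i)| * Q.size ^ (α.1 + α.2) ≤ M
  trace : ∀ i, ∀ q ∈ traceNodes p, |u (Q.edgeParam i (q : ℝ))| ≤ M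
  normal : ∀ i, ∀ q ∈ normalNodes p, |Q.normalDeriv i u (Q.edgeParam i (q : ℝ))| * Q.size ≤ M

lemma BoundaryBound.rot {M : ℝ} (h : BoundaryBound Q p u M) : BoundaryBound Q.rot p u M where
  vertex i α hα := by rw [Q.rot_closed, Q.rot_size]; exact h.vertex (i + 1) α hα
  trace i q hq := h.trace (i + 1) q hq
  normal i q hq := by
    rw [Q.rot_size, Q.rot_normalDeriv]; exact h.normal (i + 1) q hq

/-! ### Derivatives at the vertices -/

lemma clm_eq_sum_single (v : Plane) (f : Plane →L[ℝ] ℝ) :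
    f v = v 0 * f (EuclideanSpace.single 0 1) + v 1 * f (EuclideanSpace.single 1 1) := by
  have : v = v 0 • EuclideanSpace.single 0 1 + v 1 • EuclideanSpace.single 1 1 := by
    ext k; fin_cases k <;> simp
  conv_lhs => rw [this]
  rw [map_add, map_smul, map_smul, smul_eq_mul, smul_eq_mul]

/-- The jets contain only one of the two mixed derivatives; the other is equal to it, since the
vertex lies in the closure of the interior. Arbitrary directions are expanded in coordinates, which
costs a factor `2` per direction. -/
lemma vertex_bounds {M : ℝ} (hb : BoundaryBound Q p u M) (i : Fin 4)
    (hu : ContDiffWithinAt ℝ 2 u Q.closed (Q.vertex i)) :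
    (∀ a, |fderivWithin ℝ u Q.closed (Q.vertex i) a| ≤ 2 * ‖a‖ * M / Q.size) ∧
    ∃ H : Plane →L[ℝ] Plane →L[ℝ] ℝ,
      HasFDerivWithinAt (fderivWithin ℝ u Q.closed) H Q.closed (Q.vertex i) ∧
      ∀ a b, |H a b| ≤ 4 * ‖a‖ * ‖b‖ * M / Q.size ^ 2 := by
  set v := Q.vertex i
  set S := Q.closed
  set e : Fin 2 → Plane := fun k => EuclideanSpace.single k 1
  have hv : v ∈ S := subset_convexHull ℝ _ (mem_range_self i)
  have hs := Q.size_pos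
  have hM : 0 ≤ M := (mul_nonneg (abs_nonneg _) (by positivity)).trans
    (hb.vertex i (0, 0) (by decide))
  have hG : DifferentiableWithinAt ℝ (fderivWithin ℝ u S) S v :=
    (hu.fderivWithin_right (m := 1) Q.uniqueDiffOn_closed (by norm_num) hv).differentiableWithinAt
      one_ne_zero
  have hsymm : IsSymmSndFDerivWithinAt ℝ u S v :=
    hu.isSymmSndFDerivWithinAt (by simp) Q.uniqueDiffOn_closed
      (by rw [show interior S = Q.opened from rfl, Q.closure_opened]; exact hv) hv
  set H := fderivWithin ℝ (fderivWithin ℝ u S) S v with hH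
  have hU := Q.uniqueDiffOn_closed v hv
  have hpd : ∀ j k : Fin 2, pderivWithin S j (pderivWithin S k u) v = H (e j) (e k) := by
    intro j k
    have := (hG.hasFDerivWithinAt.clm_apply (hasFDerivWithinAt_const (e k) v S)).fderivWithin hU
    rw [pderivWithin, show pderivWithin S k u = fun x => fderivWithin ℝ u S x (e k) from rfl, this]
    simp [e, hH]
  have g0 := hb.vertex i (1, 0) (by decide)
  have g1 := hb.vertex i (0, 1) (by decide)
  have h00 := hb.vertex i (2, 0) (by decide)
  have h01 := hb.vertex i (1, 1) (by decide)
  have h11 := hb.vertex i (0, 2) (by decide)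
  rw [← le_div_iff₀ (by positivity)] at g0 g1 h00 h01 h11
  change |fderivWithin ℝ u S v (e 0)| ≤ M / Q.size ^ 1 at g0
  change |fderivWithin ℝ u S v (e 1)| ≤ M / Q.size ^ 1 at g1
  change |pderivWithin S 0 (pderivWithin S 0 u) v| ≤ M / Q.size ^ 2 at h00
  change |pderivWithin S 0 (pderivWithin S 1 u) v| ≤ M / Q.size ^ 2 at h01
  change |pderivWithin S 1 (pderivWithin S 1 u) v| ≤ M / Q.size ^ 2 at h11
  rw [pow_one] at g0 g1
  rw [hpd] at h00 h01 h11
  have h10 : |H (e 1) (e 0)| ≤ M / Q.size ^ 2 := by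
    rw [hsymm (e 1) (e 0)]; exact h01
  have comb : ∀ (f : Plane →L[ℝ] ℝ) (a : Plane) (B : ℝ), |f (e 0)| ≤ B → |f (e 1)| ≤ B →
      |f a| ≤ 2 * ‖a‖ * B := by
    intro f a B h0 h1
    rw [clm_eq_sum_single a f]
    refine (abs_add_le _ _).trans ?_
    rw [abs_mul, abs_mul]
    have := mul_le_mul (abs_coord_le a 0) h0 (abs_nonneg _) (norm_nonneg a)
    have := mul_le_mul (abs_coord_le a 1) h1 (abs_nonneg _) (norm_nonneg a)
    linarith
  refine ⟨fun a => ?_, H, hG.hasFDerivWithinAt, fun a b => ?_⟩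
  · rw [mul_div_assoc]
    exact comb _ a _ g0 g1
  · have h0 := comb (H.flip (e 0)) a _ h00 h10
    have h1 := comb (H.flip (e 1)) a _ h01 h11
    have := comb (H a) b _ h0 h1
    refine this.trans (le_of_eq ?_)
    ring

end
end BSQuad

namespace BSQuad
noncomputable section

open MeasureTheory Set Filter Topology

variable {p : ℕ} {Q : ConvexQuad} {u : Plane → ℝ}

/-! ### Derivatives along curves -/

lemma hasDerivWithinAt_comp_curve {f : Plane → ℝ} {γ : ℝ → Plane} {γ' : Plane} {s : ℝ}
    (hf : DifferentiableWithinAt ℝ f Q.closed (γ s)) (hγ : HasDerivAt γ γ' s)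
    (hm : MapsTo γ (Icc 0 1) Q.closed) :
    HasDerivWithinAt (fun s => f (γ s)) (fderivWithin ℝ f Q.closed (γ s) γ') (Icc 0 1) s :=
  hf.hasFDerivWithinAt.comp_hasDerivWithinAt s hγ.hasDerivWithinAt hm

lemma eq_of_hasDerivWithinAt_unit {f g : ℝ → ℝ} {f' g' : ℝ} {s : ℝ} (hs : s ∈ Icc (0 : ℝ) 1)
    (hf : HasDerivWithinAt f f' (Icc 0 1) s) (hg : HasDerivWithinAt g g' (Icc 0 1) s)
    (h : ∀ x ∈ Icc (0 : ℝ) 1, f x = g x) : f' = g' :=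
  ((uniqueDiffOn_Icc one_pos).uniqueDiffWithinAt hs).eq_deriv _ hf (hg.congr h (h s hs))

namespace ConvexQuad

lemma hasDerivAt_param_left (Q : ConvexQuad) (s t : ℝ) :
    HasDerivAt (fun s => Q.param s t) (Q.colS t) s := by
  simp only [param_eq_line]
  have := ((hasDerivAt_id s).smul_const (Q.colS t)).const_add
    ((1 - t) • Q.vertex 0 + t • Q.vertex 3)
  rw [one_smul] at this
  exact this

lemma param_eq_line' (Q : ConvexQuad) (s t : ℝ) : Q.param s t =
    ((1 - s) • Q.vertex 0 + s • Q.vertex 1) + t • Q.colT s := by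
  simp only [param, colT]; module

lemma hasDerivAt_param_right (Q : ConvexQuad) (s t : ℝ) :
    HasDerivAt (fun t => Q.param s t) (Q.colT s) t := by
  simp only [param_eq_line']
  have := ((hasDerivAt_id t).smul_const (Q.colT s)).const_add
    ((1 - s) • Q.vertex 0 + s • Q.vertex 1)
  rw [one_smul] at this
  exact this

lemma colS_zero (Q : ConvexQuad) : Q.colS 0 = Q.edgeVec 0 := by
  simp [colS, edgeVec]

lemma hasDerivAt_edgeParam_zero (Q : ConvexQuad) (s : ℝ) :
    HasDerivAt (Q.edgeParam 0) (Q.edgeVec 0) s := by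
  have := Q.hasDerivAt_param_left s 0
  rw [colS_zero] at this
  exact this.congr_of_eventuallyEq (Eventually.of_forall Q.edgeParam_zero)

lemma edgeParam_zero_mem (Q : ConvexQuad) {s : ℝ} (hs : s ∈ Icc (0 : ℝ) 1) :
    Q.edgeParam 0 s ∈ Q.closed := by
  rw [edgeParam_zero]; exact Q.param_mem hs (left_mem_Icc.2 zero_le_one)

/-- The tangential coefficient of a vector with respect to the first edge. -/
def tang (Q : ConvexQuad) (w : Plane) : ℝ :=
  (Q.edgeVec 0 0 * w 0 + Q.edgeVec 0 1 * w 1) / ‖Q.edgeVec 0‖ ^ 2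

/-- The normal coefficient of a vector with respect to the first edge. -/
def nrml (Q : ConvexQuad) (w : Plane) : ℝ := det2 (Q.edgeVec 0) w / ‖Q.edgeVec 0‖

lemma tang_add_nrml (Q : ConvexQuad) (w : Plane) :
    Q.tang w • Q.edgeVec 0 + Q.nrml w • Q.innerNormal 0 = w := by
  have h := Q.edgeVec_pos 0
  have h2 := plane_norm_sq (Q.edgeVec 0)
  have hne : ‖Q.edgeVec 0‖ ^ 2 ≠ 0 := by positivity
  have e : Q.nrml w * ‖Q.edgeVec 0‖⁻¹ = det2 (Q.edgeVec 0) w / ‖Q.edgeVec 0‖ ^ 2 := by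
    rw [nrml]; field_simp
  rw [innerNormal, smul_smul, e, tang, det2]
  ext k
  fin_cases k
  · simp
    field_simp
    rw [h2]
    ring
  · simp
    field_simp
    rw [h2]
    ring

lemma tang_colT (Q : ConvexQuad) (s : ℝ) : Q.tang (Q.colT s) =
    Q.tang (Q.colT 0) + s * (Q.tang (Q.colT 1) - Q.tang (Q.colT 0)) := by
  simp only [tang, colT, PiLp.add_apply, PiLp.smul_apply, smul_eq_mul]
  ring

lemma nrml_colT (Q : ConvexQuad) (s : ℝ) : Q.nrml (Q.colT s) =
    Q.nrml (Q.colT 0) + s * (Q.nrml (Q.colT 1) - Q.nrml (Q.colT 0)) := by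
  simp only [nrml, det2, colT, PiLp.add_apply, PiLp.smul_apply, smul_eq_mul]
  ring

lemma nrml_colT_pos (Q : ConvexQuad) {s : ℝ} (hs : s ∈ Icc (0 : ℝ) 1) : 0 < Q.nrml (Q.colT s) := by
  have := Q.jac_pos hs (left_mem_Icc.2 zero_le_one)
  rw [jac, colS_zero] at this
  exact div_pos this (Q.edgeVec_pos 0)

lemma abs_nrml_colT_le (Q : ConvexQuad) {s : ℝ} (hs : s ∈ Icc (0 : ℝ) 1) :
    |Q.nrml (Q.colT s)| ≤ Q.size := by
  have h := Q.edgeVec_pos 0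
  rw [nrml, abs_div, abs_norm, div_le_iff₀ h]
  refine (abs_det2_le _ _).trans ?_
  rw [mul_comm]
  exact mul_le_mul_of_nonneg_right (Q.norm_colT_le hs) h.le

lemma Shape.abs_tang_colT_le {κ : ℝ} (hQ : Q.Shape κ) {s : ℝ} (hs : s ∈ Icc (0 : ℝ) 1) :
    |Q.tang (Q.colT s)| ≤ 1 / κ := by
  have h := Q.edgeVec_pos 0
  have hκ := hQ.pos
  rw [tang, abs_div, abs_of_pos (by positivity : 0 < ‖Q.edgeVec 0‖ ^ 2), div_le_div_iff₀ (by positivity) hκ]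
  have h1 := abs_dot_le (Q.edgeVec 0) (Q.colT s)
  have h2 := mul_le_mul_of_nonneg_left (Q.norm_colT_le hs) h.le
  have h3 := mul_le_mul_of_nonneg_left (hQ.edge 0) h.le
  nlinarith

lemma norm_innerNormal (Q : ConvexQuad) (i : Fin 4) : ‖Q.innerNormal i‖ = 1 := by
  have h := Q.edgeVec_pos i
  have : ‖(!₂[-(Q.edgeVec i 1), Q.edgeVec i 0] : Plane)‖ = ‖Q.edgeVec i‖ := by
    refine (sq_eq_sq₀ (norm_nonneg _) (norm_nonneg _)).1 ?_
    rw [plane_norm_sq, plane_norm_sq]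
    simp
    ring
  rw [innerNormal, norm_smul, this, norm_inv, norm_norm, inv_mul_cancel₀ h.ne']

end ConvexQuad

lemma differentiableOn_lift (hp : 3 ≤ p) (c : Coef p) :
    DifferentiableOn ℝ (lift Q p c) Q.closed :=
  (contDiffOn_lift c).differentiableOn (by
    have : p - 2 ≠ 0 := by omega
    exact_mod_cast this)

/-- Away from the knot lines the tensor product spline is smooth to every order, and so is the
inverse of the bilinear map. -/
lemma contDiffWithinAt_lift {s t : ℝ} (hs : s ∈ Icc (0 : ℝ) 1) (ht : t ∈ Icc (0 : ℝ) 1)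
    (hs' : ∀ a < numSplit p - 1, s ≠ knot (numSplit p) a)
    (ht' : ∀ a < numSplit p - 1, t ≠ knot (numSplit p) a) (c : Coef p) (n : ℕ) :
    ContDiffWithinAt ℝ n (lift Q p c) Q.closed (Q.param s t) := by
  have h := (Q.contDiffOn_inv n) _ (Q.param_mem hs ht)
  have h2 := contDiffAt_surf hs' ht' c n
  rw [← Q.inv_param hs ht] at h2
  refine (h2.comp_contDiffWithinAt (Q.param s t) h).congr (fun x hx => ?_) ?_
  · rw [lift, indicator_of_mem hx]; rfl
  · rw [lift, indicator_of_mem (Q.param_mem hs ht)]; rfl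

lemma fderivWithin_lift_colS (hp : 3 ≤ p) (c : Coef p) {s t : ℝ} (hs : s ∈ Icc (0 : ℝ) 1)
    (ht : t ∈ Icc (0 : ℝ) 1) :
    fderivWithin ℝ (lift Q p c) Q.closed (Q.param s t) (Q.colS t) = surf p 1 0 c s t :=
  eq_of_hasDerivWithinAt_unit hs
    (hasDerivWithinAt_comp_curve (γ := fun s => Q.param s t)
      (differentiableOn_lift hp c _ (Q.param_mem hs ht))
      (Q.hasDerivAt_param_left s t) fun _ hx => Q.param_mem hx ht)
    (hasDerivAt_surf_left hp 0 c s t).hasDerivWithinAt fun _ hx => lift_param c hx ht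

lemma fderivWithin_lift_colT (hp : 3 ≤ p) (c : Coef p) {s t : ℝ} (hs : s ∈ Icc (0 : ℝ) 1)
    (ht : t ∈ Icc (0 : ℝ) 1) :
    fderivWithin ℝ (lift Q p c) Q.closed (Q.param s t) (Q.colT s) = surf p 0 1 c s t :=
  eq_of_hasDerivWithinAt_unit ht
    (hasDerivWithinAt_comp_curve (differentiableOn_lift hp c _ (Q.param_mem hs ht))
      (Q.hasDerivAt_param_right s t) fun _ hx => Q.param_mem hs hx)
    (hasDerivAt_surf_right hp 0 c s t).hasDerivWithinAt fun _ hx => lift_param c hs hx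

/-- The gradient in terms of the derivatives on the square. -/
lemma fderivWithin_lift (hp : 3 ≤ p) (c : Coef p) {s t : ℝ} (hs : s ∈ Icc (0 : ℝ) 1)
    (ht : t ∈ Icc (0 : ℝ) 1) (e : Plane) :
    fderivWithin ℝ (lift Q p c) Q.closed (Q.param s t) e =
      (det2 e (Q.colT s) * surf p 1 0 c s t + det2 (Q.colS t) e * surf p 0 1 c s t) /
        Q.jac s t := by
  have hj : Q.jac s t ≠ 0 := (Q.jac_pos hs ht).ne'
  have he : Q.jac s t • e = det2 e (Q.colT s) • Q.colS t + det2 (Q.colS t) e • Q.colT s := by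
    ext k
    fin_cases k <;> simp [ConvexQuad.jac, det2] <;> ring
  rw [eq_div_iff hj, ← fderivWithin_lift_colS hp c hs ht, ← fderivWithin_lift_colT hp c hs ht,
    mul_comm, ← smul_eq_mul, ← map_smul, he, map_add, map_smul, map_smul, smul_eq_mul, smul_eq_mul]

lemma contDiff_spline_one {k d r : ℕ} (c : SplineIdx k d (r + 1) → ℝ) :
    ContDiff ℝ r (spline k d (r + 1) 1 c) := by
  have h := contDiff_spline c
  rw [show ((r + 1 : ℕ) : WithTop ℕ∞) = (r : WithTop ℕ∞) + 1 by norm_cast,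
    contDiff_succ_iff_deriv] at h
  have e : deriv (spline k d (r + 1) 0 c) = spline k d (r + 1) 1 c :=
    funext fun s => (hasDerivAt_spline (n := 0) (by omega) c s).deriv
  rw [e] at h
  exact h.2.2

/-! ### The conditions on the first edge -/

/-- The conditions of the local space on the first edge. -/
structure EdgeCond (Q : ConvexQuad) (p : ℕ) (u : Plane → ℝ) : Prop where
  trace_smooth : ContDiffOn ℝ (p - 1 : ℕ) (fun s => u (Q.edgeParam 0 s)) (Icc 0 1)
  normal_poly : ∀ a : Fin (numSplit p),
    IsPolyOn (p - 1) (subInterval p a) fun s => Q.normalDeriv 0 u (Q.edgeParam 0 s)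

lemma zero_ne_knot (a : ℕ) (_ : a < numSplit p - 1) : (0 : ℝ) ≠ knot (numSplit p) a :=
  (knot_pos _ _ (numSplit_pos p)).ne

lemma one_ne_knot (a : ℕ) (h : a < numSplit p - 1) : (1 : ℝ) ≠ knot (numSplit p) a :=
  (knot_lt_one h).ne'

/-- Bounds for the trace and the normal derivative at an end point of the first edge. -/
lemma edge_vertex_bounds (hp : 3 ≤ p) {c : Coef p} {M : ℝ}
    (hb : BoundaryBound Q p (lift Q p c) M) {x : ℝ} (hx : x ∈ Icc (0 : ℝ) 1) {j : Fin 4}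
    (hj : Q.edgeParam 0 x = Q.vertex j) (h2 : ContDiffWithinAt ℝ 2 (lift Q p c) Q.closed (Q.vertex j))
    {cT : SplineIdx (numSplit p) p (p - 1) → ℝ}
    (hT0 : ∀ s ∈ Icc (0 : ℝ) 1, lift Q p c (Q.edgeParam 0 s) = spline _ _ _ 0 cT s)
    (hT1 : ∀ s ∈ Icc (0 : ℝ) 1, fderivWithin ℝ (lift Q p c) Q.closed (Q.edgeParam 0 s) (Q.edgeVec 0)
      = spline _ _ _ 1 cT s)
    {cN : SplineIdx (numSplit p) (p - 1) (p - 2) → ℝ}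
    (hN : ∀ s ∈ Icc (0 : ℝ) 1, fderivWithin ℝ (lift Q p c) Q.closed (Q.edgeParam 0 s)
      (Q.innerNormal 0) = spline _ _ _ 0 cN s) :
    (∀ n < 3, |spline _ _ _ n cT x| ≤ 4 * M) ∧ ∀ n < 2, |spline _ _ _ n cN x| ≤ 4 * M / Q.size := by
  obtain ⟨hG, H, hH, hHb⟩ := vertex_bounds hb j h2
  have hs := Q.size_pos
  have ht := Q.norm_edgeVec_le 0
  have hn := Q.norm_innerNormal 0
  have hM0 := hb.vertex j (0, 0) (by decide)
  change |lift Q p c (Q.vertex j)| * Q.size ^ 0 ≤ M at hM0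
  rw [pow_zero, mul_one] at hM0
  have hM : 0 ≤ M := (abs_nonneg _).trans hM0
  -- The second derivative is available at the vertex alone: for `p = 3` the gradient is only known
  -- to be continuous along the rest of the edge.
  have hcurve : ∀ a, HasDerivWithinAt
      (fun s => fderivWithin ℝ (lift Q p c) Q.closed (Q.edgeParam 0 s) a) (H (Q.edgeVec 0) a)
      (Icc 0 1) x := by
    intro a
    rw [← hj] at hH
    have h1 := hH.comp_hasDerivWithinAt x (Q.hasDerivAt_edgeParam_zero x).hasDerivWithinAt
      (fun s hs => Q.edgeParam_zero_mem hs)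
    refine HasDerivWithinAt.congr_deriv (h1.clm_apply (hasDerivWithinAt_const x (Icc 0 1) a)) ?_
    simp
  refine ⟨fun n hn3 => ?_, fun n hn2 => ?_⟩
  · interval_cases n
    · rw [← hT0 x hx, hj]; linarith
    · rw [← hT1 x hx, hj]
      refine (hG _).trans ?_
      rw [div_le_iff₀ hs]
      nlinarith
    · have := eq_of_hasDerivWithinAt_unit hx (hcurve (Q.edgeVec 0))
        (hasDerivAt_spline (n := 1) (by omega) cT x).hasDerivWithinAt hT1
      rw [← this]
      refine (hHb _ _).trans ?_
      rw [div_le_iff₀ (by positivity)]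
      have := mul_le_mul ht ht (norm_nonneg _) hs.le
      nlinarith
  · interval_cases n
    · rw [← hN x hx, hj]
      refine (hG _).trans ?_
      rw [hn]
      gcongr
      linarith
    · have := eq_of_hasDerivWithinAt_unit hx (hcurve (Q.innerNormal 0))
        (hasDerivAt_spline (n := 0) (by omega) cN x).hasDerivWithinAt hN
      rw [← this]
      refine (hHb _ _).trans ?_
      rw [hn, div_le_div_iff₀ (by positivity) hs]
      nlinarith [mul_le_mul_of_nonneg_left ht (by positivity : 0 ≤ 4 * M * Q.size)]

/-- Trace and normal derivative are splines that are determined by their Hermite data at the two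
vertices and their values at the nodes. The transversal derivative is recovered from them by
splitting its direction into tangential and normal parts, whose coefficients are at most `1 / κ` and
`h`. -/
lemma exists_edge_bound (hp : 3 ≤ p) {κ : ℝ} (hκ : 0 < κ) : ∃ C : ℝ, 0 ≤ C ∧
    ∀ (Q : ConvexQuad) (c : Coef p) (M : ℝ), Q.Shape κ → BoundaryBound Q p (lift Q p c) M →
      EdgeCond Q p (lift Q p c) →
      ∀ n < 2, ∀ s ∈ Icc (0 : ℝ) 1, |surf p 0 n c s 0| ≤ C * M := by
  obtain ⟨C₁, hC₁, h₁⟩ := (splineUnisolvent_trace hp).exists_bound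
  obtain ⟨C₂, hC₂, h₂⟩ := (splineUnisolvent_normal hp).exists_bound
  set K₁ : ℝ := (Fintype.card (SplineIdx (numSplit p) p (p - 1)) : ℝ) with hK₁
  set K₂ : ℝ := (Fintype.card (SplineIdx (numSplit p) (p - 1) (p - 2)) : ℝ) with hK₂
  have hK₁0 : 0 ≤ K₁ := Nat.cast_nonneg _
  have hK₂0 : 0 ≤ K₂ := Nat.cast_nonneg _
  refine ⟨K₁ * (C₁ * 4) + (1 / κ * (K₁ * p * (C₁ * 4)) + K₂ * (C₂ * 4)), by positivity,
    fun Q c M hQ hb hE => ?_⟩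
  have hs := Q.size_pos
  have hI0 : (0 : ℝ) ∈ Icc (0 : ℝ) 1 := left_mem_Icc.2 zero_le_one
  have hI1 : (1 : ℝ) ∈ Icc (0 : ℝ) 1 := right_mem_Icc.2 zero_le_one
  have hM : 0 ≤ M := (mul_nonneg (abs_nonneg _) (by positivity)).trans
    (hb.vertex 0 (0, 0) (by decide))
  -- the trace
  obtain ⟨cT, hT0⟩ := exists_spline_eq (numSplit_pos p) (Nat.sub_le p 1) hE.trace_smooth
    fun a ha => by
      obtain ⟨b, hb, hb0⟩ := exists_mem_cell (numSplit_pos p) hI0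
      simp only [Q.edgeParam_zero]
      exact ((memBase_lift c).bipoly ⟨a, ha⟩ ⟨b, hb⟩).isPolyOn_left hb0
  have hT1 : ∀ s ∈ Icc (0 : ℝ) 1, fderivWithin ℝ (lift Q p c) Q.closed (Q.edgeParam 0 s)
      (Q.edgeVec 0) = spline _ _ _ 1 cT s := fun s hs =>
    eq_of_hasDerivWithinAt_unit hs (hasDerivWithinAt_comp_curve
      (differentiableOn_lift hp c _ (Q.edgeParam_zero_mem hs)) (Q.hasDerivAt_edgeParam_zero s)
      fun _ hx => Q.edgeParam_zero_mem hx)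
      (hasDerivAt_spline (n := 0) (by omega) cT s).hasDerivWithinAt hT0
  -- the normal derivative
  have hdec : ∀ s ∈ Icc (0 : ℝ) 1, surf p 0 1 c s 0 = Q.tang (Q.colT s) * spline _ _ _ 1 cT s +
      Q.nrml (Q.colT s) * Q.normalDeriv 0 (lift Q p c) (Q.edgeParam 0 s) := by
    intro s hs
    rw [← fderivWithin_lift_colT (Q := Q) hp c hs hI0, ← hT1 s hs, ConvexQuad.normalDeriv,
      Q.edgeParam_zero, ← smul_eq_mul, ← smul_eq_mul, ← map_smul, ← map_smul, ← map_add,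
      Q.tang_add_nrml]
  -- The local space imposes no smoothness on the normal derivative. It follows by solving `hdec`
  -- for it: the coefficient is affine in `s` and positive, and the trace has one more order of
  -- smoothness than the space.
  have hgs : ContDiffOn ℝ (p - 2 : ℕ)
      (fun s => Q.normalDeriv 0 (lift Q p c) (Q.edgeParam 0 s)) (Icc 0 1) := by
    have e1 : ContDiff ℝ (p - 2 : ℕ) fun s => surf p 0 1 c s 0 := contDiff_spline _
    have e2 : ContDiff ℝ (p - 2 : ℕ) (spline (numSplit p) p (p - 1) 1 cT) := by
      obtain ⟨r, rfl⟩ : ∃ r, p = r + 2 := ⟨p - 2, by omega⟩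
      exact contDiff_spline_one cT
    have e3 : ContDiff ℝ (p - 2 : ℕ) fun s => Q.tang (Q.colT s) := by
      rw [funext Q.tang_colT]; fun_prop
    have e4 : ContDiff ℝ (p - 2 : ℕ) fun s => Q.nrml (Q.colT s) := by
      rw [funext Q.nrml_colT]; fun_prop
    refine ((e1.sub (e3.mul e2)).contDiffOn.div e4.contDiffOn
      fun s hs => (Q.nrml_colT_pos hs).ne').congr fun s hs => ?_
    rw [Pi.div_apply, eq_div_iff (Q.nrml_colT_pos hs).ne', hdec s hs]
    ring
  obtain ⟨cN, hN⟩ := exists_spline_eq (d := p - 1) (r := p - 2) (numSplit_pos p) (by omega) hgs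
    fun a ha => hE.normal_poly ⟨a, ha⟩
  -- the data
  have b0 := edge_vertex_bounds hp hb hI0 (j := 0) (by simp [ConvexQuad.edgeParam])
    (by
      have := contDiffWithinAt_lift (Q := Q) (p := p) hI0 hI0 zero_ne_knot zero_ne_knot c 2
      rwa [show Q.param 0 0 = Q.vertex 0 by simp [ConvexQuad.param]] at this) hT0 hT1 hN
  have b1 := edge_vertex_bounds hp hb hI1 (j := 1) (by simp [ConvexQuad.edgeParam])
    (by
      have := contDiffWithinAt_lift (Q := Q) (p := p) hI1 hI0 one_ne_knot zero_ne_knot c 2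
      rwa [show Q.param 1 0 = Q.vertex 1 by simp [ConvexQuad.param]] at this) hT0 hT1 hN
  have cTb := h₁ cT (4 * M) b0.1 b1.1 fun q hq => by
    rw [← hT0 _ (traceNodes_mem hp hq)]
    linarith [hb.trace 0 q hq]
  have cNb := h₂ cN (4 * M / Q.size) b0.2 b1.2 fun q hq => by
    rw [← hN _ (normalNodes_mem hp hq), le_div_iff₀ hs]
    linarith [hb.normal 0 q hq]
  intro n hn s hs'
  have f0 : |spline _ _ _ 0 cT s| ≤ K₁ * (C₁ * 4) * M :=
    (abs_spline_le 0 cTb hs').trans (le_of_eq (by rw [pow_zero]; ring))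
  have f1 : |spline _ _ _ 1 cT s| ≤ K₁ * p * (C₁ * 4) * M :=
    (abs_spline_le 1 cTb hs').trans (le_of_eq (by rw [pow_one]; ring))
  have f2 : |spline _ _ _ 0 cN s| ≤ K₂ * (C₂ * 4) * M / Q.size :=
    (abs_spline_le 0 cNb hs').trans (le_of_eq (by rw [pow_zero]; ring))
  interval_cases n
  · rw [← lift_param (Q := Q) c hs' hI0, ← Q.edgeParam_zero, hT0 s hs']
    refine f0.trans (mul_le_mul_of_nonneg_right ?_ hM)
    exact le_add_of_nonneg_right (by positivity)
  · rw [hdec s hs']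
    refine (abs_add_le _ _).trans ?_
    rw [abs_mul, abs_mul, hN s hs']
    have g1 := mul_le_mul (hQ.abs_tang_colT_le hs') f1 (abs_nonneg _) (by positivity)
    have g2 := mul_le_mul (Q.abs_nrml_colT_le hs') f2 (abs_nonneg _) hs.le
    rw [mul_div_cancel₀ _ hs.ne'] at g2
    have g3 : 0 ≤ K₁ * (C₁ * 4) * M := by positivity
    linarith

end
end BSQuad

namespace BSQuad
noncomputable section

open MeasureTheory Set Filter Topology

variable {p : ℕ} {Q : ConvexQuad} {u v : Plane → ℝ}

/-! ### The local space in terms of its edges -/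

lemma ConvexQuad.edgeParam_mem (Q : ConvexQuad) (i : Fin 4) {s : ℝ} (hs : s ∈ Icc (0 : ℝ) 1) :
    Q.edgeParam i s ∈ Q.closed :=
  Q.closed_convex (subset_convexHull ℝ _ (mem_range_self _))
    (subset_convexHull ℝ _ (mem_range_self _)) (sub_nonneg.2 hs.2) hs.1 (by ring)

/-- The conditions on the edge `i` are those on the first edge after `i` quarter turns; hence a
result on `EdgeCond` covers all edges. -/
lemma memLocalSpace_iff : MemLocalSpace Q p u ↔
    MemBase Q p u ∧ ∀ i : Fin 4, EdgeCond (ConvexQuad.rot^[i] Q) p u := by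
  constructor
  · intro h
    refine ⟨⟨h.eq_zero_off, h.smooth, h.bipoly⟩, fun i => ⟨?_, fun a => ?_⟩⟩
    · simp only [Q.iterate_rot_edgeParam]
      exact h.trace_smooth i
    · simp only [Q.iterate_rot_edgeParam, Q.iterate_rot_normalDeriv]
      exact h.normal_poly i a
  · rintro ⟨h, he⟩
    refine ⟨h.eq_zero_off, h.smooth, h.bipoly, fun i => ?_, fun i a => ?_⟩
    · have := (he i).trace_smooth
      simpa only [Q.iterate_rot_edgeParam] using this
    · have := (he i).normal_poly a
      simpa only [Q.iterate_rot_edgeParam, Q.iterate_rot_normalDeriv] using this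

/-! ### Stability -/

lemma surf_rot (hp : 3 ≤ p) {c c' : Coef p} (h : lift Q p c = lift Q.rot p c') {s t : ℝ}
    (hs : s ∈ Icc (0 : ℝ) 1) (ht : t ∈ Icc (0 : ℝ) 1) :
    surf p 0 0 c' s t = surf p 0 0 c (1 - t) s ∧ surf p 0 1 c' s t = -surf p 1 0 c (1 - t) s ∧
      surf p 1 0 c' s t = surf p 0 1 c (1 - t) s := by
  have hr : ∀ {x : ℝ}, x ∈ Icc (0 : ℝ) 1 → 1 - x ∈ Icc (0 : ℝ) 1 := fun hx =>
    ⟨by linarith [hx.2], by linarith [hx.1]⟩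
  have key : ∀ {s t : ℝ}, s ∈ Icc (0 : ℝ) 1 → t ∈ Icc (0 : ℝ) 1 →
      surf p 0 0 c' s t = surf p 0 0 c (1 - t) s := by
    intro s t hs ht
    rw [← lift_param (Q := Q.rot) c' hs ht, ← h, Q.rot_param, lift_param c (hr ht) hs]
  refine ⟨key hs ht, ?_, ?_⟩
  · have h2 : HasDerivAt (fun t => surf p 0 0 c (1 - t) s) (-surf p 1 0 c (1 - t) s) t := by
      have := (hasDerivAt_surf_left hp 0 c (1 - t) s).comp t ((hasDerivAt_id t).const_sub 1)
      refine HasDerivAt.congr_deriv this ?_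
      ring
    exact eq_of_hasDerivWithinAt_unit ht (hasDerivAt_surf_right hp 0 c' s t).hasDerivWithinAt
      h2.hasDerivWithinAt fun x hx => key hs hx
  · exact eq_of_hasDerivWithinAt_unit hs (hasDerivAt_surf_left hp 0 c' s t).hasDerivWithinAt
      (hasDerivAt_surf_right hp 0 c (1 - t) s).hasDerivWithinAt fun x hx => key hx ht

/-- The coefficients of a function of the local space are bounded by its degrees of freedom. -/
lemma exists_coef_bound (hp : 3 ≤ p) {κ : ℝ} (hκ : 0 < κ) : ∃ C : ℝ, 0 ≤ C ∧
    ∀ (Q : ConvexQuad) (c : Coef p) (M : ℝ), Q.Shape κ → MemLocalSpace Q p (lift Q p c) →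
      BoundaryBound Q p (lift Q p c) M →
      (∀ q ∈ faceNodes p, ∀ q' ∈ faceNodes p, |lift Q p c (Q.param (q : ℝ) (q' : ℝ))| ≤ M) →
      ∀ i j, |c i j| ≤ C * M := by
  obtain ⟨C₁, hC₁, h₁⟩ := exists_edge_bound hp hκ
  obtain ⟨C₂, hC₂, h₂⟩ := exists_surf_bound hp
  refine ⟨C₂ * (C₁ + 1), by positivity, fun Q c M hQ hmem hb hF => ?_⟩
  obtain ⟨hbase, he⟩ := memLocalSpace_iff.1 hmem
  have e0 : EdgeCond Q p (lift Q p c) := he 0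
  have e1 : EdgeCond Q.rot p (lift Q p c) := he 1
  have e2 : EdgeCond Q.rot.rot p (lift Q p c) := he 2
  have e3 : EdgeCond Q.rot.rot.rot p (lift Q p c) := he 3
  obtain ⟨c1, hc1⟩ := hbase.rot.exists_lift hp
  obtain ⟨c2, hc2⟩ := hbase.rot.rot.exists_lift hp
  obtain ⟨c3, hc3⟩ := hbase.rot.rot.rot.exists_lift hp
  have b1 := hb.rot
  have b2 := hb.rot.rot
  have b3 := hb.rot.rot.rot
  have r1 := fun {s t : ℝ} => surf_rot hp hc1 (s := s) (t := t)
  have r2 := fun {s t : ℝ} => surf_rot hp (hc1.symm.trans hc2) (s := s) (t := t)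
  have r3 := fun {s t : ℝ} => surf_rot hp (hc2.symm.trans hc3) (s := s) (t := t)
  rw [hc1] at e1 b1
  rw [hc2] at e2 b2
  rw [hc3] at e3 b3
  have k0 := h₁ Q c M hQ hb e0
  have k1 := h₁ _ c1 M hQ.rot b1 e1
  have k2 := h₁ _ c2 M hQ.rot.rot b2 e2
  have k3 := h₁ _ c3 M hQ.rot.rot.rot b3 e3
  have hI0 : (0 : ℝ) ∈ Icc (0 : ℝ) 1 := left_mem_Icc.2 zero_le_one
  have hI1 : (1 : ℝ) ∈ Icc (0 : ℝ) 1 := right_mem_Icc.2 zero_le_one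
  have hM : 0 ≤ M := (mul_nonneg (abs_nonneg _) (by have := Q.size_pos; positivity)).trans
    (hb.vertex 0 (0, 0) (by decide))
  have hC : C₁ * M ≤ (C₁ + 1) * M := by linarith
  intro i j
  rw [mul_assoc]
  refine h₂ c ((C₁ + 1) * M) (fun n hn s hs => ?_) (fun q hq q' hq' => ?_) i j
  · have hs' : 1 - s ∈ Icc (0 : ℝ) 1 := ⟨by linarith [hs.2], by linarith [hs.1]⟩
    have ess : 1 - (1 - s) = s := by ring
    -- The sides `t = 0`, `t = 1`, `s = 0` and `s = 1` are the first edges after zero, two, three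
    -- and one quarter turns. Two of them are traversed backwards, hence the parameter `1 - s`.
    refine ⟨(k0 n hn s hs).trans hC, ?_, ?_, ?_⟩
    · refine le_trans (le_of_eq ?_) ((k2 n hn (1 - s) hs').trans hC)
      interval_cases n
      · rw [(r2 hs' hI0).1, sub_zero, (r1 hI1 hs').1, ess]
      · rw [(r2 hs' hI0).2.1, sub_zero, (r1 hI1 hs').2.2, ess, abs_neg]
    · refine le_trans (le_of_eq ?_) ((k3 n hn (1 - s) hs').trans hC)
      interval_cases n
      · rw [(r3 hs' hI0).1, sub_zero, (r2 hI1 hs').1, ess, (r1 hs hI1).1, sub_self]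
      · rw [(r3 hs' hI0).2.1, sub_zero, (r2 hI1 hs').2.2, ess, (r1 hs hI1).2.1, sub_self, neg_neg]
    · refine le_trans (le_of_eq ?_) ((k1 n hn s hs).trans hC)
      interval_cases n
      · rw [(r1 hs hI0).1, sub_zero]
      · rw [(r1 hs hI0).2.1, sub_zero, abs_neg]
  · rw [← lift_param (Q := Q) c (faceNodes_mem hp hq) (faceNodes_mem hp hq')]
    refine (hF q hq q' hq').trans ?_
    have := mul_nonneg hC₁ hM
    linarith

/-! ### Linearity of the degrees of freedom -/

/-- The functions to which the degrees of freedom are applied. -/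
structure DofRegular (Q : ConvexQuad) (u : Plane → ℝ) : Prop where
  diff : DifferentiableOn ℝ u Q.closed
  vertex : ∀ i, ContDiffWithinAt ℝ 2 u Q.closed (Q.vertex i)

lemma dofRegular_of_contDiffOn (h : ContDiffOn ℝ 2 u Q.closed) : DofRegular Q u where
  diff := h.differentiableOn (by norm_num)
  vertex i := h _ (subset_convexHull ℝ _ (mem_range_self i))

/-- The vertices have parameters `0` and `1`, which are not knots. So second derivatives exist there
although for `p = 3` the space only requires class `C¹`. -/
lemma dofRegular_lift (hp : 3 ≤ p) (c : Coef p) : DofRegular Q (lift Q p c) where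
  diff := differentiableOn_lift hp c
  vertex i := by
    have hI0 : (0 : ℝ) ∈ Icc (0 : ℝ) 1 := left_mem_Icc.2 zero_le_one
    have hI1 : (1 : ℝ) ∈ Icc (0 : ℝ) 1 := right_mem_Icc.2 zero_le_one
    fin_cases i
    · have := contDiffWithinAt_lift (Q := Q) (p := p) hI0 hI0 zero_ne_knot zero_ne_knot c 2
      rwa [show Q.param 0 0 = Q.vertex 0 by simp [ConvexQuad.param]] at this
    · have := contDiffWithinAt_lift (Q := Q) (p := p) hI1 hI0 one_ne_knot zero_ne_knot c 2
      rwa [show Q.param 1 0 = Q.vertex 1 by simp [ConvexQuad.param]] at this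
    · have := contDiffWithinAt_lift (Q := Q) (p := p) hI1 hI1 one_ne_knot one_ne_knot c 2
      rwa [show Q.param 1 1 = Q.vertex 2 by simp [ConvexQuad.param]] at this
    · have := contDiffWithinAt_lift (Q := Q) (p := p) hI0 hI1 zero_ne_knot one_ne_knot c 2
      rwa [show Q.param 0 1 = Q.vertex 3 by simp [ConvexQuad.param]] at this

lemma MemLocalSpace.exists_lift (hp : 3 ≤ p) (h : MemLocalSpace Q p u) : ∃ c, u = lift Q p c :=
  (memLocalSpace_iff.1 h).1.exists_lift hp

lemma MemLocalSpace.dofRegular (hp : 3 ≤ p) (h : MemLocalSpace Q p u) : DofRegular Q u := by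
  obtain ⟨c, rfl⟩ := h.exists_lift hp
  exact dofRegular_lift hp c

lemma DofRegular.comb (hu : DofRegular Q u) (hv : DofRegular Q v) (a : ℝ) :
    DofRegular Q (a • u + v) where
  diff := (hu.diff.const_smul a).add hv.diff
  vertex i := ((hu.vertex i).const_smul a).add (hv.vertex i)

lemma fderivWithin_comb {S : Set Plane} {x : Plane} (hS : UniqueDiffWithinAt ℝ S x)
    (hu : DifferentiableWithinAt ℝ u S x) (hv : DifferentiableWithinAt ℝ v S x) (a : ℝ) :
    fderivWithin ℝ (a • u + v) S x = a • fderivWithin ℝ u S x + fderivWithin ℝ v S x := by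
  rw [fderivWithin_add hS (hu.const_smul a) hv, fderivWithin_const_smul hS hu]

lemma pderivWithin_comb {S : Set Plane} {x : Plane} (hS : UniqueDiffWithinAt ℝ S x)
    (hu : DifferentiableWithinAt ℝ u S x) (hv : DifferentiableWithinAt ℝ v S x) (a : ℝ) (k : Fin 2) :
    pderivWithin S k (a • u + v) x = a * pderivWithin S k u x + pderivWithin S k v x := by
  rw [pderivWithin, fderivWithin_comb hS hu hv]
  rfl

lemma ConvexQuad.vertex_mem (Q : ConvexQuad) (i : Fin 4) : Q.vertex i ∈ Q.closed :=
  subset_convexHull ℝ _ (mem_range_self i)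

lemma DofRegular.differentiableWithinAt_pderivWithin (hu : DofRegular Q u) (i : Fin 4) (k : Fin 2) :
    DifferentiableWithinAt ℝ (pderivWithin Q.closed k u) Q.closed (Q.vertex i) := by
  have hG : DifferentiableWithinAt ℝ (fderivWithin ℝ u Q.closed) Q.closed (Q.vertex i) :=
    ((hu.vertex i).fderivWithin_right (m := 1) Q.uniqueDiffOn_closed (by norm_num)
      (Q.vertex_mem i)).differentiableWithinAt one_ne_zero
  exact hG.clm_apply (differentiableWithinAt_const _)

lemma DofRegular.mderivWithin_comb (hu : DofRegular Q u) (hv : DofRegular Q v) (a : ℝ) (i : Fin 4)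
    {α : ℕ × ℕ} (hα : α ∈ vertexJets) :
    mderivWithin Q.closed α (a • u + v) (Q.vertex i) =
      a * mderivWithin Q.closed α u (Q.vertex i) + mderivWithin Q.closed α v (Q.vertex i) := by
  have hU := Q.uniqueDiffOn_closed
  have hx := Q.vertex_mem i
  have h1 : ∀ k, ∀ x ∈ Q.closed, pderivWithin Q.closed k (a • u + v) x =
      (a • pderivWithin Q.closed k u + pderivWithin Q.closed k v) x := fun k x hx =>
    pderivWithin_comb (hU x hx) (hu.diff x hx) (hv.diff x hx) a k
  have h2 : ∀ j k, pderivWithin Q.closed j (pderivWithin Q.closed k (a • u + v)) (Q.vertex i) =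
      a * pderivWithin Q.closed j (pderivWithin Q.closed k u) (Q.vertex i) +
        pderivWithin Q.closed j (pderivWithin Q.closed k v) (Q.vertex i) := by
    intro j k
    rw [← pderivWithin_comb (hU _ hx) (hu.differentiableWithinAt_pderivWithin i k)
      (hv.differentiableWithinAt_pderivWithin i k), pderivWithin, pderivWithin,
      fderivWithin_congr (h1 k) (h1 k _ hx)]
  simp only [vertexJets, Finset.mem_insert, Finset.mem_singleton] at hα
  rcases hα with rfl | rfl | rfl | rfl | rfl | rfl
  · rfl
  · exact h1 0 _ hx
  · exact h1 1 _ hx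
  · exact h2 0 0
  · exact h2 0 1
  · exact h2 1 1

lemma DofRegular.dof_comb (hp : 3 ≤ p) (σ : Fin 4 → ℤˣ) (l : DofIndex p) (hu : DofRegular Q u)
    (hv : DofRegular Q v) (a : ℝ) :
    dof Q p σ l (a • u + v) = a * dof Q p σ l u + dof Q p σ l v := by
  rcases l with ⟨i, α⟩ | ⟨i, r⟩ | ⟨i, r⟩ | ⟨r, s⟩
  · exact hu.mderivWithin_comb hv a i α.2
  · rfl
  · have hx := Q.edgeParam_mem i (normalNodes_mem hp r.2)
    simp only [dof, ConvexQuad.normalDeriv]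
    rw [fderivWithin_comb (Q.uniqueDiffOn_closed _ hx) (hu.diff _ hx) (hv.diff _ hx)]
    simp only [add_apply, smul_apply, smul_eq_mul]
    ring
  · rfl

lemma dofRegular_zero : DofRegular Q 0 :=
  dofRegular_of_contDiffOn contDiffOn_const

/-- The functions to which the degrees of freedom are applied, as a subspace. -/
def regular (Q : ConvexQuad) : Submodule ℝ (Plane → ℝ) where
  carrier := {u | DofRegular Q u}
  zero_mem' := dofRegular_zero
  add_mem' {u v} hu hv := by
    have := DofRegular.comb hu hv 1
    rwa [one_smul] at this
  smul_mem' a u hu := by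
    have := DofRegular.comb hu dofRegular_zero a
    rwa [add_zero] at this

/-- The degrees of freedom as linear functionals. -/
def dofLinear (hp : 3 ≤ p) (Q : ConvexQuad) (σ : Fin 4 → ℤˣ) (l : DofIndex p) :
    regular Q →ₗ[ℝ] ℝ where
  toFun u := dof Q p σ l u
  map_add' u v := by
    have := DofRegular.dof_comb hp σ l u.2 v.2 1
    rwa [one_smul, one_mul] at this
  map_smul' a u := by
    have h0 := DofRegular.dof_comb hp σ l (dofRegular_zero (Q := Q)) dofRegular_zero 1
    have := DofRegular.dof_comb hp σ l u.2 (dofRegular_zero (Q := Q)) a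
    simp only [smul_zero, add_zero, one_mul] at h0 this
    rw [Submodule.coe_smul, this, left_eq_add.1 h0]
    simp

/-! ### The local space as a vector space -/

open Polynomial in
lemma IsPolyOn.comb {d : ℕ} {A : Set ℝ} {f g : ℝ → ℝ} (hf : IsPolyOn d A f) (hg : IsPolyOn d A g)
    (a : ℝ) : IsPolyOn d A fun s => a * f s + g s := by
  obtain ⟨P, hP, h1⟩ := hf
  obtain ⟨R, hR, h2⟩ := hg
  refine ⟨a • P + R, (natDegree_add_le _ _).trans (max_le ((natDegree_smul_le _ _).trans hP) hR),
    fun s hs => ?_⟩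
  beta_reduce
  rw [h1 s hs, h2 s hs, eval_add, eval_smul, smul_eq_mul]

lemma IsBiPolyOn.comb {A B : Set ℝ} {f g : ℝ → ℝ → ℝ} (hf : IsBiPolyOn p A B f)
    (hg : IsBiPolyOn p A B g) (a : ℝ) : IsBiPolyOn p A B fun s t => a * f s t + g s t := by
  obtain ⟨c, h1⟩ := hf
  obtain ⟨c', h2⟩ := hg
  refine ⟨fun i j => a * c i j + c' i j, fun s hs t ht => ?_⟩
  beta_reduce
  rw [h1 s hs t ht, h2 s hs t ht]
  simp only [add_mul, Finset.sum_add_distrib, Finset.mul_sum, mul_assoc]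

lemma MemLocalSpace.comb (hp : 3 ≤ p) (hu : MemLocalSpace Q p u) (hv : MemLocalSpace Q p v)
    (a : ℝ) : MemLocalSpace Q p (a • u + v) where
  eq_zero_off x hx := by simp [hu.eq_zero_off x hx, hv.eq_zero_off x hx]
  smooth := (contDiffOn_const.smul hu.smooth).add hv.smooth
  bipoly i j := (hu.bipoly i j).comb (hv.bipoly i j) a
  trace_smooth i := (contDiffOn_const.smul (hu.trace_smooth i)).add (hv.trace_smooth i)
  normal_poly i b := by
    obtain ⟨P, hP, h⟩ := (hu.normal_poly i b).comb (hv.normal_poly i b) a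
    refine ⟨P, hP, fun s hs => ?_⟩
    have hx := Q.edgeParam_mem i (cell_subset b.2 hs)
    rw [← h s hs]
    simp only [ConvexQuad.normalDeriv]
    rw [fderivWithin_comb (Q.uniqueDiffOn_closed _ hx) ((hu.dofRegular hp).diff _ hx)
      ((hv.dofRegular hp).diff _ hx)]
    rfl

lemma memLocalSpace_zero (Q : ConvexQuad) (p : ℕ) : MemLocalSpace Q p 0 where
  eq_zero_off _ _ := rfl
  smooth := contDiffOn_const
  bipoly _ _ := ⟨0, by simp⟩
  trace_smooth _ := contDiffOn_const
  normal_poly _ _ := ⟨0, by simp, fun s _ => by simp [ConvexQuad.normalDeriv]⟩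

/-- The local space as a subspace. -/
def localSpace (hp : 3 ≤ p) (Q : ConvexQuad) : Submodule ℝ (Plane → ℝ) where
  carrier := {u | MemLocalSpace Q p u}
  zero_mem' := memLocalSpace_zero Q p
  add_mem' {u v} hu hv := by
    have := MemLocalSpace.comb hp hu hv 1
    rwa [one_smul] at this
  smul_mem' a u hu := by
    have := MemLocalSpace.comb hp hu (memLocalSpace_zero Q p) a
    rwa [add_zero] at this

/-- A function of the local space with vanishing degrees of freedom is zero. -/
lemma MemLocalSpace.eq_zero_of_dof (hp : 3 ≤ p) (σ : Fin 4 → ℤˣ) (hu : MemLocalSpace Q p u)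
    (h : ∀ l, dof Q p σ l u = 0) : u = 0 := by
  obtain ⟨κ, hQ⟩ := Q.exists_shape
  obtain ⟨c, rfl⟩ := hu.exists_lift hp
  obtain ⟨C, -, hC⟩ := exists_coef_bound hp hQ.pos
  have hc : c = 0 := by
    funext i j
    -- Uniqueness is the stability estimate with the bound `M = 0`.
    have := hC Q c 0 hQ hu ⟨fun i α hα => ?_, fun i q hq => ?_, fun i q hq => ?_⟩
      (fun q hq q' hq' => ?_) i j
    · rw [mul_zero] at this
      exact abs_nonpos_iff.1 this
    · rw [show mderivWithin Q.closed α (lift Q p c) (Q.vertex i) = 0 from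
        h (Sum.inl (i, ⟨α, hα⟩)), abs_zero, zero_mul]
    · rw [show lift Q p c (Q.edgeParam i (q : ℝ)) = 0 from h (Sum.inr (Sum.inl (i, ⟨q, hq⟩))),
        abs_zero]
    · have h1 : ((σ i : ℤ) : ℝ) * Q.normalDeriv i (lift Q p c) (Q.edgeParam i (q : ℝ)) = 0 :=
        h (Sum.inr (Sum.inr (Sum.inl (i, ⟨q, hq⟩))))
      have h2 : ((σ i : ℤ) : ℝ) ≠ 0 := by exact_mod_cast (σ i).ne_zero
      rw [(mul_eq_zero.1 h1).resolve_left h2, abs_zero, zero_mul]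
    · rw [show lift Q p c (Q.param (q : ℝ) (q' : ℝ)) = 0 from
        h (Sum.inr (Sum.inr (Sum.inr (⟨q, hq⟩, ⟨q', hq'⟩)))), abs_zero]
  rw [hc]
  exact (liftLinear Q p).map_zero

end
end BSQuad

namespace BSQuad
noncomputable section

open MeasureTheory Set Filter Topology

variable {p : ℕ} {Q : ConvexQuad} {u v : Plane → ℝ}

/-! ### The conditions on the first edge as linear equations -/

open Polynomial in
/-- The numerator of the normal derivative on the first edge, on a cell. -/
def normalNumer (Q : ConvexQuad) (p a : ℕ) : Coef p →ₗ[ℝ] ℝ[X] where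
  toFun c := splinePoly (numSplit p) p (p - 2) a (fun i => spline (numSplit p) p (p - 2) 1 (c i) 0) -
    (C (Q.tang (Q.colT 0)) + C (Q.tang (Q.colT 1) - Q.tang (Q.colT 0)) * X) *
      derivative (splinePoly (numSplit p) p (p - 2) a
        (fun i => spline (numSplit p) p (p - 2) 0 (c i) 0))
  map_add' c c' := by
    have e : ∀ n i, spline (numSplit p) p (p - 2) n (c i + c' i) 0 =
      spline (numSplit p) p (p - 2) n (c i) 0 + spline (numSplit p) p (p - 2) n (c' i) 0 :=
      fun n i => (splineEval (numSplit p) p (p - 2) n 0).map_add _ _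
    simp only [Pi.add_apply, e, splinePoly, add_smul, Finset.sum_add_distrib, derivative_add]
    ring
  map_smul' y c := by
    have e : ∀ n i, spline (numSplit p) p (p - 2) n (y • c i) 0 =
      y • spline (numSplit p) p (p - 2) n (c i) 0 :=
      fun n i => (splineEval (numSplit p) p (p - 2) n 0).map_smul _ _
    simp only [Pi.smul_apply, e, splinePoly, smul_assoc, ← Finset.smul_sum, derivative_smul,
      RingHom.id_apply, smul_sub, mul_smul_comm]

open Polynomial in
/-- Divisibility of a polynomial of degree `p` by `a + b X` as a linear equation. -/
def divisibility (p : ℕ) (a b : ℝ) : ℝ[X] →ₗ[ℝ] ℝ :=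
  -- For `b = 0` the divisor is constant, and the only demand is that the quotient has degree at
  -- most `p - 1`; for `b ≠ 0` it is a root. Either way this is one equation, so the count is
  -- independent of the shape.
  if b = 0 then lcoeff ℝ p else leval (-a / b)

open Polynomial in
lemma exists_quotient_of_divisibility (hp : 0 < p) {a b : ℝ} (hab : ¬(a = 0 ∧ b = 0)) {R : ℝ[X]}
    (hR : R.natDegree ≤ p) (h : divisibility p a b R = 0) :
    ∃ P : ℝ[X], P.natDegree ≤ p - 1 ∧ R = (C a + C b * X) * P := by
  rw [divisibility] at h
  by_cases hb : b = 0
  · rw [if_pos hb, lcoeff_apply] at h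
    have ha : a ≠ 0 := fun ha => hab ⟨ha, hb⟩
    refine ⟨C a⁻¹ * R, (natDegree_C_mul_le _ _).trans ?_, ?_⟩
    · refine natDegree_le_iff_coeff_eq_zero.2 fun n hn => ?_
      rcases eq_or_lt_of_le (show p ≤ n by omega) with rfl | h'
      · exact h
      · exact coeff_eq_zero_of_natDegree_lt (hR.trans_lt h')
    · rw [hb, C_0, zero_mul, add_zero, ← mul_assoc, ← C_mul, mul_inv_cancel₀ ha, C_1, one_mul]
  · rw [if_neg hb] at h
    obtain ⟨P, hP⟩ := dvd_iff_isRoot.2 (show R.IsRoot (-a / b) from h)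
    refine ⟨C b⁻¹ * P, (natDegree_C_mul_le _ _).trans ?_, ?_⟩
    · by_cases hP0 : P = 0
      · rw [hP0, natDegree_zero]; omega
      · have := congrArg natDegree hP
        rw [natDegree_mul (X_sub_C_ne_zero _) hP0, natDegree_X_sub_C] at this
        omega
    · have e : (C a + C b * X : ℝ[X]) = C b * (X - C (-a / b)) := by
        rw [mul_sub, ← C_mul, mul_div_cancel₀ _ hb, C_neg]; ring
      rw [e, mul_assoc, mul_comm (X - C (-a / b)), ← mul_assoc, ← mul_assoc, ← C_mul,
        mul_inv_cancel₀ hb, C_1, one_mul, mul_comm, ← hP]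

/-- The conditions on the first edge as linear equations for the coefficients. -/
def edgeFunctional (hp : 3 ≤ p) (Q : ConvexQuad) :
    Coef p →ₗ[ℝ] (Fin (numSplit p - 1) ⊕ Fin (numSplit p) → ℝ) :=
  -- There is one equation per interior knot: the coefficient of the truncated power of exponent `p
  -- - 1` in the trace vanishes, which raises the smoothness from `p - 2` to `p - 1`. There is one
  -- equation per cell: the numerator of the normal derivative is divisible by the affine normal
  -- coefficient.
  LinearMap.pi (Sum.elim
    (fun a => (splineEval (numSplit p) p (p - 2) 0 0).comp
      (LinearMap.proj (Sum.inr (a, ⟨0, by omega⟩) : SIdx p)))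
    (fun a => (divisibility p (Q.nrml (Q.colT 0)) (Q.nrml (Q.colT 1) - Q.nrml (Q.colT 0))).comp
      (normalNumer Q p a)))

lemma contDiff_splineBasis_succ {k d r : ℕ} (i : SplineIdx k d r)
    (hi : ∀ a e, i = Sum.inr (a, e) → 0 < (e : ℕ)) :
    ContDiff ℝ (r + 1 : ℕ) (splineBasis k d r 0 i) := by
  rcases i with j | ⟨a, e⟩
  · exact contDiff_const.mul (contDiff_id.pow _)
  · have he := hi a e rfl
    refine contDiff_const.mul ?_
    have h := contDiff_truncPow (r + e) (knot k a)
    rw [show r + e + 1 = r + 1 + e - 0 by omega] at h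
    exact h.of_le (by exact_mod_cast (by omega : r + 1 ≤ r + e))

-- Only sufficiency of the equations is needed, since they are used to bound the dimension of the
-- local space from below.
open Polynomial in
lemma edgeCond_of_edgeFunctional (hp : 3 ≤ p) {c : Coef p} (h : edgeFunctional hp Q c = 0) :
    EdgeCond Q p (lift Q p c) := by
  have hI0 : (0 : ℝ) ∈ Icc (0 : ℝ) 1 := left_mem_Icc.2 zero_le_one
  have htr : ∀ s ∈ Icc (0 : ℝ) 1, lift Q p c (Q.edgeParam 0 s) = surf p 0 0 c s 0 := fun s hs => by
    rw [Q.edgeParam_zero, lift_param c hs hI0]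
  constructor
  · refine ContDiffOn.congr (f := fun s => surf p 0 0 c s 0) (ContDiff.contDiffOn ?_) htr
    refine ContDiff.sum fun i _ => ?_
    by_cases hi : ∀ a e, i = Sum.inr (a, e) → 0 < (e : ℕ)
    · have := contDiff_splineBasis_succ i hi
      rw [show p - 2 + 1 = p - 1 by omega] at this
      exact contDiff_const.mul this
    · push Not at hi
      obtain ⟨a, e, rfl, he⟩ := hi
      have h0 : spline (numSplit p) p (p - 2) 0 (c (Sum.inr (a, ⟨0, by omega⟩))) 0 = 0 :=
        congrFun h (Sum.inl a)
      have : e = ⟨0, by omega⟩ := Fin.ext (by simpa using he)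
      simp only [this, h0, zero_mul]
      exact contDiff_const
  · intro a
    set R := normalNumer Q p a c with hRdef
    have hR : R.natDegree ≤ p := by
      refine (natDegree_sub_le _ _).trans (max_le (natDegree_splinePoly_le _ _) ?_)
      have d1 : (C (Q.tang (Q.colT 0)) + C (Q.tang (Q.colT 1) - Q.tang (Q.colT 0)) * X :
          ℝ[X]).natDegree ≤ 1 :=
        (natDegree_add_le _ _).trans (max_le (by simp) ((natDegree_C_mul_le _ _).trans natDegree_X_le))
      have d2 := (natDegree_derivative_le (splinePoly (numSplit p) p (p - 2) a
        (fun i => spline (numSplit p) p (p - 2) 0 (c i) 0)))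
      have d3 := natDegree_splinePoly_le (k := numSplit p) (r := p - 2) a
        (fun i => spline (numSplit p) p (p - 2) 0 (c i) 0)
      exact natDegree_mul_le.trans (by omega)
    have hpos0 := Q.nrml_colT_pos hI0
    obtain ⟨P, hP, hRP⟩ := exists_quotient_of_divisibility (p := p) (by omega)
      (fun h => hpos0.ne' h.1) hR (congrFun h (Sum.inr a))
    · refine ⟨P, hP, fun s hs => ?_⟩
      have hs' : s ∈ Icc (0 : ℝ) 1 := cell_subset a.2 hs
      have hl := (Q.nrml_colT_pos hs').ne'
      have e1 : R.eval s = surf p 0 1 c s 0 - Q.tang (Q.colT s) * surf p 1 0 c s 0 := by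
        rw [surf, surf, spline_eq_eval (Nat.zero_le _) _ hs,
          spline_eq_eval (show 1 ≤ p - 2 by omega) _ hs, Q.tang_colT s]
        simp only [hRdef, normalNumer, LinearMap.coe_mk, AddHom.coe_mk, eval_sub, eval_mul, eval_add,
          eval_C, eval_X, Function.iterate_zero, Function.iterate_one, id]
        ring
      have e2 : R.eval s = Q.nrml (Q.colT s) * P.eval s := by
        rw [hRP, eval_mul, Q.nrml_colT s]
        simp only [eval_add, eval_mul, eval_C, eval_X]
        ring
      have e3 : surf p 0 1 c s 0 = Q.tang (Q.colT s) * surf p 1 0 c s 0 +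
          Q.nrml (Q.colT s) * Q.normalDeriv 0 (lift Q p c) (Q.edgeParam 0 s) := by
        rw [← fderivWithin_lift_colT (Q := Q) hp c hs' hI0,
          ← fderivWithin_lift_colS (Q := Q) hp c hs' hI0, ConvexQuad.normalDeriv,
          Q.edgeParam_zero, Q.colS_zero, ← smul_eq_mul, ← smul_eq_mul, ← map_smul, ← map_smul,
          ← map_add, Q.tang_add_nrml]
      refine mul_left_cancel₀ hl ?_
      rw [← e2, e1, e3]
      ring

/-- The passage to the coefficients after quarter turns is linear. Thus the equations for the first
edge of a turned quadrilateral are linear in the original coefficients. -/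
lemma exists_change_of_base (hp : 3 ≤ p) (Q : ConvexQuad) (n : ℕ) :
    ∃ T : Coef p →ₗ[ℝ] Coef p, ∀ c, lift (ConvexQuad.rot^[n] Q) p (T c) = lift Q p c := by
  set e := LinearEquiv.ofInjective (liftLinear (ConvexQuad.rot^[n] Q) p) (liftLinear_injective hp)
  have hr : ∀ c, liftLinear Q p c ∈ LinearMap.range (liftLinear (ConvexQuad.rot^[n] Q) p) := by
    intro c
    obtain ⟨c', hc'⟩ := ((memBase_lift (Q := Q) c).iterate_rot n).exists_lift hp
    exact ⟨c', hc'.symm⟩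
  refine ⟨e.symm.toLinearMap.comp ((liftLinear Q p).codRestrict _ hr), fun c => ?_⟩
  have := congrArg Subtype.val (e.apply_symm_apply ((liftLinear Q p).codRestrict _ hr c))
  exact this

/-! ### Existence of the dual basis -/

lemma card_traceNodes (p : ℕ) (hp : 3 ≤ p) : (traceNodes p).card = p - 3 + 1 - 3 := by
  have hp0 : (0 : ℚ) < p := by exact_mod_cast (by omega : 0 < p)
  rw [traceNodes, Finset.card_image_of_injective, Nat.card_Icc]
  intro a b hab
  exact_mod_cast (div_left_inj' hp0.ne').1 hab

/-- Each edge contributes `k - 1` smoothness and `k` divisibility equations. The balance is `44 + 20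
= 8²` for `p = 3`, `37 + 12 = 7²` for `p = 4`, and it has `4` equations against `(p + 1)²`
coefficients for `p ≥ 5`. -/
lemma dof_count (hp : 3 ≤ p) : Fintype.card (DofIndex p) +
    4 * (numSplit p - 1 + numSplit p) = Fintype.card (SIdx p) ^ 2 := by
  have h1 : Fintype.card (DofIndex p) = 4 * 6 + (4 * (traceNodes p).card +
      (4 * (normalNodes p).card + (faceNodes p).card * (faceNodes p).card)) := by
    simp only [DofIndex, Fintype.card_sum, Fintype.card_prod, Fintype.card_fin, Fintype.card_coe]
    rfl
  have h2 : Fintype.card (SIdx p) = p + 1 + (numSplit p - 1) * (p - (p - 2)) := by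
    simp only [SIdx, SplineIdx, Fintype.card_sum, Fintype.card_prod, Fintype.card_fin]
  rw [h1, h2]
  obtain rfl | rfl | h : p = 3 ∨ p = 4 ∨ 5 ≤ p := by omega
  · have h3 : (faceNodes 3).card = 4 := by
      rw [faceNodes, if_pos rfl]; norm_num [Finset.card_insert_of_notMem]
    have h4 : (normalNodes 3).card = 1 := by rw [normalNodes, if_pos (by norm_num)]; rfl
    rw [card_traceNodes 3 hp, h3, h4, numSplit_three]
    norm_num
  · have h3 : (faceNodes 4).card = 3 := by
      rw [faceNodes, if_neg (by norm_num), if_pos rfl]; norm_num [Finset.card_insert_of_notMem]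
    have h4 : (normalNodes 4).card = 1 := by rw [normalNodes, if_pos le_rfl]; rfl
    rw [card_traceNodes 4 hp, h3, h4, numSplit_four]
    norm_num
  · have hp0 : (0 : ℚ) < p := by exact_mod_cast (by omega : 0 < p)
    have hp1 : (0 : ℚ) < (p : ℚ) - 1 := by
      have : (1 : ℚ) < p := by exact_mod_cast (by omega : 1 < p)
      linarith
    rw [numSplit_of_five_le h, card_traceNodes p hp, normalNodes, if_neg (by omega), faceNodes,
      if_neg (by omega), if_neg (by omega), Finset.card_image_of_injective _ fun a b hab => by
        exact_mod_cast (div_left_inj' hp1.ne').1 hab, Finset.card_image_of_injective _ fun a b hab => by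
        exact_mod_cast (div_left_inj' hp0.ne').1 hab, Nat.card_Icc, Nat.card_Icc]
    obtain ⟨q, rfl⟩ := Nat.exists_eq_add_of_le h
    rw [show 5 + q - 3 + 1 - 3 = q by omega, show 5 + q - 3 + 1 - 2 = q + 1 by omega,
      show 5 + q - 2 + 1 - 2 = q + 2 by omega]
    ring

/-- The solution space of the edge equations has at least as many dimensions as there are degrees of
freedom, and these are injective on it by uniqueness. Hence they form an isomorphism, and the dual
functions are the preimages of the unit vectors. -/
lemma exists_dualBasis (hp : 3 ≤ p) (Q : ConvexQuad) (σ : Fin 4 → ℤˣ) :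
    ∃ β, IsDualBasis Q p σ β := by
  choose T hT using fun i : Fin 4 => exists_change_of_base hp Q i
  set Λ : Coef p →ₗ[ℝ] (Fin 4 → Fin (numSplit p - 1) ⊕ Fin (numSplit p) → ℝ) :=
    LinearMap.pi fun i => (edgeFunctional hp (ConvexQuad.rot^[i] Q)).comp (T i) with hΛ
  have hmem : ∀ c ∈ LinearMap.ker Λ, MemLocalSpace Q p (lift Q p c) := by
    intro c hc
    refine memLocalSpace_iff.2 ⟨memBase_lift c, fun i => ?_⟩
    rw [← hT i c]
    exact edgeCond_of_edgeFunctional hp (congrFun hc i)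
  set D : LinearMap.ker Λ →ₗ[ℝ] (DofIndex p → ℝ) := LinearMap.pi fun l =>
    (dofLinear hp Q σ l).comp (((liftLinear Q p).codRestrict (regular Q)
      fun c => dofRegular_lift hp c).comp (LinearMap.ker Λ).subtype) with hD
  have hinj : Function.Injective D := by
    rw [← LinearMap.ker_eq_bot, LinearMap.ker_eq_bot']
    intro c hc
    have := (hmem c c.2).eq_zero_of_dof hp σ fun l => congrFun hc l
    exact Subtype.ext (liftLinear_injective hp (this.trans (liftLinear Q p).map_zero.symm))
  have hrank := LinearMap.finrank_range_add_finrank_ker Λ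
  have h1 : Module.finrank ℝ (LinearMap.range Λ) ≤ 4 * (numSplit p - 1 + numSplit p) := by
    refine (Submodule.finrank_le _).trans (le_of_eq ?_)
    simp [Module.finrank_pi_fintype]
  have h2 : Module.finrank ℝ (Coef p) = Fintype.card (SIdx p) ^ 2 := by
    rw [Module.finrank_pi_fintype]
    simp only [Module.finrank_fintype_fun_eq_card, Finset.sum_const, Finset.card_univ, smul_eq_mul]
    rw [sq]
  have h3 := LinearMap.finrank_le_finrank_of_injective hinj
  rw [Module.finrank_fintype_fun_eq_card] at h3
  have h4 := dof_count hp
  have hsurj : Function.Surjective D := by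
    refine (LinearMap.injective_iff_surjective_of_finrank_eq_finrank ?_).1 hinj
    rw [Module.finrank_fintype_fun_eq_card]
    omega
  choose c hc using fun l : DofIndex p => hsurj fun l' => if l' = l then 1 else 0
  refine ⟨fun l => lift Q p (c l : Coef p), fun l => hmem _ (c l).2, fun l l' => ?_⟩
  exact congrFun (hc l) l'

lemma isDualBasis_unique (hp : 3 ≤ p) {σ : Fin 4 → ℤˣ} {β β' : DofIndex p → Plane → ℝ}
    (h : IsDualBasis Q p σ β) (h' : IsDualBasis Q p σ β') : β = β' := by
  funext l
  have hm := MemLocalSpace.comb hp (h.1 l) (h'.1 l) (-1)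
  have hz := hm.eq_zero_of_dof hp σ fun l' => by
    rw [((h.1 l).dofRegular hp).dof_comb hp σ l' ((h'.1 l).dofRegular hp), h.2, h'.2]
    ring
  funext x
  have := congrFun hz x
  simp only [Pi.add_apply, Pi.smul_apply, smul_eq_mul, Pi.zero_apply] at this
  linarith

lemma isDualBasis_dualBasis (hp : 3 ≤ p) (Q : ConvexQuad) (σ : Fin 4 → ℤˣ) :
    IsDualBasis Q p σ (dualBasis Q p σ) := by
  rw [dualBasis, dif_pos (exists_dualBasis hp Q σ)]
  exact (exists_dualBasis hp Q σ).choose_spec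

end
end BSQuad

namespace BSQuad
noncomputable section

open MeasureTheory Set Filter Topology

variable {p : ℕ} {Q : ConvexQuad} {u v : Plane → ℝ}

/-! ### Jets and degrees of freedom -/

lemma gradL_eq (g : Fin 2 → ℝ) : gradL g = g 0 • (EuclideanSpace.proj 0 : Plane →L[ℝ] ℝ) +
    g 1 • (EuclideanSpace.proj 1 : Plane →L[ℝ] ℝ) := by
  ext v
  simp [Fin.sum_univ_two]

lemma Jet.contDiffOn {K : Set Plane} (hK : UniqueDiffOn ℝ K) {N : ℕ} {ψ : ℕ × ℕ → Plane → ℝ}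
    (h : Jet K N ψ) (n : ℕ) {α : ℕ × ℕ} (hα : α.1 + α.2 + n ≤ N) : ContDiffOn ℝ n (ψ α) K := by
  induction n generalizing α with
  | zero => exact contDiffOn_zero.2 (h.cont α hα)
  | succ n ih =>
    rw [show ((n + 1 : ℕ) : WithTop ℕ∞) = (n : WithTop ℕ∞) + 1 by norm_cast,
      contDiffOn_succ_iff_fderivWithin hK]
    refine ⟨fun x hx => (h.der α (by omega) x hx).differentiableWithinAt, fun h => ?_, ?_⟩
    · exact absurd h (by exact_mod_cast WithTop.natCast_ne_top (α := ℕ∞) n)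
    · have e : ∀ k, ContDiffOn ℝ n (ψ (inc k α)) K := fun k => ih (by rw [order_inc]; omega)
      refine ContDiffOn.congr
        (((e 0).smul (contDiffOn_const (c := (EuclideanSpace.proj 0 : Plane →L[ℝ] ℝ)))).add
          ((e 1).smul (contDiffOn_const (c := (EuclideanSpace.proj 1 : Plane →L[ℝ] ℝ)))))
        fun x hx => ?_
      rw [(h.der α (by omega) x hx).fderivWithin (hK x hx), gradL_eq]
      rfl

lemma pderivWithin_congr {K : Set Plane} {f g : Plane → ℝ} (h : ∀ x ∈ K, f x = g x) (k : Fin 2)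
    {x : Plane} (hx : x ∈ K) : pderivWithin K k f x = pderivWithin K k g x := by
  rw [pderivWithin, pderivWithin, fderivWithin_congr h (h x hx)]

lemma Jet.pderivWithin_eq {K : Set Plane} (hK : UniqueDiffOn ℝ K) {N : ℕ} {ψ : ℕ × ℕ → Plane → ℝ}
    (h : Jet K N ψ) {α : ℕ × ℕ} (hα : α.1 + α.2 < N) (k : Fin 2) {x : Plane} (hx : x ∈ K) :
    pderivWithin K k (ψ α) x = ψ (inc k α) x := by
  rw [pderivWithin, (h.der α hα x hx).fderivWithin (hK x hx), gradL_apply]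
  fin_cases k <;> simp

lemma Jet.mderivWithin_eq {K : Set Plane} (hK : UniqueDiffOn ℝ K) {N : ℕ} {ψ : ℕ × ℕ → Plane → ℝ}
    (h : Jet K N ψ) (hN : 2 ≤ N) {α : ℕ × ℕ} (hα : α ∈ vertexJets) {x : Plane} (hx : x ∈ K) :
    mderivWithin K α (ψ (0, 0)) x = ψ α x := by
  have h1 : ∀ k, ∀ x ∈ K, pderivWithin K k (ψ (0, 0)) x = ψ (inc k (0, 0)) x := fun k x hx =>
    h.pderivWithin_eq hK (by simp; omega) k hx
  have h2 : ∀ j k, pderivWithin K j (pderivWithin K k (ψ (0, 0))) x = ψ (inc j (inc k (0, 0))) x := by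
    intro j k
    rw [pderivWithin_congr (h1 k) j hx, h.pderivWithin_eq hK (by rw [order_inc]; simp; omega) j hx]
  simp only [vertexJets, Finset.mem_insert, Finset.mem_singleton] at hα
  rcases hα with rfl | rfl | rfl | rfl | rfl | rfl
  · rfl
  · exact h1 0 x hx
  · exact h1 1 x hx
  · exact h2 0 0
  · exact h2 0 1
  · exact h2 1 1

/-- All derivatives are taken within the closed quadrilateral. This allows a polynomial to be
replaced by its extension by zero, the form in which it belongs to the local space. -/
lemma dof_congr (hp : 3 ≤ p) (σ : Fin 4 → ℤˣ) (l : DofIndex p) (h : ∀ x ∈ Q.closed, u x = v x) :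
    dof Q p σ l u = dof Q p σ l v := by
  have hit : ∀ (k : Fin 2) (n : ℕ) (f g : Plane → ℝ), (∀ x ∈ Q.closed, f x = g x) →
      ∀ x ∈ Q.closed, (pderivWithin Q.closed k)^[n] f x = (pderivWithin Q.closed k)^[n] g x := by
    intro k n
    induction n with
    | zero => exact fun f g h => h
    | succ n ih =>
      intro f g h
      exact ih _ _ fun x hx => pderivWithin_congr h k hx
  rcases l with ⟨i, α⟩ | ⟨i, r⟩ | ⟨i, r⟩ | ⟨r, s⟩
  · exact hit 0 _ _ _ (hit 1 _ _ _ h) _ (Q.vertex_mem i)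
  · exact h _ (Q.edgeParam_mem i (traceNodes_mem hp r.2))
  · have hx := Q.edgeParam_mem i (normalNodes_mem hp r.2)
    simp only [dof, ConvexQuad.normalDeriv]
    rw [fderivWithin_congr h (h _ hx)]
  · exact h _ (Q.param_mem (faceNodes_mem hp r.2) (faceNodes_mem hp s.2))

/-! ### Polynomials belong to the local space -/

open Polynomial in
/-- The restrictions of `q` to lines are polynomials of degree at most `d`. -/
def LinePoly (d : ℕ) (q : Plane → ℝ) : Prop :=
  ∀ A B : Plane, ∃ P : ℝ[X], P.natDegree ≤ d ∧ ∀ s : ℝ, q (A + s • B) = P.eval s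

open Polynomial in
lemma linePoly_polyJet (c : Plane) (a : ℕ × ℕ → ℝ) (M : ℕ) (α : ℕ × ℕ) :
    LinePoly (M - (α.1 + α.2)) (polyJet c a M α) := by
  intro A B
  set L : Fin 2 → ℝ[X] := fun k => C (A k - c k) + C (B k) * X with hL
  have hLd : ∀ k, (L k).natDegree ≤ 1 := fun k =>
    (natDegree_add_le _ _).trans (max_le (by simp) ((natDegree_C_mul_le _ _).trans natDegree_X_le))
  set m : ℕ → ℕ → Fin 2 → ℝ[X] := fun i n k =>
    if i ≤ n then L k ^ (n - i) * C (((n - i).factorial : ℝ)⁻¹) else 0 with hm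
  have hme : ∀ i n k s, (m i n k).eval s = monoD i n ((A + s • B) k - c k) := by
    intro i n k s
    simp only [hm, hL, monoD]
    split_ifs
    · simp only [eval_mul, eval_pow, eval_add, eval_C, eval_X, PiLp.add_apply, PiLp.smul_apply,
        smul_eq_mul, div_eq_mul_inv]
      congr 2
      ring
    · simp
  have hmd : ∀ i n k, (m i n k).natDegree ≤ n - i := by
    intro i n k
    simp only [hm]
    split_ifs
    · refine (natDegree_mul_C_le _ _).trans (natDegree_pow_le.trans ?_)
      simpa using Nat.mul_le_mul_left (n - i) (hLd k)
    · simp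
  refine ⟨∑ γ ∈ indexSet M, C (a γ) * (m α.1 γ.1 0 * m α.2 γ.2 1), ?_, fun s => ?_⟩
  · refine natDegree_sum_le_of_forall_le _ _ fun γ hγ => (natDegree_C_mul_le _ _).trans ?_
    rw [mem_indexSet] at hγ
    by_cases h1 : α.1 ≤ γ.1
    · by_cases h2 : α.2 ≤ γ.2
      · refine natDegree_mul_le.trans ?_
        have := hmd α.1 γ.1 0
        have := hmd α.2 γ.2 1
        omega
      · simp [hm, h2]
    · simp [hm, h1]
  · rw [polyJet, eval_finsetSum]
    refine Finset.sum_congr rfl fun γ _ => ?_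
    rw [eval_mul, eval_C, eval_mul, hme, hme]

lemma contDiff_polyJet (c : Plane) (a : ℕ × ℕ → ℝ) (M : ℕ) (α : ℕ × ℕ) (n : ℕ) :
    ContDiff ℝ n (polyJet c a M α) :=
  contDiffOn_univ.1 ((jet_polyJet univ (α.1 + α.2 + n) c a M).contDiffOn uniqueDiffOn_univ n le_rfl)

lemma ConvexQuad.edgeParam_eq_line (Q : ConvexQuad) (i : Fin 4) (s : ℝ) :
    Q.edgeParam i s = Q.vertex i + s • Q.edgeVec i := by
  simp only [edgeParam, edgeVec]; module

lemma LinePoly.isPolyOn {d : ℕ} {q : Plane → ℝ} (h : LinePoly d q) (A B : Plane) (S : Set ℝ) :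
    IsPolyOn d S fun s => q (A + s • B) := by
  obtain ⟨P, hP, h⟩ := h A B
  exact ⟨P, hP, fun s _ => h s⟩

lemma IsPolyOn.mono {d d' : ℕ} (hd : d ≤ d') {S : Set ℝ} {f : ℝ → ℝ} (h : IsPolyOn d S f) :
    IsPolyOn d' S f := by
  obtain ⟨P, hP, h⟩ := h
  exact ⟨P, hP.trans hd, h⟩

lemma IsPolyOn.congr {d : ℕ} {S : Set ℝ} {f g : ℝ → ℝ} (h : IsPolyOn d S f)
    (hfg : ∀ s ∈ S, g s = f s) : IsPolyOn d S g := by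
  obtain ⟨P, hP, h⟩ := h
  exact ⟨P, hP, fun s hs => (hfg s hs).trans (h s hs)⟩

/-- The bilinear map is affine in each parameter, so a polynomial of total degree at most `p`
becomes one of degree at most `p` in each parameter. Edges are straight, so the normal derivative
along them has degree at most `p - 1`. -/
lemma memLocalSpace_polyJet (hp : 3 ≤ p) (c : Plane) (a : ℕ × ℕ → ℝ) {M : ℕ} (hM : M ≤ p) :
    MemLocalSpace Q p (Q.closed.indicator (polyJet c a M (0, 0))) := by
  set q := polyJet c a M (0, 0) with hq
  have hline : LinePoly M q := linePoly_polyJet c a M (0, 0)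
  have hsm : ∀ n : ℕ, ContDiff ℝ n q := contDiff_polyJet c a M (0, 0)
  have hin : ∀ x ∈ Q.closed, Q.closed.indicator q x = q x := fun x hx => indicator_of_mem hx q
  have hF : ContDiff ℝ (p - 2 : ℕ) fun ξ : ℝ × ℝ => Q.param ξ.1 ξ.2 := Q.contDiff_param
  obtain ⟨b, hb⟩ := exists_surf_eq hp (w := fun s t => q (Q.param s t))
    (fun t _ => exists_spline_eq (numSplit_pos p) (by omega)
      ((hsm _).comp (hF.comp (contDiff_id.prodMk contDiff_const))).contDiffOn fun _ _ => by
        simp only [Q.param_eq_line]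
        exact (hline.isPolyOn _ _ _).mono hM)
    (fun s _ => exists_spline_eq (numSplit_pos p) (by omega)
      ((hsm _).comp (hF.comp (contDiff_const.prodMk contDiff_id))).contDiffOn fun _ _ => by
        simp only [Q.param_eq_line']
        exact (hline.isPolyOn _ _ _).mono hM)
  have hlift : Q.closed.indicator q = lift Q p b := by
    funext x
    by_cases hx : x ∈ Q.closed
    · have hm := Q.inv_mem hx
      rw [hin x hx, lift, indicator_of_mem hx, ← hb _ hm.1 _ hm.2, Q.param_inv hx]
    · rw [lift, indicator_of_notMem hx, indicator_of_notMem hx]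
  have hbase : MemBase Q p (Q.closed.indicator q) := by rw [hlift]; exact memBase_lift b
  refine ⟨hbase.eq_zero_off, hbase.smooth, hbase.bipoly, fun i => ?_, fun i j => ?_⟩
  · refine ContDiffOn.congr (f := fun s => q (Q.edgeParam i s)) ?_ fun s hs =>
      hin _ (Q.edgeParam_mem i hs)
    refine ((hsm _).comp ?_).contDiffOn
    simp only [funext (Q.edgeParam_eq_line i)]
    fun_prop
  · have h0 := (linePoly_polyJet c a M (1, 0)).isPolyOn (Q.vertex i) (Q.edgeVec i)
      (subInterval p j)
    have h1 := (linePoly_polyJet c a M (0, 1)).isPolyOn (Q.vertex i) (Q.edgeVec i)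
      (subInterval p j)
    have hz : IsPolyOn (p - 1) (subInterval p j) fun _ => (0 : ℝ) := ⟨0, by simp, by simp⟩
    have hc := ((h0.mono (by simp; omega)).comb ((h1.mono (by simp; omega)).comb hz
      (Q.innerNormal i 1)) (Q.innerNormal i 0) : IsPolyOn (p - 1) _ _)
    refine hc.congr fun s hs => ?_
    have hx := Q.edgeParam_mem i (cell_subset j.2 hs)
    rw [ConvexQuad.normalDeriv, fderivWithin_congr hin (hin _ hx),
      (hasFDerivAt_polyJet c a M (0, 0) _).hasFDerivWithinAt.fderivWithin
        (Q.uniqueDiffOn_closed _ hx), gradL_apply, Fin.sum_univ_two, Q.edgeParam_eq_line]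
    simp only [inc_zero, inc_one]
    ring

end
end BSQuad

namespace BSQuad
noncomputable section

open MeasureTheory Set Filter Topology

variable {p : ℕ} {Q : ConvexQuad} {u v : Plane → ℝ}

/-! ### Bounds for the derivatives of functions of the local space -/

lemma abs_div_sub_div_le {a a' b b' m N : ℝ} (hm : 0 < m) (hb : m ≤ b) (hb' : m ≤ b')
    (ha' : |a'| ≤ N) : |a / b - a' / b'| ≤ |a - a'| / m + N * |b - b'| / m ^ 2 := by
  have p1 : 0 < b := hm.trans_le hb
  have p2 : 0 < b' := hm.trans_le hb'
  have e : a / b - a' / b' = (a - a') / b + a' * (b' - b) / (b * b') := by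
    field_simp
    ring
  rw [e]
  refine (abs_add_le _ _).trans (add_le_add ?_ ?_)
  · rw [abs_div, abs_of_pos p1]
    exact div_le_div_of_nonneg_left (abs_nonneg _) hm hb
  · rw [abs_div, abs_mul, abs_of_pos (mul_pos p1 p2), abs_sub_comm b']
    refine div_le_div₀ (mul_nonneg ((abs_nonneg _).trans ha') (abs_nonneg _))
      (mul_le_mul_of_nonneg_right ha' (abs_nonneg _)) (by positivity) ?_
    rw [sq]
    exact mul_le_mul hb hb' hm.le p1.le

lemma abs_mul_sub_mul_le {a a' b b' A B La Lb : ℝ} (ha : |a| ≤ A) (hb' : |b'| ≤ B)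
    (hA : |a - a'| ≤ La) (hB : |b - b'| ≤ Lb) : |a * b - a' * b'| ≤ A * Lb + La * B := by
  have e : a * b - a' * b' = a * (b - b') + (a - a') * b' := by ring
  rw [e]
  refine (abs_add_le _ _).trans ?_
  rw [abs_mul, abs_mul]
  exact add_le_add (mul_le_mul ha hB (abs_nonneg _) ((abs_nonneg _).trans ha))
    (mul_le_mul hA hb' (abs_nonneg _) ((abs_nonneg _).trans hA))

lemma det2_sub_left (a b c : Plane) : det2 (a - b) c = det2 a c - det2 b c := by
  simp [det2]; ring

lemma det2_sub_right (a b c : Plane) : det2 a (b - c) = det2 a b - det2 a c := by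
  simp [det2]; ring

namespace ConvexQuad

lemma norm_colT_sub_le (Q : ConvexQuad) (s s' : ℝ) :
    ‖Q.colT s - Q.colT s'‖ ≤ 2 * Q.size * |s - s'| := by
  have e : Q.colT s - Q.colT s' = (s - s') • (Q.colT 1 - Q.colT 0) := by
    simp only [colT]; module
  rw [e, norm_smul, Real.norm_eq_abs, mul_comm]
  refine mul_le_mul_of_nonneg_right ((norm_sub_le _ _).trans ?_) (abs_nonneg _)
  have h1 := Q.norm_colT_le (right_mem_Icc.2 zero_le_one)
  have h0 := Q.norm_colT_le (left_mem_Icc.2 zero_le_one)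
  linarith

lemma norm_colS_sub_le (Q : ConvexQuad) (t t' : ℝ) :
    ‖Q.colS t - Q.colS t'‖ ≤ 2 * Q.size * |t - t'| := by
  have e : Q.colS t - Q.colS t' = (t - t') • (Q.colS 1 - Q.colS 0) := by
    simp only [colS]; module
  rw [e, norm_smul, Real.norm_eq_abs, mul_comm]
  refine mul_le_mul_of_nonneg_right ((norm_sub_le _ _).trans ?_) (abs_nonneg _)
  have h1 := Q.norm_colS_le (right_mem_Icc.2 zero_le_one)
  have h0 := Q.norm_colS_le (left_mem_Icc.2 zero_le_one)
  linarith

lemma abs_jac_sub_le (Q : ConvexQuad) {s t s' t' : ℝ} (hs : s ∈ Icc (0 : ℝ) 1)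
    (ht' : t' ∈ Icc (0 : ℝ) 1) :
    |Q.jac s t - Q.jac s' t'| ≤ 4 * Q.size ^ 2 * (|s - s'| + |t - t'|) := by
  have e : Q.jac s t - Q.jac s' t' =
      det2 (Q.colS t - Q.colS t') (Q.colT s) + det2 (Q.colS t') (Q.colT s - Q.colT s') := by
    rw [det2_sub_left, det2_sub_right, jac, jac]; ring
  have hh := Q.size_pos
  have h1 := mul_le_mul (Q.norm_colS_sub_le t t') (Q.norm_colT_le hs) (norm_nonneg _)
    (by positivity)
  have h2 := mul_le_mul (Q.norm_colS_le ht') (Q.norm_colT_sub_le s s') (norm_nonneg _) hh.le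
  rw [e]
  refine (abs_add_le _ _).trans ((add_le_add ((abs_det2_le _ _).trans h1)
    ((abs_det2_le _ _).trans h2)).trans ?_)
  have := mul_nonneg (sq_nonneg Q.size) (add_nonneg (abs_nonneg (s - s')) (abs_nonneg (t - t')))
  nlinarith

end ConvexQuad

/-- The gradient is a quotient with numerator of size `h` and denominator at least `κ h²`. Both are
Lipschitz in the parameters, and the parameters are Lipschitz in the point with constant `1 / (κ
h)`; this explains the powers of `h`. The Lipschitz bound stands in for second derivatives, which
need not exist everywhere. -/
lemma exists_lift_bound (hp : 3 ≤ p) {κ : ℝ} (hκ : 0 < κ) : ∃ C : ℝ, 0 ≤ C ∧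
    ∀ (Q : ConvexQuad) (c : Coef p) (A : ℝ), Q.Shape κ → (∀ i j, |c i j| ≤ A) →
      (∀ x ∈ Q.closed, |lift Q p c x| ≤ C * A) ∧
      (∀ k, ∀ x ∈ Q.closed, |pderivWithin Q.closed k (lift Q p c) x| ≤ C * A / Q.size) ∧
      ∀ k, ∀ x ∈ Q.closed, ∀ y ∈ Q.closed,
        |pderivWithin Q.closed k (lift Q p c) x - pderivWithin Q.closed k (lift Q p c) y| ≤
          C * A / Q.size ^ 2 * ‖x - y‖ := by
  set B : ℝ := (Fintype.card (SIdx p) : ℝ) ^ 2 * p ^ 2 with hB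
  have hB0 : 0 ≤ B := by positivity
  -- The three summands serve the value, the gradient and its Lipschitz constant, in this order.
  refine ⟨B * (1 + 2 / κ + 2 * (6 / κ + 8 / κ ^ 2) / κ), by positivity, fun Q c A hQ hc => ?_⟩
  have hA : 0 ≤ A := (abs_nonneg _).trans (hc (Sum.inl 0) (Sum.inl 0))
  have hh := Q.size_pos
  have hp1 : (1 : ℝ) ≤ p := by exact_mod_cast (by omega : 1 ≤ p)
  have hW : ∀ n m, n + m ≤ 2 → ∀ {s t : ℝ}, s ∈ Icc (0 : ℝ) 1 → t ∈ Icc (0 : ℝ) 1 →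
      |surf p n m c s t| ≤ B * A := by
    intro n m hnm s t hs ht
    refine (abs_surf_le n m hc hs ht).trans (mul_le_mul_of_nonneg_right ?_ hA)
    exact mul_le_mul_of_nonneg_left (pow_le_pow_right₀ hp1 hnm) (by positivity)
  have hL : ∀ n m, n + m ≤ 1 → ∀ {s t s' t' : ℝ}, s ∈ Icc (0 : ℝ) 1 → t ∈ Icc (0 : ℝ) 1 →
      s' ∈ Icc (0 : ℝ) 1 → t' ∈ Icc (0 : ℝ) 1 →
      |surf p n m c s t - surf p n m c s' t'| ≤ B * A * (|s - s'| + |t - t'|) := by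
    intro n m hnm s t s' t' hs ht hs' ht'
    refine (abs_surf_sub_le n m hc hs ht hs' ht').trans
      (mul_le_mul_of_nonneg_right (mul_le_mul_of_nonneg_right ?_ hA) (by positivity))
    exact mul_le_mul_of_nonneg_left (pow_le_pow_right₀ hp1 (by omega)) (by positivity)
  have hone : ∀ k : Fin 2, ‖(EuclideanSpace.single k 1 : Plane)‖ = 1 := fun k => by simp
  have hdT : ∀ (k : Fin 2) {s : ℝ}, s ∈ Icc (0 : ℝ) 1 →
      |det2 (EuclideanSpace.single k 1) (Q.colT s)| ≤ Q.size := fun k s hs =>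
    (abs_det2_le _ _).trans (by rw [hone, one_mul]; exact Q.norm_colT_le hs)
  have hdS : ∀ (k : Fin 2) {t : ℝ}, t ∈ Icc (0 : ℝ) 1 →
      |det2 (Q.colS t) (EuclideanSpace.single k 1)| ≤ Q.size := fun k t ht =>
    (abs_det2_le _ _).trans (by rw [hone, mul_one]; exact Q.norm_colS_le ht)
  set num : Fin 2 → ℝ → ℝ → ℝ := fun k s t =>
    det2 (EuclideanSpace.single k 1) (Q.colT s) * surf p 1 0 c s t +
      det2 (Q.colS t) (EuclideanSpace.single k 1) * surf p 0 1 c s t with hnum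
  have hpd : ∀ k, ∀ x ∈ Q.closed, pderivWithin Q.closed k (lift Q p c) x =
      num k (Q.inv x).1 (Q.inv x).2 / Q.jac (Q.inv x).1 (Q.inv x).2 := by
    intro k x hx
    have hm := Q.inv_mem hx
    rw [hnum, ← fderivWithin_lift hp c hm.1 hm.2, Q.param_inv hx]
    rfl
  have hnumb : ∀ k {s t : ℝ}, s ∈ Icc (0 : ℝ) 1 → t ∈ Icc (0 : ℝ) 1 →
      |num k s t| ≤ 2 * Q.size * (B * A) := by
    intro k s t hs ht
    refine (abs_add_le _ _).trans ?_
    rw [abs_mul, abs_mul]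
    have h1 := mul_le_mul (hdT k hs) (hW 1 0 (by norm_num) hs ht) (abs_nonneg _) hh.le
    have h2 := mul_le_mul (hdS k ht) (hW 0 1 (by norm_num) hs ht) (abs_nonneg _) hh.le
    linarith
  have hnuml : ∀ k {s t s' t' : ℝ}, s ∈ Icc (0 : ℝ) 1 → t ∈ Icc (0 : ℝ) 1 → s' ∈ Icc (0 : ℝ) 1 →
      t' ∈ Icc (0 : ℝ) 1 →
      |num k s t - num k s' t'| ≤ 6 * Q.size * (B * A) * (|s - s'| + |t - t'|) := by
    intro k s t s' t' hs ht hs' ht'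
    have d1 : |det2 (EuclideanSpace.single k 1) (Q.colT s) -
        det2 (EuclideanSpace.single k 1) (Q.colT s')| ≤ 2 * Q.size * |s - s'| := by
      rw [← det2_sub_right]
      exact (abs_det2_le _ _).trans (by rw [hone, one_mul]; exact Q.norm_colT_sub_le s s')
    have d2 : |det2 (Q.colS t) (EuclideanSpace.single k 1) -
        det2 (Q.colS t') (EuclideanSpace.single k 1)| ≤ 2 * Q.size * |t - t'| := by
      rw [← det2_sub_left]
      exact (abs_det2_le _ _).trans (by rw [hone, mul_one]; exact Q.norm_colS_sub_le t t')
    have e1 := abs_mul_sub_mul_le (hdT k hs) (hW 1 0 (by norm_num) hs' ht') d1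
      (hL 1 0 (by norm_num) hs ht hs' ht')
    have e2 := abs_mul_sub_mul_le (hdS k ht) (hW 0 1 (by norm_num) hs' ht') d2
      (hL 0 1 (by norm_num) hs ht hs' ht')
    have e3 : num k s t - num k s' t' =
        (det2 (EuclideanSpace.single k 1) (Q.colT s) * surf p 1 0 c s t -
          det2 (EuclideanSpace.single k 1) (Q.colT s') * surf p 1 0 c s' t') +
        (det2 (Q.colS t) (EuclideanSpace.single k 1) * surf p 0 1 c s t -
          det2 (Q.colS t') (EuclideanSpace.single k 1) * surf p 0 1 c s' t') := by
      simp only [hnum]; ring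
    rw [e3]
    refine (abs_add_le _ _).trans ((add_le_add e1 e2).trans ?_)
    have q1 : 0 ≤ Q.size * (B * A) * |s - s'| := by positivity
    have q2 : 0 ≤ Q.size * (B * A) * |t - t'| := by positivity
    linarith
  have hm0 : 0 < κ * Q.size ^ 2 := by positivity
  have hBA : 0 ≤ B * A := mul_nonneg hB0 hA
  refine ⟨fun x hx => ?_, fun k x hx => ?_, fun k x hx y hy => ?_⟩
  · have hm := Q.inv_mem hx
    rw [lift, indicator_of_mem hx]
    refine (hW 0 0 (by norm_num) hm.1 hm.2).trans ?_
    have e : B * (1 + 2 / κ + 2 * (6 / κ + 8 / κ ^ 2) / κ) * A =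
        B * A * (1 + (2 / κ + 2 * (6 / κ + 8 / κ ^ 2) / κ)) := by ring
    rw [e]
    exact le_mul_of_one_le_right hBA (le_add_of_nonneg_right (by positivity))
  · have hm := Q.inv_mem hx
    have hj := Q.le_jac hQ.area hm.1 hm.2
    rw [hpd k x hx, abs_div, abs_of_pos (hm0.trans_le hj)]
    refine (div_le_div₀ (by positivity) (hnumb k hm.1 hm.2) hm0 hj).trans ?_
    have e : 2 * Q.size * (B * A) / (κ * Q.size ^ 2) = B * A * (2 / κ) / Q.size := by
      field_simp
    rw [e, mul_right_comm]
    have : 0 ≤ 2 * (6 / κ + 8 / κ ^ 2) / κ := by positivity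
    gcongr
    linarith
  · have hm := Q.inv_mem hx
    have hm' := Q.inv_mem hy
    have hl := hQ.inv_lipschitz hx hy
    set δ := |(Q.inv x).1 - (Q.inv y).1| + |(Q.inv x).2 - (Q.inv y).2| with hδ
    have hδ0 : 0 ≤ δ := by positivity
    have hδl : δ ≤ 2 * (‖x - y‖ / (κ * Q.size)) := by linarith [hl.1, hl.2]
    rw [hpd k x hx, hpd k y hy]
    refine (abs_div_sub_div_le hm0 (Q.le_jac hQ.area hm.1 hm.2) (Q.le_jac hQ.area hm'.1 hm'.2)
      (hnumb k hm'.1 hm'.2)).trans ?_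
    have h1 := hnuml k hm.1 hm.2 hm'.1 hm'.2
    have h2 := Q.abs_jac_sub_le (t := (Q.inv x).2) (s' := (Q.inv y).1) hm.1 hm'.2
    rw [← hδ] at h1 h2
    calc _ ≤ 6 * Q.size * (B * A) * δ / (κ * Q.size ^ 2) +
          2 * Q.size * (B * A) * (4 * Q.size ^ 2 * δ) / (κ * Q.size ^ 2) ^ 2 := by gcongr
      _ = (6 / κ + 8 / κ ^ 2) * (B * A) / Q.size * δ := by field_simp; ring
      _ ≤ (6 / κ + 8 / κ ^ 2) * (B * A) / Q.size * (2 * (‖x - y‖ / (κ * Q.size))) := by gcongr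
      _ = B * (2 * (6 / κ + 8 / κ ^ 2) / κ) * A / Q.size ^ 2 * ‖x - y‖ := by field_simp
      _ ≤ _ := by
        have : 0 ≤ 2 / κ := by positivity
        gcongr
        linarith

/-! ### The projector -/

lemma localProjector_eq (hp : 3 ≤ p) (Q : ConvexQuad) (σ : Fin 4 → ℤˣ) (ψ : Plane → ℝ) :
    localProjector Q p σ ψ = ((∑ l, dof Q p σ l ψ •
      (⟨dualBasis Q p σ l, ((isDualBasis_dualBasis hp Q σ).1 l).dofRegular hp⟩ : regular Q) :
      regular Q) : Plane → ℝ) := by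
  funext x
  rw [Submodule.coe_sum, Finset.sum_apply]
  rfl

lemma memLocalSpace_localProjector (hp : 3 ≤ p) (Q : ConvexQuad) (σ : Fin 4 → ℤˣ)
    (ψ : Plane → ℝ) : MemLocalSpace Q p (localProjector Q p σ ψ) := by
  have h : ∑ l, dof Q p σ l ψ • dualBasis Q p σ l ∈ localSpace hp Q :=
    Submodule.sum_mem _ fun l _ => Submodule.smul_mem _ _ ((isDualBasis_dualBasis hp Q σ).1 l)
  have e : localProjector Q p σ ψ = ∑ l, dof Q p σ l ψ • dualBasis Q p σ l := by
    funext x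
    rw [Finset.sum_apply]
    rfl
  rw [e]
  exact h

lemma dof_localProjector (hp : 3 ≤ p) (Q : ConvexQuad) (σ : Fin 4 → ℤˣ) (ψ : Plane → ℝ)
    (l : DofIndex p) : dof Q p σ l (localProjector Q p σ ψ) = dof Q p σ l ψ := by
  classical
  rw [localProjector_eq hp]
  change dofLinear hp Q σ l _ = _
  rw [map_sum]
  simp only [map_smul]
  have : ∀ l', dofLinear hp Q σ l ⟨dualBasis Q p σ l', ((isDualBasis_dualBasis hp Q σ).1 l').dofRegular hp⟩
      = if l = l' then 1 else 0 := fun l' => by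
    refine ((isDualBasis_dualBasis hp Q σ).2 l' l).trans ?_
    congr
  simp only [this, smul_eq_mul, mul_ite, mul_one, mul_zero]
  exact (Finset.sum_eq_single l (fun b _ hb => if_neg hb.symm) (by simp)).trans (if_pos rfl)

/-- The projector is stable on functions whose derivatives of order at most two are bounded. -/
lemma exists_localProjector_bound (hp : 3 ≤ p) {κ : ℝ} (hκ : 0 < κ) : ∃ C : ℝ, 0 ≤ C ∧
    ∀ (Q : ConvexQuad) (σ : Fin 4 → ℤˣ) (N : ℕ) (E : ℕ × ℕ → Plane → ℝ) (M : ℝ), Q.Shape κ → 2 ≤ N →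
      Jet Q.closed N E →
      (∀ α : ℕ × ℕ, α.1 + α.2 ≤ 2 → ∀ x ∈ Q.closed, |E α x| * Q.size ^ (α.1 + α.2) ≤ M) →
      (∀ x ∈ Q.closed, |localProjector Q p σ (E (0, 0)) x| ≤ C * M) ∧
      (∀ k, ∀ x ∈ Q.closed,
        |pderivWithin Q.closed k (localProjector Q p σ (E (0, 0))) x| ≤ C * M / Q.size) ∧
      ∀ k, ∀ x ∈ Q.closed, ∀ y ∈ Q.closed,
        |pderivWithin Q.closed k (localProjector Q p σ (E (0, 0))) x -
          pderivWithin Q.closed k (localProjector Q p σ (E (0, 0))) y| ≤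
          C * M / Q.size ^ 2 * ‖x - y‖ := by
  obtain ⟨C₁, hC₁, h₁⟩ := exists_coef_bound hp hκ
  obtain ⟨C₂, hC₂, h₂⟩ := exists_lift_bound hp hκ
  refine ⟨C₂ * (C₁ * 2), by positivity, fun Q σ N E M hQ hN hE hb => ?_⟩
  have hmem := memLocalSpace_localProjector hp Q σ (E (0, 0))
  have hdof := dof_localProjector hp Q σ (E (0, 0))
  obtain ⟨c, hc⟩ := hmem.exists_lift hp
  rw [hc] at hmem hdof ⊢
  have hh := Q.size_pos
  have hM : 0 ≤ M := (mul_nonneg (abs_nonneg _) (by positivity)).trans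
    (hb (0, 0) (by norm_num) _ (Q.vertex_mem 0))
  have hb0 : ∀ x ∈ Q.closed, |E (0, 0) x| ≤ M := fun x hx => by
    have := hb (0, 0) (by norm_num) x hx
    simpa using this
  -- The factor `2` is needed for the normal derivative, a combination of two partial derivatives
  -- with coefficients of absolute value at most `1`.
  have hcb := h₁ Q c (2 * M) hQ hmem ⟨fun i α hα => ?_, fun i q hq => ?_, fun i q hq => ?_⟩
    fun q hq q' hq' => ?_
  · have := h₂ Q c _ hQ hcb
    have e : C₂ * (C₁ * (2 * M)) = C₂ * (C₁ * 2) * M := by ring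
    rwa [e] at this
  · have hx := Q.vertex_mem i
    rw [show mderivWithin Q.closed α (lift Q p c) (Q.vertex i) =
      mderivWithin Q.closed α (E (0, 0)) (Q.vertex i) from hdof (Sum.inl (i, ⟨α, hα⟩)),
      hE.mderivWithin_eq Q.uniqueDiffOn_closed hN hα hx]
    have hα2 : α.1 + α.2 ≤ 2 := by
      simp only [vertexJets, Finset.mem_insert, Finset.mem_singleton] at hα
      rcases hα with rfl | rfl | rfl | rfl | rfl | rfl <;> norm_num
    linarith [hb α hα2 _ hx]
  · rw [show lift Q p c (Q.edgeParam i (q : ℝ)) = E (0, 0) (Q.edgeParam i (q : ℝ)) from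
      hdof (Sum.inr (Sum.inl (i, ⟨q, hq⟩)))]
    linarith [hb0 _ (Q.edgeParam_mem i (traceNodes_mem hp hq))]
  · have hx := Q.edgeParam_mem i (normalNodes_mem hp hq)
    have h1 : ((σ i : ℤ) : ℝ) * Q.normalDeriv i (lift Q p c) (Q.edgeParam i (q : ℝ)) =
        ((σ i : ℤ) : ℝ) * Q.normalDeriv i (E (0, 0)) (Q.edgeParam i (q : ℝ)) :=
      hdof (Sum.inr (Sum.inr (Sum.inl (i, ⟨q, hq⟩))))
    have h2 : ((σ i : ℤ) : ℝ) ≠ 0 := by exact_mod_cast (σ i).ne_zero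
    rw [mul_left_cancel₀ h2 h1, ConvexQuad.normalDeriv,
      (hE.der (0, 0) (by simp; omega) _ hx).fderivWithin (Q.uniqueDiffOn_closed _ hx), gradL_apply,
      Fin.sum_univ_two]
    have g0 := hb (1, 0) (by norm_num) _ hx
    have g1 := hb (0, 1) (by norm_num) _ hx
    simp only [add_zero, zero_add, pow_one] at g0 g1
    have n0 := abs_coord_le (Q.innerNormal i) 0
    have n1 := abs_coord_le (Q.innerNormal i) 1
    rw [Q.norm_innerNormal] at n0 n1
    simp only [inc_zero, inc_one, zero_add]
    refine (mul_le_mul_of_nonneg_right (abs_add_le _ _) hh.le).trans ?_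
    rw [abs_mul, abs_mul]
    have m0 := mul_le_mul_of_nonneg_left n0 (abs_nonneg (E (1, 0) (Q.edgeParam i (q : ℝ))))
    have m1 := mul_le_mul_of_nonneg_left n1 (abs_nonneg (E (0, 1) (Q.edgeParam i (q : ℝ))))
    nlinarith
  · rw [show lift Q p c (Q.param (q : ℝ) (q' : ℝ)) = E (0, 0) (Q.param (q : ℝ) (q' : ℝ)) from
      hdof (Sum.inr (Sum.inr (Sum.inr (⟨q, hq⟩, ⟨q', hq'⟩))))]
    linarith [hb0 _ (Q.param_mem (faceNodes_mem hp hq) (faceNodes_mem hp hq'))]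

/-- The projector reproduces polynomials of degree at most `p`. -/
lemma sub_localProjector_eq (hp : 3 ≤ p) (σ : Fin 4 → ℤˣ) {ψ : Plane → ℝ} (hψ : DofRegular Q ψ)
    (c : Plane) (a : ℕ × ℕ → ℝ) {M : ℕ} (hM : M ≤ p) {x : Plane} (hx : x ∈ Q.closed) :
    ψ x - localProjector Q p σ ψ x =
      (ψ x - polyJet c a M (0, 0) x) -
        localProjector Q p σ (fun x => ψ x - polyJet c a M (0, 0) x) x := by
  set q := polyJet c a M (0, 0) with hq
  set qi := Q.closed.indicator q
  have hqr : DofRegular Q q := dofRegular_of_contDiffOn (contDiff_polyJet c a M (0, 0) 2).contDiffOn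
  have hqm : MemLocalSpace Q p qi := memLocalSpace_polyJet hp c a hM
  have hin : ∀ x ∈ Q.closed, qi x = q x := fun x hx => indicator_of_mem hx q
  have e : (fun x => ψ x - q x) = (-1 : ℝ) • q + ψ := by
    funext x
    simp only [Pi.add_apply, Pi.smul_apply, smul_eq_mul]
    ring
  have m1 := memLocalSpace_localProjector hp Q σ ψ
  have m2 := memLocalSpace_localProjector hp Q σ (fun x => ψ x - q x)
  have m3 := m2.comb hp hqm 1
  have m4 := m3.comb hp m1 (-1)
  -- The projection of `ψ - q` plus `q`, extended by zero, minus the projection of `ψ` lies in the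
  -- local space and has vanishing degrees of freedom.
  have hz := m4.eq_zero_of_dof hp σ fun l => by
    rw [(m3.dofRegular hp).dof_comb hp σ l (m1.dofRegular hp),
      (m2.dofRegular hp).dof_comb hp σ l (hqm.dofRegular hp), dof_localProjector hp,
      dof_localProjector hp, dof_congr hp σ l hin, e, hqr.dof_comb hp σ l hψ]
    ring
  have := congrFun hz x
  simp only [Pi.add_apply, Pi.smul_apply, smul_eq_mul, Pi.zero_apply, hin x hx] at this
  linarith

end
end BSQuad

namespace BSQuad
noncomputable section

open MeasureTheory Set Filter Topology
open ConvexQuad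

variable {p : ℕ}

/-! ### The approximation error -/

lemma gradL_eq_self (L : Plane →L[ℝ] ℝ) : (gradL fun k => L (EuclideanSpace.single k 1)) = L := by
  refine ContinuousLinearMap.coe_injective ((EuclideanSpace.basisFun (Fin 2) ℝ).toBasis.ext fun k => ?_)
  simp

/-- The error of the projector in terms of the error of a polynomial approximation. -/
lemma exists_error_bound (hp : 3 ≤ p) {κ : ℝ} (hκ : 0 < κ) : ∃ C : ℝ, 0 < C ∧
    ∀ (Q : ConvexQuad) (σ : Fin 4 → ℤˣ) (N M : ℕ) (ψ : ℕ × ℕ → Plane → ℝ) (c : Plane)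
      (a : ℕ × ℕ → ℝ) (B : ℝ), Q.Shape κ → 2 ≤ N → M ≤ p → Jet Q.closed N ψ →
      (∀ α : ℕ × ℕ, α.1 + α.2 ≤ 2 → ∀ x ∈ Q.closed,
        |ψ α x - polyJet c a M α x| * Q.size ^ (α.1 + α.2) ≤ B) →
      (∀ x ∈ Q.closed, |ψ (0, 0) x - localProjector Q p σ (ψ (0, 0)) x| ≤ C * B) ∧
      ∀ f : Plane → ℝ, f =ᵐ[volume.restrict Q.opened] ψ (0, 0) → ∀ l ≤ 2,
        sobolevSeminorm 2 l Q.opened (fun x => f x - localProjector Q p σ (ψ (0, 0)) x) ≤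
          3 * (ENNReal.ofReal (C * B / Q.size ^ l) * volume Q.opened ^ (1 / 2 : ℝ)) := by
  obtain ⟨C, hC, h⟩ := exists_localProjector_bound hp hκ
  -- The summand `2` comes from the mean value estimate for the first derivatives of `E`; orders
  -- zero and one would need only `1 + C`.
  refine ⟨2 + C, by positivity, fun Q σ N M ψ c a B hQ hN hM hψ hb => ?_⟩
  have hE : Jet Q.closed N fun α x => ψ α x - polyJet c a M α x :=
    hψ.sub (jet_polyJet Q.closed N c a M)
  obtain ⟨w0, w1, w2⟩ := h Q σ N _ B hQ hN hE hb
  set E : ℕ × ℕ → Plane → ℝ := fun α x => ψ α x - polyJet c a M α x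
  set w := localProjector Q p σ (E (0, 0))
  have hh := Q.size_pos
  have hreg : DofRegular Q (ψ (0, 0)) := dofRegular_of_contDiffOn
    (hψ.contDiffOn Q.uniqueDiffOn_closed 2 (by simpa using hN))
  have hwd := ((memLocalSpace_localProjector hp Q σ (E (0, 0))).dofRegular hp).diff
  have he : ∀ x ∈ Q.closed, ψ (0, 0) x - localProjector Q p σ (ψ (0, 0)) x = E (0, 0) x - w x :=
    fun x hx => sub_localProjector_eq hp σ hreg c a hM hx
  have hle : ∀ α : ℕ × ℕ, α.1 + α.2 ≤ 2 → ∀ x ∈ Q.closed,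
      |E α x| ≤ B / Q.size ^ (α.1 + α.2) := fun α hα x hx =>
    (le_div_iff₀ (by positivity)).2 (hb α hα x hx)
  have hB : 0 ≤ B := (mul_nonneg (abs_nonneg _) (by positivity)).trans
    (hb (0, 0) (by norm_num) _ (Q.vertex_mem 0))
  have h0 : ∀ x ∈ Q.closed, |E (0, 0) x - w x| ≤ (2 + C) * B := fun x hx => by
    have h1 := hle (0, 0) (by norm_num) x hx
    simp only [add_zero, pow_zero, div_one] at h1
    linarith [abs_sub (E (0, 0) x) (w x), w0 x hx]
  refine ⟨fun x hx => by rw [he x hx]; exact h0 x hx, fun f hf l hl => ?_⟩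
  refine sobolevSeminorm_two_le_of_lipschitz (K := fun l => (2 + C) * B / Q.size ^ l)
    (E := fun x => E (0, 0) x - w x)
    (E1 := fun k x => E (inc k (0, 0)) x - pderivWithin Q.closed k w x)
    isOpen_interior Q.closed_convex.interior (Q.closed_compact.isBounded.subset interior_subset)
    ?_ (fun x hx => ?_) (fun x hx => ?_) (fun k x hx => ?_) (fun k x hx y hy => ?_) hl
  · filter_upwards [hf, ae_restrict_mem isOpen_interior.measurableSet] with x hx hxU
    rw [hx]
    exact he x (interior_subset hxU)
  · have hn := mem_interior_iff_mem_nhds.1 hx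
    have h1 := (hE.der (0, 0) (by simp; omega) x (interior_subset hx)).hasFDerivAt hn
    have h2 := ((hwd x (interior_subset hx)).hasFDerivWithinAt).hasFDerivAt hn
    rw [← gradL_eq_self (fderivWithin ℝ w Q.closed x)] at h2
    have := h1.sub h2
    rw [gradL_sub] at this
    exact this
  · rw [pow_zero, div_one]
    exact h0 x (interior_subset hx)
  · have h1 := hle (inc k (0, 0)) (by simp [order_inc]) x (interior_subset hx)
    have h2 := w1 k x (interior_subset hx)
    rw [order_inc] at h1
    simp only [add_zero, zero_add, pow_one] at h1 ⊢
    refine (abs_sub _ _).trans ((add_le_add h1 h2).trans ?_)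
    rw [← add_div]
    gcongr
    linarith
  · have hx' := interior_subset hx
    have hy' := interior_subset hy
    have h1 := hE.abs_sub_le Q.closed_convex (α := inc k (0, 0)) (B := B / Q.size ^ 2)
      (by rw [order_inc]; simp; omega) (fun j z hz => by
        have := hle (inc j (inc k (0, 0))) (by simp [order_inc]) z hz
        rwa [order_inc, order_inc] at this) hy' hx'
    have h2 := w2 k x hx' y hy'
    beta_reduce
    rw [sub_sub_sub_comm]
    refine (abs_sub _ _).trans ((add_le_add h1 h2).trans (le_of_eq ?_))
    ring

lemma HasWeakDeriv.ae_eq_self {U : Set Plane} (hU : IsOpen U) {f g : Plane → ℝ}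
    (h : HasWeakDeriv U (0, 0) f g) : g =ᵐ[volume.restrict U] f :=
  h.ae_eq hU ⟨h.1, h.1, fun η _ _ _ => by simp [mderivWithin]⟩

lemma ConvexQuad.Shape.ball_subset_opened {Q : ConvexQuad} {κ : ℝ} (h : Q.Shape κ) :
    Metric.ball Q.center (κ * Q.size / 2) ⊆ Q.opened :=
  interior_maximal h.ball_subset Metric.isOpen_ball

lemma ConvexQuad.volume_opened_pos (Q : ConvexQuad) : 0 < volume.real Q.opened := by
  refine ENNReal.toReal_pos (isOpen_interior.measure_pos volume Q.interior_nonempty).ne'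
    (Q.closed_compact.isBounded.subset interior_subset).measure_lt_top.ne

/-- The estimate in `H^l`. -/
lemma exists_sobolev_error_bound (hp : 3 ≤ p) {κ : ℝ} (hκ : 0 < κ) : ∃ C : ℝ, 0 < C ∧
    ∀ (Q : ConvexQuad) (σ : Fin 4 → ℤˣ) (l m : ℕ), Q.Shape κ → l ≤ 2 → 4 ≤ m → m ≤ p + 1 →
      ∀ f : Plane → ℝ, MemSobolev 2 m Q.opened f → ∃ ψ : Plane → ℝ, IsC2Rep Q f ψ ∧
        sobolevSeminorm 2 l Q.opened (fun x => f x - localProjector Q p σ ψ x) ≤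
          ENNReal.ofReal (C * Q.size ^ (m - l)) * sobolevSeminorm 2 m Q.opened f := by
  obtain ⟨C, hC, h⟩ := exists_error_bound hp hκ
  refine ⟨3 * C * 4 ^ (p + 1), by positivity, fun Q σ l m hQ hl hm hmp f hf => ?_⟩
  -- The embedding from `L²` costs two derivatives, and `C²` needs `N ≥ 2`: this is where `m ≥ 4`
  -- enters. The approximating polynomial has degree `N + 1 = m - 1 ≤ p`.
  obtain ⟨N, rfl⟩ : ∃ N, m = N + 2 := ⟨m - 2, by omega⟩
  have hU : IsOpen Q.opened := isOpen_interior
  have hUb : Bornology.IsBounded Q.opened := Q.closed_compact.isBounded.subset interior_subset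
  have hh := Q.size_pos
  obtain ⟨g, hg, hgf⟩ := hf.exists_weakJet le_rfl hUb
  set S := sobolevSeminorm 2 (N + 2) Q.opened f with hS
  have hSdef : S = (∑ α ∈ Finset.HasAntidiagonal.antidiagonal (N + 2),
      weakDerivNorm 2 Q.opened α f ^ (2 : ℝ)) ^ (1 / 2 : ℝ) := by
    rw [hS, sobolevSeminorm, if_neg (by norm_num), ENNReal.toReal_ofNat]
  have hnorm : ∀ α : ℕ × ℕ, α.1 + α.2 = N + 2 →
      weakDerivNorm 2 Q.opened α f = eLpNorm (g α) 2 (volume.restrict Q.opened) := fun α hα =>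
    (hgf α hα.le).1.weakDerivNorm_eq hU 2
  have hSfin : S ≠ ∞ := by
    rw [hSdef]
    refine (ENNReal.rpow_lt_top_of_nonneg (by norm_num) (ENNReal.sum_lt_top.2 fun α hα => ?_).ne).ne
    have hα := Finset.HasAntidiagonal.mem_antidiagonal.1 hα
    rw [hnorm α hα]
    exact ENNReal.rpow_lt_top_of_nonneg (by norm_num) (hgf α hα.le).2.2.ne
  have hle : ∀ α : ℕ × ℕ, α.1 + α.2 = N + 2 → l2norm Q.opened (g α) ≤ S.toReal := fun α hα => by
    refine ENNReal.toReal_mono hSfin ?_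
    rw [← hnorm α hα, hSdef]
    have h1 := Finset.single_le_sum (f := fun α => weakDerivNorm 2 Q.opened α f ^ (2 : ℝ))
      (fun _ _ => zero_le) (Finset.HasAntidiagonal.mem_antidiagonal.2 hα)
    have h2 := ENNReal.rpow_le_rpow h1 (show (0 : ℝ) ≤ 1 / 2 by norm_num)
    rw [← ENNReal.rpow_mul] at h2
    simpa using h2
  have hvol := Q.volume_opened_pos
  obtain ⟨ψ, a, hψ, hae, hb⟩ := hg.exists_jet_of_l2 (r := κ * Q.size / 2) (d := 2 * Q.size)
    (by positivity) Q.closed_convex.interior hU hUb hQ.ball_subset_opened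
    (fun x hx z hz => Q.norm_sub_le_of_mem (interior_subset hz) (Q.closure_opened ▸ hx)) hvol hle
  rw [Q.closure_opened] at hψ hb
  have hf0 : f =ᵐ[volume.restrict Q.opened] ψ (0, 0) :=
    ((hae (0, 0) (by simp)).trans ((hgf (0, 0) (by simp)).1.ae_eq_self hU)).symm
  refine ⟨ψ (0, 0), ⟨hψ.contDiffOn Q.uniqueDiffOn_closed 2 (by simp; omega), hf0.symm⟩, ?_⟩
  set V := Real.sqrt (volume.real Q.opened) with hV
  have hV0 : 0 < V := Real.sqrt_pos.2 hvol
  -- The scaled `C²` bound has the square root `V` of the area in the denominator. It cancels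
  -- against the same factor in the passage from the maximum norm back to `L²`, so no lower bound
  -- for the area is needed here.
  have key := (h Q σ N (N + 1) ψ Q.center a (4 ^ (N + 2) * Q.size ^ (N + 2) * S.toReal / V) hQ
    (by omega) (by omega) hψ fun α hα x hx => ?_).2 f hf0 l hl
  · refine key.trans (le_of_eq ?_ |>.trans (mul_le_mul_left (ENNReal.ofReal_le_ofReal
      (mul_le_mul_of_nonneg_right (mul_le_mul_of_nonneg_left (pow_le_pow_right₀ (by norm_num) hmp)
        (by positivity)) (by positivity))) S))
    have e1 : volume Q.opened ^ (1 / 2 : ℝ) = ENNReal.ofReal V := by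
      rw [hV, Real.sqrt_eq_rpow, ← ENNReal.ofReal_rpow_of_pos hvol, Measure.real,
        ENNReal.ofReal_toReal hUb.measure_lt_top.ne]
    have e3 : (3 : ℝ≥0∞) = ENNReal.ofReal 3 := by simp
    rw [e1, ← ENNReal.ofReal_mul (by positivity), e3, ← ENNReal.ofReal_mul (by positivity)]
    nth_rewrite 2 [← ENNReal.ofReal_toReal hSfin]
    rw [← ENNReal.ofReal_mul (by positivity)]
    congr 1
    have e2 : Q.size ^ (N + 2) = Q.size ^ (N + 2 - l) * Q.size ^ l := by
      rw [← pow_add]; congr 1; omega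
    rw [e2]
    field_simp
  · refine (mul_le_mul_of_nonneg_right (hb α (by omega) x hx) (by positivity)).trans ?_
    obtain ⟨j, hj⟩ : ∃ j, N = α.1 + α.2 + j := ⟨N - (α.1 + α.2), by omega⟩
    have hj' : N - (α.1 + α.2) = j := by omega
    rw [hj']
    have e : (2 * (2 * Q.size)) ^ j * (4 * (2 * Q.size) ^ 2 * S.toReal / V) *
        Q.size ^ (α.1 + α.2) = 4 ^ (j + 2) * Q.size ^ (N + 2) * S.toReal / V := by
      have : (4 : ℝ) ^ j = 2 ^ j * 2 ^ j := by rw [← mul_pow]; norm_num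
      rw [hj, mul_pow, mul_pow, pow_add (4 : ℝ), this]
      ring
    rw [e]
    gcongr
    · norm_num
    · omega

/-- The estimate in the maximum norm. -/
lemma exists_sup_error_bound (hp : 3 ≤ p) {κ : ℝ} (hκ : 0 < κ) : ∃ C : ℝ, 0 < C ∧
    ∀ (Q : ConvexQuad) (σ : Fin 4 → ℤˣ) (m : ℕ), Q.Shape κ → 3 ≤ m → m ≤ p + 1 →
      ∀ f : Plane → ℝ, MemSobolev ∞ m Q.opened f → ∃ ψ : Plane → ℝ, IsC2Rep Q f ψ ∧
        eLpNorm (fun x => f x - localProjector Q p σ ψ x) ∞ (volume.restrict Q.opened) ≤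
          ENNReal.ofReal (C * Q.size ^ m) * sobolevSeminorm ∞ m Q.opened f := by
  obtain ⟨C, hC, h⟩ := exists_error_bound hp hκ
  refine ⟨C * 4 ^ (p + 1), by positivity, fun Q σ m hQ hm hmp f hf => ?_⟩
  -- Bounded derivatives cost only one order in the embedding, so `m ≥ 3` suffices for `C²`; the
  -- polynomial has degree `N = m - 1 ≤ p`.
  obtain ⟨N, rfl⟩ : ∃ N, m = N + 1 := ⟨m - 1, by omega⟩
  have hU : IsOpen Q.opened := isOpen_interior
  have hUb : Bornology.IsBounded Q.opened := Q.closed_compact.isBounded.subset interior_subset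
  have hh := Q.size_pos
  obtain ⟨g, hg, hgf⟩ := hf.exists_weakJet le_top hUb
  have hbd : ∀ α : ℕ × ℕ, α.1 + α.2 ≤ N + 1 → ∀ B : ℝ≥0∞, B ≠ ∞ →
      weakDerivNorm ∞ Q.opened α f ≤ B →
        ∀ᵐ x ∂volume.restrict Q.opened, |g α x| ≤ B.toReal := fun α hα B hB hle => by
    rw [(hgf α hα).1.weakDerivNorm_eq hU, eLpNorm_exponent_top] at hle
    filter_upwards [ae_le_eLpNormEssSup (f := g α) (μ := volume.restrict Q.opened)] with x hx
    have := ENNReal.toReal_mono hB (hx.trans hle)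
    rwa [toReal_enorm, Real.norm_eq_abs] at this
  have hfin : ∀ α : ℕ × ℕ, α.1 + α.2 ≤ N + 1 → weakDerivNorm ∞ Q.opened α f < ∞ := fun α hα => by
    rw [(hgf α hα).1.weakDerivNorm_eq hU]
    exact (hgf α hα).2.2
  set S := sobolevSeminorm ∞ (N + 1) Q.opened f with hS
  have hSdef : S = ⨆ α ∈ Finset.HasAntidiagonal.antidiagonal (N + 1),
      weakDerivNorm ∞ Q.opened α f := by
    rw [hS, sobolevSeminorm, if_pos rfl]
  have hSfin : S ≠ ∞ := by
    rw [hSdef, ← Finset.sup_eq_iSup]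
    refine ((Finset.sup_lt_iff (by simp)).2 fun α hα => hfin α ?_).ne
    exact (Finset.HasAntidiagonal.mem_antidiagonal.1 hα).le
  have hle : ∀ α : ℕ × ℕ, α.1 + α.2 = N + 1 →
      ∀ᵐ x ∂volume.restrict Q.opened, |g α x| ≤ S.toReal := fun α hα =>
    hbd α hα.le S hSfin (by
      rw [hSdef]
      exact le_iSup₂_of_le α (Finset.HasAntidiagonal.mem_antidiagonal.2 hα) le_rfl)
  obtain ⟨ψ, a, hψ, hae, hb⟩ := hg.exists_jet_of_bounded (r := κ * Q.size / 2) (d := 2 * Q.size)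
    (by positivity) Q.closed_convex.interior hU hUb hQ.ball_subset_opened
    (fun x hx z hz => Q.norm_sub_le_of_mem (interior_subset hz) (Q.closure_opened ▸ hx))
    Q.volume_opened_pos (fun α hα => ⟨_, hbd α hα _ (hfin α hα).ne le_rfl⟩)
    ENNReal.toReal_nonneg hle
  rw [Q.closure_opened] at hψ hb
  have hf0 : ψ (0, 0) =ᵐ[volume.restrict Q.opened] f :=
    (hae (0, 0) (by simp)).trans ((hgf (0, 0) (by simp)).1.ae_eq_self hU)
  refine ⟨ψ (0, 0), ⟨hψ.contDiffOn Q.uniqueDiffOn_closed 2 (by simp; omega), hf0⟩, ?_⟩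
  have key := (h Q σ N N ψ Q.center a (4 ^ (N + 1) * Q.size ^ (N + 1) * S.toReal) hQ
    (by omega) (by omega) hψ fun α hα x hx => ?_).1
  · have h1 : eLpNorm (fun x => f x - localProjector Q p σ (ψ (0, 0)) x) ∞
        (volume.restrict Q.opened) ≤
        ENNReal.ofReal (C * (4 ^ (N + 1) * Q.size ^ (N + 1) * S.toReal)) := by
      rw [eLpNorm_exponent_top]
      refine eLpNormEssSup_le_of_ae_bound ?_
      filter_upwards [hf0, ae_restrict_mem hU.measurableSet] with x hx hxU
      rw [← hx, Real.norm_eq_abs]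
      exact key x (interior_subset hxU)
    refine h1.trans ?_
    rw [← ENNReal.ofReal_toReal hSfin, ← ENNReal.ofReal_mul (by positivity),
      ENNReal.toReal_ofReal ENNReal.toReal_nonneg]
    refine ENNReal.ofReal_le_ofReal ?_
    rw [← mul_assoc, ← mul_assoc]
    gcongr
    norm_num
  · refine (mul_le_mul_of_nonneg_right (hb α (by omega) x hx) (by positivity)).trans ?_
    obtain ⟨j, hj⟩ : ∃ j, N = α.1 + α.2 + j := ⟨N - (α.1 + α.2), by omega⟩
    have hj' : N - (α.1 + α.2) = j := by omega
    rw [hj']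
    have e : (2 * (2 * Q.size)) ^ j * (2 * (2 * Q.size) * S.toReal) *
        Q.size ^ (α.1 + α.2) = 4 ^ (j + 1) * Q.size ^ (N + 1) * S.toReal := by
      rw [hj, mul_pow, mul_pow]
      have : (4 : ℝ) ^ j = 2 ^ j * 2 ^ j := by rw [← mul_pow]; norm_num
      rw [pow_succ (4 : ℝ), this]
      ring
    rw [e]
    gcongr
    · norm_num
    · omega

end
end BSQuad

/-! ### The theorem, with one constant for both norms -/

theorem mainTheorem1 (p : ℕ) (hp : 3 ≤ p) (ρ : ℝ) (hρ : 0 < ρ) :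
    ∃ C : ℝ, 0 < C ∧
      ∀ (Q : BSQuad.ConvexQuad) (σ : Fin 4 → ℤˣ), ρ ≤ Q.minAngle →
        (∃! β : BSQuad.DofIndex p → BSQuad.Plane → ℝ, BSQuad.IsDualBasis Q p σ β) ∧
        (∀ (l m : ℕ), l ≤ 2 → 4 ≤ m → m ≤ p + 1 →
          ∀ f : BSQuad.Plane → ℝ, BSQuad.MemSobolev 2 m Q.opened f →
            ∃ ψ : BSQuad.Plane → ℝ, BSQuad.IsC2Rep Q f ψ ∧
              BSQuad.sobolevSeminorm 2 l Q.opened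
                  (fun x => f x - BSQuad.localProjector Q p σ ψ x) ≤
                ENNReal.ofReal (C * Q.size ^ (m - l)) *
                  BSQuad.sobolevSeminorm 2 m Q.opened f) ∧
        (∀ m : ℕ, 3 ≤ m → m ≤ p + 1 →
          ∀ f : BSQuad.Plane → ℝ, BSQuad.MemSobolev ∞ m Q.opened f →
            ∃ ψ : BSQuad.Plane → ℝ, BSQuad.IsC2Rep Q f ψ ∧
              MeasureTheory.eLpNorm
                  (fun x => f x - BSQuad.localProjector Q p σ ψ x) ∞
                  (MeasureTheory.volume.restrict Q.opened) ≤
                ENNReal.ofReal (C * Q.size ^ m) *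
                  BSQuad.sobolevSeminorm ∞ m Q.opened f) := by
  obtain ⟨κ, hκ, hshape⟩ := BSQuad.ConvexQuad.exists_shape_of_minAngle hρ
  obtain ⟨C₁, h₁, H₁⟩ := BSQuad.exists_sobolev_error_bound hp hκ
  obtain ⟨C₂, h₂, H₂⟩ := BSQuad.exists_sup_error_bound hp hκ
  refine ⟨max C₁ C₂, lt_max_of_lt_left h₁, fun Q σ hQ => ⟨?_, fun l m hl hm hmp f hf => ?_,
    fun m hm hmp f hf => ?_⟩⟩
  · obtain ⟨β, hβ⟩ := BSQuad.exists_dualBasis hp Q σ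
    exact ⟨β, hβ, fun β' hβ' => BSQuad.isDualBasis_unique hp hβ' hβ⟩
  · obtain ⟨ψ, hψ, h⟩ := H₁ Q σ l m (hshape Q hQ) hl hm hmp f hf
    refine ⟨ψ, hψ, h.trans (mul_le_mul_left (ENNReal.ofReal_le_ofReal ?_) _)⟩
    exact mul_le_mul_of_nonneg_right (le_max_left _ _) (pow_nonneg Q.size_pos.le _)
  · obtain ⟨ψ, hψ, h⟩ := H₂ Q σ m (hshape Q hQ) hm hmp f hf
    refine ⟨ψ, hψ, h.trans (mul_le_mul_left (ENNReal.ofReal_le_ofReal ?_) _)⟩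
    exact mul_le_mul_of_nonneg_right (le_max_right _ _) (pow_nonneg Q.size_pos.le _)
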